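/- Write $\mathbb D$ for the open unit disk of $\mathbb C$. Let $\Omega\subset\mathbb C$ be a quasidisk, i.e. the image of $\mathbb D$ under a quasiconformal homeomorphism of $\mathbb C$ onto itself, let $\Gamma=\partial\Omega$ and $a\in\Omega$. A uniformization of $\Omega$ is a holomorphic bijection $f:\mathbb D\to\Omega$, extended by continuity to $\mathbb S^1$. Let $g:\Gamma\to\mathbb S^1$ be in $H^{1/2}(\Gamma,\mathbb S^1)$ with $\deg(g,\Gamma)=1$; this means that for a uniformization $f$ of $\Omega$, $g\circ f\in H^{1/2}(\mathbb S^1,\mathbb S^1)$ and $g\circ f$ has degree $1$, where $h\in H^{1/2}(\mathbb S^1,\mathbb S^1)$ has degree $n$ if $h(z)=z^n e^{i\varphi(z)}$ for a.e. $z\in\mathbb S^1$, with $\varphi\in H^{1/2}(\mathbb S^1,\mathbb R)$. There are uniformizations $f$ of $\Omega$ with $f(0)=a$. For each of them, the Neumann problem $$\Delta\tilde\Phi=2\pi\delta_0\ \text{ in }\mathbb D,\qquad \partial_r\tilde\Phi=\langle\partial_\theta(g\circ f),\,i\,(g\circ f)\rangle\ \text{ on }\mathbb S^1,$$ has a weak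 solution $\tilde\Phi\in W^{1,1}(\mathbb D)$, unique up to an additive constant; that is, $$\int_{\mathbb D}\nabla\tilde\Phi\cdot\nabla\zeta\,dx+2\pi\zeta(0)=\big\langle \partial_\theta(g\circ f),\ \zeta\, i\,(g\circ f)\big\rangle_{H^{-1/2}(\mathbb S^1),H^{1/2}(\mathbb S^1)}\qquad\text{for all real }\zeta\in C^\infty(\overline{\mathbb D}).$$ There is a map $u:\Omega\setminus\{a\}\to\mathbb S^1$, unique up to equality almost everywhere, and not depending on the choice of the uniformization $f$ with $f(0)=a$, such that 1. $u\in H^1_{loc}(\overline\Omega\setminus\{a\})$, i.e. $u$ is weakly differentiable in $\Omega\setminus\{a\}$, and $u$ and $du$ are square integrable on $C\cap\Omega$ for every compact $C\subset\overline\Omega\setminus\{a\}$; 2. $\deg(u,a)=1$, i.e. the trace of $u$ on $\partial B(a,r)$ is of class $H^{1/2}$ and has degree $1$ for all small $r>0$; 3. $u=g$ on $\Gamma$, i.e. $u\circ f$ has trace $g\circ f$ on $\mathbb S^1$; 4. $\star\omega=d\Phi$ a.e. in $\Omega\setminus\{a\}$, where $\omega=\langle du,iu\rangle$, $\Phi=\tilde\Phi\circ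 f^{-1}$, and $\star$ is normalized by $\star dx=-dy$, $\star dy=dx$ (thus $\star d\theta=dr/r$). Moreover, after modification on a null set, $u$ is a smooth harmonic map $\Omega\setminus\{a\}\to\mathbb S^1$: $-\Delta u=|\nabla u|^2u$. -/

import Mathlib

open MeasureTheory Set Complex
open scoped ENNReal ContDiff InnerProductSpace

noncomputable section

/-- `Dv` is the weak (distributional) differential of `v` on the open set `U` of the plane:
both are locally integrable on `U`, and integration by parts holds against every
smooth function with compact support in `U`. -/
structure HasWeakFDeriv {E : Type} [NormedAddCommGroup E] [NormedSpace ℝ E]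
    (U : Set ℂ) (v : ℂ → E) (Dv : ℂ → ℂ →L[ℝ] E) : Prop where
  locallyIntegrable : LocallyIntegrableOn v U
  locallyIntegrable_deriv : LocallyIntegrableOn Dv U
  integral_eq : ∀ ζ : ℂ → ℝ, ContDiff ℝ ∞ ζ → HasCompactSupport ζ → tsupport ζ ⊆ U →
    ∀ e : ℂ, ∫ z in U, (fderiv ℝ ζ z e) • v z = - ∫ z in U, ζ z • Dv z e

/-- `v ∈ H¹(U)`, with weak differential `Dv`. -/
structure MemH1 {E : Type} [NormedAddCommGroup E] [NormedSpace ℝ E]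
    (U : Set ℂ) (v : ℂ → E) (Dv : ℂ → ℂ →L[ℝ] E) : Prop where
  weak : HasWeakFDeriv U v Dv
  memLp : MemLp v 2 (volume.restrict U)
  memLp_deriv : MemLp Dv 2 (volume.restrict U)

/-! ### Quasidisks -/

/-- `∂F/∂z`, computed from the real differential `L` of `F`. -/
def dz (L : ℂ →L[ℝ] ℂ) : ℂ := (L 1 - I * L I) / 2

/-- `∂F/∂z̄`, computed from the real differential `L` of `F`. -/
def dzbar (L : ℂ →L[ℝ] ℂ) : ℂ := (L 1 + I * L I) / 2

/-- The homeomorphism `F` of the plane is `K`-quasiconformal: it is in `H¹_loc(ℂ)` and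
`|∂F/∂z̄| ≤ (K - 1)/(K + 1) |∂F/∂z|` almost everywhere. -/
def IsQuasiconformal (K : ℝ) (F : ℂ ≃ₜ ℂ) : Prop :=
  1 ≤ K ∧ ∃ DF : ℂ → ℂ →L[ℝ] ℂ, HasWeakFDeriv univ F DF ∧
    (∀ C : Set ℂ, IsCompact C →
      MemLp F 2 (volume.restrict C) ∧ MemLp DF 2 (volume.restrict C)) ∧
    ∀ᵐ z, ‖dzbar (DF z)‖ ≤ (K - 1) / (K + 1) * ‖dz (DF z)‖

/-- A quasidisk: the image of the open unit disk by a quasiconformal map of the plane. -/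
def IsQuasidisk (Ω : Set ℂ) : Prop :=
  ∃ (K : ℝ) (F : ℂ ≃ₜ ℂ), IsQuasiconformal K F ∧ Ω = F '' Metric.ball 0 1

/-- `f` is a uniformization of `Ω`: a holomorphic bijection from the unit disk onto `Ω`. -/
structure IsUniformization (f : ℂ → ℂ) (Ω : Set ℂ) : Prop where
  holo : DifferentiableOn ℂ f (Metric.ball 0 1)
  bij : BijOn f (Metric.ball 0 1) Ω

/-- The extension by continuity of `f` from the open disk (used at points of the unit circle). -/
def boundaryExt (f : ℂ → ℂ) : ℂ → ℂ := extendFrom (Metric.ball 0 1) f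

/-- The inverse `Ω → 𝔻` of a uniformization `f`. -/
def uniformizationInv (f : ℂ → ℂ) : ℂ → ℂ := Function.invFunOn f (Metric.ball 0 1)

/-! ### `H^{1/2}` and the degree on the unit circle and on quasicircles -/

/-- The restriction of `h` to the unit circle, in the angular variable. -/
def onCircle {E : Type} (h : ℂ → E) (t : ℝ) : E := h (circleMap 0 1 t)

/-- Arc length on the unit circle, in the angular variable. -/
def arcMeasure : Measure ℝ := volume.restrict (Ioc 0 (2 * Real.pi))

/-- `h ∈ H^{1/2}(𝕊¹, E)`: square integrable with finite Gagliardo integral. -/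
def MemHHalf {E : Type} [NormedAddCommGroup E] (h : ℂ → E) : Prop :=
  MemLp (onCircle h) 2 arcMeasure ∧
    ∫⁻ s, ∫⁻ t, ‖onCircle h s - onCircle h t‖ₑ ^ 2 /
      ‖circleMap 0 1 s - circleMap 0 1 t‖ₑ ^ 2 ∂arcMeasure ∂arcMeasure < ⊤

/-- `h ∈ H^{1/2}(𝕊¹, 𝕊¹)`. -/
def MemHHalfCircle (h : ℂ → ℂ) : Prop :=
  MemHHalf h ∧ ∀ᵐ t ∂arcMeasure, ‖onCircle h t‖ = 1

/-- `deg h = n`, that is, `h = z ^ n e^{iφ}` on the unit circle, with `φ ∈ H^{1/2}(𝕊¹, ℝ)`. -/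
def HasCircleDegree (h : ℂ → ℂ) (n : ℤ) : Prop :=
  ∃ φ : ℂ → ℝ, MemHHalf φ ∧ ∀ᵐ t ∂arcMeasure,
    onCircle h t = circleMap 0 1 t ^ n * exp (I * onCircle φ t)

/-- `g ∈ H^{1/2}(Γ, 𝕊¹)` for the boundary `Γ` of `Ω`: `g` is a map `Γ → 𝕊¹` whose pullback by a
uniformization of `Ω` is in `H^{1/2}(𝕊¹, 𝕊¹)`. -/
def MemHHalfBoundary (Ω : Set ℂ) (g : ℂ → ℂ) : Prop :=
  (∀ z ∈ frontier Ω, ‖g z‖ = 1) ∧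
    ∃ f : ℂ → ℂ, IsUniformization f Ω ∧ MemHHalfCircle (g ∘ boundaryExt f)

/-- `deg(g, Γ) = n` for the boundary `Γ` of `Ω`: the pullback of `g` by a
uniformization of `Ω` has degree `n`. -/
def HasBoundaryDegree (Ω : Set ℂ) (g : ℂ → ℂ) (n : ℤ) : Prop :=
  ∃ f : ℂ → ℂ, IsUniformization f Ω ∧ HasCircleDegree (g ∘ boundaryExt f) n

/-! ### Traces, `H¹_loc` up to the boundary, and the degree at a point -/

/-- The open annulus `ρ < |z| < 1`. -/
def innerAnnulus (ρ : ℝ) : Set ℂ := Metric.ball 0 1 \ Metric.closedBall 0 ρ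

/-- The function `v`, which is `H¹` on an annulus `ρ < |z| < 1`, has trace `h` on the unit circle:
the Gauss-Green formula `∫ ∂ₑ(ζ v) = ∫_{𝕊¹} ⟨e, ν⟩ ζ h` holds for all smooth `ζ` which vanish
near the disk `|z| ≤ ρ`. Here `ν = e^{it}` is the outward normal. -/
def HasCircleTrace (v h : ℂ → ℂ) : Prop :=
  Integrable (onCircle h) arcMeasure ∧
  ∃ ρ : ℝ, 0 ≤ ρ ∧ ρ < 1 ∧ ∃ Dv : ℂ → ℂ →L[ℝ] ℂ, MemH1 (innerAnnulus ρ) v Dv ∧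
    ∀ ζ : ℂ → ℝ, ContDiff ℝ ∞ ζ → HasCompactSupport ζ → tsupport ζ ⊆ (Metric.closedBall 0 ρ)ᶜ →
      ∀ e : ℂ, ∫ z in innerAnnulus ρ, ((fderiv ℝ ζ z e) • v z + ζ z • Dv z e) =
        ∫ t, (⟪e, circleMap 0 1 t⟫_ℝ * onCircle ζ t) • onCircle h t ∂arcMeasure

/-- `u ∈ H¹_loc(closure Ω \ {a})`: `u` is weakly differentiable on `Ω \ {a}` and, for
every compact subset `C` of `closure Ω \ {a}`, `u` and `Du` are square integrable on `C ∩ Ω`. -/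
def MemH1LocPunctured (Ω : Set ℂ) (a : ℂ) (u : ℂ → ℂ) : Prop :=
  ∃ Du : ℂ → ℂ →L[ℝ] ℂ, HasWeakFDeriv (Ω \ {a}) u Du ∧
    ∀ C : Set ℂ, IsCompact C → C ⊆ closure Ω \ {a} →
      MemLp u 2 (volume.restrict (C ∩ Ω)) ∧ MemLp Du 2 (volume.restrict (C ∩ Ω))

/-- `deg(u, a) = n`: for every small `r > 0`, the trace of `u` on the circle `∂B(a, r)`,
transported to the unit circle, is in `H^{1/2}(𝕊¹, 𝕊¹)` and has degree `n`. -/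
def HasDegreeAt (u : ℂ → ℂ) (a : ℂ) (n : ℤ) : Prop :=
  ∃ r₀ : ℝ, 0 < r₀ ∧ ∀ r : ℝ, 0 < r → r < r₀ →
    ∃ h : ℂ → ℂ, HasCircleTrace (fun z => u (a + r * z)) h ∧
      MemHHalfCircle h ∧ HasCircleDegree h n

/-! ### The Neumann problem -/

/-- The `n`-th Fourier coefficient of a function on the unit circle. -/
def circleCoeff (h : ℂ → ℂ) (n : ℤ) : ℂ :=
  (2 * Real.pi : ℝ)⁻¹ • ∫ t, exp (-(I * n * t)) * onCircle h t ∂arcMeasure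

/-- The value `s` of the duality product between `∂_θ h ∈ H^{-1/2}(𝕊¹)` and `k ∈ H^{1/2}(𝕊¹)`,
which extends `∫ ⟨∂_θ h, k⟩ dθ` (real scalar product of `ℂ`) from smooth functions, in Fourier
series: the coefficients of `∂_θ h` are `i n ĥ(n)`. -/
def HasTangentialPairing (h k : ℂ → ℂ) (s : ℝ) : Prop :=
  HasSum (fun n : ℤ => 2 * Real.pi * ⟪I * n * circleCoeff h n, circleCoeff k n⟫_ℝ) s

/-- `Φ ∈ W^{1,1}(𝔻)` is a weak solution of the Neumann problem `ΔΦ = 2πδ₀` in `𝔻`,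
`∂_r Φ = ⟨∂_θ h, i h⟩` on `𝕊¹`: for every real `ζ` smooth up to the boundary,
`∫_𝔻 ∇Φ · ∇ζ + 2π ζ(0)` is the value of the distribution `⟨∂_θ h, i h⟩` at `ζ`, which is the
duality product of `∂_θ h` with `ζ i h`. -/
def IsNeumannSolution (h : ℂ → ℂ) (Φ : ℂ → ℝ) : Prop :=
  ∃ DΦ : ℂ → ℂ →L[ℝ] ℝ, HasWeakFDeriv (Metric.ball 0 1) Φ DΦ ∧
    IntegrableOn Φ (Metric.ball 0 1) ∧ IntegrableOn DΦ (Metric.ball 0 1) ∧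
    ∀ ζ : ℂ → ℝ, ContDiff ℝ ∞ ζ →
      HasTangentialPairing h (fun z => ζ z • (I * h z))
        ((∫ z in Metric.ball 0 1, (DΦ z 1 * fderiv ℝ ζ z 1 + DΦ z I * fderiv ℝ ζ z I))
          + 2 * Real.pi * ζ 0)

/-! ### Canonical harmonic maps -/

/-- The 1-form `ω = ⟨du, i u⟩` at a point where `u` has value `w` and differential `L`. -/
def currentForm (w : ℂ) (L : ℂ →L[ℝ] ℂ) (e : ℂ) : ℝ := ⟪L e, I * w⟫_ℝ

/-- The star operator on real 1-forms of the plane, `(⋆α)(e) = α(i e)`, so that `⋆dx = -dy`,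
`⋆dy = dx` and `⋆dθ = dr / r`. -/
def starForm (α : ℂ → ℝ) (e : ℂ) : ℝ := α (I * e)

/-- `u : Ω \ {a} → 𝕊¹` has all the properties of the canonical harmonic map of degree one
associated with the data `(g, a)`, relative to the uniformization `f` of `Ω` (`f 0 = a`). -/
structure IsCanonicalHarmonicMap (Ω : Set ℂ) (a : ℂ) (g f u : ℂ → ℂ) : Prop where
  norm_eq_one : ∀ z ∈ Ω \ {a}, ‖u z‖ = 1
  memH1Loc : MemH1LocPunctured Ω a u
  degree : HasDegreeAt u a 1
  boundary : HasCircleTrace (u ∘ f) (g ∘ boundaryExt f)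
  star_eq : ∃ Φ : ℂ → ℝ, IsNeumannSolution (g ∘ boundaryExt f) Φ ∧
    ∃ (Du : ℂ → ℂ →L[ℝ] ℂ) (DΦ : ℂ → ℂ →L[ℝ] ℝ),
      HasWeakFDeriv (Ω \ {a}) u Du ∧
      HasWeakFDeriv (Ω \ {a}) (Φ ∘ uniformizationInv f) DΦ ∧
      ∀ᵐ z ∂(volume.restrict (Ω \ {a})), ∀ e : ℂ,
        starForm (currentForm (u z) (Du z)) e = DΦ z e

/-- `u` is a (smooth) harmonic map from the open set `U` to `𝕊¹`: `-Δu = |∇u|² u`. -/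
structure IsHarmonicMapToCircle (U : Set ℂ) (u : ℂ → ℂ) : Prop where
  smooth : ContDiffOn ℝ ∞ u U
  norm_eq_one : ∀ z ∈ U, ‖u z‖ = 1
  equation : ∀ z ∈ U,
    -(Laplacian.laplacian u z) = (‖fderiv ℝ u z 1‖ ^ 2 + ‖fderiv ℝ u z I‖ ^ 2) • u z

end

open Filter Topology ContinuousLinearMap

/-! ### Weak differentials -/

section WeakDeriv

variable {E F : Type} [NormedAddCommGroup E] [NormedSpace ℝ E]
  [NormedAddCommGroup F] [NormedSpace ℝ F]

/-! Write g ∘ f = z e^{iφ} on the unit circle, with φ of class H^{1/2}. Let G (`herglotz φ`) be the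
holomorphic function on the disk whose real part is the Poisson integral of φ, and put q = z e^{iG}
(`phaseLift φ`). Everything is read off from the two parts of log q: the canonical map is u = (q /
|q|) ∘ f⁻¹, and the Neumann solution is log |q| = log |z| - Im G. If l is the logarithmic derivative
of q ∘ f⁻¹, then ω = Im (l dz) and dΦ = Re (l dz), so ⋆ω = dΦ is the Cauchy-Riemann relation
(`starForm_currentForm`). Locally u is e^{i·harmonic}, hence a harmonic map; q ∘ f⁻¹ has a simple
zero at a, hence the degree; the L² norm of du is a conformal invariant, and G has finite Dirichlet
integral because φ is in H^{1/2}, hence the H¹ bounds up to the boundary. On |z| = R the phase of q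
is the Poisson mean of φ plus the angle, and these means converge to φ in L¹, hence the trace
(`hasCircleTrace_unitLift`).

That log |q| solves the Neumann problem rests on the formula ⟨∂_θ h, ζ i h⟩ = ∫ ζ - ∫ φ ∂_θ ζ for h
= z e^{iφ} (`hasTangentialPairing_of_lifting`). It is clear for smooth φ; for φ in H^{1/2} one
compares Abel means of Fourier series, where the error is quadratic in the differences of φ and is
dominated by the Gagliardo integrand.

Uniqueness of the Neumann solution: the difference W of two gradients is integrable, curl free, and
orthogonal to all gradients up to the boundary. Since 1 / (z - z₀) coincides on the circle with the
antiholomorphic function z̄ / (1 - z₀ z̄), testing with a regularized Cauchy kernel shows that W_x -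
i W_y has integral zero on every disk (`integral_ball_complexGradient_eq_zero`), so W = 0.

Uniqueness of u: a unimodular map is orthogonal to its weak differential
(`HasWeakFDeriv.ae_inner_eq_zero`), so its value and its current ω determine the differential. For a
second canonical map u' this makes ū u' constant on the connected set Ω \ {a}, and the common trace
makes the constant 1.

Independence of f: by Schwarz' lemma two uniformizations with the same value at 0 differ by a
rotation, and q is carried along by it. A uniformization with f(0) = a is obtained by precomposing a
given one with a Möbius transformation, which preserves H^{1/2} and the degree. -/

theorem fderiv_eq_zero_of_notMem_tsupport {E F : Type*} [NormedAddCommGroup E] [NormedSpace ℝ E]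
    [NormedAddCommGroup F] [NormedSpace ℝ F] {ζ : E → F} {z : E} (hz : z ∉ tsupport ζ) :
    fderiv ℝ ζ z = 0 := by
  have : ζ =ᶠ[𝓝 z] fun _ => 0 := notMem_tsupport_iff_eventuallyEq.1 hz
  rw [this.fderiv_eq]; simp

theorem MeasureTheory.LocallyIntegrableOn.fun_add {E' : Type*} [NormedAddCommGroup E'] {U : Set ℂ}
    {f g : ℂ → E'} (hf : LocallyIntegrableOn f U) (hg : LocallyIntegrableOn g U) :
    LocallyIntegrableOn (fun z => f z + g z) U := by
  have := hf.sub hg.neg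
  rwa [sub_neg_eq_add] at this

theorem MeasureTheory.LocallyIntegrableOn.integrable_smul_of_tsupport_subset {U : Set ℂ} {v : ℂ → E}
    (hv : LocallyIntegrableOn v U) {ζ : ℂ → ℝ} (hζ : Continuous ζ) (hc : HasCompactSupport ζ)
    (hU : tsupport ζ ⊆ U) : Integrable (fun z => ζ z • v z) := by
  have h1 : IntegrableOn v (tsupport ζ) := hv.integrableOn_compact_subset hU hc
  have h2 : IntegrableOn (fun z => ζ z • v z) (tsupport ζ) :=
    h1.continuousOn_smul hζ.continuousOn hc
  refine (integrableOn_iff_integrable_of_support_subset ?_).1 h2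
  intro z hz
  by_contra hn
  exact hz (by simp [image_eq_zero_of_notMem_tsupport hn])

theorem realCLM_ext {L M : ℂ →L[ℝ] E} (h1 : L 1 = M 1) (h2 : L I = M I) : L = M := by
  ext z
  have : z = z.re • (1 : ℂ) + z.im • I := by simp [Complex.re_add_im]
  rw [this, map_add, map_add, map_smul, map_smul, map_smul, map_smul, h1, h2]

namespace HasWeakFDeriv

variable {U : Set ℂ} {v : ℂ → E} {Dv : ℂ → ℂ →L[ℝ] E}

theorem locallyIntegrable_apply (h : HasWeakFDeriv U v Dv) (e : ℂ) :
    LocallyIntegrableOn (fun z => Dv z e) U :=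
  fun z hz => (h.2 z hz).imp fun _ hs => ⟨hs.1, (ContinuousLinearMap.apply ℝ E e).integrable_comp hs.2⟩

/-- The definition of a weak differential integrates over `U`. As test functions vanish off `U`,
computations can be done with integrals over the whole plane. -/
theorem setIntegral_smul_eq {U : Set ℂ} {v : ℂ → E} {ζ : ℂ → ℝ} (hU : tsupport ζ ⊆ U) :
    ∫ z in U, ζ z • v z = ∫ z, ζ z • v z :=
  setIntegral_eq_integral_of_forall_compl_eq_zero fun z hz => by
    rw [image_eq_zero_of_notMem_tsupport fun h => hz (hU h), zero_smul]

theorem setIntegral_fderiv_smul_eq {U : Set ℂ} {v : ℂ → E} {ζ : ℂ → ℝ} (hU : tsupport ζ ⊆ U) (e : ℂ) :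
    ∫ z in U, (fderiv ℝ ζ z e) • v z = ∫ z, (fderiv ℝ ζ z e) • v z :=
  setIntegral_eq_integral_of_forall_compl_eq_zero fun z hz => by
    rw [fderiv_eq_zero_of_notMem_tsupport fun h => hz (hU h)]; simp

theorem integral_eq_neg (h : HasWeakFDeriv U v Dv) {ζ : ℂ → ℝ} (hζ : ContDiff ℝ ∞ ζ)
    (hc : HasCompactSupport ζ) (hU : tsupport ζ ⊆ U) (e : ℂ) :
    ∫ z, (fderiv ℝ ζ z e) • v z = - ∫ z, ζ z • Dv z e := by
  rw [← setIntegral_smul_eq hU, ← setIntegral_fderiv_smul_eq hU, h.integral_eq ζ hζ hc hU]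

theorem integrable_smul (h : HasWeakFDeriv U v Dv) {ζ : ℂ → ℝ} (hζ : ContDiff ℝ ∞ ζ)
    (hc : HasCompactSupport ζ) (hU : tsupport ζ ⊆ U) : Integrable (fun z => ζ z • v z) :=
  h.1.integrable_smul_of_tsupport_subset hζ.continuous hc hU

theorem integrable_smul_deriv (h : HasWeakFDeriv U v Dv) {ζ : ℂ → ℝ} (hζ : ContDiff ℝ ∞ ζ)
    (hc : HasCompactSupport ζ) (hU : tsupport ζ ⊆ U) (e : ℂ) :
    Integrable (fun z => ζ z • Dv z e) :=
  (h.locallyIntegrable_apply e).integrable_smul_of_tsupport_subset hζ.continuous hc hU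

theorem integrable_fderiv_smul (h : HasWeakFDeriv U v Dv) {ζ : ℂ → ℝ} (hζ : ContDiff ℝ ∞ ζ)
    (hc : HasCompactSupport ζ) (hU : tsupport ζ ⊆ U) (e : ℂ) :
    Integrable (fun z => (fderiv ℝ ζ z e) • v z) := by
  have h1 : tsupport (fun z => fderiv ℝ ζ z e) ⊆ tsupport ζ := by
    refine closure_minimal (fun z hz => ?_) (isClosed_tsupport ζ)
    by_contra hn
    exact hz (by simp [fderiv_eq_zero_of_notMem_tsupport hn])
  refine h.1.integrable_smul_of_tsupport_subset ?_ ?_ (h1.trans hU)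
  · exact (hζ.continuous_fderiv (by simp)).clm_apply continuous_const
  · exact hc.of_isClosed_subset (isClosed_tsupport _) h1

end HasWeakFDeriv

theorem hasWeakFDeriv_of_forall_integral {U : Set ℂ} {v : ℂ → E} {Dv : ℂ → ℂ →L[ℝ] E}
    (h1 : LocallyIntegrableOn v U) (h2 : LocallyIntegrableOn Dv U)
    (h : ∀ ζ : ℂ → ℝ, ContDiff ℝ ∞ ζ → HasCompactSupport ζ → tsupport ζ ⊆ U →
      ∀ e : ℂ, ∫ z, (fderiv ℝ ζ z e) • v z = - ∫ z, ζ z • Dv z e) : HasWeakFDeriv U v Dv :=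
  ⟨h1, h2, fun ζ a b c e => by
    rw [HasWeakFDeriv.setIntegral_smul_eq c, HasWeakFDeriv.setIntegral_fderiv_smul_eq c, h ζ a b c e]⟩

/-- A continuously differentiable function is weakly differentiable. -/
theorem hasWeakFDeriv_of_hasFDerivAt {U : Set ℂ} {v : ℂ → E} {Dv : ℂ → ℂ →L[ℝ] E} (hU : IsOpen U)
    (hv : ∀ z ∈ U, HasFDerivAt v (Dv z) z) (hc : ContinuousOn Dv U) : HasWeakFDeriv U v Dv := by
  have cv : ContinuousOn v U := fun z hz => (hv z hz).continuousAt.continuousWithinAt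
  have l1 : LocallyIntegrableOn v U := cv.locallyIntegrableOn hU.measurableSet
  have l2 : LocallyIntegrableOn Dv U := hc.locallyIntegrableOn hU.measurableSet
  refine hasWeakFDeriv_of_forall_integral l1 l2 fun ζ a b c e => ?_
  have l3 : LocallyIntegrableOn (fun z => Dv z e) U :=
    (hc.clm_apply continuousOn_const).locallyIntegrableOn hU.measurableSet
  have h1 : tsupport (fun z => fderiv ℝ ζ z e) ⊆ tsupport ζ := by
    refine closure_minimal (fun z hz => ?_) (isClosed_tsupport ζ)
    by_contra hn
    exact hz (by simp [fderiv_eq_zero_of_notMem_tsupport hn])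
  -- Integration by parts asks for the derivative of `v` only on the support of `ζ`, which lies in
  -- `U`.
  have := integral_bilinear_hasFDerivAt_right_eq_neg_left_of_integrable (μ := volume)
    (f := ζ) (f' := fderiv ℝ ζ) (g := v) (g' := Dv) (v := e) (B := ContinuousLinearMap.lsmul ℝ ℝ)
    (l1.integrable_smul_of_tsupport_subset
      ((a.continuous_fderiv (by simp)).clm_apply continuous_const)
      (b.of_isClosed_subset (isClosed_tsupport _) h1) (h1.trans c))
    (l3.integrable_smul_of_tsupport_subset a.continuous b c)
    (l1.integrable_smul_of_tsupport_subset a.continuous b c)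
    (fun x _ => (a.differentiable (by simp) x).hasFDerivAt) (fun x hx => hv x (c hx))
  simp only [ContinuousLinearMap.lsmul_apply] at this
  rw [this, neg_neg]

namespace HasWeakFDeriv

variable {U : Set ℂ} {v w : ℂ → E} {Dv Dw : ℂ → ℂ →L[ℝ] E}

theorem mono (h : HasWeakFDeriv U v Dv) {V : Set ℂ} (hV : V ⊆ U) : HasWeakFDeriv V v Dv :=
  hasWeakFDeriv_of_forall_integral (h.1.mono_set hV) (h.2.mono_set hV)
    fun _ a b c e => h.integral_eq_neg a b (c.trans hV) e

theorem congr_ae (h : HasWeakFDeriv U v Dv) (hv : v =ᵐ[volume.restrict U] w)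
    (hD : Dv =ᵐ[volume.restrict U] Dw) : HasWeakFDeriv U w Dw where
  locallyIntegrable := h.1.congr hv
  locallyIntegrable_deriv := h.2.congr hD
  integral_eq ζ a b c e := by
    have := h.integral_eq ζ a b c e
    have e1 : ∫ z in U, (fderiv ℝ ζ z e) • v z = ∫ z in U, (fderiv ℝ ζ z e) • w z :=
      integral_congr_ae (hv.mono fun z hz => by simp [hz])
    have e2 : ∫ z in U, ζ z • Dv z e = ∫ z in U, ζ z • Dw z e :=
      integral_congr_ae (hD.mono fun z hz => by simp [hz])
    rw [← e1, ← e2, this]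

theorem add (h : HasWeakFDeriv U v Dv) (h' : HasWeakFDeriv U w Dw) :
    HasWeakFDeriv U (fun z => v z + w z) (fun z => Dv z + Dw z) := by
  refine hasWeakFDeriv_of_forall_integral (h.1.fun_add h'.1) (h.2.fun_add h'.2) fun ζ a b c e => ?_
  simp only [smul_add, ContinuousLinearMap.add_apply]
  rw [integral_add (h.integrable_fderiv_smul a b c e) (h'.integrable_fderiv_smul a b c e),
    integral_add (h.integrable_smul_deriv a b c e) (h'.integrable_smul_deriv a b c e),
    h.integral_eq_neg a b c, h'.integral_eq_neg a b c, neg_add]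

theorem clm_comp [CompleteSpace E] [CompleteSpace F] (h : HasWeakFDeriv U v Dv) (L : E →L[ℝ] F) :
    HasWeakFDeriv U (fun z => L (v z)) (fun z => L.comp (Dv z)) := by
  refine hasWeakFDeriv_of_forall_integral (fun z hz => (h.1 z hz).imp fun s hs => ⟨hs.1, L.integrable_comp hs.2⟩)
    (fun z hz => (h.2 z hz).imp fun s hs => ⟨hs.1, ((ContinuousLinearMap.compL ℝ ℂ E F L)).integrable_comp hs.2⟩)
    fun ζ a b c e => ?_
  have := congrArg L (h.integral_eq_neg a b c e)
  rw [map_neg, ← L.integral_comp_comm (h.integrable_fderiv_smul a b c e),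
    ← L.integral_comp_comm (h.integrable_smul_deriv a b c e)] at this
  simpa using this

/-- The product with a smooth real function. -/
theorem smul (h : HasWeakFDeriv U v Dv) (hU : IsOpen U) {s : ℂ → ℝ} (hs : ContDiffOn ℝ ∞ s U) :
    HasWeakFDeriv U (fun z => s z • v z)
      (fun z => s z • Dv z + (fderiv ℝ s z).smulRight (v z)) := by
  have cs := hs.continuousOn
  have cds : ContinuousOn (fderiv ℝ s) U := hs.continuousOn_fderiv_of_isOpen hU (by simp)
  have l1 : LocallyIntegrableOn (fun z => s z • v z) U :=
    h.1.continuousOn_smul hU.isLocallyClosed cs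
  have l2 : LocallyIntegrableOn (fun z => s z • Dv z) U :=
    h.2.continuousOn_smul hU.isLocallyClosed cs
  have l3 : LocallyIntegrableOn (fun z => (fderiv ℝ s z).smulRight (v z)) U := by
    rw [locallyIntegrableOn_iff hU.isLocallyClosed] at *
    intro K hK hKc
    have i1 := (h.1.integrableOn_compact_subset hK hKc)
    obtain ⟨C, hC⟩ := (hKc.bddAbove_image (cds.mono hK).norm)
    refine Integrable.mono' (g := fun z => C * ‖v z‖) (i1.norm.const_mul C) ?_ ?_
    · exact ((ContinuousLinearMap.smulRightL ℝ ℂ E).continuous₂).comp_aestronglyMeasurable₂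
        ((cds.mono hK).aestronglyMeasurable_of_isCompact hKc hKc.measurableSet) i1.1
    · refine (ae_restrict_iff' hKc.measurableSet).2 (ae_of_all _ fun z hz => ?_)
      rw [ContinuousLinearMap.norm_smulRight_apply]
      exact mul_le_mul_of_nonneg_right (hC ⟨z, hz, rfl⟩) (norm_nonneg _)
  refine hasWeakFDeriv_of_forall_integral l1 (l2.fun_add l3) fun ζ a b c e => ?_
  -- The product `ζ s` is smooth on the whole plane, although `s` is smooth only on `U`, because `ζ`
  -- vanishes near every point off its support. It is therefore a test function for `v`.
  have hξ : ContDiff ℝ ∞ (fun z => ζ z * s z) := by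
    rw [contDiff_iff_contDiffAt]
    intro z
    by_cases hz : z ∈ tsupport ζ
    · exact a.contDiffAt.mul (hs.contDiffAt (hU.mem_nhds (c hz)))
    · have : ζ =ᶠ[𝓝 z] fun _ => 0 := notMem_tsupport_iff_eventuallyEq.1 hz
      refine (contDiffAt_const (c := (0:ℝ))).congr_of_eventuallyEq (this.mono fun y hy => by simp [hy])
  have sub : tsupport (fun z => ζ z * s z) ⊆ tsupport ζ := tsupport_mul_subset_left
  have key := h.integral_eq_neg hξ (b.of_isClosed_subset (isClosed_tsupport _) sub) (sub.trans c) e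
  have e1 : ∀ z, (fderiv ℝ (fun z => ζ z * s z) z e) • v z
      = (fderiv ℝ ζ z e) • s z • v z + ζ z • (fderiv ℝ s z e) • v z := by
    intro z
    by_cases hz : z ∈ tsupport ζ
    · rw [fderiv_fun_mul (a.differentiable (by simp) z)
        ((hs.contDiffAt (hU.mem_nhds (c hz))).differentiableAt (by simp))]
      simp only [ContinuousLinearMap.add_apply, ContinuousLinearMap.smul_apply, smul_eq_mul, add_smul,
        smul_smul]
      rw [add_comm, mul_comm (s z)]
    · rw [fderiv_eq_zero_of_notMem_tsupport hz,
        fderiv_eq_zero_of_notMem_tsupport (fun h => hz (sub h)), image_eq_zero_of_notMem_tsupport hz]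
      simp
  have h1 : tsupport (fun z => fderiv ℝ ζ z e) ⊆ tsupport ζ := by
    refine closure_minimal (fun z hz => ?_) (isClosed_tsupport ζ)
    by_contra hn
    exact hz (by simp [fderiv_eq_zero_of_notMem_tsupport hn])
  have i1 : Integrable fun z => (fderiv ℝ ζ z e) • s z • v z :=
    l1.integrable_smul_of_tsupport_subset
      ((a.continuous_fderiv (by simp)).clm_apply continuous_const)
      (b.of_isClosed_subset (isClosed_tsupport _) h1) (h1.trans c)
  have i2 : Integrable fun z => ζ z • (fderiv ℝ s z e) • v z := by
    have l4 : LocallyIntegrableOn (fun z => (fderiv ℝ s z e) • v z) U :=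
      h.1.continuousOn_smul hU.isLocallyClosed (cds.clm_apply continuousOn_const)
    exact l4.integrable_smul_of_tsupport_subset a.continuous b c
  have i3 : Integrable fun z => ζ z • s z • Dv z e := by
    have l4 : LocallyIntegrableOn (fun z => s z • Dv z e) U :=
      (h.locallyIntegrable_apply e).continuousOn_smul hU.isLocallyClosed cs
    exact l4.integrable_smul_of_tsupport_subset a.continuous b c
  simp only [e1] at key
  rw [integral_add i1 i2] at key
  simp only [ContinuousLinearMap.add_apply, ContinuousLinearMap.smul_apply, smul_add,
    ContinuousLinearMap.smulRight_apply]
  have e2 : ∀ z, (ζ z * s z) • Dv z e = ζ z • s z • Dv z e := fun z => mul_smul _ _ _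
  simp only [e2] at key
  rw [integral_add i3 i2, neg_add, ← key]
  abel

/-- Fundamental lemma of the calculus of variations in the directions `1` and `I`, which determine a
real linear map on ℂ. -/
theorem ae_eq (hU : IsOpen U) [CompleteSpace E] (h : HasWeakFDeriv U v Dv) (h' : HasWeakFDeriv U w Dw)
    (hvw : v =ᵐ[volume.restrict U] w) : Dv =ᵐ[volume.restrict U] Dw := by
  have key : ∀ e : ℂ, ∀ᵐ z, z ∈ U → Dv z e - Dw z e = 0 := by
    intro e
    refine hU.ae_eq_zero_of_integral_contDiff_smul_eq_zero
      ((h.locallyIntegrable_apply e).sub (h'.locallyIntegrable_apply e)) fun ζ a b c => ?_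
    simp only [smul_sub]
    rw [integral_sub (h.integrable_smul_deriv a b c e) (h'.integrable_smul_deriv a b c e)]
    have e1 := h.integral_eq ζ a b c e
    have e2 := h'.integral_eq ζ a b c e
    have e3 : ∫ z in U, (fderiv ℝ ζ z e) • v z = ∫ z in U, (fderiv ℝ ζ z e) • w z :=
      integral_congr_ae (hvw.mono fun z hz => by simp [hz])
    rw [e3, e2, neg_inj, setIntegral_smul_eq c, setIntegral_smul_eq c] at e1
    rw [e1, sub_self]
  rw [EventuallyEq, ae_restrict_iff' hU.measurableSet]
  filter_upwards [key 1, key I] with z h1 h2 hz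
  exact realCLM_ext (sub_eq_zero.1 (h1 hz)) (sub_eq_zero.1 (h2 hz))

end HasWeakFDeriv

end WeakDeriv

/-! ### Mollification -/

section Mollify

variable {E : Type} [NormedAddCommGroup E] [NormedSpace ℝ E]

/-- A sequence of bump functions with shrinking supports. -/
noncomputable def shrinkingBump (n : ℕ) : ContDiffBump (0 : ℂ) :=
  ⟨1 / (2 * ((n : ℝ) + 1)), 1 / ((n : ℝ) + 1), by positivity, by
    apply one_div_lt_one_div_of_lt <;> nlinarith [Nat.cast_nonneg (α := ℝ) n]⟩

/-- The mollifying kernels. -/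
noncomputable def mollifier (n : ℕ) : ℂ → ℝ := (shrinkingBump n).normed volume

/-- Mollification. -/
noncomputable def mollify (n : ℕ) (k : ℂ → E) (x : ℂ) : E := ∫ t, mollifier n (x - t) • k t

theorem tendsto_rOut_shrinkingBump : Tendsto (fun n => (shrinkingBump n).rOut) atTop (𝓝 0) :=
  tendsto_one_div_add_atTop_nhds_zero_nat

theorem mollifier_nonneg (n : ℕ) (x : ℂ) : 0 ≤ mollifier n x := ContDiffBump.nonneg_normed _ _

theorem contDiff_mollifier (n : ℕ) : ContDiff ℝ ∞ (mollifier n) := ContDiffBump.contDiff_normed _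

theorem hasCompactSupport_mollifier (n : ℕ) : HasCompactSupport (mollifier n) :=
  ContDiffBump.hasCompactSupport_normed _

theorem integral_mollifier (n : ℕ) : ∫ x, mollifier n x = 1 := ContDiffBump.integral_normed _

theorem tsupport_mollifier (n : ℕ) :
    tsupport (mollifier n) = Metric.closedBall 0 (shrinkingBump n).rOut :=
  ContDiffBump.tsupport_normed_eq _

theorem mollifier_sub_comm (n : ℕ) (x y : ℂ) : mollifier n (x - y) = mollifier n (y - x) := by
  rw [← neg_sub y x]; exact ContDiffBump.normed_neg _ _

theorem mollify_eq_convolution (n : ℕ) (k : ℂ → E) :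
    mollify n k = convolution k (mollifier n) (lsmul ℝ ℝ).flip volume := rfl

theorem ae_tendsto_mollify [CompleteSpace E] {k : ℂ → E} (hk : LocallyIntegrable k) :
    ∀ᵐ x, Tendsto (fun n => mollify n k x) atTop (𝓝 (k x)) := by
  -- The constant `K = 2` is the ratio of the outer to the inner radius of the bumps; a bounded
  -- ratio is what Lebesgue differentiation requires.
  have := ContDiffBump.ae_convolution_tendsto_right_of_locallyIntegrable (μ := volume)
    (φ := shrinkingBump) (K := 2) tendsto_rOut_shrinkingBump
    (Eventually.of_forall fun n => ?_) hk
  · filter_upwards [this] with x hx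
    refine hx.congr fun n => ?_
    rw [convolution_lsmul_swap]; rfl
  · simp only [shrinkingBump]
    rw [← mul_div_assoc, mul_one, div_mul_eq_div_div, div_self two_ne_zero]

theorem contDiff_mollify (n : ℕ) {k : ℂ → E} (hk : LocallyIntegrable k) :
    ContDiff ℝ ∞ (mollify n k) :=
  (hasCompactSupport_mollifier n).contDiff_convolution_right (lsmul ℝ ℝ).flip hk
    (contDiff_mollifier n)

theorem hasCompactSupport_mollify (n : ℕ) {k : ℂ → E} (hk : HasCompactSupport k) :
    HasCompactSupport (mollify n k) :=
  hk.convolution (μ := volume) (lsmul ℝ ℝ).flip (hasCompactSupport_mollifier n)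

theorem tsupport_mollify_subset (n : ℕ) {k : ℂ → E} :
    tsupport (mollify n k) ⊆ Metric.cthickening (shrinkingBump n).rOut (tsupport k) := by
  refine closure_minimal ?_ Metric.isClosed_cthickening
  refine (support_convolution_subset (μ := volume) (f := k) (g := mollifier n) (lsmul ℝ ℝ).flip).trans ?_
  rintro _ ⟨a, ha, b, hb, rfl⟩
  refine Metric.mem_cthickening_of_dist_le _ a _ _ (subset_tsupport _ ha) ?_
  have := (tsupport_mollifier n) ▸ subset_tsupport _ hb
  simpa using this

theorem integrable_mollifier_smul (n : ℕ) {k : ℂ → E} (hk : LocallyIntegrable k) (x : ℂ) :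
    Integrable fun t => mollifier n (x - t) • k t :=
  (hasCompactSupport_mollifier n).convolutionExists_right (lsmul ℝ ℝ).flip hk
    (contDiff_mollifier n).continuous x

theorem fderiv_mollify [CompleteSpace E] (n : ℕ) {k : ℂ → E} (hk : LocallyIntegrable k) (x e : ℂ) :
    fderiv ℝ (mollify n k) x e = ∫ t, fderiv ℝ (mollifier n) (x - t) e • k t := by
  have h := (hasCompactSupport_mollifier n).hasFDerivAt_convolution_right (lsmul ℝ ℝ).flip hk
    ((contDiff_mollifier n).of_le (by simp)) x
  rw [mollify_eq_convolution, h.fderiv, convolution_def, ContinuousLinearMap.integral_apply]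
  · rfl
  · exact ((hasCompactSupport_mollifier n).fderiv ℝ).convolutionExists_right _ hk
      ((contDiff_mollifier n).continuous_fderiv (by simp)) x

theorem fderiv_mollifier_sub (n : ℕ) (x t e : ℂ) :
    fderiv ℝ (fun t => mollifier n (x - t)) t e = - fderiv ℝ (mollifier n) (x - t) e := by
  have h : HasFDerivAt (fun t => mollifier n (x - t)) _ t :=
    (((contDiff_mollifier n).differentiable (by simp) (x - t)).hasFDerivAt).comp t
      ((hasFDerivAt_id t).const_sub x)
  rw [h.fderiv]; simp

theorem norm_mollify_le (n : ℕ) {k : ℂ → E} {M : ℝ} (hM : ∀ z, ‖k z‖ ≤ M) (x : ℂ) :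
    ‖mollify n k x‖ ≤ M := by
  have h1 : Integrable (fun t => mollifier n (x - t)) :=
    ((contDiff_mollifier n).continuous.integrable_of_hasCompactSupport
      (hasCompactSupport_mollifier n)).comp_sub_left x
  calc ‖mollify n k x‖ ≤ ∫ t, mollifier n (x - t) * M := by
        refine norm_integral_le_of_norm_le (h1.mul_const M) (ae_of_all _ fun t => ?_)
        rw [norm_smul, Real.norm_of_nonneg (mollifier_nonneg _ _)]
        exact mul_le_mul_of_nonneg_left (hM t) (mollifier_nonneg _ _)
    _ = M := by rw [integral_mul_const, integral_sub_left_eq_self (mollifier n) volume x,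
        integral_mollifier, one_mul]

/-- Mollification is symmetric. -/
theorem integral_inner_mollify (n : ℕ) {a b : ℂ → ℂ} (ha : Integrable a) (hb : AEStronglyMeasurable b)
    {M : ℝ} (hM : ∀ z, ‖b z‖ ≤ M) :
    ∫ x, ⟪mollify n a x, b x⟫_ℝ = ∫ x, ⟪a x, mollify n b x⟫_ℝ := by
  have lb : LocallyIntegrable b := by
    refine (locallyIntegrable_const M).mono hb (ae_of_all _ fun z => ?_)
    exact (hM z).trans (le_abs_self M)
  have e1 : ∀ x, ⟪mollify n a x, b x⟫_ℝ = ∫ t, mollifier n (x - t) * ⟪a t, b x⟫_ℝ := fun x => by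
    rw [real_inner_comm, mollify, ← integral_inner (integrable_mollifier_smul n ha.locallyIntegrable x)]
    congr 1; ext t; rw [real_inner_smul_right, real_inner_comm]
  have e2 : ∀ t, ⟪a t, mollify n b t⟫_ℝ = ∫ x, mollifier n (x - t) * ⟪a t, b x⟫_ℝ := fun t => by
    rw [mollify, ← integral_inner (integrable_mollifier_smul n lb t)]
    congr 1; ext x; rw [real_inner_smul_right, mollifier_sub_comm]
  simp only [e1, e2]
  rw [integral_integral_swap]
  have hm : Integrable (mollifier n) := (contDiff_mollifier n).continuous.integrable_of_hasCompactSupport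
      (hasCompactSupport_mollifier n)
  have i1 : Integrable (fun p : ℂ × ℂ => mollifier n (p.1 - p.2) * ‖a p.2‖) (volume.prod volume) := by
    have := Integrable.convolution_integrand (lsmul ℝ ℝ) ha.norm hm
    refine this.congr (ae_of_all _ fun p => ?_)
    simp [mul_comm]
  refine Integrable.mono' (i1.mul_const M) ?_ (ae_of_all _ fun p => ?_)
  · exact (((contDiff_mollifier n).continuous.comp (continuous_fst.sub continuous_snd)).aestronglyMeasurable).mul
      (ha.1.comp_snd.inner hb.comp_fst)
  · simp only [Function.uncurry, norm_mul]
    rw [Real.norm_of_nonneg (mollifier_nonneg _ _), mul_assoc]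
    gcongr
    · exact mollifier_nonneg _ _
    · exact (norm_inner_le_norm _ _).trans (mul_le_mul_of_nonneg_left (hM _) (norm_nonneg _))

end Mollify

/-! ### Functions with vanishing weak differential -/

section Constancy

variable {E : Type} [NormedAddCommGroup E] [NormedSpace ℝ E] [CompleteSpace E]

/-- For centres in the half ball and large n, the translated mollifier is an admissible test
function, so the mollifications of v have zero gradient there; they are constants converging almost
everywhere to v. On a closed ball local integrability already gives integrability. -/
theorem HasWeakFDeriv.ae_const_ball {v : ℂ → E} {c : ℂ} {r : ℝ} (hr : 0 < r)
    (h : HasWeakFDeriv (Metric.closedBall c r) v (fun _ => 0)) :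
    ∃ b : E, ∀ᵐ z, z ∈ Metric.ball c (r / 2) → v z = b := by
  set k : ℂ → E := (Metric.closedBall c r).indicator v
  have ik : Integrable k := (integrable_indicator_iff Metric.isClosed_closedBall.measurableSet).2
    (h.1.integrableOn_isCompact (isCompact_closedBall c r))
  have hlim := ae_tendsto_mollify ik.locallyIntegrable
  have hev : ∀ᶠ n in atTop, (shrinkingBump n).rOut < r / 2 :=
    tendsto_rOut_shrinkingBump.eventually_lt_const (by positivity)
  have hconst : ∀ᶠ n in atTop, ∀ x ∈ Metric.ball c (r / 2), ∀ y ∈ Metric.ball c (r / 2),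
      mollify n k x = mollify n k y := by
    filter_upwards [hev] with n hn x hx y hy
    have sub : ∀ x ∈ Metric.ball c (r / 2), tsupport (fun t => mollifier n (x - t)) ⊆
        Metric.closedBall c r := by
      intro x hx
      refine closure_minimal (fun t ht => ?_) Metric.isClosed_closedBall
      have : x - t ∈ Metric.closedBall 0 (shrinkingBump n).rOut :=
        (tsupport_mollifier n) ▸ subset_tsupport _ ht
      rw [mem_closedBall_zero_iff] at this
      rw [Metric.mem_ball, dist_eq_norm] at hx
      rw [Metric.mem_closedBall, dist_eq_norm]
      calc ‖t - c‖ = ‖(x - c) - (x - t)‖ := by congr 1; ring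
        _ ≤ ‖x - c‖ + ‖x - t‖ := norm_sub_le _ _
        _ ≤ r := by linarith
    refine (convex_ball c (r / 2)).is_const_of_fderivWithin_eq_zero (𝕜 := ℝ)
      ((contDiff_mollify n ik.locallyIntegrable).differentiable (by simp)).differentiableOn ?_ hx hy
    intro x hx
    rw [fderivWithin_of_isOpen Metric.isOpen_ball hx]
    ext e
    rw [fderiv_mollify n ik.locallyIntegrable]
    have cs : HasCompactSupport (fun t => mollifier n (x - t)) :=
      HasCompactSupport.of_support_subset_isCompact (isCompact_closedBall c r)
        ((subset_tsupport _).trans (sub x hx))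
    have := h.integral_eq_neg ((contDiff_mollifier n).comp (contDiff_const.sub contDiff_id)) cs
      (sub x hx) e
    simp only [zero_apply, smul_zero, integral_zero, neg_zero] at this
    rw [zero_apply, ← neg_eq_zero, ← integral_neg, ← this]
    refine integral_congr_ae (ae_of_all _ fun t => ?_)
    have e0 := fderiv_mollifier_sub n x t e
    simp only [Function.comp_def, id] at this ⊢
    rw [e0, neg_smul]
    by_cases ht : t ∈ Metric.closedBall c r
    · simp [k, ht]
    · have := fderiv_eq_zero_of_notMem_tsupport (fun h => ht (sub x hx h))
      rw [this, zero_apply, zero_eq_neg] at e0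
      simp [e0]
  -- The half ball has positive measure, so it contains a point of convergence; the limit there is
  -- the constant.
  have hne : ∃ x ∈ Metric.ball c (r / 2), Tendsto (fun n => mollify n k x) atTop (𝓝 (k x)) := by
    by_contra! hcon
    have : volume (Metric.ball c (r / 2)) = 0 :=
      measure_mono_null (fun x hx => hcon x hx) hlim
    exact (Metric.measure_ball_pos volume c (by positivity : 0 < r / 2)).ne' this
  obtain ⟨x, hx, hxl⟩ := hne
  refine ⟨k x, ?_⟩
  filter_upwards [hlim] with y hy hyb
  have hyr : y ∈ Metric.closedBall c r :=
    Metric.ball_subset_closedBall (Metric.ball_subset_ball (by linarith) hyb)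
  have e1 : k y = v y := by simp [k, hyr]
  rw [← e1]
  refine tendsto_nhds_unique hy (hxl.congr' ?_)
  filter_upwards [hconst] with n hn using hn x hx y hyb

/-- A function with vanishing weak differential on a connected open set is constant. -/
theorem HasWeakFDeriv.ae_const {U : Set ℂ} (hU : IsOpen U) (hc : IsPreconnected U) {v : ℂ → E}
    {Dv : ℂ → ℂ →L[ℝ] E}
    (h : HasWeakFDeriv U v Dv) (h0 : Dv =ᵐ[volume.restrict U] fun _ => 0) :
    ∃ b : E, ∀ᵐ z ∂(volume.restrict U), v z = b := by
  replace h : HasWeakFDeriv U v (fun _ => 0) := h.congr_ae (EventuallyEq.refl _ _) h0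
  rcases U.eq_empty_or_nonempty with rfl | ⟨z₀, hz₀⟩
  · exact ⟨0, by simp⟩
  have loc : ∀ z ∈ U, ∃ (b : E) (r : ℝ), 0 < r ∧ ∀ᵐ y, y ∈ Metric.ball z r → v y = b := by
    intro z hz
    obtain ⟨r, hr, hrU⟩ := Metric.nhds_basis_closedBall.mem_iff.1 (hU.mem_nhds hz)
    obtain ⟨b, hb⟩ := (h.mono hrU).ae_const_ball hr
    exact ⟨b, r / 2, by positivity, hb⟩
  choose! b r hr hb using loc
  -- The two balls meet in a nonempty open set, which has positive measure, so the local constants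
  -- agree.
  have uniq : ∀ z ∈ U, ∀ y ∈ U, y ∈ Metric.ball z (r z) → b y = b z := by
    intro z hz y hy hyz
    have hpos : 0 < volume (Metric.ball z (r z) ∩ Metric.ball y (r y)) :=
      (Metric.isOpen_ball.inter Metric.isOpen_ball).measure_pos volume
        ⟨y, hyz, Metric.mem_ball_self (hr y hy)⟩
    by_contra hne
    refine hpos.ne' (measure_mono_null (fun x hx => ?_) ((hb z hz).and (hb y hy)))
    intro hcon
    exact hne ((hcon.2 hx.2).symm.trans (hcon.1 hx.1))
  have hbc : ∀ z ∈ U, b z = b z₀ := by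
    intro z hz
    refine hc.induction₂ (fun x y => b x = b y) (fun x hx => ?_) (fun _ _ _ _ _ _ h1 h2 => h1.trans h2)
      (fun _ _ _ _ h => h.symm) hz hz₀
    filter_upwards [self_mem_nhdsWithin, mem_nhdsWithin_of_mem_nhds (Metric.ball_mem_nhds x (hr x hx))]
      with y hy hyx using (uniq x hx y hy hyx).symm
  refine ⟨b z₀, ?_⟩
  rw [ae_restrict_iff' hU.measurableSet]
  refine (measure_null_of_locally_null {z | ¬ (z ∈ U → v z = b z₀)} fun z hz => ?_)
  have hzU : z ∈ U := by by_contra hn; exact hz fun h => absurd h hn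
  refine ⟨_, inter_mem_nhdsWithin _ (Metric.ball_mem_nhds z (hr z hzU)), ?_⟩
  refine measure_mono_null (fun y hy => ?_) (hb z hzU)
  intro hcon
  exact hy.1 fun _ => (hcon hy.2).trans (hbc z hzU)

end Constancy

/-- The real and imaginary parts of ψ are scalar test functions for those of v. Vector-valued test
functions make it possible to test the weak differential with a mollification of ζ v itself. -/
theorem HasWeakFDeriv.integral_inner_eq_neg {U : Set ℂ} {v : ℂ → ℂ} {Dv : ℂ → ℂ →L[ℝ] ℂ}
    (h : HasWeakFDeriv U v Dv) {ψ : ℂ → ℂ} (hψ : ContDiff ℝ ∞ ψ) (hc : HasCompactSupport ψ)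
    (hU : tsupport ψ ⊆ U) (e : ℂ) :
    ∫ z, ⟪fderiv ℝ ψ z e, v z⟫_ℝ = - ∫ z, ⟪ψ z, Dv z e⟫_ℝ := by
  have hr : ContDiff ℝ ∞ (fun z => (ψ z).re) := reCLM.contDiff.comp hψ
  have hi : ContDiff ℝ ∞ (fun z => (ψ z).im) := imCLM.contDiff.comp hψ
  have cr : HasCompactSupport (fun z => (ψ z).re) := hc.comp_left (g := Complex.re) rfl
  have ci : HasCompactSupport (fun z => (ψ z).im) := hc.comp_left (g := Complex.im) rfl
  have sr : tsupport (fun z => (ψ z).re) ⊆ U := by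
    refine (closure_mono fun z hz => ?_ : _ ⊆ tsupport ψ).trans hU
    rw [Function.mem_support] at hz ⊢
    exact fun h => hz (by simp [h])
  have si : tsupport (fun z => (ψ z).im) ⊆ U := by
    refine (closure_mono fun z hz => ?_ : _ ⊆ tsupport ψ).trans hU
    rw [Function.mem_support] at hz ⊢
    exact fun h => hz (by simp [h])
  have dψ : ∀ z, fderiv ℝ ψ z e = ⟨fderiv ℝ (fun z => (ψ z).re) z e, fderiv ℝ (fun z => (ψ z).im) z e⟩ := by
    intro z
    have hd := (hψ.differentiable (by simp) z).hasFDerivAt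
    have h1 := (reCLM.hasFDerivAt.comp z hd).fderiv
    have h2 := (imCLM.hasFDerivAt.comp z hd).fderiv
    simp only [Function.comp_def, reCLM_apply, imCLM_apply] at h1 h2
    rw [h1, h2]; rfl
  have k1 := congrArg reCLM (h.integral_eq_neg hr cr sr e)
  have k2 := congrArg imCLM (h.integral_eq_neg hi ci si e)
  have a1 := h.integrable_fderiv_smul hr cr sr e
  have a2 := h.integrable_fderiv_smul hi ci si e
  have a3 := h.integrable_smul_deriv hr cr sr e
  have a4 := h.integrable_smul_deriv hi ci si e
  rw [map_neg, ← reCLM.integral_comp_comm a1, ← reCLM.integral_comp_comm a3] at k1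
  rw [map_neg, ← imCLM.integral_comp_comm a2, ← imCLM.integral_comp_comm a4] at k2
  have b1 := reCLM.integrable_comp a1
  have b2 := imCLM.integrable_comp a2
  have b3 := reCLM.integrable_comp a3
  have b4 := imCLM.integrable_comp a4
  have i1 : ∀ z, ⟪fderiv ℝ ψ z e, v z⟫_ℝ = reCLM ((fderiv ℝ (fun z => (ψ z).re) z e) • v z)
      + imCLM ((fderiv ℝ (fun z => (ψ z).im) z e) • v z) := by
    intro z
    rw [dψ, Complex.inner]; simp [mul_comm]
  have i2 : ∀ z, ⟪ψ z, Dv z e⟫_ℝ = reCLM ((ψ z).re • Dv z e) + imCLM ((ψ z).im • Dv z e) := by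
    intro z
    rw [Complex.inner]; simp [mul_comm]
  simp only [i1, i2]
  rw [integral_add b1 b2, integral_add b3 b4, k1, k2, neg_add]

/-- A unimodular weakly differentiable function is orthogonal to its differential. -/
theorem HasWeakFDeriv.ae_inner_eq_zero {U : Set ℂ} (hUo : IsOpen U) {v : ℂ → ℂ} {Dv : ℂ → ℂ →L[ℝ] ℂ}
    (h : HasWeakFDeriv U v Dv) (hv : ∀ z ∈ U, ‖v z‖ = 1) (e : ℂ) :
    ∀ᵐ z, z ∈ U → ⟪v z, Dv z e⟫_ℝ = 0 := by
  have l0 : LocallyIntegrableOn (fun z => ⟪v z, Dv z e⟫_ℝ) U := by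
    rw [locallyIntegrableOn_iff hUo.isLocallyClosed]
    intro K hK hKc
    have i1 := h.1.integrableOn_compact_subset hK hKc
    have i2 := (h.locallyIntegrable_apply e).integrableOn_compact_subset hK hKc
    refine i2.norm.mono' (i1.1.inner i2.1) ((ae_restrict_iff' hKc.measurableSet).2
      (ae_of_all _ fun z hz => ?_))
    simpa [hv z (hK hz)] using norm_inner_le_norm (𝕜 := ℝ) (v z) (Dv z e)
  refine hUo.ae_eq_zero_of_integral_contDiff_smul_eq_zero l0 fun ζ hζ hc hU => ?_
  simp only [smul_eq_mul]
  -- The aim is X = -X. Testing `Dv` with the mollification of `k = ζ v` gives, in the limit, X on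
  -- one side. On the other side it gives minus the integral of ⟨κ, v⟩, where κ = ∂ₑ(ζ v); as |v| =
  -- 1 this is -(∫ ∂ₑζ + X) = -X.
  set X := ∫ z, ζ z * ⟪v z, Dv z e⟫_ℝ with hX
  set k : ℂ → ℂ := fun z => ζ z • v z
  set κ : ℂ → ℂ := fun z => (fderiv ℝ ζ z e) • v z + ζ z • Dv z e
  have ik : Integrable k := h.integrable_smul hζ hc hU
  have iκ : Integrable κ := (h.integrable_fderiv_smul hζ hc hU e).add
    (h.integrable_smul_deriv hζ hc hU e)
  have sk : tsupport k ⊆ tsupport ζ := closure_mono fun z hz h => hz (by simp [k, h])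
  have ck : HasCompactSupport k := hc.of_isClosed_subset (isClosed_tsupport _) sk
  obtain ⟨δ, hδ, hδU⟩ := hc.exists_cthickening_subset_open hUo hU
  set K := Metric.cthickening δ (tsupport ζ)
  have hK : IsCompact K := hc.isCompact.cthickening
  have iD : IntegrableOn (fun z => Dv z e) K :=
    (h.locallyIntegrable_apply e).integrableOn_compact_subset hδU hK
  set w : ℂ → ℂ := K.indicator v
  have hw1 : ∀ z, ‖w z‖ ≤ 1 := by
    intro z
    by_cases hz : z ∈ K
    · simp [w, hz, hv z (hδU hz)]
    · simp [w, hz]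
  have mw : AEStronglyMeasurable w :=
    (aestronglyMeasurable_indicator_iff hK.measurableSet).2
      (h.1.integrableOn_compact_subset hδU hK).1
  have lw : LocallyIntegrable w := by
    refine (locallyIntegrable_const (1:ℝ)).mono mw (ae_of_all _ fun z => ?_)
    simpa using hw1 z
  obtain ⟨M, hM⟩ : ∃ M, ∀ z, ‖k z‖ ≤ M := by
    obtain ⟨M, hM⟩ := hζ.continuous.bounded_above_of_compact_support hc
    refine ⟨M, fun z => ?_⟩
    by_cases hz : z ∈ tsupport ζ
    · simpa [k, norm_smul, hv z (hU hz)] using hM z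
    · simpa [k, image_eq_zero_of_notMem_tsupport hz] using (norm_nonneg _).trans (hM 0)
  -- the differential of the mollification
  have dk : ∀ n x, fderiv ℝ (mollify n k) x e = mollify n κ x := by
    intro n x
    rw [fderiv_mollify n ik.locallyIntegrable, mollify]
    have hs : ContDiff ℝ ∞ (fun t => mollifier n (x - t) * ζ t) :=
      ((contDiff_mollifier n).comp (contDiff_const.sub contDiff_id)).mul hζ
    have sub : tsupport (fun t => mollifier n (x - t) * ζ t) ⊆ tsupport ζ :=
      tsupport_mul_subset_right
    have key := h.integral_eq_neg hs (hc.of_isClosed_subset (isClosed_tsupport _) sub) (sub.trans hU) e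
    have e1 : ∀ t, (fderiv ℝ (fun t => mollifier n (x - t) * ζ t) t e) • v t =
        mollifier n (x - t) • (fderiv ℝ ζ t e) • v t
          - fderiv ℝ (mollifier n) (x - t) e • k t := by
      intro t
      have d1 : DifferentiableAt ℝ (fun t => mollifier n (x - t)) t :=
        ((contDiff_mollifier n).comp (contDiff_const.sub contDiff_id)).differentiable (by simp) t
      rw [fderiv_fun_mul d1 (hζ.differentiable (by simp) t)]
      simp only [add_apply, smul_apply, fderiv_mollifier_sub, smul_eq_mul, k]
      module
    have i1 : Integrable fun t => mollifier n (x - t) • (fderiv ℝ ζ t e) • v t :=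
      integrable_mollifier_smul n (h.integrable_fderiv_smul hζ hc hU e).locallyIntegrable x
    have i2 : Integrable fun t => fderiv ℝ (mollifier n) (x - t) e • k t :=
      ((hasCompactSupport_mollifier n).fderiv_apply (𝕜 := ℝ) e).convolutionExists_right
        (lsmul ℝ ℝ).flip ik.locallyIntegrable
        (((contDiff_mollifier n).continuous_fderiv (by simp)).clm_apply continuous_const) x
    have i3 : Integrable fun t => mollifier n (x - t) • ζ t • Dv t e :=
      integrable_mollifier_smul n (h.integrable_smul_deriv hζ hc hU e).locallyIntegrable x
    simp only [e1, mul_smul] at key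
    rw [integral_sub i1 i2] at key
    simp only [κ, smul_add]
    rw [integral_add i1 i3, ← sub_eq_zero]
    rw [← sub_eq_zero] at key
    rw [← neg_eq_zero, ← key]
    abel
  have hev : ∀ᶠ n in atTop, (shrinkingBump n).rOut < δ :=
    tendsto_rOut_shrinkingBump.eventually_lt_const hδ
  have sK : ∀ᶠ n in atTop, tsupport (mollify n k) ⊆ K := by
    filter_upwards [hev] with n hn
    refine (tsupport_mollify_subset n).trans ?_
    exact (Metric.cthickening_mono hn.le _).trans (Metric.cthickening_subset_of_subset δ sk)
  have step : ∀ᶠ n in atTop, ∫ z, ⟪mollify n k z, Dv z e⟫_ℝ = - ∫ z, ⟪κ z, mollify n w z⟫_ℝ := by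
    filter_upwards [sK] with n hn
    have := h.integral_inner_eq_neg (contDiff_mollify n ik.locallyIntegrable)
      (hasCompactSupport_mollify n ck) (hn.trans hδU) e
    rw [← neg_eq_iff_eq_neg] at this
    -- `κ` is only integrable, so its mollifications have no evident pointwise bound. By symmetry
    -- the mollification is moved to the bounded function `w`, and dominated convergence applies.
    rw [← this, ← integral_inner_mollify n iκ mw hw1]
    congr 1
    refine integral_congr_ae (ae_of_all _ fun z => ?_)
    simp only
    rw [dk]
    by_cases hz : z ∈ K
    · simp [w, hz]
    · rw [← dk, fderiv_eq_zero_of_notMem_tsupport fun h => hz (hn h)]; simp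
  have lim1 : Tendsto (fun n => ∫ z, ⟪mollify n k z, Dv z e⟫_ℝ) atTop (𝓝 X) := by
    have e0 : ∀ᶠ n in atTop, ∫ z, ⟪mollify n k z, Dv z e⟫_ℝ = ∫ z in K, ⟪mollify n k z, Dv z e⟫_ℝ := by
      filter_upwards [sK] with n hn
      exact (setIntegral_eq_integral_of_forall_compl_eq_zero fun z hz => by
        rw [image_eq_zero_of_notMem_tsupport fun h => hz (hn h), inner_zero_left]).symm
    have e2 : X = ∫ z in K, ⟪k z, Dv z e⟫_ℝ := by
      rw [setIntegral_eq_integral_of_forall_compl_eq_zero]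
      · simp only [hX, k, real_inner_smul_left]
      · intro z hz
        rw [image_eq_zero_of_notMem_tsupport
          fun h => hz (Metric.self_subset_cthickening _ (sk h)), inner_zero_left]
    rw [e2]
    refine Tendsto.congr' (EventuallyEq.symm e0) ?_
    refine tendsto_integral_of_dominated_convergence (fun z => M * ‖Dv z e‖) ?_
      (iD.norm.const_mul M) ?_ ?_
    · exact fun n => ((contDiff_mollify n ik.locallyIntegrable).continuous.aestronglyMeasurable).inner iD.1
    · exact fun n => ae_of_all _ fun z => (norm_inner_le_norm _ _).trans
        (mul_le_mul_of_nonneg_right (norm_mollify_le n hM z) (norm_nonneg _))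
    · filter_upwards [ae_restrict_of_ae (ae_tendsto_mollify ik.locallyIntegrable)] with z hz
        using hz.inner tendsto_const_nhds
  have lim2 : Tendsto (fun n => ∫ z, ⟪κ z, mollify n w z⟫_ℝ) atTop (𝓝 X) := by
    have e2 : X = ∫ z, ⟪κ z, w z⟫_ℝ := by
      have i0 : Integrable fun z => fderiv ℝ ζ z e :=
        ((hζ.continuous_fderiv (by simp)).clm_apply continuous_const).integrable_of_hasCompactSupport
          (hc.fderiv_apply (𝕜 := ℝ) e)
      have i1 : Integrable fun z => ζ z * ⟪v z, Dv z e⟫_ℝ :=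
        l0.integrable_smul_of_tsupport_subset hζ.continuous hc hU
      -- The contribution ∂ₑζ |v|² = ∂ₑζ of the unimodular map integrates to zero.
      have z0 : ∫ z, fderiv ℝ ζ z e = 0 := by
        have := integral_bilinear_hasFDerivAt_right_eq_neg_left_of_integrable (μ := volume)
          (f := fun _ => (1:ℝ)) (f' := fun _ => 0) (g := ζ) (g' := fderiv ℝ ζ) (v := e)
          (B := ContinuousLinearMap.lsmul ℝ ℝ) (by simp) (by simpa using i0)
          (by simpa using hζ.continuous.integrable_of_hasCompactSupport hc)
          (fun x _ => hasFDerivAt_const _ _) (fun x _ => (hζ.differentiable (by simp) x).hasFDerivAt)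
        simpa using this
      rw [hX, ← zero_add (∫ z, ζ z * _), ← z0, ← integral_add i0 i1]
      refine integral_congr_ae (ae_of_all _ fun z => ?_)
      simp only [κ]
      by_cases hz : z ∈ tsupport ζ
      · have : z ∈ K := Metric.self_subset_cthickening _ hz
        simp only [w, indicator_of_mem this]
        rw [inner_add_left, real_inner_smul_left, real_inner_smul_left, real_inner_self_eq_norm_sq,
          hv z (hU hz), real_inner_comm]
        ring
      · simp [fderiv_eq_zero_of_notMem_tsupport hz, image_eq_zero_of_notMem_tsupport hz]
    rw [e2]
    refine tendsto_integral_of_dominated_convergence (fun z => ‖κ z‖ * 1) ?_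
      (iκ.norm.mul_const 1) ?_ ?_
    · exact fun n => iκ.1.inner (contDiff_mollify n lw).continuous.aestronglyMeasurable
    · exact fun n => ae_of_all _ fun z => (norm_inner_le_norm _ _).trans
        (mul_le_mul_of_nonneg_left (norm_mollify_le n hw1 z) (norm_nonneg _))
    · filter_upwards [ae_tendsto_mollify lw] with z hz using tendsto_const_nhds.inner hz
  have := tendsto_nhds_unique (lim1.congr' step) lim2.neg
  linarith

/-! ### Polar coordinates and the Gauss-Green formula on the disk -/

section Polar

variable {E : Type} [NormedAddCommGroup E] [NormedSpace ℝ E]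

theorem polarCoord_symm_eq_circleMap (p : ℝ × ℝ) :
    Complex.polarCoord.symm p = circleMap 0 p.1 p.2 := by
  rw [Complex.polarCoord_symm_apply, circleMap, zero_add, Complex.exp_mul_I]; push_cast; ring

theorem polarCoord_target_inter (F : ℂ → E) (p : ℝ × ℝ) (hp : p ∈ Complex.polarCoord.target) :
    p.1 • (Metric.ball (0:ℂ) 1).indicator F (Complex.polarCoord.symm p) =
    (Ioo (0:ℝ) 1 ×ˢ Ioo (-Real.pi) Real.pi).indicator (fun p : ℝ × ℝ => p.1 • F (circleMap 0 p.1 p.2)) p := by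
  rw [Complex.polarCoord_target] at hp
  have h0 : 0 < p.1 := hp.1
  rw [polarCoord_symm_eq_circleMap]
  by_cases h1 : p.1 < 1
  · rw [indicator_of_mem, indicator_of_mem]
    · exact ⟨⟨h0, h1⟩, hp.2⟩
    · simpa [circleMap, abs_of_pos h0] using h1
  · rw [indicator_of_notMem, indicator_of_notMem, smul_zero]
    · exact fun h => h1 h.1.2
    · simpa [circleMap, abs_of_pos h0] using h1

theorem integral_ball_eq_polar (F : ℂ → E) :
    ∫ z in Metric.ball (0:ℂ) 1, F z =
      ∫ p in Ioo (0:ℝ) 1 ×ˢ Ioo (-Real.pi) Real.pi, p.1 • F (circleMap 0 p.1 p.2) := by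
  rw [← integral_indicator measurableSet_ball, ← Complex.integral_comp_polarCoord_symm]
  have hm : MeasurableSet (Ioo (0:ℝ) 1 ×ˢ Ioo (-Real.pi) Real.pi) := measurableSet_Ioo.prod measurableSet_Ioo
  refine (setIntegral_congr_fun Complex.polarCoord.open_target.measurableSet
    (fun p hp => polarCoord_target_inter F p hp)).trans ?_
  rw [setIntegral_indicator hm]
  congr 2
  rw [Complex.polarCoord_target, inter_eq_right]
  exact prod_mono Ioo_subset_Ioi_self subset_rfl

theorem lintegral_ball_eq_polar (F : ℂ → ℝ≥0∞) :
    ∫⁻ z in Metric.ball (0:ℂ) 1, F z =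
      ∫⁻ p in Ioo (0:ℝ) 1 ×ˢ Ioo (-Real.pi) Real.pi, ENNReal.ofReal p.1 * F (circleMap 0 p.1 p.2) := by
  rw [← lintegral_indicator measurableSet_ball, ← Complex.lintegral_comp_polarCoord_symm]
  have hm : MeasurableSet (Ioo (0:ℝ) 1 ×ˢ Ioo (-Real.pi) Real.pi) := measurableSet_Ioo.prod measurableSet_Ioo
  have hs : Ioo (0:ℝ) 1 ×ˢ Ioo (-Real.pi) Real.pi ⊆ Complex.polarCoord.target := by
    rw [Complex.polarCoord_target]
    exact prod_mono Ioo_subset_Ioi_self subset_rfl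
  rw [← inter_eq_left.2 hs, ← setLIntegral_indicator hm]
  refine setLIntegral_congr_fun Complex.polarCoord.open_target.measurableSet fun p hp => ?_
  have h0 : 0 < p.1 := hp.1
  simp only [polarCoord_symm_eq_circleMap, smul_eq_mul]
  by_cases h1 : p.1 < 1
  · rw [indicator_of_mem, indicator_of_mem]
    · exact ⟨⟨h0, h1⟩, hp.2⟩
    · simpa [circleMap, abs_of_pos h0] using h1
  · rw [indicator_of_notMem, indicator_of_notMem, mul_zero]
    · exact fun h => h1 h.1.2
    · simpa [circleMap, abs_of_pos h0] using h1

omit [NormedSpace ℝ E] in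
-- In polar coordinates the Jacobian r cancels a singularity of order 1 / |z|.
theorem integrableOn_ball_of_norm_le {F : ℂ → E}
    (hF : AEStronglyMeasurable F (volume.restrict (Metric.ball (0:ℂ) 1))) {C : ℝ}
    (hC : ∀ z ∈ Metric.ball (0:ℂ) 1, z ≠ 0 → ‖F z‖ ≤ C * ‖z‖⁻¹) :
    IntegrableOn F (Metric.ball (0:ℂ) 1) := by
  have key : IntegrableOn (fun z : ℂ => ‖z‖⁻¹) (Metric.ball (0:ℂ) 1) := by
    refine ⟨(measurable_norm.inv).aestronglyMeasurable, ?_⟩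
    rw [HasFiniteIntegral, lintegral_ball_eq_polar]
    have hm : MeasurableSet (Ioo (0:ℝ) 1 ×ˢ Ioo (-Real.pi) Real.pi) := measurableSet_Ioo.prod measurableSet_Ioo
    calc ∫⁻ p in Ioo (0:ℝ) 1 ×ˢ Ioo (-Real.pi) Real.pi, ENNReal.ofReal p.1 * ‖‖circleMap 0 p.1 p.2‖⁻¹‖ₑ
        = ∫⁻ p in Ioo (0:ℝ) 1 ×ˢ Ioo (-Real.pi) Real.pi, 1 := by
          refine setLIntegral_congr_fun hm fun p hp => ?_
          have h0 : 0 < p.1 := hp.1.1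
          simp only [circleMap, zero_add, norm_mul, norm_exp_ofReal_mul_I, mul_one, norm_real,
            Real.norm_of_nonneg h0.le]
          rw [Real.enorm_of_nonneg (by positivity), ← ENNReal.ofReal_mul h0.le,
            mul_inv_cancel₀ h0.ne', ENNReal.ofReal_one]
      _ < ⊤ := by
          rw [setLIntegral_one, Measure.volume_eq_prod, Measure.prod_prod]
          exact ENNReal.mul_lt_top (by simp) (by simp)
  refine (key.const_mul C).mono' hF ?_
  have : ∀ᵐ z : ℂ, z ≠ 0 := by simp [ae_iff]
  filter_upwards [ae_restrict_mem measurableSet_ball, ae_restrict_of_ae this] with z h1 h2 using hC z h1 h2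

/-- The Gauss-Green formula on the unit disk. -/
theorem integral_ball_fderiv [CompleteSpace E] {w : ℂ → E} {w' : ℂ → ℂ →L[ℝ] E}
    (hw : ∀ z ∈ Metric.closedBall (0:ℂ) 1, HasFDerivAt w (w' z) z)
    (hc : ContinuousOn w' (Metric.closedBall 0 1)) (e : ℂ) :
    ∫ z in Metric.ball (0:ℂ) 1, w' z e =
      ∫ t, ⟪e, circleMap 0 1 t⟫_ℝ • w (circleMap 0 1 t) ∂arcMeasure := by
  have hpi := Real.pi_pos
  set ν : ℝ → ℂ := fun t => exp (t * I)
  have hν : ∀ t, HasDerivAt ν (I * ν t) t := fun t => by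
    have := ((hasDerivAt_id (t:ℂ)).mul_const I).cexp.comp_ofReal
    simpa [ν, mul_comm] using this
  set P : ℝ × ℝ → ℂ := fun p => p.1 • ν p.2
  have hP : ∀ p, circleMap 0 p.1 p.2 = P p := fun p => by simp [circleMap, P, ν]
  have hν1 : ∀ t, ‖ν t‖ = 1 := fun t => norm_exp_ofReal_mul_I t
  let ν' : ℝ × ℝ → ℝ × ℝ →L[ℝ] ℂ := fun p => (snd ℝ ℝ ℝ).smulRight (I * ν p.2)
  have dν : ∀ p : ℝ × ℝ, HasFDerivAt (fun p : ℝ × ℝ => ν p.2) (ν' p) p := fun p => by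
    have h0 : HasFDerivAt (Prod.snd : ℝ × ℝ → ℝ) (snd ℝ ℝ ℝ) p := hasFDerivAt_snd
    exact ((hν p.2).hasFDerivAt.comp p h0).congr_fderiv (by ext <;> simp [ν'])
  let P' : ℝ × ℝ → ℝ × ℝ →L[ℝ] ℂ := fun p => p.1 • ν' p + (fst ℝ ℝ ℝ).smulRight (ν p.2)
  have dP : ∀ p, HasFDerivAt P (P' p) p := fun p => hasFDerivAt_fst.smul (dν p)
  -- With ν = e^{it}, one has r ∂ₑw = ∂_r(r ⟨e, ν⟩ w) + ∂_t(⟨e, iν⟩ w): this is `key` below. The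
  -- divergence theorem on the rectangle [0, 1] × [-π, π] then leaves only the side r = 1: the side
  -- r = 0 carries the factor r, and the sides t = ±π cancel.
  let a : ℝ × ℝ → ℝ := fun p => ⟪e, ν p.2⟫_ℝ
  let b : ℝ × ℝ → ℝ := fun p => ⟪e, I * ν p.2⟫_ℝ
  have da : ∀ p, HasFDerivAt a ((innerSL ℝ e).comp (ν' p)) p := fun p =>
    (innerSL ℝ e).hasFDerivAt.comp p (dν p)
  have db : ∀ p, HasFDerivAt b ((innerSL ℝ e).comp (I • ν' p)) p := fun p =>
    (innerSL ℝ e).hasFDerivAt.comp p ((dν p).const_mul I)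
  have cν : Continuous ν := by fun_prop
  have cP : Continuous P := by fun_prop
  have hbox : ∀ p ∈ Icc ((0:ℝ), -Real.pi) (1, Real.pi), P p ∈ Metric.closedBall (0:ℂ) 1 := by
    intro p hp
    rw [mem_closedBall_zero_iff, norm_smul, hν1, mul_one, Real.norm_of_nonneg hp.1.1]
    exact hp.2.1
  have cw : ContinuousOn w (Metric.closedBall 0 1) := fun z hz =>
    (hw z hz).continuousAt.continuousWithinAt
  have cwP : ContinuousOn (fun p => w (P p)) (Icc ((0:ℝ), -Real.pi) (1, Real.pi)) :=
    cw.comp cP.continuousOn hbox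
  have ca : Continuous a := by fun_prop
  have cb : Continuous b := by fun_prop
  have dw : ∀ p ∈ Icc ((0:ℝ), -Real.pi) (1, Real.pi),
      HasFDerivAt (fun p => w (P p)) ((w' (P p)).comp (P' p)) p := fun p hp =>
    (hw _ (hbox p hp)).comp p (dP p)
  have hIoo : ∀ p ∈ Ioo (0:ℝ) 1 ×ˢ Ioo (-Real.pi) Real.pi, p ∈ Icc ((0:ℝ), -Real.pi) (1, Real.pi) :=
    fun p hp => ⟨⟨hp.1.1.le, hp.2.1.le⟩, ⟨hp.1.2.le, hp.2.2.le⟩⟩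
  have dec : ∀ t, e = ⟪e, ν t⟫_ℝ • ν t + ⟪e, I * ν t⟫_ℝ • (I * ν t) := by
    intro t
    have h1 : (ν t).re ^ 2 + (ν t).im ^ 2 = 1 := by
      have := hν1 t
      rw [← sq_eq_sq₀ (norm_nonneg _) zero_le_one, Complex.sq_norm, normSq_apply] at this
      linarith
    apply Complex.ext
    · simp [Complex.inner]; linear_combination (-e.re) * h1
    · simp [Complex.inner]; linear_combination (-e.im) * h1
  have key : ∀ p : ℝ × ℝ, ((p.1 • (innerSL ℝ e).comp (ν' p) + a p • (fst ℝ ℝ ℝ)).smulRight (w (P p)) +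
      (p.1 * a p) • (w' (P p)).comp (P' p)) (1, 0) +
      (b p • (w' (P p)).comp (P' p) + ((innerSL ℝ e).comp (I • ν' p)).smulRight (w (P p))) (0, 1)
      = p.1 • w' (P p) e := by
    intro p
    conv_rhs => rw [dec p.2]
    have hI : I * (I * ν p.2) = - ν p.2 := by rw [← mul_assoc, I_mul_I]; ring
    simp only [add_apply, smulRight_apply, FunLike.coe_smul, Pi.smul_apply, ContinuousLinearMap.coe_comp, Function.comp_apply,
      ν', P', a, b, coe_snd', coe_fst', zero_smul, one_smul, map_zero, smul_zero, zero_add, add_zero,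
      smul_eq_mul, mul_one, innerSL_apply_apply, hI, inner_neg_right, map_add, map_smul]
    module
  have main := integral_divergence_prod_Icc_of_hasFDerivAt_of_le
    (fun p : ℝ × ℝ => (p.1 * a p) • w (P p)) (fun p => b p • w (P p))
    (fun p => ((p.1 • (innerSL ℝ e).comp (ν' p) + a p • (fst ℝ ℝ ℝ)).smulRight (w (P p)) +
      (p.1 * a p) • (w' (P p)).comp (P' p)))
    (fun p => b p • (w' (P p)).comp (P' p) + ((innerSL ℝ e).comp (I • ν' p)).smulRight (w (P p)))
    (0, -Real.pi) (1, Real.pi) ⟨by norm_num, by simp only; linarith⟩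
    ((continuous_fst.mul ca).continuousOn.smul cwP) (cb.continuousOn.smul cwP)
    (fun p hp => by
      have := (hasFDerivAt_fst.mul (da p)).smul (dw p (hIoo p hp))
      rwa [add_comm] at this)
    (fun p hp => (db p).smul (dw p (hIoo p hp)))
    (by
      simp only [key]
      refine ContinuousOn.integrableOn_compact isCompact_Icc ?_
      exact continuous_fst.continuousOn.smul ((hc.comp cP.continuousOn hbox).clm_apply continuousOn_const))
  simp only [key] at main
  have e1 : ∫ z in Metric.ball (0:ℂ) 1, w' z e = ∫ p in Icc ((0:ℝ), -Real.pi) (1, Real.pi), p.1 • w' (P p) e := by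
    rw [integral_ball_eq_polar]
    simp only [hP]
    rw [Icc_prod_eq] 
    refine setIntegral_congr_set ?_
    exact Measure.set_prod_ae_eq Ioo_ae_eq_Icc Ioo_ae_eq_Icc
  have e2 : ∀ x : ℝ, b (x, Real.pi) • w (P (x, Real.pi)) = b (x, -Real.pi) • w (P (x, -Real.pi)) := by
    intro x
    have : ν (-Real.pi) = ν Real.pi := by simp [ν, exp_neg, exp_pi_mul_I]
    simp only [b, P, this]
  rw [e1, main]
  simp only [e2, sub_self, zero_add, zero_mul, zero_smul, intervalIntegral.integral_zero, sub_zero, one_mul]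
  have e3 : ∀ y : ℝ, a (1, y) • w (P (1, y)) = ⟪e, circleMap 0 1 y⟫_ℝ • w (circleMap 0 1 y) := by
    intro y; simp [a, P, circleMap, ν]
  simp only [e3]
  -- Polar coordinates use angles in (-π, π), while `arcMeasure` lives on (0, 2π].
  have per : Function.Periodic (fun y => ⟪e, circleMap 0 1 y⟫_ℝ • w (circleMap 0 1 y)) (2 * Real.pi) := by
    intro y; simp only [periodic_circleMap 0 1 y]
  have := per.intervalIntegral_add_eq (-Real.pi) 0
  rw [show -Real.pi + 2 * Real.pi = Real.pi by ring, zero_add] at this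
  rw [this, intervalIntegral.integral_of_le (by positivity), arcMeasure]

/-- Dilations depend continuously on the parameter, against continuous functions. -/
theorem tendsto_integral_dilation {K : ℂ → E} (hK : IntegrableOn K (Metric.ball 0 1)) {ζ : ℂ → ℝ}
    (hζ : Continuous ζ) :
    Tendsto (fun R : ℝ => ∫ z in Metric.ball (0:ℂ) 1, ζ z • K (R * z)) (𝓝[<] 1)
      (𝓝 (∫ z in Metric.ball (0:ℂ) 1, ζ z • K z)) := by
  set B := Metric.ball (0:ℂ) 1
  set κ := B.indicator K
  have iκ : Integrable κ := (integrable_indicator_iff measurableSet_ball).2 hK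
  have hev : ∀ᶠ R : ℝ in 𝓝[<] 1, 1 / 2 < R ∧ R < 1 := by
    filter_upwards [self_mem_nhdsWithin, mem_nhdsWithin_of_mem_nhds (lt_mem_nhds (by norm_num : (1/2:ℝ) < 1))]
      with R h1 h2 using ⟨h2, h1⟩
  -- The substitution w = R z moves the dilation from the merely integrable `K` to the continuous
  -- `ζ`, cut off to the disk, so that pointwise convergence and domination are available.
  have e1 : ∀ᶠ R : ℝ in 𝓝[<] 1, (R ^ 2)⁻¹ • ∫ w, B.indicator ζ (R⁻¹ • w) • κ w =
      ∫ z in B, ζ z • K (R * z) := by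
    filter_upwards [hev] with R hR
    have hR0 : 0 < R := by linarith [hR.1]
    have := Measure.integral_comp_smul volume (fun w => B.indicator ζ (R⁻¹ • w) • κ w) R
    rw [finrank_real_complex, abs_of_pos (by positivity)] at this
    rw [← this, ← integral_indicator measurableSet_ball]
    refine integral_congr_ae (ae_of_all _ fun z => ?_)
    simp only [smul_smul, inv_mul_cancel₀ hR0.ne', one_smul]
    by_cases hz : z ∈ B
    · have : R • z ∈ B := by
        simp only [B, mem_ball_zero_iff, norm_smul, Real.norm_of_nonneg hR0.le] at hz ⊢
        nlinarith [norm_nonneg z, hR.2]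
      simp only [hz, indicator_of_mem, κ, this]
      change _ = B.indicator _ z
      simp [hz]
    · change _ = B.indicator _ z
      simp [hz]
  have e2 : ∫ z in B, ζ z • K z = ((1:ℝ) ^ 2)⁻¹ • ∫ w, B.indicator ζ w • κ w := by
    rw [← integral_indicator measurableSet_ball, one_pow, inv_one, one_smul]
    refine integral_congr_ae (ae_of_all _ fun z => ?_)
    change B.indicator _ z = _
    by_cases hz : z ∈ B <;> simp only [hz, κ, indicator_of_mem, indicator_of_notMem, not_false_eq_true, smul_zero]
  rw [e2]
  refine Tendsto.congr' e1 (Tendsto.smul ?_ ?_)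
  · exact ((continuousAt_id.pow 2).inv₀ (by simp)).tendsto.mono_left nhdsWithin_le_nhds
  obtain ⟨M, hM⟩ := (isCompact_closedBall (0:ℂ) 1).exists_bound_of_continuousOn hζ.continuousOn
  have hM0 : 0 ≤ M := (norm_nonneg _).trans (hM 0 (by simp))
  refine tendsto_integral_filter_of_dominated_convergence (fun w => M * ‖κ w‖) ?_ ?_
    (iκ.norm.const_mul M) ?_
  · refine Eventually.of_forall fun R => ?_
    refine AEStronglyMeasurable.smul ?_ iκ.1
    exact ((hζ.measurable.indicator measurableSet_ball).comp (measurable_const_smul (R⁻¹))).aestronglyMeasurable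
  · refine Eventually.of_forall fun R => ae_of_all _ fun w => ?_
    rw [norm_smul]
    refine mul_le_mul_of_nonneg_right ?_ (norm_nonneg _)
    by_cases hz : R⁻¹ • w ∈ B
    · rw [indicator_of_mem hz]; exact hM _ (Metric.ball_subset_closedBall hz)
    · rw [indicator_of_notMem hz, norm_zero]; exact hM0
  · refine ae_of_all _ fun w => ?_
    by_cases hw : w ∈ B
    · refine Tendsto.smul ?_ tendsto_const_nhds
      have hl : Tendsto (fun R : ℝ => R⁻¹ • w) (𝓝[<] 1) (𝓝 w) := by
        have : ContinuousAt (fun R : ℝ => R⁻¹ • w) 1 :=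
          (continuousAt_inv₀ one_ne_zero).smul continuousAt_const
        have h := this.tendsto.mono_left (nhdsWithin_le_nhds (s := Iio 1))
        simpa using h
      rw [indicator_of_mem hw]
      refine ((hζ.tendsto w).comp hl).congr' ?_
      filter_upwards [hl.eventually (Metric.isOpen_ball.mem_nhds hw)] with R hR
      rw [indicator_of_mem (show R⁻¹ • w ∈ B from hR)]; rfl
    · simp [κ, hw]

end Polar

/-! ### The logarithm of the modulus and the unit part of a holomorphic function -/

section UnitPart

/-- The real form `e ↦ Re (l e)`. -/
noncomputable def reForm (l : ℂ) : ℂ →L[ℝ] ℝ := reCLM.comp (ContinuousLinearMap.mul ℝ ℂ l)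

/-- The real form `e ↦ Im (l e)`. -/
noncomputable def imForm (l : ℂ) : ℂ →L[ℝ] ℝ := imCLM.comp (ContinuousLinearMap.mul ℝ ℂ l)

/-- The differential of the unit part of a holomorphic function with value `u` and
logarithmic derivative `l`. -/
noncomputable def circForm (u l : ℂ) : ℂ →L[ℝ] ℂ := (imForm l).smulRight (I * u)

@[simp] theorem reForm_apply (l e : ℂ) : reForm l e = (l * e).re := rfl
@[simp] theorem imForm_apply (l e : ℂ) : imForm l e = (l * e).im := rfl
@[simp] theorem circForm_apply (u l e : ℂ) : circForm u l e = (l * e).im • (I * u) := rfl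

theorem continuous_reForm : Continuous reForm :=
  (ContinuousLinearMap.compL ℝ ℂ ℂ ℝ reCLM).continuous.comp (ContinuousLinearMap.mul ℝ ℂ).continuous

theorem continuous_imForm : Continuous imForm :=
  (ContinuousLinearMap.compL ℝ ℂ ℂ ℝ imCLM).continuous.comp (ContinuousLinearMap.mul ℝ ℂ).continuous

theorem continuous_circForm : Continuous fun p : ℂ × ℂ => circForm p.1 p.2 :=
  (ContinuousLinearMap.smulRightL ℝ ℂ ℂ).continuous₂.comp
    ((continuous_imForm.comp continuous_snd).prodMk (continuous_const.mul continuous_fst))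

theorem norm_reForm_le (l : ℂ) : ‖reForm l‖ ≤ ‖l‖ :=
  ContinuousLinearMap.opNorm_le_bound _ (norm_nonneg _) fun e =>
    (abs_re_le_norm _).trans (norm_mul l e).le

theorem norm_imForm_le (l : ℂ) : ‖imForm l‖ ≤ ‖l‖ :=
  ContinuousLinearMap.opNorm_le_bound _ (norm_nonneg _) fun e =>
    (abs_im_le_norm _).trans (norm_mul l e).le

theorem norm_circForm_le {u : ℂ} (hu : ‖u‖ = 1) (l : ℂ) : ‖circForm u l‖ ≤ ‖l‖ := by
  rw [circForm, norm_smulRight_apply, norm_mul, norm_I, hu, mul_one, mul_one]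
  exact norm_imForm_le l

theorem HasDerivAt.re_comp {q : ℂ → ℂ} {q' z : ℂ} (h : HasDerivAt q q' z) :
    HasFDerivAt (fun z => (q z).re) (reForm q') z := by
  have := reCLM.hasFDerivAt.comp z (h.hasFDerivAt.restrictScalars ℝ)
  refine this.congr_fderiv ?_
  ext e; simp [mul_comm]

theorem HasDerivAt.im_comp {q : ℂ → ℂ} {q' z : ℂ} (h : HasDerivAt q q' z) :
    HasFDerivAt (fun z => (q z).im) (imForm q') z := by
  have := imCLM.hasFDerivAt.comp z (h.hasFDerivAt.restrictScalars ℝ)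
  refine this.congr_fderiv ?_
  ext e; simp [mul_comm]

/-- Dividing by the value at z keeps the argument of the logarithm near 1, so no branch of log q has
to be chosen. -/
theorem hasDerivAt_log_div {q : ℂ → ℂ} {q' z : ℂ} (h : HasDerivAt q q' z) (hz : q z ≠ 0) :
    HasDerivAt (fun y => Complex.log (q y / q z)) (q' / q z) z := by
  have := (h.div_const (q z)).clog (by rw [div_self hz]; exact one_mem_slitPlane)
  simpa [div_self hz] using this

theorem hasFDerivAt_log_norm {q : ℂ → ℂ} {q' z : ℂ} (h : HasDerivAt q q' z) (hz : q z ≠ 0) :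
    HasFDerivAt (fun z => Real.log ‖q z‖) (reForm (q' / q z)) z := by
  have h1 := (hasDerivAt_log_div h hz).re_comp.add_const (Real.log ‖q z‖)
  refine h1.congr_of_eventuallyEq ?_
  filter_upwards [h.continuousAt.eventually_ne hz] with y hy
  rw [Complex.log_re, norm_div, Real.log_div (norm_ne_zero_iff.2 hy) (norm_ne_zero_iff.2 hz)]
  ring

/-- The phase of a is that of b turned by the argument of a / b. When a is close to b this argument
is a smooth function of a. -/
theorem div_norm_eq_mul_exp {a b : ℂ} (ha : a ≠ 0) (hb : b ≠ 0) :
    a / ‖a‖ = b / ‖b‖ * exp (I * (Complex.log (a / b)).im) := by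
  have h1 : a / b = ‖a / b‖ * exp (I * (Complex.log (a / b)).im) := by
    rw [Complex.log_im, mul_comm I, Complex.norm_mul_exp_arg_mul_I]
  have na : (‖a‖ : ℂ) ≠ 0 := by simpa using ha
  have nb : (‖b‖ : ℂ) ≠ 0 := by simpa using hb
  rw [norm_div, div_eq_iff hb] at h1
  push_cast at h1
  conv_lhs => enter [1]; rw [h1]
  field_simp

theorem hasFDerivAt_div_norm {q : ℂ → ℂ} {q' z : ℂ} (h : HasDerivAt q q' z) (hz : q z ≠ 0) :
    HasFDerivAt (fun z => q z / ‖q z‖) (circForm (q z / ‖q z‖) (q' / q z)) z := by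
  have h1 := (ofRealCLM.hasFDerivAt.comp z (hasDerivAt_log_div h hz).im_comp).const_mul I
  have h2 := (h1.cexp).const_mul (q z / ‖q z‖)
  refine (h2.congr_fderiv ?_).congr_of_eventuallyEq ?_
  · ext e; simp [div_self hz]; ring
  · filter_upwards [h.continuousAt.eventually_ne hz] with y hy
    exact div_norm_eq_mul_exp hy hz

theorem norm_div_norm {q : ℂ} (hq : q ≠ 0) : ‖q / (‖q‖ : ℂ)‖ = 1 := by
  rw [norm_div, norm_real, norm_norm, div_self (norm_ne_zero_iff.2 hq)]

theorem currentForm_circForm {u : ℂ} (hu : ‖u‖ = 1) (l e : ℂ) :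
    currentForm u (circForm u l) e = (l * e).im := by
  rw [currentForm, circForm_apply, real_inner_smul_left, real_inner_self_eq_norm_sq, norm_mul,
    norm_I, hu]; ring

/-- Replacing e by i e turns Im (l e) into Re (l e): the Cauchy-Riemann relation between the phase
and the logarithm of the modulus. It is the equation ⋆ω = dΦ. -/
theorem starForm_currentForm {u : ℂ} (hu : ‖u‖ = 1) (l e : ℂ) :
    starForm (currentForm u (circForm u l)) e = reForm l e := by
  rw [starForm, currentForm_circForm hu]; simp; ring

theorem contDiffOn_div_norm {q : ℂ → ℂ} {U : Set ℂ} (hU : IsOpen U) (hq : DifferentiableOn ℂ q U)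
    (h0 : ∀ z ∈ U, q z ≠ 0) : ContDiffOn ℝ ∞ (fun z => q z / ‖q z‖) U := by
  have hc : ContDiffOn ℝ ∞ q U := (hq.contDiffOn hU).restrict_scalars ℝ
  have h1 : ContDiffOn ℝ ∞ (fun z => ‖q z‖⁻¹) U := (hc.norm ℝ h0).inv fun z hz => norm_ne_zero_iff.2 (h0 z hz)
  refine (h1.smul hc).congr fun z _ => ?_
  simp [div_eq_inv_mul]

/-- The unit part of a holomorphic function without zeros is a harmonic map to the circle. -/
theorem isHarmonicMapToCircle_div_norm {q : ℂ → ℂ} {U : Set ℂ} (hU : IsOpen U)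
    (hq : DifferentiableOn ℂ q U) (h0 : ∀ z ∈ U, q z ≠ 0) :
    IsHarmonicMapToCircle U (fun z => q z / ‖q z‖) where
  smooth := contDiffOn_div_norm hU hq h0
  norm_eq_one z hz := norm_div_norm (h0 z hz)
  equation z hz := by
    set u : ℂ → ℂ := fun z => q z / ‖q z‖
    set l : ℂ → ℂ := fun z => deriv q z / q z
    have hd : ∀ y ∈ U, HasFDerivAt u (circForm (u y) (l y)) y := fun y hy =>
      hasFDerivAt_div_norm (hq.differentiableAt (hU.mem_nhds hy)).hasDerivAt (h0 y hy)
    have hl : HasDerivAt l (deriv l z) z :=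
      (((hq.deriv hU).div hq h0).differentiableAt (hU.mem_nhds hz)).hasDerivAt
    have hu1 : ‖u z‖ = 1 := norm_div_norm (h0 z hz)
    -- The part along i u carries e², so its values at e = 1 and e = I cancel in the Laplacian; the
    -- parts along u add up to -|∇u|² u.
    have key : ∀ e : ℂ, fderiv ℝ (fderiv ℝ u) z e e =
        (deriv l z * e * e).im • (I * u z) - ((l z * e).im ^ 2) • u z := by
      intro e
      have hdd : DifferentiableAt ℝ (fderiv ℝ u) z :=
        (((contDiffOn_div_norm hU hq h0).fderiv_of_isOpen hU (m := ∞) (by simp)).contDiffAt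
          (hU.mem_nhds hz)).differentiableAt (by simp)
      have e1 : fderiv ℝ (fderiv ℝ u) z e e = fderiv ℝ (fun y => fderiv ℝ u y e) z e := by
        rw [fderiv_clm_apply hdd (differentiableAt_const e)]; simp
      have e2 : (fun y => fderiv ℝ u y e) =ᶠ[𝓝 z] fun y => (l y * e).im • (I * u y) := by
        filter_upwards [hU.mem_nhds hz] with y hy
        rw [(hd y hy).fderiv, circForm_apply]
      have h1 : HasFDerivAt (fun y => (l y * e).im • (I * u y)) _ z :=
        (hl.mul_const e).im_comp.smul ((hd z hz).const_mul I)
      rw [e1, e2.fderiv_eq, h1.fderiv]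
      have hI : ∀ c : ℂ, I * (I * c) = -c := fun c => by rw [← mul_assoc, I_mul_I]; ring
      simp only [add_apply, FunLike.coe_smul, Pi.smul_apply, circForm_apply, smulRight_apply, imForm_apply,
        smul_eq_mul, mul_smul_comm, hI]
      module
    have n2 : ∀ e : ℂ, ‖fderiv ℝ u z e‖ ^ 2 = (l z * e).im ^ 2 := by
      intro e
      rw [(hd z hz).fderiv, circForm_apply, norm_smul, norm_mul, norm_I, hu1, mul_one, mul_one,
        Real.norm_eq_abs, sq_abs]
    rw [InnerProductSpace.laplacian_eq_iteratedFDeriv_complexPlane]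
    simp only [iteratedFDeriv_two_apply, Matrix.cons_val_zero, Matrix.cons_val_one]
    rw [key, key, n2, n2]
    have : (deriv l z * I * I).im = - (deriv l z * 1 * 1).im := by
      rw [mul_assoc, I_mul_I]; simp
    rw [this]
    module

end UnitPart

/-! ### The weak gradient and the flux of log |z| -/

section LogNorm

/-- The smooth functions ½ log (|z|² + ε) converge to log |z|. In the disk they are bounded by |log
|z|| + 1 and their gradients by 1 / |z|, both integrable, so integration by parts passes to the
limit. -/
theorem hasWeakFDeriv_log_norm_self :
    HasWeakFDeriv (Metric.ball 0 1) (fun z : ℂ => Real.log ‖z‖) (fun z => reForm z⁻¹) ∧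
    IntegrableOn (fun z : ℂ => Real.log ‖z‖) (Metric.ball 0 1) ∧
    IntegrableOn (fun z : ℂ => reForm z⁻¹) (Metric.ball 0 1) := by
  have hl : ∀ z ∈ Metric.ball (0:ℂ) 1, z ≠ 0 → |Real.log ‖z‖| ≤ ‖z‖⁻¹ := by
    intro z hz h0
    have hp : 0 < ‖z‖ := norm_pos_iff.2 h0
    have h1 : ‖z‖ < 1 := by simpa using hz
    rw [abs_of_nonpos (Real.log_nonpos hp.le h1.le), ← Real.log_inv]
    linarith [Real.log_le_sub_one_of_pos (inv_pos.2 hp)]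
  have i1 : IntegrableOn (fun z : ℂ => Real.log ‖z‖) (Metric.ball 0 1) :=
    integrableOn_ball_of_norm_le (C := 1)
      (Real.measurable_log.comp measurable_norm).aestronglyMeasurable
      fun z hz h0 => by simpa using hl z hz h0
  have i2 : IntegrableOn (fun z : ℂ => reForm z⁻¹) (Metric.ball 0 1) :=
    integrableOn_ball_of_norm_le (C := 1)
      (continuous_reForm.comp_aestronglyMeasurable measurable_inv.aestronglyMeasurable)
      fun z hz h0 => by simpa using norm_reForm_le z⁻¹
  refine ⟨hasWeakFDeriv_of_forall_integral i1.locallyIntegrableOn i2.locallyIntegrableOn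
    fun ζ hζ hc hU e => ?_, i1, i2⟩
  set ε : ℕ → ℝ := fun n => 1 / ((n:ℝ) + 1)
  have hε : ∀ n, 0 < ε n := fun n => by positivity
  have hε1 : ∀ n, ε n ≤ 1 := fun n => by
    rw [div_le_one (by positivity)]; linarith [Nat.cast_nonneg (α := ℝ) n]
  have hεl : Tendsto ε atTop (𝓝 0) := tendsto_one_div_add_atTop_nhds_zero_nat
  set W : ℕ → ℂ → ℝ := fun n z => 2⁻¹ * Real.log (‖z‖ ^ 2 + ε n)
  have hpos : ∀ n (z : ℂ), 0 < ‖z‖ ^ 2 + ε n := fun n z => by have := hε n; positivity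
  let W' : ℕ → ℂ → ℂ →L[ℝ] ℝ := fun n z => (‖z‖ ^ 2 + ε n)⁻¹ • innerSL ℝ z
  have dW : ∀ n z, HasFDerivAt (W n) (W' n z) z := by
    intro n z
    have h1 : HasFDerivAt (fun z : ℂ => ‖z‖ ^ 2 + ε n) (2 • innerSL ℝ z) z :=
      (hasStrictFDerivAt_norm_sq z).hasFDerivAt.add_const _
    refine ((h1.log (hpos n z).ne').const_mul 2⁻¹).congr_fderiv ?_
    ext x <;> simp [W'] <;> ring
  have cW' : ∀ n, Continuous (W' n) := fun n =>
    ((continuous_norm.pow 2).add continuous_const).inv₀ (fun z => (hpos n z).ne') |>.smul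
      (innerSL ℝ).continuous
  have key : ∀ n, ∫ z, fderiv ℝ ζ z e • W n z = - ∫ z, ζ z • W' n z e := fun n =>
    (hasWeakFDeriv_of_hasFDerivAt isOpen_univ (fun z _ => dW n z) (cW' n).continuousOn).integral_eq_neg
      hζ hc (subset_univ _) e
  have hne : ∀ᵐ z : ℂ, z ≠ 0 := by simp [ae_iff]
  have hzl : ∀ z : ℂ, Tendsto (fun n => ‖z‖ ^ 2 + ε n) atTop (𝓝 (‖z‖ ^ 2)) := fun z => by
    simpa using tendsto_const_nhds.add hεl
  have lim1 : Tendsto (fun n => ∫ z, fderiv ℝ ζ z e • W n z) atTop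
      (𝓝 (∫ z, fderiv ℝ ζ z e • Real.log ‖z‖)) := by
    have cd : Continuous fun z => fderiv ℝ ζ z e := (hζ.continuous_fderiv (by simp)).clm_apply continuous_const
    refine tendsto_integral_of_dominated_convergence
      (fun z => |fderiv ℝ ζ z e| * ((Metric.ball (0:ℂ) 1).indicator (fun z => |Real.log ‖z‖| + 1) z)) ?_ ?_ ?_ ?_
    · intro n
      exact (cd.smul (continuous_iff_continuousAt.2 fun z => (dW n z).continuousAt)).aestronglyMeasurable
    · have hi : Integrable ((Metric.ball (0:ℂ) 1).indicator (fun z => |Real.log ‖z‖| + 1)) :=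
        (integrable_indicator_iff measurableSet_ball).2 (i1.norm.add (integrableOn_const (by simp)))
      obtain ⟨M, hM⟩ := cd.bounded_above_of_compact_support (hc.fderiv_apply (𝕜 := ℝ) e)
      exact hi.bdd_mul (c := M) cd.norm.aestronglyMeasurable (ae_of_all _ fun z => by simpa using hM z)
    · intro n
      filter_upwards [hne] with z h0
      rw [norm_smul, Real.norm_eq_abs]
      by_cases hz : z ∈ Metric.ball (0:ℂ) 1
      · refine mul_le_mul_of_nonneg_left ?_ (abs_nonneg _)
        rw [indicator_of_mem hz, Real.norm_eq_abs]
        have hp : 0 < ‖z‖ := norm_pos_iff.2 h0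
        have h1 : ‖z‖ < 1 := by simpa using hz
        have b1 : Real.log ‖z‖ ≤ W n z := by
          have : Real.log (‖z‖ ^ 2) ≤ Real.log (‖z‖ ^ 2 + ε n) :=
            Real.log_le_log (by positivity) (by linarith [hε n])
          rw [Real.log_pow] at this
          simp only [W]; push_cast at this; linarith
        have b2 : W n z ≤ 1 := by
          have := Real.log_le_sub_one_of_pos (hpos n z)
          have h3 : ‖z‖ ^ 2 ≤ 1 := by nlinarith
          simp only [W]; linarith [hε1 n]
        rw [abs_le]
        constructor
        · linarith [neg_abs_le (Real.log ‖z‖)]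
        · linarith [abs_nonneg (Real.log ‖z‖)]
      · have : z ∉ tsupport ζ := fun h => hz (hU h)
        simp [fderiv_eq_zero_of_notMem_tsupport this]
    · filter_upwards [hne] with z h0
      refine tendsto_const_nhds.smul ?_
      have hp : 0 < ‖z‖ := norm_pos_iff.2 h0
      have := ((hzl z).log (by positivity)).const_mul 2⁻¹
      rw [Real.log_pow] at this
      convert this using 2
      push_cast; ring
  have lim2 : Tendsto (fun n => ∫ z, ζ z • W' n z e) atTop (𝓝 (∫ z, ζ z • reForm z⁻¹ e)) := by
    refine tendsto_integral_of_dominated_convergence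
      (fun z => ‖ζ z • ((Metric.ball (0:ℂ) 1).indicator (fun z => ‖z‖⁻¹ * ‖e‖) z)‖) ?_ ?_ ?_ ?_
    · exact fun n => (hζ.continuous.smul ((cW' n).clm_apply continuous_const)).aestronglyMeasurable
    · have h0 : IntegrableOn (fun z : ℂ => ‖z‖⁻¹ * ‖e‖) (Metric.ball 0 1) :=
        integrableOn_ball_of_norm_le (C := ‖e‖) ((measurable_norm.inv.mul_const _).aestronglyMeasurable)
          fun z _ _ => by simp [mul_comm]
      have hi : Integrable ((Metric.ball (0:ℂ) 1).indicator (fun z => ‖z‖⁻¹ * ‖e‖)) :=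
        (integrable_indicator_iff measurableSet_ball).2 h0
      obtain ⟨M, hM⟩ := hζ.continuous.bounded_above_of_compact_support hc
      exact (hi.bdd_mul (c := M) hζ.continuous.aestronglyMeasurable (ae_of_all _ hM)).norm
    · intro n
      filter_upwards [hne] with z h0
      by_cases hz : z ∈ Metric.ball (0:ℂ) 1
      · rw [indicator_of_mem hz, norm_smul, norm_smul]
        refine mul_le_mul_of_nonneg_left ?_ (norm_nonneg _)
        have hp : 0 < ‖z‖ := norm_pos_iff.2 h0
        simp only [W', FunLike.coe_smul, Pi.smul_apply, innerSL_apply_apply, smul_eq_mul, norm_mul, norm_inv,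
          norm_norm, Real.norm_of_nonneg (hpos n z).le]
        calc (‖z‖ ^ 2 + ε n)⁻¹ * ‖⟪z, e⟫_ℝ‖ ≤ (‖z‖ ^ 2)⁻¹ * (‖z‖ * ‖e‖) := by
              gcongr
              · linarith [hε n]
              · exact norm_inner_le_norm _ _
          _ = ‖z‖⁻¹ * ‖e‖ := by field_simp
      · have : z ∉ tsupport ζ := fun h => hz (hU h)
        simp [image_eq_zero_of_notMem_tsupport this]
    · filter_upwards [hne] with z h0
      have hp : 0 < ‖z‖ := norm_pos_iff.2 h0
      refine tendsto_const_nhds.smul ?_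
      have := ((hzl z).inv₀ (by positivity)).mul_const ⟪z, e⟫_ℝ
      have e1 : reForm z⁻¹ e = (‖z‖ ^ 2)⁻¹ * ⟪z, e⟫_ℝ := by
        rw [reForm_apply, Complex.inner, mul_re, mul_re, inv_re, inv_im, normSq_eq_norm_sq,
          conj_re, conj_im]
        ring
      rw [e1]
      exact this
  have l3 := lim2.neg
  simp only [← key] at l3
  exact tendsto_nhds_unique lim1 l3

/-- The flux of the gradient of `log |z|`. -/
theorem integral_ball_log_gradient {ζ : ℂ → ℝ} (hζ : ContDiff ℝ ∞ ζ) :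
    ∫ z in Metric.ball (0:ℂ) 1, (reForm z⁻¹ 1 * fderiv ℝ ζ z 1 + reForm z⁻¹ I * fderiv ℝ ζ z I) =
      (∫ t, onCircle ζ t ∂arcMeasure) - 2 * Real.pi * ζ 0 := by
  have hpi := Real.pi_pos
  have cd : Continuous (fderiv ℝ ζ) := hζ.continuous_fderiv (by simp)
  -- Since ∇ log |z| is the radial unit vector divided by r, the Jacobian leaves ∂_r ζ, and each ray
  -- contributes ζ(e^{it}) - ζ(0).
  have e1 : ∀ p ∈ Ioo (0:ℝ) 1 ×ˢ Ioo (-Real.pi) Real.pi,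
      p.1 • (reForm (circleMap 0 p.1 p.2)⁻¹ 1 * fderiv ℝ ζ (circleMap 0 p.1 p.2) 1 +
        reForm (circleMap 0 p.1 p.2)⁻¹ I * fderiv ℝ ζ (circleMap 0 p.1 p.2) I) =
      fderiv ℝ ζ (p.1 • circleMap 0 1 p.2) (circleMap 0 1 p.2) := by
    intro p hp
    have h0 : 0 < p.1 := hp.1.1
    have h1 : circleMap 0 p.1 p.2 = p.1 • circleMap 0 1 p.2 := by simp [circleMap]
    rw [h1]
    set ν := circleMap 0 1 p.2
    have hν : ‖ν‖ = 1 := by simp [ν]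
    have h2 : (p.1 • ν)⁻¹ = p.1⁻¹ • (starRingEnd ℂ) ν := by
      rw [smul_inv₀, Complex.inv_def, normSq_eq_norm_sq, hν]; simp
    have h3 : ν = ν.re • (1:ℂ) + ν.im • I := by simp [Complex.re_add_im]
    rw [h2]
    conv_rhs => rw [h3, map_add, map_smul, map_smul, ← h3]
    simp [mul_add]
    field_simp
  rw [integral_ball_eq_polar, setIntegral_congr_fun (measurableSet_Ioo.prod measurableSet_Ioo) e1]
  rw [Measure.volume_eq_prod, ← Measure.prod_restrict, integral_prod_symm]
  · have e2 : ∀ t : ℝ, ∫ r in Ioo (0:ℝ) 1, fderiv ℝ ζ (r • circleMap 0 1 t) (circleMap 0 1 t) =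
        ζ (circleMap 0 1 t) - ζ 0 := by
      intro t
      rw [← integral_Ioc_eq_integral_Ioo, ← intervalIntegral.integral_of_le zero_le_one]
      have hd : ∀ r : ℝ, HasDerivAt (fun r : ℝ => ζ (r • circleMap 0 1 t))
          (fderiv ℝ ζ (r • circleMap 0 1 t) (circleMap 0 1 t)) r := by
        intro r
        have h2 : HasDerivAt (fun r : ℝ => r • circleMap 0 1 t) (circleMap 0 1 t) r := by
          simpa using (hasDerivAt_id r).smul_const (circleMap 0 1 t)
        exact (hζ.differentiable (by simp) _).hasFDerivAt.comp_hasDerivAt r h2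
      rw [intervalIntegral.integral_eq_sub_of_hasDerivAt (fun r _ => hd r)]
      · simp
      · refine Continuous.intervalIntegrable ?_ _ _
        exact (cd.comp (continuous_id.smul continuous_const)).clm_apply continuous_const
    simp only [e2]
    have ci : Continuous fun t => ζ (circleMap 0 1 t) := hζ.continuous.comp (continuous_circleMap 0 1)
    have per : Function.Periodic (fun t => ζ (circleMap 0 1 t) - ζ 0) (2 * Real.pi) := by
      intro y; simp only [periodic_circleMap 0 1 y]
    have := per.intervalIntegral_add_eq (-Real.pi) 0
    rw [show -Real.pi + 2 * Real.pi = Real.pi by ring, zero_add] at this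
    rw [← integral_Ioc_eq_integral_Ioo, ← intervalIntegral.integral_of_le (by linarith), this,
      intervalIntegral.integral_sub (ci.intervalIntegrable _ _) (by simp),
      intervalIntegral.integral_const, intervalIntegral.integral_of_le (by positivity), arcMeasure]
    simp [onCircle]
  · rw [Measure.prod_restrict]
    refine IntegrableOn.mono_set (t := Icc ((0:ℝ), -Real.pi) (1, Real.pi)) ?_ ?_
    · refine ContinuousOn.integrableOn_compact isCompact_Icc (Continuous.continuousOn ?_)
      have cm : Continuous fun p : ℝ × ℝ => circleMap 0 1 p.2 := (continuous_circleMap 0 1).comp continuous_snd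
      exact (cd.comp (continuous_fst.smul cm)).clm_apply cm
    · rw [Icc_prod_eq]; exact prod_mono Ioo_subset_Icc_self Ioo_subset_Icc_self

end LogNorm

/-! ### Fourier kernels and `H^{1/2}` on the circle -/

section Kernels

local notation "conj" => starRingEnd ℂ

theorem HasSum.of_fun_eq {ι α : Type*} [AddCommMonoid α] [TopologicalSpace α] {f g : ι → α} {a : α}
    (hf : HasSum f a) (h : ∀ n, f n = g n) : HasSum g a := by
  rwa [show g = f from funext fun n => (h n).symm]

instance : IsFiniteMeasure arcMeasure := by unfold arcMeasure; infer_instance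

theorem arcMeasure_real_univ : arcMeasure.real univ = 2 * Real.pi := by
  simp [arcMeasure, Measure.real, Real.pi_pos.le]

theorem integral_arcMeasure_const (c : ℂ) : ∫ _, c ∂arcMeasure = 2 * Real.pi * c := by
  rw [integral_const, arcMeasure_real_univ, real_smul]; push_cast; ring

/-- Summation against a kernel with absolutely summable Fourier coefficients. -/
theorem hasSum_circleCoeff_mul_exp {a : ℤ → ℂ} (ha : Summable fun n => ‖a n‖) {k : ℝ → ℂ}
    (hk : ∀ x : ℝ, HasSum (fun n : ℤ => a n * exp (I * n * x)) (k x)) {h : ℂ → ℂ}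
    (hh : Integrable (onCircle h) arcMeasure) (t : ℝ) :
    HasSum (fun n : ℤ => a n * circleCoeff h n * exp (I * n * t))
      ((2 * Real.pi : ℝ)⁻¹ • ∫ s, k (t - s) * onCircle h s ∂arcMeasure) := by
  have key : HasSum (fun n : ℤ => ∫ s, a n * exp (I * n * (t - s : ℝ)) * onCircle h s ∂arcMeasure)
      (∫ s, k (t - s) * onCircle h s ∂arcMeasure) := by
    refine hasSum_integral_of_dominated_convergence (fun n s => ‖a n‖ * ‖onCircle h s‖) ?_ ?_ ?_ ?_ ?_
    · intro n
      exact (Continuous.aestronglyMeasurable (by fun_prop)).mul hh.1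
    · intro n
      refine ae_of_all _ fun s => ?_
      rw [norm_mul, norm_mul, show I * n * ((t - s : ℝ) : ℂ) = ((n * (t - s) : ℝ) : ℂ) * I by
        push_cast; ring, norm_exp_ofReal_mul_I, mul_one]
    · exact ae_of_all _ fun s => ha.mul_right _
    · simp_rw [tsum_mul_right]
      exact hh.norm.const_mul _
    · exact ae_of_all _ fun s => (hk (t - s)).mul_right _
  convert key.const_smul ((2 * Real.pi : ℝ)⁻¹) using 2 with n
  have e1 : ∀ s : ℝ, a n * exp (I * n * (t - s : ℝ)) * onCircle h s =
      (a n * exp (I * n * t)) * (exp (-(I * n * s)) * onCircle h s) := by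
    intro s
    have : exp (I * n * (t - s : ℝ)) = exp (I * n * t) * exp (-(I * n * s)) := by
      rw [← Complex.exp_add]
      congr 1
      push_cast; ring
    rw [this]; ring
  simp only [e1]
  rw [integral_const_mul]
  simp only [circleCoeff, real_smul]
  ring

/-- Bilinear summation against a kernel with absolutely summable Fourier coefficients. -/
theorem hasSum_circleCoeff_mul_conj {a : ℤ → ℂ} (ha : Summable fun n => ‖a n‖) {k : ℝ → ℂ}
    (hk : ∀ x : ℝ, HasSum (fun n : ℤ => a n * exp (I * n * x)) (k x)) {h g : ℂ → ℂ}
    (hh : Integrable (onCircle h) arcMeasure) (hg : Integrable (onCircle g) arcMeasure) :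
    HasSum (fun n : ℤ => a n * (circleCoeff h n * conj (circleCoeff g n)))
      (((2 * Real.pi : ℝ)⁻¹) ^ 2 • ∫ p : ℝ × ℝ, k (p.2 - p.1) * (onCircle h p.1 * conj (onCircle g p.2))
        ∂(arcMeasure.prod arcMeasure)) := by
  have hg' : Integrable (fun t => conj (onCircle g t)) arcMeasure :=
    (conjCLE : ℂ →L[ℝ] ℂ).integrable_comp hg
  have hp := hh.mul_prod hg'
  have key : HasSum (fun n : ℤ => ∫ p : ℝ × ℝ, a n * exp (I * n * (p.2 - p.1 : ℝ)) *
      (onCircle h p.1 * conj (onCircle g p.2)) ∂(arcMeasure.prod arcMeasure))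
      (∫ p : ℝ × ℝ, k (p.2 - p.1) * (onCircle h p.1 * conj (onCircle g p.2))
        ∂(arcMeasure.prod arcMeasure)) := by
    refine hasSum_integral_of_dominated_convergence
      (fun n p => ‖a n‖ * ‖onCircle h p.1 * conj (onCircle g p.2)‖) ?_ ?_ ?_ ?_ ?_
    · intro n
      exact (Continuous.aestronglyMeasurable (by fun_prop)).mul hp.1
    · intro n
      refine ae_of_all _ fun p => ?_
      rw [norm_mul, norm_mul, show I * n * ((p.2 - p.1 : ℝ) : ℂ) = ((n * (p.2 - p.1) : ℝ) : ℂ) * I by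
        push_cast; ring, norm_exp_ofReal_mul_I, mul_one]
    · exact ae_of_all _ fun s => ha.mul_right _
    · simp_rw [tsum_mul_right]
      exact hp.norm.const_mul _
    · exact ae_of_all _ fun p => (hk (p.2 - p.1)).mul_right _
  convert key.const_smul (((2 * Real.pi : ℝ)⁻¹) ^ 2) using 2 with n
  have e1 : ∀ p : ℝ × ℝ, a n * exp (I * n * (p.2 - p.1 : ℝ)) * (onCircle h p.1 * conj (onCircle g p.2)) =
      a n * ((exp (-(I * n * p.1)) * onCircle h p.1) * conj (exp (-(I * n * p.2)) * onCircle g p.2)) := by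
    intro p
    have : exp (I * n * (p.2 - p.1 : ℝ)) = exp (-(I * n * p.1)) * conj (exp (-(I * n * p.2))) := by
      rw [← exp_conj, ← Complex.exp_add]
      congr 1
      simp; ring
    rw [this, map_mul]; ring
  simp only [e1]
  rw [integral_const_mul, integral_prod_mul (fun s : ℝ => exp (-(I * n * s)) * onCircle h s)
    (fun s : ℝ => conj (exp (-(I * n * s)) * onCircle g s)), integral_conj]
  simp only [circleCoeff, real_smul, map_mul, conj_ofReal]
  push_cast; ring

variable {r : ℝ}

/-- The generating function `z / (1 - z)²` of the integers, at `z = r e^{ix}`. -/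
noncomputable def koebe (r x : ℝ) : ℂ := r * exp (I * x) / (1 - r * exp (I * x)) ^ 2

theorem norm_real_mul_exp (hr : 0 ≤ r) (x : ℝ) : ‖(r : ℂ) * exp (I * x)‖ = r := by
  rw [norm_mul, mul_comm I, norm_exp_ofReal_mul_I, mul_one, norm_real, Real.norm_of_nonneg hr]

theorem summable_natAbs_mul_pow (hr0 : 0 ≤ r) (hr1 : r < 1) :
    Summable fun n : ℤ => ‖((n.natAbs * r ^ n.natAbs : ℝ) : ℂ)‖ := by
  have h := (hasSum_coe_mul_geometric_of_norm_lt_one (𝕜 := ℝ)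
    (by rwa [Real.norm_of_nonneg hr0] : ‖r‖ < 1)).summable
  have e : ∀ n : ℤ, ‖((n.natAbs * r ^ n.natAbs : ℝ) : ℂ)‖ = n.natAbs * r ^ n.natAbs := fun n => by
    rw [norm_real, Real.norm_of_nonneg (by positivity)]
  simp only [e]
  refine Summable.of_nat_of_neg ?_ ?_ <;> simpa using h

theorem summable_pow_natAbs (hr0 : 0 ≤ r) (hr1 : r < 1) :
    Summable fun n : ℤ => ‖((r ^ n.natAbs : ℝ) : ℂ)‖ := by
  have h := summable_geometric_of_lt_one hr0 hr1
  have e : ∀ n : ℤ, ‖((r ^ n.natAbs : ℝ) : ℂ)‖ = r ^ n.natAbs := fun n => by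
    rw [norm_real, Real.norm_of_nonneg (by positivity)]
  simp only [e]
  refine Summable.of_nat_of_neg ?_ ?_ <;> simpa using h

theorem hasSum_koebe (hr0 : 0 ≤ r) (hr1 : r < 1) (x : ℝ) :
    HasSum (fun n : ℕ => (n : ℂ) * (r ^ n * exp (I * n * x))) (koebe r x) := by
  have := hasSum_coe_mul_geometric_of_norm_lt_one (𝕜 := ℂ) (r := r * exp (I * x))
    (by rwa [norm_real_mul_exp hr0])
  refine HasSum.of_fun_eq this fun n => ?_
  rw [mul_pow, ← Complex.exp_nat_mul]
  congr 3; ring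

/-- The term of index 0 vanishes, so the series is written from index 1 on, ready to be used for the
negative frequencies -(n + 1). -/
theorem hasSum_koebe_conj (hr0 : 0 ≤ r) (hr1 : r < 1) (x : ℝ) :
    HasSum (fun n : ℕ => ((n + 1 : ℕ) : ℂ) * (r ^ (n + 1) * exp (-(I * (n + 1 : ℕ) * x)))) (conj (koebe r x)) := by
  have h := (hasSum_nat_add_iff' 1).2 (hasSum_koebe hr0 hr1 x)
  have h2 := h.map (conjCLE : ℂ →L[ℝ] ℂ) (conjCLE : ℂ →L[ℝ] ℂ).continuous
  simp only [Finset.range_one, Finset.sum_singleton, Nat.cast_zero, zero_mul, sub_zero] at h2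
  refine HasSum.of_fun_eq h2 fun n => ?_
  simp only [Function.comp_apply, ContinuousLinearEquiv.coe_coe, conjCLE_apply, map_mul, map_pow,
    conj_ofReal, ← exp_conj, conj_I, map_natCast]
  congr 3; ring

/-- The even multiplier |n| r^|n|: its kernel produces the Abel means of Σ |n| |ĥ(n)|², the Fourier
form of the H^{1/2} seminorm. -/
theorem hasSum_kernel_abs (hr0 : 0 ≤ r) (hr1 : r < 1) (x : ℝ) :
    HasSum (fun n : ℤ => ((n.natAbs * r ^ n.natAbs : ℝ) : ℂ) * exp (I * n * x))
      ((2 * (koebe r x).re : ℝ) : ℂ) := by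
  have e : ((2 * (koebe r x).re : ℝ) : ℂ) = koebe r x + conj (koebe r x) := (add_conj _).symm
  rw [e]
  refine HasSum.of_nat_of_neg_add_one ?_ ?_
  · refine HasSum.of_fun_eq (hasSum_koebe hr0 hr1 x) fun n => ?_
    simp [mul_assoc]
  · refine HasSum.of_fun_eq (hasSum_koebe_conj hr0 hr1 x) fun n => ?_
    have : (-((n : ℤ) + 1)).natAbs = n + 1 := by omega
    rw [this]
    push_cast
    rw [show I * -((n:ℂ) + 1) * x = -(I * (n + 1) * x) by ring]
    ring

/-- The odd multiplier n r^|n|: its kernel produces the Abel means of the pairing with ∂_θ h. -/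
theorem hasSum_kernel_int (hr0 : 0 ≤ r) (hr1 : r < 1) (x : ℝ) :
    HasSum (fun n : ℤ => ((n * r ^ n.natAbs : ℝ) : ℂ) * exp (I * n * x))
      (((2 * (koebe r x).im : ℝ) : ℂ) * I) := by
  have e : ((2 * (koebe r x).im : ℝ) : ℂ) * I = koebe r x + -conj (koebe r x) := by
    rw [← sub_eq_add_neg, sub_conj]
  rw [e]
  refine HasSum.of_nat_of_neg_add_one ?_ ?_
  · refine HasSum.of_fun_eq (hasSum_koebe hr0 hr1 x) fun n => ?_
    simp [mul_assoc]
  · refine HasSum.of_fun_eq ((hasSum_koebe_conj hr0 hr1 x).neg) fun n => ?_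
    have : (-((n : ℤ) + 1)).natAbs = n + 1 := by omega
    rw [this]
    push_cast
    rw [show I * (-((n:ℂ) + 1)) * x = -(I * (n + 1) * x) by ring]
    ring

/-- The Poisson kernel. -/
noncomputable def diskPoisson (r x : ℝ) : ℝ := (1 - r ^ 2) / ‖1 - r * exp (I * x)‖ ^ 2

theorem hasSum_diskPoisson (hr0 : 0 ≤ r) (hr1 : r < 1) (x : ℝ) :
    HasSum (fun n : ℤ => ((r ^ n.natAbs : ℝ) : ℂ) * exp (I * n * x)) (diskPoisson r x : ℂ) := by
  set z : ℂ := r * exp (I * x)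
  have hz : ‖z‖ < 1 := by rwa [norm_real_mul_exp hr0]
  have hz1 : 1 - z ≠ 0 := by
    intro h; rw [← sub_eq_zero.1 h] at hz; simp at hz
  have h1 := hasSum_geometric_of_norm_lt_one hz
  have h2 := ((hasSum_nat_add_iff' 1).2 h1).map (conjCLE : ℂ →L[ℝ] ℂ) (conjCLE : ℂ →L[ℝ] ℂ).continuous
  simp only [Finset.range_one, Finset.sum_singleton, pow_zero] at h2
  have e : (diskPoisson r x : ℂ) = (1 - z)⁻¹ + conj ((1 - z)⁻¹ - 1) := by
    have hc : conj (1 - z) ≠ 0 := (map_ne_zero _).2 hz1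
    have hr2 : ((r : ℂ)) ^ 2 = z * conj z := by
      rw [mul_conj, normSq_eq_norm_sq, norm_real_mul_exp hr0]; push_cast; rfl
    have hc' : 1 - conj z ≠ 0 := by simpa using hc
    have : (diskPoisson r x : ℂ) = (1 - z * conj z) / ((1 - z) * (1 - conj z)) := by
      have e2 : (1 - z) * (1 - conj z) = ((‖1 - z‖ ^ 2 : ℝ) : ℂ) := by
        rw [← normSq_eq_norm_sq, ← mul_conj, map_sub, map_one]
      rw [e2, ← hr2, diskPoisson]; push_cast; rfl
    rw [this, map_sub, map_inv₀, map_one, map_sub, map_one]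
    field_simp
    ring
  rw [e]
  refine HasSum.of_nat_of_neg_add_one ?_ ?_
  · refine HasSum.of_fun_eq h1 fun n => ?_
    simp only [z, mul_pow, ← Complex.exp_nat_mul, Int.natAbs_natCast]
    push_cast
    congr 2; ring
  · refine HasSum.of_fun_eq h2 fun n => ?_
    have : (-((n : ℤ) + 1)).natAbs = n + 1 := by omega
    rw [this]
    simp only [Function.comp_apply, ContinuousLinearEquiv.coe_coe, conjCLE_apply, z, mul_pow, map_mul, map_pow,
      conj_ofReal, ← exp_conj, ← Complex.exp_nat_mul, conj_I, map_add, map_one, map_natCast]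
    push_cast
    congr 2; ring

theorem one_sub_ne_zero (hr0 : 0 ≤ r) (hr1 : r < 1) (x : ℝ) : (1:ℂ) - r * exp (I * x) ≠ 0 := by
  intro h
  have := norm_real_mul_exp hr0 x
  rw [← sub_eq_zero.1 h, norm_one] at this
  linarith

/-- The point r e^{ix} is at distance 1 - r from e^{ix}, and at distance at least 1 - r from 1. All
bounds uniform in r come from this comparison. -/
theorem norm_one_sub_exp_le (hr0 : 0 ≤ r) (hr1 : r < 1) (x : ℝ) :
    ‖1 - exp (I * x)‖ ≤ 2 * ‖1 - r * exp (I * x)‖ := by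
  have h1 : 1 - r ≤ ‖1 - r * exp (I * x)‖ := by
    have := norm_sub_norm_le (1:ℂ) (r * exp (I * x))
    rwa [norm_real_mul_exp hr0, norm_one] at this
  have h2 : ‖r * exp (I * x) - exp (I * x)‖ = 1 - r := by
    rw [← sub_one_mul, norm_mul, mul_comm I, norm_exp_ofReal_mul_I, mul_one, ← ofReal_one, ← ofReal_sub,
      norm_real, Real.norm_of_nonpos (by linarith)]; ring
  calc ‖1 - exp (I * x)‖ = ‖(1 - r * exp (I * x)) + (r * exp (I * x) - exp (I * x))‖ := by congr 1; ring
    _ ≤ _ := norm_add_le _ _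
    _ ≤ _ := by rw [h2]; linarith

/-- The kernel is dominated, uniformly in r, by the weight of the Gagliardo integral; the constant 4
is the square of the 2 in `norm_one_sub_exp_le`. -/
theorem norm_koebe_mul_le (hr0 : 0 ≤ r) (hr1 : r < 1) (x : ℝ) :
    ‖koebe r x‖ * ‖1 - exp (I * x)‖ ^ 2 ≤ 4 := by
  have h0 : 0 < ‖1 - r * exp (I * x)‖ := norm_pos_iff.2 (one_sub_ne_zero hr0 hr1 x)
  have h := pow_le_pow_left₀ (norm_nonneg _) (norm_one_sub_exp_le hr0 hr1 x) 2
  rw [koebe, norm_div, norm_real_mul_exp hr0, norm_pow, div_mul_eq_mul_div, div_le_iff₀ (by positivity)]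
  nlinarith [sq_nonneg ‖1 - exp (I * x)‖]

/-- Compared with the Gagliardo weight, the Poisson kernel gains the factor 1 - r², which is the
source of the convergence of Poisson means. -/
theorem diskPoisson_mul_le (hr0 : 0 ≤ r) (hr1 : r < 1) (x : ℝ) :
    diskPoisson r x * ‖1 - exp (I * x)‖ ^ 2 ≤ 4 * (1 - r ^ 2) := by
  have h0 : 0 < ‖1 - r * exp (I * x)‖ := norm_pos_iff.2 (one_sub_ne_zero hr0 hr1 x)
  have h := pow_le_pow_left₀ (norm_nonneg _) (norm_one_sub_exp_le hr0 hr1 x) 2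
  rw [diskPoisson, div_mul_eq_mul_div, div_le_iff₀ (by positivity)]
  have : 0 ≤ 1 - r ^ 2 := by nlinarith
  nlinarith [mul_le_mul_of_nonneg_left h this]

theorem diskPoisson_nonneg (hr0 : 0 ≤ r) (hr1 : r < 1) (x : ℝ) : 0 ≤ diskPoisson r x :=
  div_nonneg (by nlinarith) (by positivity)

theorem continuous_koebe (hr0 : 0 ≤ r) (hr1 : r < 1) : Continuous (koebe r) := by
  unfold koebe
  exact Continuous.div (by fun_prop) (by fun_prop) fun x => pow_ne_zero 2 (one_sub_ne_zero hr0 hr1 x)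

theorem continuous_diskPoisson (hr0 : 0 ≤ r) (hr1 : r < 1) : Continuous (diskPoisson r) := by
  unfold diskPoisson
  exact Continuous.div (by fun_prop) (by fun_prop) fun x =>
    pow_ne_zero 2 (norm_ne_zero_iff.2 (one_sub_ne_zero hr0 hr1 x))

/-- The imaginary part of the kernel vanishes in the limit. -/
theorem tendsto_koebe_im {x : ℝ} (hx : exp (I * x) ≠ 1) :
    Tendsto (fun r => (koebe r x).im) (𝓝[<] 1) (𝓝 0) := by
  set w := exp (I * x)
  have hw1 : 1 - w ≠ 0 := sub_ne_zero.2 (Ne.symm hx)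
  have hw : w * conj w = 1 := by
    rw [mul_conj, normSq_eq_norm_sq, show w = exp (x * I) by simp [w, mul_comm], norm_exp_ofReal_mul_I]; simp
  have hc : ContinuousAt (fun r => (koebe r x).im) 1 := by
    refine Complex.continuous_im.continuousAt.comp ?_
    unfold koebe
    refine ContinuousAt.div (by fun_prop) (by fun_prop) ?_
    rw [ofReal_one, one_mul]; exact pow_ne_zero 2 hw1
  -- On the unit circle conjugation is inversion, and w / (1 - w)² is invariant under w ↦ 1 / w.
  have h1 : (koebe 1 x).im = 0 := by
    rw [← conj_eq_iff_im]
    have hw0 : w ≠ 0 := exp_ne_zero _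
    have hcw : conj w = w⁻¹ := eq_inv_of_mul_eq_one_right hw
    have : koebe 1 x = w / (1 - w) ^ 2 := by simp [koebe, w]
    rw [this, map_div₀, map_pow, map_sub, map_one, hcw]
    have : w - 1 ≠ 0 := sub_ne_zero.2 hx
    rw [show 1 - w⁻¹ = (w - 1) / w by field_simp]
    field_simp
    ring
  have := hc.tendsto.mono_left (nhdsWithin_le_nhds (s := Iio 1))
  rwa [h1] at this

theorem norm_circleMap_sub (s t : ℝ) :
    ‖circleMap 0 1 s - circleMap 0 1 t‖ = ‖1 - exp (I * (t - s : ℝ))‖ := by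
  have : circleMap 0 1 s - circleMap 0 1 t = circleMap 0 1 s * (1 - exp (I * (t - s : ℝ))) := by
    simp only [circleMap, zero_add, ofReal_one, one_mul]
    rw [mul_sub, mul_one, ← Complex.exp_add]
    congr 2; push_cast; ring
  rw [this, norm_mul, norm_circleMap_zero]; simp

end Kernels

/-! ### The space H^{1/2} of the circle: Gagliardo integral and Fourier coefficients -/

section HHalf

local notation "conj" => starRingEnd ℂ

variable {E F : Type} [NormedAddCommGroup E] [NormedAddCommGroup F]

/-- The integrand of the Gagliardo seminorm of `H^{1/2}(𝕊¹)`. -/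
noncomputable def gagliardo (h : ℂ → E) (p : ℝ × ℝ) : ℝ :=
  ‖onCircle h p.1 - onCircle h p.2‖ ^ 2 / ‖circleMap 0 1 p.1 - circleMap 0 1 p.2‖ ^ 2

theorem gagliardo_nonneg (h : ℂ → E) (p : ℝ × ℝ) : 0 ≤ gagliardo h p := by
  unfold gagliardo; positivity

theorem gagliardo_mul (h : ℂ → E) (p : ℝ × ℝ) :
    gagliardo h p * ‖circleMap 0 1 p.1 - circleMap 0 1 p.2‖ ^ 2 =
      ‖onCircle h p.1 - onCircle h p.2‖ ^ 2 := by
  by_cases hp : circleMap 0 1 p.1 = circleMap 0 1 p.2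
  · simp [onCircle, hp]
  · exact div_mul_cancel₀ _ (pow_ne_zero _ (norm_ne_zero_iff.2 (sub_ne_zero.2 hp)))

/-- Where the two points coincide both quotients are 0 / 0, which is 0 in ℝ as well as in `ℝ≥0∞`. -/
theorem ofReal_gagliardo (h : ℂ → E) (p : ℝ × ℝ) :
    ENNReal.ofReal (gagliardo h p) = ‖onCircle h p.1 - onCircle h p.2‖ₑ ^ 2 /
      ‖circleMap 0 1 p.1 - circleMap 0 1 p.2‖ₑ ^ 2 := by
  by_cases hp : circleMap 0 1 p.1 = circleMap 0 1 p.2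
  · simp [onCircle, gagliardo, hp]
  · have := norm_pos_iff.2 (sub_ne_zero.2 hp)
    rw [gagliardo, ENNReal.ofReal_div_of_pos (by positivity), ENNReal.ofReal_pow (norm_nonneg _),
      ENNReal.ofReal_pow (norm_nonneg _), ofReal_norm, ofReal_norm]

theorem aestronglyMeasurable_gagliardo {h : ℂ → E} (hh : AEStronglyMeasurable (onCircle h) arcMeasure) :
    AEStronglyMeasurable (gagliardo h) (arcMeasure.prod arcMeasure) := by
  have h1 : AEMeasurable (fun p : ℝ × ℝ => ‖onCircle h p.1 - onCircle h p.2‖)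
      (arcMeasure.prod arcMeasure) := (hh.comp_fst.sub hh.comp_snd).norm.aemeasurable
  have h2 : Measurable (fun p : ℝ × ℝ => ‖circleMap 0 1 p.1 - circleMap 0 1 p.2‖) :=
    Continuous.measurable (by fun_prop)
  exact ((h1.pow_const 2).div (h2.pow_const 2).aemeasurable).aestronglyMeasurable

theorem memHHalf_iff {h : ℂ → E} : MemHHalf h ↔
    MemLp (onCircle h) 2 arcMeasure ∧ Integrable (gagliardo h) (arcMeasure.prod arcMeasure) := by
  refine and_congr_right fun h1 => ?_
  have hm := aestronglyMeasurable_gagliardo h1.1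
  have e : ∫⁻ p, ENNReal.ofReal (gagliardo h p) ∂(arcMeasure.prod arcMeasure) =
      ∫⁻ s, ∫⁻ t, ‖onCircle h s - onCircle h t‖ₑ ^ 2 /
      ‖circleMap 0 1 s - circleMap 0 1 t‖ₑ ^ 2 ∂arcMeasure ∂arcMeasure := by
    rw [lintegral_prod _ hm.aemeasurable.ennreal_ofReal]
    simp only [ofReal_gagliardo]
  rw [← e, ← hasFiniteIntegral_iff_ofReal (ae_of_all _ (gagliardo_nonneg h))]
  exact ⟨fun h => ⟨hm, h⟩, fun h => h.2⟩

theorem MemHHalf.integrable {h : ℂ → E} (hh : MemHHalf h) : Integrable (onCircle h) arcMeasure :=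
  hh.1.integrable one_le_two

theorem MemHHalf.integrable_gagliardo {h : ℂ → E} (hh : MemHHalf h) :
    Integrable (gagliardo h) (arcMeasure.prod arcMeasure) := (memHHalf_iff.1 hh).2

/-- Comparison principle for membership in `H^{1/2}`. -/
theorem MemHHalf.of_norm_sub_le {h : ℂ → E} {k : ℂ → F} (hh : MemHHalf h)
    (hk : MemLp (onCircle k) 2 arcMeasure) {A B : ℝ}
    (hle : ∀ᵐ p ∂(arcMeasure.prod arcMeasure), ‖onCircle k p.1 - onCircle k p.2‖ ^ 2 ≤
      A * ‖onCircle h p.1 - onCircle h p.2‖ ^ 2 + B * ‖circleMap 0 1 p.1 - circleMap 0 1 p.2‖ ^ 2) :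
    MemHHalf k := by
  refine memHHalf_iff.2 ⟨hk, ?_⟩
  refine Integrable.mono' ((hh.integrable_gagliardo.const_mul A).add (integrable_const |B|))
    (aestronglyMeasurable_gagliardo hk.1) ?_
  filter_upwards [hle] with p hp
  rw [Real.norm_of_nonneg (gagliardo_nonneg _ _)]
  by_cases hE : circleMap 0 1 p.1 = circleMap 0 1 p.2
  · simp [gagliardo, hE]
  · have h0 := norm_pos_iff.2 (sub_ne_zero.2 hE)
    rw [gagliardo, div_le_iff₀ (by positivity)]
    have := gagliardo_mul h p
    simp only [Pi.add_apply]
    rw [add_mul, mul_assoc, this]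
    refine hp.trans ?_
    gcongr
    exact le_abs_self B

theorem memHHalf_zero : MemHHalf (fun _ : ℂ => (0 : E)) := by
  refine memHHalf_iff.2 ⟨?_, ?_⟩
  · show MemLp (fun _ => (0:E)) 2 arcMeasure
    exact MemLp.zero'
  · have : gagliardo (fun _ : ℂ => (0 : E)) = 0 := by ext p; simp [gagliardo, onCircle]
    rw [this]; exact integrable_zero _ _ _

theorem memHHalf_of_lipschitz {k : ℂ → F} (hk : Continuous (onCircle k)) {C : ℝ}
    (hle : ∀ s t : ℝ, ‖onCircle k s - onCircle k t‖ ≤ C * ‖circleMap 0 1 s - circleMap 0 1 t‖) :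
    MemHHalf k := by
  have hb : MemLp (onCircle k) 2 arcMeasure := by
    refine MemLp.of_bound hk.aestronglyMeasurable (‖onCircle k 0‖ + |C| * 2) (ae_of_all _ fun t => ?_)
    have h1 := hle t 0
    have h2 : ‖circleMap 0 1 t - circleMap 0 1 0‖ ≤ 2 := by
      refine (norm_sub_le _ _).trans ?_
      rw [norm_circleMap_zero, norm_circleMap_zero]; norm_num
    have h3 := norm_le_norm_add_norm_sub' (onCircle k t) (onCircle k 0)
    have h4 : C * ‖circleMap 0 1 t - circleMap 0 1 0‖ ≤ |C| * 2 :=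
      mul_le_mul (le_abs_self C) h2 (norm_nonneg _) (abs_nonneg C)
    linarith
  refine (memHHalf_zero (E := ℝ)).of_norm_sub_le hb (A := 0) (B := C ^ 2) (ae_of_all _ fun p => ?_)
  rw [zero_mul, zero_add, ← mul_pow]
  exact pow_le_pow_left₀ (norm_nonneg _) (hle _ _) 2

theorem MemHHalf.ofReal {φ : ℂ → ℝ} (hφ : MemHHalf φ) : MemHHalf (fun z => (φ z : ℂ)) := by
  refine hφ.of_norm_sub_le (A := 1) (B := 0) hφ.1.ofReal (ae_of_all _ fun p => ?_)
  have : onCircle (fun z => (φ z : ℂ)) p.1 - onCircle (fun z => (φ z : ℂ)) p.2 =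
    ((onCircle φ p.1 - onCircle φ p.2 : ℝ) : ℂ) := by simp [onCircle]
  rw [this, norm_real]; simp

/-- A smooth function is Lipschitz along the unit circle. -/
theorem exists_lipschitz_circle {ζ : ℂ → ℝ} (hζ : ContDiff ℝ ∞ ζ) :
    ∃ C : ℝ, 0 ≤ C ∧ (∀ t, |onCircle ζ t| ≤ C) ∧
      ∀ s t, |onCircle ζ s - onCircle ζ t| ≤ C * ‖circleMap 0 1 s - circleMap 0 1 t‖ := by
  obtain ⟨C1, h1⟩ := (isCompact_closedBall (0:ℂ) 1).exists_bound_of_continuousOn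
    (hζ.continuous_fderiv (by simp)).continuousOn
  obtain ⟨C2, h2⟩ := (isCompact_closedBall (0:ℂ) 1).exists_bound_of_continuousOn
    hζ.continuous.continuousOn
  have hm : ∀ t, circleMap 0 1 t ∈ Metric.closedBall (0:ℂ) 1 := fun t => by simp
  refine ⟨max (max C1 C2) 0, le_max_right _ _, fun t => ((h2 _ (hm t)).trans (le_max_right _ _)).trans
    (le_max_left _ _), fun s t => ?_⟩
  refine Convex.norm_image_sub_le_of_norm_fderiv_le (𝕜 := ℝ) (s := Metric.closedBall (0:ℂ) 1)
    (fun x _ => (hζ.differentiable (by simp)) x)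
    (fun x hx => ((h1 x hx).trans (le_max_left _ _)).trans (le_max_left _ _))
    (convex_closedBall _ _) (hm t) (hm s)

theorem continuous_onCircle {h : ℂ → E} (hh : Continuous h) : Continuous (onCircle h) :=
  hh.comp (continuous_circleMap 0 1)

/-- The field ζ i h against which ∂_θ h is paired is in H^{1/2}: a difference of products splits
into a term with a difference of h, where ζ is bounded, and a term with a difference of ζ, where |h|
= 1. -/
theorem MemHHalfCircle.smul_I_mul {h : ℂ → ℂ} (hh : MemHHalfCircle h) {ζ : ℂ → ℝ}
    (hζ : ContDiff ℝ ∞ ζ) : MemHHalf (fun z => ζ z • (I * h z)) := by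
  obtain ⟨C, hC0, hC1, hC2⟩ := exists_lipschitz_circle hζ
  have hm : AEStronglyMeasurable (onCircle (fun z => ζ z • (I * h z))) arcMeasure :=
    (continuous_onCircle hζ.continuous).aestronglyMeasurable.smul (hh.1.1.1.const_mul I)
  refine hh.1.of_norm_sub_le (A := 2 * C ^ 2) (B := 2 * C ^ 2) (MemLp.of_bound hm C ?_) ?_
  · filter_upwards [hh.2] with t ht
    have : onCircle (fun z => ζ z • (I * h z)) t = onCircle ζ t • (I * onCircle h t) := rfl
    rw [this, norm_smul, norm_mul, norm_I, ht]
    simpa using hC1 t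
  · have := Measure.quasiMeasurePreserving_snd (μ := arcMeasure) (ν := arcMeasure) |>.ae hh.2
    filter_upwards [this] with p hp
    have e : onCircle (fun z => ζ z • (I * h z)) p.1 - onCircle (fun z => ζ z • (I * h z)) p.2 =
        onCircle ζ p.1 • (I * (onCircle h p.1 - onCircle h p.2)) +
        (onCircle ζ p.1 - onCircle ζ p.2) • (I * onCircle h p.2) := by
      simp only [onCircle, real_smul]; push_cast; ring
    have e2 : ‖onCircle (fun z => ζ z • (I * h z)) p.1 - onCircle (fun z => ζ z • (I * h z)) p.2‖ ≤
        C * ‖onCircle h p.1 - onCircle h p.2‖ + C * ‖circleMap 0 1 p.1 - circleMap 0 1 p.2‖ := by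
      rw [e]
      refine (norm_add_le _ _).trans (add_le_add ?_ ?_)
      · rw [norm_smul, norm_mul, norm_I, one_mul]
        exact mul_le_mul_of_nonneg_right (hC1 _) (norm_nonneg _)
      · rw [norm_smul, norm_mul, norm_I, one_mul, hp, mul_one]
        exact hC2 _ _
    refine (pow_le_pow_left₀ (norm_nonneg _) e2 2).trans ?_
    nlinarith [sq_nonneg (C * ‖onCircle h p.1 - onCircle h p.2‖ -
      C * ‖circleMap 0 1 p.1 - circleMap 0 1 p.2‖)]

theorem circleCoeff_one (n : ℤ) : circleCoeff (fun _ => 1) n = if n = 0 then 1 else 0 := by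
  have h2 : (2 * Real.pi : ℂ) ≠ 0 := by
    exact_mod_cast (by positivity : (2 * Real.pi : ℝ) ≠ 0)
  split_ifs with h
  · subst h
    simp only [circleCoeff, onCircle, Int.cast_zero, mul_zero, zero_mul, neg_zero, Complex.exp_zero, mul_one]
    rw [integral_arcMeasure_const, real_smul]
    push_cast
    field_simp
  · simp only [circleCoeff, onCircle, mul_one, arcMeasure]
    rw [← intervalIntegral.integral_of_le Real.two_pi_pos.le]
    have hn : (-(I * n) : ℂ) ≠ 0 := neg_ne_zero.2 (mul_ne_zero I_ne_zero (by exact_mod_cast h))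
    have e : ∀ t : ℝ, exp (-(I * n * t)) = exp (-(I * n) * t) := fun t => by rw [neg_mul]
    simp only [e]
    rw [integral_exp_mul_complex hn]
    have : exp (-(I * n) * ((2 * Real.pi : ℝ) : ℂ)) = 1 := by
      rw [Complex.exp_eq_one_iff]; exact ⟨-n, by push_cast; ring⟩
    rw [this]; simp

/-- A uniform bound on the Abel means bounds every finite partial sum, by letting r → 1 in it. -/
theorem summable_of_sum_mul_pow_le {ι : Type*} {f : ι → ℝ} (hf : ∀ n, 0 ≤ f n) (N : ι → ℕ) {C : ℝ}
    (h : ∀ r : ℝ, 0 ≤ r → r < 1 → Summable (fun n => f n * r ^ N n) ∧ ∑' n, f n * r ^ N n ≤ C) :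
    Summable f := by
  refine summable_of_sum_le hf (c := C) fun u => ?_
  have h1 : Tendsto (fun r : ℝ => ∑ n ∈ u, f n * r ^ N n) (𝓝[<] 1) (𝓝 (∑ n ∈ u, f n)) := by
    have : ContinuousAt (fun r : ℝ => ∑ n ∈ u, f n * r ^ N n) 1 := by fun_prop
    have := this.tendsto.mono_left (nhdsWithin_le_nhds (s := Iio 1))
    simpa using this
  refine le_of_tendsto h1 ?_
  filter_upwards [Ioo_mem_nhdsLT (zero_lt_one (α := ℝ))] with r hr
  obtain ⟨h2, h3⟩ := h r hr.1.le hr.2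
  exact (h2.sum_le_tsum u fun n _ => mul_nonneg (hf n) (pow_nonneg hr.1.le _)).trans h3

/-- Abel's theorem for absolutely convergent series. -/
theorem tendsto_tsum_mul_pow {ι : Type*} {f : ι → ℝ} (hf : Summable f) (N : ι → ℕ) :
    Tendsto (fun r : ℝ => ∑' n, f n * r ^ N n) (𝓝[<] 1) (𝓝 (∑' n, f n)) := by
  refine tendsto_tsum_of_dominated_convergence hf.abs (fun n => ?_) ?_
  · have : ContinuousAt (fun r : ℝ => f n * r ^ N n) 1 := by fun_prop
    have := this.tendsto.mono_left (nhdsWithin_le_nhds (s := Iio 1))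
    simpa using this
  · filter_upwards [Ioo_mem_nhdsLT (zero_lt_one (α := ℝ))] with r hr n
    rw [norm_mul, Real.norm_eq_abs, norm_pow, Real.norm_of_nonneg hr.1.le]
    exact mul_le_of_le_one_right (abs_nonneg _) (pow_le_one₀ hr.1.le hr.2.le)

theorem _root_.MeasureTheory.Integrable.conj {α : Type*} {m : MeasurableSpace α} {μ : Measure α} {f : α → ℂ}
    (hf : Integrable f μ) : Integrable (fun x => conj (f x)) μ :=
  (conjCLE : ℂ →L[ℝ] ℂ).integrable_comp hf

theorem MemLp.integrable_norm_sq_ofReal {h : ℂ → ℂ} (hh : MemLp (onCircle h) 2 arcMeasure) :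
    Integrable (onCircle fun z => ((‖h z‖ ^ 2 : ℝ) : ℂ)) arcMeasure := by
  have := (memLp_two_iff_integrable_sq_norm hh.1).1 hh
  exact this.ofReal

theorem norm_koebe_mul_gagliardo_le {r : ℝ} (hr0 : 0 ≤ r) (hr1 : r < 1) (h : ℂ → E) (p : ℝ × ℝ) :
    ‖koebe r (p.2 - p.1)‖ * ‖onCircle h p.1 - onCircle h p.2‖ ^ 2 ≤ 4 * gagliardo h p := by
  have := norm_koebe_mul_le hr0 hr1 (p.2 - p.1)
  rw [← gagliardo_mul h p, norm_circleMap_sub]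
  nlinarith [gagliardo_nonneg h p]

/-- By polarization, 2 Re (h(s) h̄(t)) = |h(s)|² + |h(t)|² - |h(s) - h(t)|². The kernel of the
multiplier |n| r^|n| has no zeroth coefficient, so the first two terms, each depending on one
variable, integrate to zero. The Abel means of Σ |n| |ĥ(n)|² thus involve only |h(s) - h(t)|² and
are bounded by the Gagliardo integral through `norm_koebe_mul_le`. -/
theorem MemHHalf.summable {h : ℂ → ℂ} (hh : MemHHalf h) :
    Summable fun n : ℤ => (n.natAbs : ℝ) * ‖circleCoeff h n‖ ^ 2 := by
  set M := arcMeasure.prod arcMeasure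
  have h1 : Integrable (onCircle fun _ => (1:ℂ)) arcMeasure := integrable_const _
  have hq := MemLp.integrable_norm_sq_ofReal hh.1
  refine summable_of_sum_mul_pow_le (fun n => by positivity) (fun n => n.natAbs)
    (C := ((2 * Real.pi)⁻¹) ^ 2 * ∫ p, 4 * gagliardo h p ∂M) fun r hr0 hr1 => ?_
  have ha := summable_natAbs_mul_pow hr0 hr1
  have hk := hasSum_kernel_abs hr0 hr1
  have s1 := hasSum_circleCoeff_mul_conj ha hk hh.integrable hh.integrable
  have s2 := hasSum_circleCoeff_mul_conj ha hk hq h1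
  have s3 := hasSum_circleCoeff_mul_conj ha hk h1 hq
  have z2 : ∀ n : ℤ, ((n.natAbs * r ^ n.natAbs : ℝ) : ℂ) *
      (circleCoeff (fun z => ((‖h z‖ ^ 2 : ℝ) : ℂ)) n * conj (circleCoeff (fun _ => 1) n)) = 0 := fun n => by
    rw [circleCoeff_one]; split_ifs with h0 <;> simp [h0]
  have z3 : ∀ n : ℤ, ((n.natAbs * r ^ n.natAbs : ℝ) : ℂ) *
      (circleCoeff (fun _ => 1) n * conj (circleCoeff (fun z => ((‖h z‖ ^ 2 : ℝ) : ℂ)) n)) = 0 := fun n => by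
    rw [circleCoeff_one]; split_ifs with h0 <;> simp [h0]
  simp only [z2] at s2
  simp only [z3] at s3
  have i2 := s2.unique hasSum_zero
  have i3 := s3.unique hasSum_zero
  rw [smul_eq_zero_iff_right (by positivity)] at i2 i3
  have kc : Continuous fun p : ℝ × ℝ => ((2 * (koebe r (p.2 - p.1)).re : ℝ) : ℂ) := by
    have := continuous_koebe hr0 hr1
    fun_prop
  have kb : ∃ C, ∀ p : ℝ × ℝ, ‖((2 * (koebe r (p.2 - p.1)).re : ℝ) : ℂ)‖ ≤ C := by
    refine ⟨∑' n : ℤ, ‖((n.natAbs * r ^ n.natAbs : ℝ) : ℂ)‖, fun p => ?_⟩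
    rw [← (hk (p.2 - p.1)).tsum_eq]
    have e : ∀ n : ℤ, ‖((n.natAbs * r ^ n.natAbs : ℝ) : ℂ) * exp (I * n * (p.2 - p.1 : ℝ))‖ =
        ‖((n.natAbs * r ^ n.natAbs : ℝ) : ℂ)‖ := fun n => by
      rw [norm_mul, show I * n * ((p.2 - p.1 : ℝ) : ℂ) = ((n * (p.2 - p.1) : ℝ) : ℂ) * I by
        push_cast; ring, norm_exp_ofReal_mul_I, mul_one]
    refine (norm_tsum_le_tsum_norm (by simpa only [e] using ha)).trans_eq (by simp only [e])
  obtain ⟨C, hC⟩ := kb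
  have int : ∀ {f g : ℂ → ℂ}, Integrable (onCircle f) arcMeasure → Integrable (onCircle g) arcMeasure →
      Integrable (fun p : ℝ × ℝ => ((2 * (koebe r (p.2 - p.1)).re : ℝ) : ℂ) *
        (onCircle f p.1 * conj (onCircle g p.2))) M := fun hf hg =>
    (hf.mul_prod ((conjCLE : ℂ →L[ℝ] ℂ).integrable_comp hg)).bdd_mul kc.aestronglyMeasurable
      (ae_of_all _ hC)
  have e1 : ∀ p : ℝ × ℝ, ((2 * (koebe r (p.2 - p.1)).re : ℝ) : ℂ) *
      (onCircle h p.1 * conj (onCircle h p.2)) + conj (((2 * (koebe r (p.2 - p.1)).re : ℝ) : ℂ) *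
      (onCircle h p.1 * conj (onCircle h p.2))) =
      ((2 * (koebe r (p.2 - p.1)).re : ℝ) : ℂ) * (onCircle (fun z => ((‖h z‖ ^ 2 : ℝ) : ℂ)) p.1 *
        conj (onCircle (fun _ => 1) p.2)) + ((2 * (koebe r (p.2 - p.1)).re : ℝ) : ℂ) *
        (onCircle (fun _ => 1) p.1 * conj (onCircle (fun z => ((‖h z‖ ^ 2 : ℝ) : ℂ)) p.2)) -
      ((2 * (koebe r (p.2 - p.1)).re * ‖onCircle h p.1 - onCircle h p.2‖ ^ 2 : ℝ) : ℂ) := by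
    intro p
    rw [← normSq_eq_norm_sq, ofReal_mul _ (normSq _), ← mul_conj]
    simp only [onCircle, ← normSq_eq_norm_sq, ← mul_conj, map_mul, conj_ofReal, map_sub, map_one, conj_conj]
    ring
  have hint : Integrable (fun p : ℝ × ℝ => 2 * (koebe r (p.2 - p.1)).re *
      ‖onCircle h p.1 - onCircle h p.2‖ ^ 2) M := by
    refine Integrable.mono' (hh.integrable_gagliardo.const_mul 8) ?_ (ae_of_all _ fun p => ?_)
    · have := continuous_koebe hr0 hr1
      exact (Continuous.aestronglyMeasurable (by fun_prop)).mul
        (((hh.1.1.comp_fst.sub hh.1.1.comp_snd).norm.aemeasurable.pow_const 2).aestronglyMeasurable)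
    · have := norm_koebe_mul_gagliardo_le hr0 hr1 h p
      rw [norm_mul, norm_mul, Real.norm_ofNat, Real.norm_eq_abs, Real.norm_of_nonneg (by positivity)]
      nlinarith [abs_re_le_norm (koebe r (p.2 - p.1)),
        mul_le_mul_of_nonneg_right (abs_re_le_norm (koebe r (p.2 - p.1)))
          (sq_nonneg ‖onCircle h p.1 - onCircle h p.2‖)]
  have hintc : Integrable (fun p : ℝ × ℝ => ((2 * (koebe r (p.2 - p.1)).re *
      ‖onCircle h p.1 - onCircle h p.2‖ ^ 2 : ℝ) : ℂ)) M := hint.ofReal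
  have key : (∫ p : ℝ × ℝ, ((2 * (koebe r (p.2 - p.1)).re : ℝ) : ℂ) *
      (onCircle h p.1 * conj (onCircle h p.2)) ∂M) + conj (∫ p : ℝ × ℝ, ((2 * (koebe r (p.2 - p.1)).re : ℝ) : ℂ) *
      (onCircle h p.1 * conj (onCircle h p.2)) ∂M) =
      ((-∫ p : ℝ × ℝ, 2 * (koebe r (p.2 - p.1)).re * ‖onCircle h p.1 - onCircle h p.2‖ ^ 2 ∂M : ℝ) : ℂ) := by
    rw [← integral_conj, ← integral_add (int hh.integrable hh.integrable)
      (int hh.integrable hh.integrable).conj]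
    simp only [e1]
    rw [integral_sub ((int hq h1).fun_add (int h1 hq)) hintc, integral_add (int hq h1) (int h1 hq), i2, i3,
      integral_complex_ofReal]
    simp
  have s1r := (s1.map Complex.reCLM Complex.reCLM.continuous)
  have s1e : HasSum (fun n : ℤ => (n.natAbs : ℝ) * ‖circleCoeff h n‖ ^ 2 * r ^ n.natAbs)
      (((2 * Real.pi)⁻¹) ^ 2 * (∫ p : ℝ × ℝ, ((2 * (koebe r (p.2 - p.1)).re : ℝ) : ℂ) *
      (onCircle h p.1 * conj (onCircle h p.2)) ∂M).re) := by
    convert s1r.of_fun_eq fun n => ?_ using 1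
    · simp [-ofReal_pow, -ofReal_inv, -ofReal_mul, re_ofReal_mul]
      rfl
    · simp only [Function.comp_apply, reCLM_apply]
      rw [mul_conj, ← ofReal_mul, ofReal_re, normSq_eq_norm_sq]; ring
  refine ⟨s1e.summable, s1e.tsum_eq.trans_le ?_⟩
  refine mul_le_mul_of_nonneg_left ?_ (by positivity)
  have k2 := congrArg Complex.re key
  rw [add_re, conj_re, ofReal_re] at k2
  have k3 : -∫ p : ℝ × ℝ, 2 * (koebe r (p.2 - p.1)).re * ‖onCircle h p.1 - onCircle h p.2‖ ^ 2 ∂M ≤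
      2 * ∫ p, 4 * gagliardo h p ∂M := by
    rw [← integral_neg, ← integral_const_mul]
    refine integral_mono hint.neg ((hh.integrable_gagliardo.const_mul 4).const_mul 2) fun p => ?_
    have := norm_koebe_mul_gagliardo_le hr0 hr1 h p
    simp only
    nlinarith [mul_le_mul_of_nonneg_right (neg_le_of_abs_le (abs_re_le_norm (koebe r (p.2 - p.1))))
          (sq_nonneg ‖onCircle h p.1 - onCircle h p.2‖)]
  linarith

theorem MemHHalf.summable_pairing {h k : ℂ → ℂ} (hh : MemHHalf h) (hk : MemHHalf k) :
    Summable fun n : ℤ => 2 * Real.pi * ⟪I * n * circleCoeff h n, circleCoeff k n⟫_ℝ := by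
  refine Summable.mul_left _ ?_
  refine Summable.of_norm_bounded (hh.summable.add hk.summable) fun n => ?_
  refine (norm_inner_le_norm _ _).trans ?_
  rw [norm_mul, norm_mul, norm_I, one_mul, norm_intCast]
  have : ((n.natAbs : ℕ) : ℝ) = |(n:ℝ)| := by rw [Nat.cast_natAbs]; simp
  rw [this]
  nlinarith [sq_nonneg (‖circleCoeff h n‖ - ‖circleCoeff k n‖), abs_nonneg (n:ℝ),
    mul_nonneg (abs_nonneg (n:ℝ)) (sq_nonneg (‖circleCoeff h n‖ - ‖circleCoeff k n‖)),
    mul_nonneg (abs_nonneg (n:ℝ)) (sq_nonneg (‖circleCoeff h n‖)),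
    mul_nonneg (abs_nonneg (n:ℝ)) (sq_nonneg (‖circleCoeff k n‖))]

end HHalf

/-! ### Poisson means of H^{1/2} functions -/

section Pairing

local notation "conj" => starRingEnd ℂ

variable {r : ℝ}

theorem integral_diskPoisson (hr0 : 0 ≤ r) (hr1 : r < 1) (t : ℝ) :
    ∫ s, diskPoisson r (t - s) ∂arcMeasure = 2 * Real.pi := by
  have h := hasSum_circleCoeff_mul_exp (summable_pow_natAbs hr0 hr1) (hasSum_diskPoisson hr0 hr1)
    (h := fun _ => 1) (integrable_const _) t
  have h2 : HasSum (fun n : ℤ => ((r ^ n.natAbs : ℝ) : ℂ) * circleCoeff (fun _ => 1) n * exp (I * n * t)) 1 := by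
    convert hasSum_ite_eq (0:ℤ) (1:ℂ) using 2 with n
    rw [circleCoeff_one]
    split_ifs with h0 <;> simp [h0]
  have h3 := h.unique h2
  simp only [onCircle, mul_one] at h3
  rw [integral_complex_ofReal, real_smul, ← ofReal_mul, ← ofReal_one, ofReal_inj] at h3
  have := Real.pi_pos
  field_simp at h3
  linarith

theorem exists_bound_diskPoisson (hr0 : 0 ≤ r) (hr1 : r < 1) : ∃ C, ∀ x, ‖diskPoisson r x‖ ≤ C := by
  refine ⟨(1 - r ^ 2) / (1 - r) ^ 2, fun x => ?_⟩
  rw [Real.norm_of_nonneg (diskPoisson_nonneg hr0 hr1 x), diskPoisson]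
  have h1 : 1 - r ≤ ‖1 - r * exp (I * x)‖ := by
    have := norm_sub_norm_le (1:ℂ) (r * exp (I * x))
    rwa [norm_real_mul_exp hr0, norm_one] at this
  have : 0 < 1 - r := by linarith
  have : 0 ≤ 1 - r ^ 2 := by nlinarith
  gcongr

/-- The Poisson integral of `φ` at `r e^{it}`. -/
noncomputable def poissonMean (φ : ℂ → ℝ) (r t : ℝ) : ℝ :=
  (2 * Real.pi)⁻¹ * ∫ s, diskPoisson r (t - s) * onCircle φ s ∂arcMeasure

theorem integrable_diskPoisson_mul {φ : ℂ → ℝ} (hr0 : 0 ≤ r) (hr1 : r < 1)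
    (hφ : Integrable (onCircle φ) arcMeasure) (t : ℝ) :
    Integrable (fun s => diskPoisson r (t - s) * onCircle φ s) arcMeasure := by
  obtain ⟨C, hC⟩ := exists_bound_diskPoisson hr0 hr1
  have := continuous_diskPoisson hr0 hr1
  exact hφ.bdd_mul (Continuous.aestronglyMeasurable (by fun_prop)) (ae_of_all _ fun s => hC _)

theorem continuous_poissonMean {φ : ℂ → ℝ} (hr0 : 0 ≤ r) (hr1 : r < 1)
    (hφ : Integrable (onCircle φ) arcMeasure) : Continuous (poissonMean φ r) := by
  obtain ⟨C, hC⟩ := exists_bound_diskPoisson hr0 hr1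
  have hc := continuous_diskPoisson hr0 hr1
  refine continuous_const.mul (continuous_of_dominated (bound := fun s => C * ‖onCircle φ s‖)
    (fun t => (integrable_diskPoisson_mul hr0 hr1 hφ t).1) (fun t => ae_of_all _ fun s => ?_)
    (hφ.norm.const_mul C) (ae_of_all _ fun s => by fun_prop))
  rw [norm_mul]
  exact mul_le_mul_of_nonneg_right (hC _) (norm_nonneg _)

theorem integrable_of_continuous_arc {E : Type} [NormedAddCommGroup E] {f : ℝ → E} (hf : Continuous f) :
    Integrable f arcMeasure :=
  (hf.integrableOn_Icc (a := 0) (b := 2 * Real.pi)).mono_set Ioc_subset_Icc_self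

theorem poissonMean_sub_eq {φ : ℂ → ℝ} (hr0 : 0 ≤ r) (hr1 : r < 1)
    (hφ : Integrable (onCircle φ) arcMeasure) (t : ℝ) :
    poissonMean φ r t - onCircle φ t =
      (2 * Real.pi)⁻¹ * ∫ s, diskPoisson r (t - s) * (onCircle φ s - onCircle φ t) ∂arcMeasure := by
  have h1 := integrable_diskPoisson_mul hr0 hr1 hφ t
  have h2 : Integrable (fun s => diskPoisson r (t - s) * onCircle φ t) arcMeasure :=
    integrable_diskPoisson_mul (φ := fun _ => onCircle φ t) hr0 hr1 (integrable_const _) t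
  simp only [mul_sub]
  rw [integral_sub h1 h2, integral_mul_const, integral_diskPoisson hr0 hr1, poissonMean]
  have := Real.pi_pos
  field_simp

/-- Quantitative convergence in `L¹` of the Poisson integral of an `H^{1/2}` function. -/
theorem integral_abs_poissonMean_sub_le {φ : ℂ → ℝ} (hφ : MemHHalf φ) (hr0 : 0 ≤ r) (hr1 : r < 1) :
    ∫ t, |poissonMean φ r t - onCircle φ t| ∂arcMeasure ≤
      √(1 - r ^ 2) * (2 * Real.pi + (2 * Real.pi)⁻¹ * ∫ p, gagliardo φ p ∂(arcMeasure.prod arcMeasure)) := by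
  set M := arcMeasure.prod arcMeasure
  set η := √(1 - r ^ 2)
  have hη2 : η ^ 2 = 1 - r ^ 2 := Real.sq_sqrt (by nlinarith)
  have hη : 0 < η := Real.sqrt_pos.2 (by nlinarith)
  have hpi := Real.pi_pos
  have hc := continuous_diskPoisson hr0 hr1
  obtain ⟨C, hC⟩ := exists_bound_diskPoisson hr0 hr1
  have hi := hφ.integrable
  have hδ : Integrable (fun p : ℝ × ℝ => onCircle φ p.2 - onCircle φ p.1) M :=
    (hi.comp_snd _).sub (hi.comp_fst _)
  have hK : Integrable (fun p : ℝ × ℝ => diskPoisson r (p.1 - p.2) * (onCircle φ p.2 - onCircle φ p.1)) M :=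
    hδ.bdd_mul (Continuous.aestronglyMeasurable (by fun_prop)) (ae_of_all _ fun s => hC _)
  have hP : Integrable (fun p : ℝ × ℝ => diskPoisson r (p.1 - p.2)) M :=
    (integrable_const (1:ℝ)).bdd_mul (f := fun p : ℝ × ℝ => diskPoisson r (p.1 - p.2))
      (Continuous.aestronglyMeasurable (by fun_prop)) (ae_of_all _ fun s => hC _) |>.congr
      (ae_of_all _ fun p => mul_one _)
  have e1 : ∫ t, |poissonMean φ r t - onCircle φ t| ∂arcMeasure ≤
      (2 * Real.pi)⁻¹ * ∫ p : ℝ × ℝ, |diskPoisson r (p.1 - p.2) * (onCircle φ p.2 - onCircle φ p.1)| ∂M := by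
    rw [integral_prod _ hK.abs, ← integral_const_mul]
    refine integral_mono_of_nonneg (ae_of_all _ fun t => abs_nonneg _)
      (hK.abs.integral_prod_left.const_mul _) (ae_of_all _ fun t => ?_)
    simp only
    rw [poissonMean_sub_eq hr0 hr1 hi, abs_mul, abs_of_pos (by positivity)]
    exact mul_le_mul_of_nonneg_left abs_integral_le_integral_abs (by positivity)
  refine e1.trans ?_
  have e2 : ∫ p : ℝ × ℝ, |diskPoisson r (p.1 - p.2) * (onCircle φ p.2 - onCircle φ p.1)| ∂M ≤
      ∫ p : ℝ × ℝ, (η * diskPoisson r (p.1 - p.2) + η * gagliardo φ p) ∂M := by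
    refine integral_mono hK.abs ((hP.const_mul _).add (hφ.integrable_gagliardo.const_mul _)) fun p => ?_
    simp only
    have hp0 := diskPoisson_nonneg hr0 hr1 (p.1 - p.2)
    rw [abs_mul, abs_of_nonneg hp0]
    set P := diskPoisson r (p.1 - p.2)
    set d := |onCircle φ p.2 - onCircle φ p.1|
    have hd : d ^ 2 = ‖onCircle φ p.1 - onCircle φ p.2‖ ^ 2 := by
      rw [Real.norm_eq_abs, abs_sub_comm]
    have hP2 : P * d ^ 2 ≤ 4 * η ^ 2 * gagliardo φ p := by
      have h1 := diskPoisson_mul_le hr0 hr1 (p.1 - p.2)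
      rw [hd, ← gagliardo_mul φ p, norm_sub_rev, norm_circleMap_sub, hη2]
      nlinarith [gagliardo_nonneg φ p]
    -- Expanding P (2η - d)² ≥ 0 and using `hP2` gives P d ≤ η P + η · (Gagliardo quotient). The
    -- weight η = √(1 - r²) is chosen so that both terms on the right are small as r → 1.
    have hη4 : η * (P * d) ≤ η * (η * P + η * gagliardo φ p) := by
      nlinarith [mul_nonneg hp0 (sq_nonneg (2 * η - d)), gagliardo_nonneg φ p]
    exact le_of_mul_le_mul_left hη4 hη
  have e3 : ∫ p : ℝ × ℝ, diskPoisson r (p.1 - p.2) ∂M = (2 * Real.pi) ^ 2 := by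
    rw [integral_prod _ hP]
    simp only [integral_diskPoisson hr0 hr1]
    rw [integral_const, arcMeasure_real_univ, smul_eq_mul]; ring
  rw [integral_add (hP.const_mul _) (hφ.integrable_gagliardo.const_mul _), integral_const_mul,
    integral_const_mul, e3] at e2
  refine (mul_le_mul_of_nonneg_left e2 (by positivity)).trans_eq ?_
  field_simp

theorem tendsto_integral_abs_poissonMean_sub {φ : ℂ → ℝ} (hφ : MemHHalf φ) :
    Tendsto (fun r => ∫ t, |poissonMean φ r t - onCircle φ t| ∂arcMeasure) (𝓝[<] 1) (𝓝 0) := by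
  set A := 2 * Real.pi + (2 * Real.pi)⁻¹ * ∫ p, gagliardo φ p ∂(arcMeasure.prod arcMeasure)
  have h1 : Tendsto (fun r : ℝ => √(1 - r ^ 2) * A) (𝓝[<] 1) (𝓝 0) := by
    have : ContinuousAt (fun r : ℝ => √(1 - r ^ 2) * A) 1 := by fun_prop
    have := this.tendsto.mono_left (nhdsWithin_le_nhds (s := Iio 1))
    simpa using this
  refine tendsto_of_tendsto_of_tendsto_of_le_of_le' tendsto_const_nhds h1
    (Eventually.of_forall fun r => integral_nonneg fun t => abs_nonneg _) ?_
  filter_upwards [Ioo_mem_nhdsLT (zero_lt_one (α := ℝ))] with r hr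
  exact integral_abs_poissonMean_sub_le hφ hr.1.le hr.2

theorem tendsto_integral_poissonMean_mul {φ : ℂ → ℝ} (hφ : MemHHalf φ) {ψ : ℝ → ℝ} (hψ : Continuous ψ)
    {C : ℝ} (hC : ∀ t, |ψ t| ≤ C) :
    Tendsto (fun r => ∫ t, poissonMean φ r t * ψ t ∂arcMeasure) (𝓝[<] 1)
      (𝓝 (∫ t, onCircle φ t * ψ t ∂arcMeasure)) := by
  rw [tendsto_iff_norm_sub_tendsto_zero]
  have h1 := (tendsto_integral_abs_poissonMean_sub hφ).mul_const C
  rw [zero_mul] at h1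
  refine tendsto_of_tendsto_of_tendsto_of_le_of_le' tendsto_const_nhds h1
    (Eventually.of_forall fun r => norm_nonneg _) ?_
  filter_upwards [Ioo_mem_nhdsLT (zero_lt_one (α := ℝ))] with r hr
  have hm := integrable_of_continuous_arc (continuous_poissonMean hr.1.le hr.2 hφ.integrable)
  have b : ∀ {f : ℝ → ℝ}, Integrable f arcMeasure → Integrable (fun t => f t * ψ t) arcMeasure := fun hf =>
    hf.mul_bdd hψ.aestronglyMeasurable (ae_of_all _ hC)
  rw [← integral_sub (b hm) (b hφ.integrable), ← integral_mul_const]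
  refine (norm_integral_le_integral_norm _).trans (integral_mono ((b hm).sub (b hφ.integrable)).norm
    (((hm.sub hφ.integrable).abs).mul_const C) fun t => ?_)
  simp only [Pi.sub_apply]
  rw [← sub_mul, norm_mul, Real.norm_eq_abs, Real.norm_eq_abs]
  exact mul_le_mul_of_nonneg_left (hC t) (abs_nonneg _)

end Pairing

/-! ### The duality product of ∂_θ h with ζ i h, computed from a lifting of h -/

section Pairing

local notation "conj" => starRingEnd ℂ

variable {r : ℝ}

theorem _root_.MeasureTheory.Integrable.fun_sub' {α E : Type*} [NormedAddCommGroup E] {m : MeasurableSpace α}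
    {μ : Measure α} {f g : α → E} (hf : Integrable f μ) (hg : Integrable g μ) :
    Integrable (fun x => f x - g x) μ := hf.sub hg

theorem summable_intCast_mul_pow (hr0 : 0 ≤ r) (hr1 : r < 1) :
    Summable fun n : ℤ => ‖((n * r ^ n.natAbs : ℝ) : ℂ)‖ := by
  refine (summable_natAbs_mul_pow hr0 hr1).congr fun n => ?_
  rw [norm_real, norm_real, norm_mul, norm_mul, Nat.cast_natAbs]
  simp

/-- The Abel means of the pairing are double integrals against the odd kernel Im `koebe`, which
tends to zero off the diagonal: the limit r → 1 is insensitive to perturbations that are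
quadratically small at the diagonal. -/
theorem hasSum_pairing_mul_pow (hr0 : 0 ≤ r) (hr1 : r < 1) {f g : ℂ → ℂ}
    (hf : Integrable (onCircle f) arcMeasure) (hg : Integrable (onCircle g) arcMeasure) :
    HasSum (fun n : ℤ => 2 * Real.pi * ⟪I * n * circleCoeff f n, circleCoeff g n⟫_ℝ * r ^ n.natAbs)
      (-Real.pi⁻¹ * ∫ p : ℝ × ℝ, (koebe r (p.2 - p.1)).im * (onCircle f p.1 * conj (onCircle g p.2)).re
        ∂(arcMeasure.prod arcMeasure)) := by
  have h1 := hasSum_circleCoeff_mul_conj (summable_intCast_mul_pow hr0 hr1) (hasSum_kernel_int hr0 hr1) hf hg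
  have h2 := ((h1.mul_left (2 * Real.pi * I)).map Complex.reCLM Complex.reCLM.continuous)
  have hi : Integrable (fun p : ℝ × ℝ => ((2 * (koebe r (p.2 - p.1)).im : ℝ) : ℂ) * I *
      (onCircle f p.1 * conj (onCircle g p.2))) (arcMeasure.prod arcMeasure) := by
    have := continuous_koebe hr0 hr1
    refine (hf.mul_prod hg.conj).bdd_mul (c := ∑' n : ℤ, ‖((n * r ^ n.natAbs : ℝ) : ℂ)‖)
      (Continuous.aestronglyMeasurable (by fun_prop)) (ae_of_all _ fun p => ?_)
    have e : ∀ n : ℤ, ‖((n * r ^ n.natAbs : ℝ) : ℂ) * exp (I * n * (p.2 - p.1 : ℝ))‖ =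
        ‖((n * r ^ n.natAbs : ℝ) : ℂ)‖ := fun n => by
      rw [norm_mul, show I * n * ((p.2 - p.1 : ℝ) : ℂ) = ((n * (p.2 - p.1) : ℝ) : ℂ) * I by
        push_cast; ring, norm_exp_ofReal_mul_I, mul_one]
    have ha := summable_intCast_mul_pow hr0 hr1
    rw [← (hasSum_kernel_int hr0 hr1 (p.2 - p.1)).tsum_eq]
    exact (norm_tsum_le_tsum_norm (by simpa only [e] using ha)).trans_eq (by simp only [e])
  convert h2.of_fun_eq fun n => ?_ using 1
  · rw [mul_smul_comm, ← integral_const_mul (2 * Real.pi * I : ℂ), ← integral_smul]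
    have := Complex.reCLM.integral_comp_comm ((hi.const_mul (2 * Real.pi * I)).smul ((2 * Real.pi : ℝ)⁻¹ ^ 2))
    simp only [Pi.smul_apply] at this
    rw [← this, ← integral_const_mul]
    congr 1; ext p
    have hpi := Real.pi_pos.ne'
    set w := onCircle f p.1 * conj (onCircle g p.2)
    set x := (koebe r (p.2 - p.1)).im
    have : ((2 * Real.pi : ℝ)⁻¹ ^ 2) • (2 * Real.pi * I * (((2 * x : ℝ) : ℂ) * I * w)) =
        ((-Real.pi⁻¹ * x : ℝ) : ℂ) * w := by
      rw [real_smul]; push_cast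
      have : (Real.pi : ℂ) ≠ 0 := by exact_mod_cast hpi
      field_simp
      linear_combination (w * x) * I_sq
    rw [this, reCLM_apply, re_ofReal_mul]; ring
  · simp only [Function.comp_apply, reCLM_apply]
    rw [real_inner_comm, Complex.inner, ← re_ofReal_mul, ← re_mul_ofReal]
    congr 1; push_cast; ring

/-- The Abel means of a Parseval sum are integrals against Poisson means, whose limit as r → 1 is
known. -/
theorem hasSum_inner_mul_pow (hr0 : 0 ≤ r) (hr1 : r < 1) {φ : ℂ → ℝ} {g : ℂ → ℂ}
    (hf : Integrable (onCircle φ) arcMeasure) {ψ : ℝ → ℝ} (hg : onCircle g = fun t => (ψ t : ℂ))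
    (hψ : Integrable ψ arcMeasure) :
    HasSum (fun n : ℤ => 2 * Real.pi * ⟪circleCoeff (fun z => (φ z : ℂ)) n, circleCoeff g n⟫_ℝ * r ^ n.natAbs)
      (∫ t, poissonMean φ r t * ψ t ∂arcMeasure) := by
  have hf' : Integrable (onCircle fun z => (φ z : ℂ)) arcMeasure := hf.ofReal
  have hg' : Integrable (onCircle g) arcMeasure := by rw [hg]; exact hψ.ofReal
  have h1 := hasSum_circleCoeff_mul_conj (summable_pow_natAbs hr0 hr1) (hasSum_diskPoisson hr0 hr1) hf' hg'
  have h2 := ((h1.mul_left (2 * Real.pi : ℂ)).map Complex.reCLM Complex.reCLM.continuous)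
  have hc := continuous_diskPoisson hr0 hr1
  obtain ⟨C, hC⟩ := exists_bound_diskPoisson hr0 hr1
  have hi : Integrable (fun p : ℝ × ℝ => diskPoisson r (p.1 - p.2) * (onCircle φ p.2 * ψ p.1))
      (arcMeasure.prod arcMeasure) := by
    refine Integrable.bdd_mul (c := C) ?_ (Continuous.aestronglyMeasurable (by fun_prop))
      (ae_of_all _ fun p => hC _)
    exact (hψ.mul_prod hf).congr (ae_of_all _ fun p => mul_comm _ _)
  convert h2.of_fun_eq fun n => ?_ using 1
  · have e1 : ∀ p : ℝ × ℝ, (diskPoisson r (p.2 - p.1) : ℂ) * (onCircle (fun z => (φ z : ℂ)) p.1 *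
        conj (onCircle g p.2)) = ((diskPoisson r (p.2 - p.1) * (onCircle φ p.1 * ψ p.2) : ℝ) : ℂ) := by
      intro p
      rw [hg, conj_ofReal]; simp [onCircle]
    simp only [e1]
    rw [integral_complex_ofReal, real_smul, ← ofReal_mul, reCLM_apply, show (2 * Real.pi : ℂ) = (2 * Real.pi : ℝ) by
      push_cast; rfl, ← ofReal_mul, ofReal_re, ← integral_prod_swap, integral_prod]
    · simp only [poissonMean, Prod.fst_swap, Prod.snd_swap]
      have hpi := Real.pi_pos.ne'
      rw [← mul_assoc, show 2 * Real.pi * (2 * Real.pi)⁻¹ ^ 2 = (2 * Real.pi)⁻¹ by field_simp, ← integral_const_mul]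
      congr 1; ext t
      rw [mul_assoc, ← integral_mul_const]
      simp only [mul_assoc]
    · exact hi
  · simp only [Function.comp_apply, reCLM_apply]
    rw [real_inner_comm, Complex.inner, ← re_ofReal_mul, ← re_mul_ofReal]
    congr 1; push_cast; ring

theorem circleCoeff_id (n : ℤ) : circleCoeff (fun z => z) n = if n = 1 then 1 else 0 := by
  have : circleCoeff (fun z => z) n = circleCoeff (fun _ => 1) (n - 1) := by
    simp only [circleCoeff, onCircle, mul_one]
    congr 2; ext t
    rw [circleMap, ofReal_one, one_mul, zero_add, ← Complex.exp_add]
    congr 1; push_cast; ring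
  rw [this, circleCoeff_one]
  simp [sub_eq_zero]

theorem hasDerivAt_onCircle {ζ : ℂ → ℝ} (hζ : ContDiff ℝ ∞ ζ) (t : ℝ) :
    HasDerivAt (onCircle ζ) (fderiv ℝ ζ (circleMap 0 1 t) (I * circleMap 0 1 t)) t := by
  have h1 := ((hζ.differentiable (by simp)) (circleMap 0 1 t)).hasFDerivAt
  have h2 := h1.comp_hasDerivAt t (hasDerivAt_circleMap 0 1 t)
  rwa [mul_comm] at h2

theorem continuous_tangential {ζ : ℂ → ℝ} (hζ : ContDiff ℝ ∞ ζ) :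
    Continuous fun t => fderiv ℝ ζ (circleMap 0 1 t) (I * circleMap 0 1 t) :=
  ((hζ.continuous_fderiv (by simp)).comp (continuous_circleMap 0 1)).clm_apply (by fun_prop)

theorem circleCoeff_tangential {ζ : ℂ → ℝ} (hζ : ContDiff ℝ ∞ ζ) (n : ℤ) :
    circleCoeff (fun z => (fderiv ℝ ζ z (I * z) : ℂ)) n = I * n * circleCoeff (fun z => (ζ z : ℂ)) n := by
  simp only [circleCoeff, arcMeasure]
  rw [← intervalIntegral.integral_of_le Real.two_pi_pos.le, ← intervalIntegral.integral_of_le Real.two_pi_pos.le]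
  have hu : ∀ t ∈ uIcc (0:ℝ) (2 * Real.pi), HasDerivAt (fun t : ℝ => exp (-(I * n * t)))
      (-(I * n) * exp (-(I * n * t))) t := fun t _ => by
    have h1 : HasDerivAt (fun t : ℝ => -(I * n * (t:ℂ))) (-(I * n)) t := by
      have := ((ofRealCLM.hasDerivAt (x := t)).const_mul (I * n)).fun_neg
      rw [ofRealCLM_apply, ofReal_one, mul_one] at this
      exact this
    exact (mul_comm (exp (-(I * n * t))) (-(I * n))) ▸ h1.cexp
  have hv : ∀ t ∈ uIcc (0:ℝ) (2 * Real.pi), HasDerivAt (fun t => ((onCircle ζ t : ℝ) : ℂ))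
      ((fderiv ℝ ζ (circleMap 0 1 t) (I * circleMap 0 1 t) : ℝ) : ℂ) t := fun t _ =>
    (hasDerivAt_onCircle hζ t).ofReal_comp
  have h := intervalIntegral.integral_mul_deriv_eq_deriv_mul hu hv
    (Continuous.intervalIntegrable (by fun_prop) _ _)
    (Continuous.intervalIntegrable (by have := continuous_tangential hζ; fun_prop) _ _)
  have e1 : circleMap 0 1 (2 * Real.pi) = circleMap 0 1 0 := by simp [circleMap]
  have e2 : exp (-(I * n * ((2 * Real.pi : ℝ) : ℂ))) = 1 := by
    rw [Complex.exp_eq_one_iff]; exact ⟨-n, by push_cast; ring⟩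
  simp only [onCircle] at h ⊢
  rw [h, e1, e2]
  simp only [ofReal_zero, mul_zero, neg_zero, Complex.exp_zero, sub_self, zero_sub, mul_assoc]
  rw [← intervalIntegral.integral_neg, mul_smul_comm, mul_smul_comm, ← intervalIntegral.integral_const_mul,
    ← intervalIntegral.integral_const_mul]
  congr 2; ext t; ring

/-- Second-order expansion: e^{id} - 1 - id is at most 2 d², by Taylor for |d| ≤ 1 and trivially for
|d| > 1; the cross term |d| |w - 1| is split by Young's inequality. -/
theorem abs_im_sub_le {w : ℂ} (hw : ‖w‖ = 1) (d : ℝ) :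
    |(w * exp (I * d)).im - w.im - d| ≤ 3 * d ^ 2 + ‖w - 1‖ ^ 2 := by
  have h1 : ‖exp (I * d) - 1 - I * d‖ ≤ 2 * d ^ 2 := by
    rcases le_or_gt |d| 1 with hd | hd
    · have hn : ‖I * (d:ℂ)‖ = |d| := by simp
      refine (norm_exp_sub_one_sub_id_le (by rwa [hn])).trans ?_
      rw [hn, sq_abs]; nlinarith [sq_nonneg d]
    · have h2 := Real.norm_exp_I_mul_ofReal_sub_one_le (x := d)
      refine (norm_sub_le _ _).trans ?_
      rw [norm_mul, norm_I, one_mul, norm_real]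
      rw [Real.norm_eq_abs] at *
      nlinarith [sq_abs d]
  have e : (w * exp (I * d)).im - w.im - d = (w * (exp (I * d) - 1 - I * d) + I * d * (w - 1)).im := by
    simp; ring
  rw [e]
  refine (abs_im_le_norm _).trans ((norm_add_le _ _).trans ?_)
  rw [norm_mul, norm_mul, hw, one_mul, norm_mul, norm_I, one_mul, norm_real, Real.norm_eq_abs]
  nlinarith [sq_abs d, sq_nonneg (|d| - ‖w - 1‖), sq_nonneg ‖w - 1‖]

/-- The diagonal is a null set. Off it, two angles in the half-open interval (0, 2π] differ by less
than 2π in absolute value, so they give distinct points of the circle. -/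
theorem ae_exp_ne_one : ∀ᵐ p ∂(arcMeasure.prod arcMeasure), exp (I * (p.2 - p.1 : ℝ)) ≠ 1 := by
  have h1 : ∀ᵐ p : ℝ × ℝ ∂(volume.restrict (Ioc 0 (2 * Real.pi) ×ˢ Ioc 0 (2 * Real.pi))), p.1 ≠ p.2 := by
    refine ae_restrict_of_ae ?_
    rw [Measure.volume_eq_prod, Measure.ae_prod_iff_ae_ae]
    · refine ae_of_all _ fun s => ?_
      filter_upwards [compl_mem_ae_iff.2 (measure_singleton s)] with t ht h
      exact ht h.symm
    · exact (measurableSet_eq_fun measurable_fst measurable_snd).compl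
  have e : arcMeasure.prod arcMeasure = volume.restrict (Ioc 0 (2 * Real.pi) ×ˢ Ioc 0 (2 * Real.pi)) := by
    rw [arcMeasure, Measure.prod_restrict, Measure.volume_eq_prod]
  rw [e]
  filter_upwards [h1, ae_restrict_mem (measurableSet_Ioc.prod measurableSet_Ioc)] with p hp hm h
  obtain ⟨n, hn⟩ := Complex.exp_eq_one_iff.1 h
  have h3 : p.2 - p.1 = n * (2 * Real.pi) := by
    have : ((p.2 - p.1 : ℝ) : ℂ) = ((n * (2 * Real.pi) : ℝ) : ℂ) := by
      apply mul_left_cancel₀ I_ne_zero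
      rw [hn]; push_cast; ring
    exact_mod_cast this
  obtain ⟨⟨a1, a2⟩, ⟨b1, b2⟩⟩ := hm
  have hpi := Real.pi_pos
  have hn1 : (n:ℝ) < 1 := by
    by_contra hc; push Not at hc; nlinarith
  have hn2 : (-1:ℝ) < n := by
    by_contra hc; push Not at hc; nlinarith
  have : n = 0 := by
    have h4 : n < 1 := by exact_mod_cast hn1
    have h5 : -1 < n := by exact_mod_cast hn2
    omega
  rw [this] at h3
  apply hp; push_cast at h3; linarith

/-- The duality product `⟨∂_θ h, ζ i h⟩` for a map `h = z e^{iφ}` of class `H^{1/2}`. -/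
theorem hasTangentialPairing_of_lifting {h : ℂ → ℂ} (hh : MemHHalfCircle h) {φ : ℂ → ℝ} (hφ : MemHHalf φ)
    (hl : ∀ᵐ t ∂arcMeasure, onCircle h t = circleMap 0 1 t * exp (I * onCircle φ t))
    {ζ : ℂ → ℝ} (hζ : ContDiff ℝ ∞ ζ) :
    HasTangentialPairing h (fun z => ζ z • (I * h z)) (∫ t, onCircle ζ t ∂arcMeasure -
      ∫ t, onCircle φ t * fderiv ℝ ζ (circleMap 0 1 t) (I * circleMap 0 1 t) ∂arcMeasure) := by
  -- Abel means of four pairings are compared. That of (z, ζ i z) tends to ∫ ζ, since z has the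
  -- single frequency 1; that of (φ, ζ) tends to -∫ φ ∂_θ ζ, with the derivative moved to ζ; that of
  -- (1, ζ φ) is zero. With w = z_s z̄_t and d = φ(s) - φ(t), what remains of (h, ζ i h) is the
  -- double integral of Im `koebe` against R = ζ(t) (Im (w e^{id}) - Im w - d), which is quadratic
  -- by `abs_im_sub_le`.
  set M := arcMeasure.prod arcMeasure with hM
  have hk := hh.smul_I_mul hζ
  have hs := hh.1.summable_pairing hk
  have hζc := continuous_onCircle hζ.continuous
  have hi1 := integrable_of_continuous_arc hζc
  obtain ⟨C, hC0, hC1, -⟩ := exists_lipschitz_circle hζ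
  have hφi := hφ.integrable
  have hφc : Integrable (onCircle fun z => (φ z : ℂ)) arcMeasure := hφi.ofReal
  have hζi : Integrable (onCircle fun z => (ζ z : ℂ)) arcMeasure := hi1.ofReal
  have hidi : Integrable (onCircle fun z => z) arcMeasure :=
    integrable_of_continuous_arc (continuous_onCircle continuous_id)
  have hidi' : Integrable (onCircle fun z => ζ z • (I * z)) arcMeasure :=
    integrable_of_continuous_arc (continuous_onCircle (by have := hζ.continuous; fun_prop))
  have hζφ : Integrable (onCircle fun z => ((ζ z * φ z : ℝ) : ℂ)) arcMeasure :=
    (hφi.bdd_mul hζc.aestronglyMeasurable (ae_of_all _ hC1)).ofReal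
  -- the four pairings
  have T0 := fun r (hr : r ∈ Ioo (0:ℝ) 1) => hasSum_pairing_mul_pow hr.1.le hr.2 hh.1.integrable hk.integrable
  have T1 := fun r (hr : r ∈ Ioo (0:ℝ) 1) => hasSum_pairing_mul_pow hr.1.le hr.2 hidi hidi'
  have T2 := fun r (hr : r ∈ Ioo (0:ℝ) 1) => hasSum_pairing_mul_pow hr.1.le hr.2 hφc hζi
  have T3 := fun r (hr : r ∈ Ioo (0:ℝ) 1) => hasSum_pairing_mul_pow hr.1.le hr.2
    (f := fun _ => 1) (integrable_const _) hζφ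
  have t2 : ∀ n : ℤ, 2 * Real.pi * ⟪I * n * circleCoeff (fun z => (φ z : ℂ)) n,
      circleCoeff (fun z => (ζ z : ℂ)) n⟫_ℝ = -(2 * Real.pi * ⟪circleCoeff (fun z => (φ z : ℂ)) n,
      circleCoeff (fun z => (fderiv ℝ ζ z (I * z) : ℂ)) n⟫_ℝ) := fun n => by
    rw [circleCoeff_tangential hζ, Complex.inner, Complex.inner, ← mul_neg, ← neg_re]
    congr 2
    simp only [map_mul, conj_I, map_intCast]; ring
  have v2 : ∀ r ∈ Ioo (0:ℝ) 1, -Real.pi⁻¹ * ∫ p : ℝ × ℝ, (koebe r (p.2 - p.1)).im *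
      (onCircle (fun z => (φ z : ℂ)) p.1 * conj (onCircle (fun z => (ζ z : ℂ)) p.2)).re ∂M =
      -∫ t, poissonMean φ r t * fderiv ℝ ζ (circleMap 0 1 t) (I * circleMap 0 1 t) ∂arcMeasure := by
    intro r hr
    have h1 := hasSum_inner_mul_pow hr.1.le hr.2 (g := fun z => (fderiv ℝ ζ z (I * z) : ℂ)) hφi rfl
      (integrable_of_continuous_arc (continuous_tangential hζ))
    refine (T2 r hr).unique (h1.neg.of_fun_eq fun n => ?_)
    rw [t2, neg_mul]
  have v3 : ∀ r ∈ Ioo (0:ℝ) 1, -Real.pi⁻¹ * ∫ p : ℝ × ℝ, (koebe r (p.2 - p.1)).im *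
      (onCircle (fun _ => (1:ℂ)) p.1 * conj (onCircle (fun z => ((ζ z * φ z : ℝ) : ℂ)) p.2)).re ∂M = 0 := by
    intro r hr
    refine (T3 r hr).unique (hasSum_zero.of_fun_eq fun n => ?_)
    rw [circleCoeff_one]; split_ifs with h0 <;> simp [h0]
  have c1 : circleCoeff (fun z => ζ z • (I * z)) 1 =
      I * (((2 * Real.pi)⁻¹ * ∫ t, onCircle ζ t ∂arcMeasure : ℝ) : ℂ) := by
    have e : ∀ t : ℝ, exp (-(I * (1:ℤ) * t)) * (onCircle (fun z => ζ z • (I * z)) t) =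
        I * ((onCircle ζ t : ℝ) : ℂ) := fun t => by
      have : exp (-(I * (1:ℤ) * t)) * circleMap 0 1 t = 1 := by
        rw [circleMap, ofReal_one, one_mul, zero_add, ← Complex.exp_add, ← Complex.exp_zero]
        congr 1; push_cast; ring
      simp only [onCircle, real_smul]
      linear_combination (I * (ζ (circleMap 0 1 t) : ℂ)) * this
    simp only [circleCoeff, e]
    rw [integral_const_mul, integral_complex_ofReal, real_smul]; push_cast; ring
  have v1 : ∀ r ∈ Ioo (0:ℝ) 1, -Real.pi⁻¹ * ∫ p : ℝ × ℝ, (koebe r (p.2 - p.1)).im *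
      (onCircle (fun z => z) p.1 * conj (onCircle (fun z => ζ z • (I * z)) p.2)).re ∂M =
      r * ∫ t, onCircle ζ t ∂arcMeasure := by
    intro r hr
    refine (T1 r hr).unique ?_
    convert hasSum_single (1:ℤ) (fun n hn => ?_) using 1
    · rw [circleCoeff_id, if_pos rfl, c1, Complex.inner]
      have hpi := Real.pi_pos.ne'
      simp only [Int.cast_one, mul_one, conj_I, Int.natAbs_one, pow_one]
      have e : ∀ x : ℝ, (I * (x : ℂ) * -I).re = x := fun x => by simp
      rw [e]
      field_simp
    · rw [circleCoeff_id, if_neg hn]; simp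
  -- the remainder
  set R : ℝ × ℝ → ℝ := fun p => (onCircle h p.1 * conj (onCircle (fun z => ζ z • (I * h z)) p.2)).re -
    (onCircle (fun z => z) p.1 * conj (onCircle (fun z => ζ z • (I * z)) p.2)).re -
    (onCircle (fun z => (φ z : ℂ)) p.1 * conj (onCircle (fun z => (ζ z : ℂ)) p.2)).re +
    (onCircle (fun _ => (1:ℂ)) p.1 * conj (onCircle (fun z => ((ζ z * φ z : ℝ) : ℂ)) p.2)).re with hR
  have iM : ∀ {f g : ℂ → ℂ}, Integrable (onCircle f) arcMeasure → Integrable (onCircle g) arcMeasure →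
      Integrable (fun p : ℝ × ℝ => (onCircle f p.1 * conj (onCircle g p.2)).re) M := fun hf hg =>
    (hf.mul_prod hg.conj).re
  have iK : ∀ r ∈ Ioo (0:ℝ) 1, ∀ {F : ℝ × ℝ → ℝ}, Integrable F M →
      Integrable (fun p : ℝ × ℝ => (koebe r (p.2 - p.1)).im * F p) M := by
    intro r hr F hF
    have := continuous_koebe hr.1.le hr.2
    refine hF.bdd_mul (c := ((1 - r) ^ 2)⁻¹) (Continuous.aestronglyMeasurable (by fun_prop)) (ae_of_all _ fun p => ?_)
    refine (abs_im_le_norm _).trans ?_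
    have h1 : 1 - r ≤ ‖1 - r * exp (I * (p.2 - p.1 : ℝ))‖ := by
      have := norm_sub_norm_le (1:ℂ) (r * exp (I * (p.2 - p.1 : ℝ)))
      rwa [norm_real_mul_exp hr.1.le, norm_one] at this
    have h2 : 0 < 1 - r := by linarith [hr.2]
    rw [koebe, norm_div, norm_real_mul_exp hr.1.le, norm_pow, div_eq_mul_inv]
    refine (mul_le_of_le_one_left (by positivity) hr.2.le).trans ?_
    gcongr
  have dec : ∀ r ∈ Ioo (0:ℝ) 1, ∑' n : ℤ, 2 * Real.pi * ⟪I * n * circleCoeff h n,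
      circleCoeff (fun z => ζ z • (I * h z)) n⟫_ℝ * r ^ n.natAbs =
      r * ∫ t, onCircle ζ t ∂arcMeasure -
      ∫ t, poissonMean φ r t * fderiv ℝ ζ (circleMap 0 1 t) (I * circleMap 0 1 t) ∂arcMeasure +
      -Real.pi⁻¹ * ∫ p : ℝ × ℝ, (koebe r (p.2 - p.1)).im * R p ∂M := by
    intro r hr
    rw [(T0 r hr).tsum_eq, sub_eq_add_neg, ← v2 r hr, ← v1 r hr, ← mul_add, ← mul_add]
    congr 1
    have j0 := iK r hr (iM hh.1.integrable hk.integrable)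
    have j1 := iK r hr (iM hidi hidi')
    have j2 := iK r hr (iM hφc hζi)
    have j3 := iK r hr (iM (f := fun _ => 1) (integrable_const _) hζφ)
    have z3 := (mul_eq_zero.1 (v3 r hr)).resolve_left (neg_ne_zero.2 (inv_ne_zero Real.pi_pos.ne'))
    simp only [hR, mul_add, mul_sub]
    rw [integral_add ((j0.fun_sub' j1).fun_sub' j2) j3, integral_sub (j0.fun_sub' j1) j2, integral_sub j0 j1, z3]
    ring
  have hRle : ∀ᵐ p ∂M, |R p| ≤ C * (3 * ‖onCircle φ p.1 - onCircle φ p.2‖ ^ 2 +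
      ‖circleMap 0 1 p.1 - circleMap 0 1 p.2‖ ^ 2) := by
    have q1 := Measure.quasiMeasurePreserving_fst (μ := arcMeasure) (ν := arcMeasure) |>.ae hl
    have q2 := Measure.quasiMeasurePreserving_snd (μ := arcMeasure) (ν := arcMeasure) |>.ae hl
    filter_upwards [q1, q2] with p h1 h2
    have nE : ∀ t, circleMap 0 1 t * conj (circleMap 0 1 t) = 1 := fun t => by
      rw [mul_conj, normSq_eq_norm_sq, norm_circleMap_zero]; simp
    have hw : ‖circleMap 0 1 p.1 * conj (circleMap 0 1 p.2)‖ = 1 := by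
      rw [norm_mul, RCLike.norm_conj, norm_circleMap_zero, norm_circleMap_zero]; simp
    have hw1 : ‖circleMap 0 1 p.1 * conj (circleMap 0 1 p.2) - 1‖ = ‖circleMap 0 1 p.1 - circleMap 0 1 p.2‖ := by
      rw [← nE p.2, ← sub_mul, norm_mul, RCLike.norm_conj, norm_circleMap_zero]; simp
    have key := abs_im_sub_le hw (onCircle φ p.1 - onCircle φ p.2)
    have e : R p = onCircle ζ p.2 * ((circleMap 0 1 p.1 * conj (circleMap 0 1 p.2) *
        exp (I * ((onCircle φ p.1 - onCircle φ p.2 : ℝ) : ℂ))).im -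
        (circleMap 0 1 p.1 * conj (circleMap 0 1 p.2)).im - (onCircle φ p.1 - onCircle φ p.2)) := by
      have e0 : onCircle (fun z => ζ z • (I * h z)) p.2 = onCircle ζ p.2 * (I * onCircle h p.2) := rfl
      have e1 : onCircle (fun z => ζ z • (I * z)) p.2 = onCircle ζ p.2 * (I * circleMap 0 1 p.2) := rfl
      have e2 : exp (I * ((onCircle φ p.1 - onCircle φ p.2 : ℝ) : ℂ)) =
          exp (I * onCircle φ p.1) * conj (exp (I * onCircle φ p.2)) := by
        rw [← exp_conj, ← Complex.exp_add]
        congr 1; simp; ring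
      have e3 : ∀ z : ℂ, z.im = (-I * z).re := fun z => by simp
      have e4 : onCircle (fun z => (φ z : ℂ)) p.1 * conj (onCircle (fun z => (ζ z : ℂ)) p.2) =
        ((onCircle ζ p.2 * onCircle φ p.1 : ℝ) : ℂ) := by simp [onCircle, mul_comm]
      have e5 : onCircle (fun _ => (1:ℂ)) p.1 * conj (onCircle (fun z => ((ζ z * φ z : ℝ) : ℂ)) p.2) =
        ((onCircle ζ p.2 * onCircle φ p.2 : ℝ) : ℂ) := by simp [onCircle, mul_comm]
      have e6 : onCircle (fun z : ℂ => z) p.1 = circleMap 0 1 p.1 := rfl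
      simp only [hR]
      rw [e0, e1, e2, e4, e5, e6, h1, h2, ofReal_re, ofReal_re, mul_sub, mul_sub, e3, e3 (_ * _),
        ← re_ofReal_mul, ← re_ofReal_mul]
      have e7 : circleMap 0 1 p.1 * exp (I * onCircle φ p.1) * conj (onCircle ζ p.2 * (I * (circleMap 0 1 p.2 *
          exp (I * onCircle φ p.2)))) = onCircle ζ p.2 * (-I * (circleMap 0 1 p.1 * conj (circleMap 0 1 p.2) *
        (exp (I * onCircle φ p.1) * conj (exp (I * onCircle φ p.2))))) := by
        simp only [map_mul, conj_ofReal, conj_I]; ring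
      have e8 : circleMap 0 1 p.1 * conj (onCircle ζ p.2 * (I * (circleMap 0 1 p.2))) =
          onCircle ζ p.2 * (-I * (circleMap 0 1 p.1 * conj (circleMap 0 1 p.2))) := by
        simp only [map_mul, conj_ofReal, conj_I]; ring
      rw [e7, e8]
      ring
    rw [e, abs_mul, ← hw1]
    refine mul_le_mul (hC1 _) (key.trans_eq ?_) (abs_nonneg _) hC0
    rw [Real.norm_eq_abs, sq_abs]
  have hRm : AEStronglyMeasurable R M :=
    ((((iM hh.1.integrable hk.integrable).sub (iM hidi hidi')).sub (iM hφc hζi)).add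
      (iM (f := fun _ => 1) (integrable_const _) hζφ)).1
  -- Dominated convergence: the bound on `R` times the uniform bound on the kernel is a multiple of
  -- the Gagliardo integrand of φ plus a constant, with 12 = 3 · 4, and Im `koebe` tends to zero off
  -- the diagonal.
  have hRlim : Tendsto (fun r => ∫ p : ℝ × ℝ, (koebe r (p.2 - p.1)).im * R p ∂M) (𝓝[<] 1) (𝓝 0) := by
    have := tendsto_integral_filter_of_dominated_convergence (μ := M) (l := 𝓝[<] (1:ℝ))
      (F := fun r p => (koebe r (p.2 - p.1)).im * R p) (f := fun _ => 0)
      (fun p => C * (12 * gagliardo φ p + 4)) ?_ ?_ ?_ ?_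
    · simpa using this
    · filter_upwards [Ioo_mem_nhdsLT (zero_lt_one (α := ℝ))] with r hr
      have := continuous_koebe hr.1.le hr.2
      exact (Continuous.aestronglyMeasurable (by fun_prop)).mul hRm
    · filter_upwards [Ioo_mem_nhdsLT (zero_lt_one (α := ℝ))] with r hr
      filter_upwards [hRle] with p hp
      have g1 := norm_koebe_mul_gagliardo_le hr.1.le hr.2 φ p
      have g2 := norm_koebe_mul_le hr.1.le hr.2 (p.2 - p.1)
      rw [← norm_circleMap_sub] at g2
      rw [norm_mul, Real.norm_eq_abs, Real.norm_eq_abs]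
      calc _ ≤ ‖koebe r (p.2 - p.1)‖ * (C * (3 * ‖onCircle φ p.1 - onCircle φ p.2‖ ^ 2 +
            ‖circleMap 0 1 p.1 - circleMap 0 1 p.2‖ ^ 2)) :=
            mul_le_mul (abs_im_le_norm _) hp (abs_nonneg _) (norm_nonneg _)
        _ = C * (3 * (‖koebe r (p.2 - p.1)‖ * ‖onCircle φ p.1 - onCircle φ p.2‖ ^ 2) +
            ‖koebe r (p.2 - p.1)‖ * ‖circleMap 0 1 p.1 - circleMap 0 1 p.2‖ ^ 2) := by ring
        _ ≤ _ := mul_le_mul_of_nonneg_left (by linarith) hC0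
    · exact ((hφ.integrable_gagliardo.const_mul 12).add (integrable_const 4)).const_mul C
    · filter_upwards [ae_exp_ne_one] with p hp
      simpa using (tendsto_koebe_im hp).mul_const (R p)
  have lim1 := tendsto_tsum_mul_pow hs (fun n : ℤ => n.natAbs)
  obtain ⟨C2, hC2⟩ : ∃ C2, ∀ t, |fderiv ℝ ζ (circleMap 0 1 t) (I * circleMap 0 1 t)| ≤ C2 := by
    obtain ⟨C2, h2⟩ := (isCompact_closedBall (0:ℂ) 1).exists_bound_of_continuousOn
      (hζ.continuous_fderiv (by simp)).continuousOn
    refine ⟨C2, fun t => ?_⟩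
    have := (fderiv ℝ ζ (circleMap 0 1 t)).le_opNorm (I * circleMap 0 1 t)
    rw [norm_mul, norm_I, norm_circleMap_zero, abs_one, one_mul, mul_one] at this
    exact this.trans (h2 _ (by simp))
  have lim2 := tendsto_integral_poissonMean_mul hφ (continuous_tangential hζ) hC2
  have lim3 : Tendsto (fun r : ℝ => r * ∫ t, onCircle ζ t ∂arcMeasure) (𝓝[<] 1) (𝓝 (∫ t, onCircle ζ t ∂arcMeasure)) := by
    have : ContinuousAt (fun r : ℝ => r * ∫ t, onCircle ζ t ∂arcMeasure) 1 := by fun_prop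
    simpa using this.tendsto.mono_left (nhdsWithin_le_nhds (s := Iio 1))
  have lim4 := (lim3.sub lim2).add (hRlim.const_mul (-Real.pi⁻¹))
  rw [mul_zero, add_zero] at lim4
  have lim5 := lim4.congr' (by
    filter_upwards [Ioo_mem_nhdsLT (zero_lt_one (α := ℝ))] with r hr using (dec r hr).symm)
  have := tendsto_nhds_unique lim1 lim5
  rw [← this]
  exact hs.hasSum

end Pairing

/-! ### The analytic completion of a Poisson integral -/

section Herglotz

local notation "conj" => starRingEnd ℂ

theorem integral_ball_pow_mul_conj_pow {j k : ℕ} :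
    ∫ z in Metric.ball (0:ℂ) 1, z ^ j * conj (z ^ k) = if j = k then ((Real.pi / (k + 1) : ℝ) : ℂ) else 0 := by
  have hpi := Real.pi_pos
  rw [integral_ball_eq_polar]
  have e : ∀ p : ℝ × ℝ, p.1 • (circleMap 0 p.1 p.2 ^ j * conj (circleMap 0 p.1 p.2 ^ k)) =
      ((p.1 ^ (j + k + 1) : ℝ) : ℂ) * exp (I * ((j : ℤ) - k : ℤ) * p.2) := by
    intro p
    have h1 : exp (I * ((j : ℤ) - k : ℤ) * p.2) = exp (p.2 * I) ^ j * conj (exp (p.2 * I) ^ k) := by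
      rw [← Complex.exp_nat_mul, ← Complex.exp_nat_mul, ← exp_conj, ← Complex.exp_add]
      congr 1
      simp; ring
    rw [h1, circleMap, zero_add, real_smul, mul_pow, mul_pow, map_mul, ← ofReal_pow, ← ofReal_pow, conj_ofReal]
    push_cast; ring
  simp only [e]
  rw [Measure.volume_eq_prod, setIntegral_prod_mul (fun r : ℝ => ((r ^ (j + k + 1) : ℝ) : ℂ))
    (fun t : ℝ => exp (I * ((j : ℤ) - k : ℤ) * t))]
  rw [← integral_Ioc_eq_integral_Ioo, ← integral_Ioc_eq_integral_Ioo,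
    ← intervalIntegral.integral_of_le zero_le_one, ← intervalIntegral.integral_of_le (by linarith)]
  split_ifs with h
  · subst h
    simp only [sub_self, Int.cast_zero, mul_zero, zero_mul, Complex.exp_zero]
    rw [intervalIntegral.integral_ofReal, integral_pow, intervalIntegral.integral_const]
    have : ((j:ℝ) + 1) ≠ 0 := by positivity
    rw [real_smul, mul_one, ← ofReal_mul]
    congr 1
    push_cast
    simp only [one_pow, ne_eq, Nat.add_eq_zero_iff, one_ne_zero, and_false, not_false_eq_true, zero_pow, sub_zero]
    have : ((j:ℝ) + j + 1 + 1) ≠ 0 := by positivity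
    field_simp
    ring
  · have hn : (I * ((j : ℤ) - k : ℤ) : ℂ) ≠ 0 := by
      refine mul_ne_zero I_ne_zero ?_
      have : ((j:ℤ) - k) ≠ 0 := by omega
      exact_mod_cast this
    rw [integral_exp_mul_complex hn]
    have : exp (I * ((j : ℤ) - k : ℤ) * (Real.pi : ℝ)) = exp (I * ((j : ℤ) - k : ℤ) * ((-Real.pi : ℝ) : ℂ)) := by
      rw [Complex.exp_eq_exp_iff_exists_int]
      exact ⟨(j:ℤ) - k, by push_cast; ring⟩
    rw [this, sub_self, zero_div, mul_zero]

theorem integrableOn_ball_of_continuous {E : Type} [NormedAddCommGroup E] {F : ℂ → E} (hF : Continuous F) :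
    IntegrableOn F (Metric.ball (0:ℂ) 1) :=
  (hF.continuousOn.integrableOn_compact (isCompact_closedBall 0 1)).mono_set Metric.ball_subset_closedBall

theorem integral_ball_norm_sq_sum (b : ℕ → ℂ) (N : ℕ) :
    ∫ z in Metric.ball (0:ℂ) 1, ‖∑ n ∈ Finset.range N, b n * z ^ n‖ ^ 2 =
      Real.pi * ∑ n ∈ Finset.range N, ‖b n‖ ^ 2 / (n + 1) := by
  rw [← ofReal_inj, ← integral_complex_ofReal]
  have e : ∀ z : ℂ, ((‖∑ n ∈ Finset.range N, b n * z ^ n‖ ^ 2 : ℝ) : ℂ) =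
      ∑ j ∈ Finset.range N, ∑ k ∈ Finset.range N, (b j * conj (b k)) * (z ^ j * conj (z ^ k)) := by
    intro z
    rw [← normSq_eq_norm_sq, ← mul_conj, map_sum, Finset.sum_mul_sum]
    refine Finset.sum_congr rfl fun j _ => Finset.sum_congr rfl fun k _ => ?_
    rw [map_mul]; ring
  simp only [e]
  rw [integral_finsetSum _ fun j _ => integrableOn_ball_of_continuous (by fun_prop)]
  have e2 : ∀ j ∈ Finset.range N, ∫ z in Metric.ball (0:ℂ) 1, ∑ k ∈ Finset.range N,
      (b j * conj (b k)) * (z ^ j * conj (z ^ k)) = ((Real.pi * (‖b j‖ ^ 2 / (j + 1)) : ℝ) : ℂ) := by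
    intro j hj
    rw [integral_finsetSum _ fun k _ => integrableOn_ball_of_continuous (by fun_prop)]
    simp only [integral_const_mul, integral_ball_pow_mul_conj_pow]
    rw [Finset.sum_eq_single_of_mem j hj fun k _ hk => by rw [if_neg (Ne.symm hk), mul_zero], if_pos rfl,
      mul_conj, normSq_eq_norm_sq, ← ofReal_mul]
    congr 1; ring
  rw [Finset.sum_congr rfl e2, ← ofReal_sum, Finset.mul_sum]

/-- A power series with `∑ |b n|² / (n + 1) < ∞` is square integrable on the unit disk. -/
theorem memLp_two_of_hasSum_mul_pow {b : ℕ → ℂ} {g : ℂ → ℂ}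
    (hg : ∀ z ∈ Metric.ball (0:ℂ) 1, HasSum (fun n => b n * z ^ n) (g z))
    (hb : Summable fun n : ℕ => ‖b n‖ ^ 2 / (n + 1))
    (hm : AEStronglyMeasurable g (volume.restrict (Metric.ball 0 1))) :
    MemLp g 2 (volume.restrict (Metric.ball 0 1)) := by
  rw [memLp_two_iff_integrable_sq_norm hm]
  refine ⟨hm.norm.aemeasurable.pow_const 2 |>.aestronglyMeasurable, ?_⟩
  rw [hasFiniteIntegral_iff_ofReal (ae_of_all _ fun z => by positivity)]
  set P : ℕ → ℂ → ℝ := fun N z => ‖∑ n ∈ Finset.range N, b n * z ^ n‖ ^ 2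
  -- Fatou's lemma for the partial sums, whose norms are explicit because the monomials are
  -- orthogonal on the disk.
  have h1 : ∫⁻ z in Metric.ball (0:ℂ) 1, ENNReal.ofReal (‖g z‖ ^ 2) =
      ∫⁻ z in Metric.ball (0:ℂ) 1, liminf (fun N => ENNReal.ofReal (P N z)) atTop := by
    refine setLIntegral_congr_fun measurableSet_ball fun z hz => ?_
    have := ((hg z hz).tendsto_sum_nat.norm.pow 2)
    exact ((ENNReal.continuous_ofReal.tendsto _).comp this).liminf_eq.symm
  rw [h1]
  have hP : ∀ N, Continuous (P N) := fun N => by fun_prop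
  refine (lintegral_liminf_le fun N => (hP N).measurable.ennreal_ofReal).trans_lt ?_
  refine lt_of_le_of_lt ?_ (ENNReal.ofReal_lt_top (r := Real.pi * ∑' n : ℕ, ‖b n‖ ^ 2 / (n + 1)))
  refine liminf_le_of_le (by isBoundedDefault) fun c hc => ?_
  obtain ⟨N, hN⟩ := hc.exists
  refine hN.trans ?_
  rw [← ofReal_integral_eq_lintegral_ofReal (integrableOn_ball_of_continuous (hP N))
    (ae_of_all _ fun z => by positivity), integral_ball_norm_sq_sum]
  refine ENNReal.ofReal_le_ofReal (mul_le_mul_of_nonneg_left ?_ Real.pi_pos.le)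
  exact hb.sum_le_tsum _ fun n _ => by positivity

theorem norm_circleCoeff_le (h : ℂ → ℂ) (n : ℤ) :
    ‖circleCoeff h n‖ ≤ (2 * Real.pi)⁻¹ * ∫ t, ‖onCircle h t‖ ∂arcMeasure := by
  rw [circleCoeff, norm_smul, Real.norm_of_nonneg (by have := Real.pi_pos; positivity)]
  refine mul_le_mul_of_nonneg_left ((norm_integral_le_integral_norm _).trans_eq ?_)
    (by have := Real.pi_pos; positivity)
  congr 1; ext t
  rw [norm_mul, show -(I * n * t) = ((-(n * t) : ℝ) : ℂ) * I by push_cast; ring, norm_exp_ofReal_mul_I, one_mul]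

theorem circleCoeff_neg_ofReal (φ : ℂ → ℝ) (n : ℤ) :
    circleCoeff (fun z => (φ z : ℂ)) (-n) = conj (circleCoeff (fun z => (φ z : ℂ)) n) := by
  simp only [circleCoeff, real_smul, map_mul, conj_ofReal, ← integral_conj, onCircle, ← exp_conj, map_neg, conj_I,
    map_intCast]
  congr 2; ext t; congr 2; push_cast; ring

/-- The Taylor coefficients of the holomorphic function on the disk whose real part is the Poisson
integral of `φ`. -/
noncomputable def herglotzCoeff (φ : ℂ → ℝ) (n : ℕ) : ℂ :=
  (if n = 0 then 1 else 2) * circleCoeff (fun z => (φ z : ℂ)) n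

/-- The holomorphic function on the disk whose real part is the Poisson integral of `φ`. -/
noncomputable def herglotz (φ : ℂ → ℝ) (z : ℂ) : ℂ := ∑' n : ℕ, herglotzCoeff φ n * z ^ n

theorem exists_bound_herglotzCoeff (φ : ℂ → ℝ) : ∃ B : ℝ, ∀ n, ‖herglotzCoeff φ n‖ ≤ B := by
  refine ⟨2 * ((2 * Real.pi)⁻¹ * ∫ t, ‖onCircle (fun z => (φ z : ℂ)) t‖ ∂arcMeasure), fun n => ?_⟩
  rw [herglotzCoeff, norm_mul]
  refine mul_le_mul ?_ (norm_circleCoeff_le _ _) (norm_nonneg _) (by norm_num)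
  split_ifs <;> simp

theorem hasSum_herglotz (φ : ℂ → ℝ) {z : ℂ} (hz : z ∈ Metric.ball (0:ℂ) 1) :
    HasSum (fun n : ℕ => herglotzCoeff φ n * z ^ n) (herglotz φ z) := by
  obtain ⟨B, hB⟩ := exists_bound_herglotzCoeff φ
  refine Summable.hasSum (Summable.of_norm_bounded (g := fun n : ℕ => B * ‖z‖ ^ n) ?_ fun n => ?_)
  · exact (summable_geometric_of_lt_one (norm_nonneg _) (by simpa using hz)).mul_left _
  · rw [norm_mul, norm_pow]; gcongr; exact hB n

theorem hasSum_deriv_herglotz (φ : ℂ → ℝ) {z : ℂ} (hz : z ∈ Metric.ball (0:ℂ) 1) :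
    DifferentiableAt ℂ (herglotz φ) z ∧
    HasSum (fun n : ℕ => (n + 1) * herglotzCoeff φ (n + 1) * z ^ n) (deriv (herglotz φ) z) := by
  obtain ⟨B, hB⟩ := exists_bound_herglotzCoeff φ
  have hz1 : ‖z‖ < 1 := by simpa using hz
  obtain ⟨ρ, h1, h2⟩ := exists_between hz1
  have hρ0 : 0 < ρ := (norm_nonneg z).trans_lt h1
  have hu : Summable fun n : ℕ => B * ((n:ℝ) * ρ ^ (n - 1)) := by
    refine Summable.mul_left _ ?_
    rw [← summable_nat_add_iff 1]
    have := summable_pow_mul_geometric_of_norm_lt_one (R := ℝ) 1 (r := ρ) (by rwa [Real.norm_of_nonneg hρ0.le])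
    have h3 := this.add (summable_geometric_of_lt_one hρ0.le h2)
    refine h3.congr fun n => ?_
    simp; ring
  have hle : ∀ n : ℕ, ∀ y ∈ Metric.ball (0:ℂ) ρ, ‖herglotzCoeff φ n * (n * y ^ (n - 1))‖ ≤ B * ((n:ℝ) * ρ ^ (n - 1)) := by
    intro n y hy
    rw [norm_mul, norm_mul, norm_natCast, norm_pow]
    have : ‖y‖ ≤ ρ := by simpa using (Metric.mem_ball.1 hy).le
    have := (norm_nonneg _).trans (hB 0)
    gcongr
    exact hB n
  have hzρ : z ∈ Metric.ball (0:ℂ) ρ := by simpa using h1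
  have hd := hasDerivAt_tsum_of_isPreconnected (𝕜 := ℂ) (g := fun (n : ℕ) z => herglotzCoeff φ n * z ^ n)
    (g' := fun n y => herglotzCoeff φ n * (n * y ^ (n - 1))) hu Metric.isOpen_ball
    (convex_ball (0:ℂ) ρ).isPreconnected (fun n y _ => by
      simpa using (hasDerivAt_pow n y).const_mul (herglotzCoeff φ n)) hle hzρ (hasSum_herglotz φ hz).summable hzρ
  refine ⟨hd.differentiableAt, ?_⟩
  have hs : Summable fun n : ℕ => herglotzCoeff φ n * (n * z ^ (n - 1)) :=
    Summable.of_norm_bounded hu fun n => hle n z hzρ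
  -- The differentiated term of index 0 is zero, which permits the shift of the index.
  have h4 := (hasSum_nat_add_iff' 1).2 hs.hasSum
  rw [← hd.deriv] at h4
  simp only [Finset.range_one, Finset.sum_singleton, Nat.cast_zero, zero_mul, mul_zero, sub_zero] at h4
  refine h4.of_fun_eq fun n => ?_
  rw [Nat.add_sub_cancel]
  push_cast
  ring

theorem differentiableOn_herglotz (φ : ℂ → ℝ) : DifferentiableOn ℂ (herglotz φ) (Metric.ball 0 1) :=
  fun z hz => (hasSum_deriv_herglotz φ hz).1.differentiableWithinAt

/-- As φ is real, its coefficients at n and -n are conjugate, so the two-sided Poisson series is the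
real part of the one-sided series in which the coefficients of positive index are doubled. -/
theorem re_herglotz {φ : ℂ → ℝ} (hφ : Integrable (onCircle φ) arcMeasure) {r : ℝ} (hr0 : 0 ≤ r) (hr1 : r < 1)
    (t : ℝ) : (herglotz φ (circleMap 0 r t)).re = poissonMean φ r t := by
  set z := circleMap 0 r t with hz
  have hz1 : z ∈ Metric.ball (0:ℂ) 1 := by simpa [z, abs_of_nonneg hr0] using hr1
  set c := circleCoeff (fun z => (φ z : ℂ))
  have h1 := hasSum_circleCoeff_mul_exp (summable_pow_natAbs hr0 hr1) (hasSum_diskPoisson hr0 hr1)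
    (h := fun z => (φ z : ℂ)) hφ.ofReal t
  have e1 : ((2 * Real.pi : ℝ)⁻¹ • ∫ s, (diskPoisson r (t - s) : ℂ) * onCircle (fun z => (φ z : ℂ)) s ∂arcMeasure) =
      (poissonMean φ r t : ℂ) := by
    have e : ∀ s, (diskPoisson r (t - s) : ℂ) * onCircle (fun z => (φ z : ℂ)) s =
      ((diskPoisson r (t - s) * onCircle φ s : ℝ) : ℂ) := fun s => by simp [onCircle]
    simp only [e]
    rw [integral_complex_ofReal, real_smul, ← ofReal_mul, poissonMean]
  rw [e1] at h1
  have h2 := h1.nat_add_neg.map Complex.reCLM Complex.reCLM.continuous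
  -- Pairing n with -n counts the index 0 twice; one copy is removed.
  have h3 := h2.sub (hasSum_ite_eq (0:ℕ) ((c 0).re))
  have h4 := (hasSum_herglotz φ hz1).map Complex.reCLM Complex.reCLM.continuous
  have h5 : HasSum (reCLM ∘ fun n : ℕ => herglotzCoeff φ n * z ^ n) (poissonMean φ r t) := by
    have hl : reCLM ((poissonMean φ r t : ℂ) + ((r ^ Int.natAbs 0 : ℝ) : ℂ) * circleCoeff (fun z => (φ z : ℂ)) 0 *
        exp (I * ((0 : ℤ) : ℂ) * t)) - (c 0).re = poissonMean φ r t := by simp [c]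
    rw [hl] at h3
    refine h3.of_fun_eq fun n => ?_
    · have e2 : ((r ^ n : ℝ) : ℂ) * exp (I * n * t) = z ^ n := by
        rw [hz, circleMap, zero_add, mul_pow, ← Complex.exp_nat_mul]
        push_cast; congr 2; ring
      have e3 : ((r ^ n : ℝ) : ℂ) * exp (I * ((-n : ℤ) : ℂ) * t) = conj (z ^ n) := by
        rw [← e2, map_mul, conj_ofReal, ← exp_conj]
        congr 2
        simp
      simp only [Function.comp_apply, reCLM_apply, Int.natAbs_natCast, Int.natAbs_neg, Int.cast_natCast, herglotzCoeff]
      have e4 : (((r ^ n : ℝ) : ℂ) * c n * exp (I * n * t) +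
        ((r ^ n : ℝ) : ℂ) * c (-n) * exp (I * ((-n : ℤ) : ℂ) * t)).re = 2 * (c n * z ^ n).re := by
        have : ((r ^ n : ℝ) : ℂ) * c n * exp (I * n * t) +
          ((r ^ n : ℝ) : ℂ) * c (-n) * exp (I * ((-n : ℤ) : ℂ) * t) = c n * z ^ n + conj (c n * z ^ n) := by
          rw [map_mul, ← e3, ← circleCoeff_neg_ofReal, ← e2]; ring
        rw [this, add_re, conj_re]; ring
      rw [e4]
      split_ifs with h0
      · subst h0; simp [c]; ring
      · rw [mul_assoc, sub_zero, show (2:ℂ) = ((2:ℝ):ℂ) by push_cast; rfl, re_ofReal_mul]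
  have := h4.unique h5
  exact this

theorem continuousOn_deriv_herglotz (φ : ℂ → ℝ) : ContinuousOn (deriv (herglotz φ)) (Metric.ball 0 1) :=
  ((differentiableOn_herglotz φ).deriv Metric.isOpen_ball).continuousOn

theorem summable_natCast_mul_norm_herglotzCoeff {φ : ℂ → ℝ} (hφ : MemHHalf φ) :
    Summable fun n : ℕ => (n : ℝ) * ‖herglotzCoeff φ n‖ ^ 2 := by
  have h := hφ.ofReal.summable.comp_injective Nat.cast_injective
  refine (h.mul_left 4).congr fun n => ?_
  simp only [Function.comp_apply, Int.natAbs_natCast, herglotzCoeff]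
  split_ifs with h0
  · simp [h0]
  · rw [norm_mul]; simp; ring

/-- The squared norm of z^n on the disk is π / (n + 1), so the Dirichlet integral of the series is a
multiple of Σ n |c_n|², finite by the Fourier bound on H^{1/2}. -/
theorem memLp_deriv_herglotz {φ : ℂ → ℝ} (hφ : MemHHalf φ) :
    MemLp (deriv (herglotz φ)) 2 (volume.restrict (Metric.ball 0 1)) := by
  refine memLp_two_of_hasSum_mul_pow (fun z hz => (hasSum_deriv_herglotz φ hz).2) ?_
    ((continuousOn_deriv_herglotz φ).aestronglyMeasurable measurableSet_ball)
  refine ((summable_nat_add_iff 1).2 (summable_natCast_mul_norm_herglotzCoeff hφ)).congr fun n => ?_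
  have : (n:ℂ) + 1 = ((n + 1 : ℕ) : ℂ) := by push_cast; rfl
  rw [norm_mul, this, norm_natCast]
  have : (n:ℝ) + 1 ≠ 0 := by positivity
  push_cast
  field_simp

theorem memLp_herglotz {φ : ℂ → ℝ} (hφ : MemHHalf φ) :
    MemLp (herglotz φ) 2 (volume.restrict (Metric.ball 0 1)) := by
  refine memLp_two_of_hasSum_mul_pow (fun z hz => hasSum_herglotz φ hz) ?_
    ((differentiableOn_herglotz φ).continuousOn.aestronglyMeasurable measurableSet_ball)
  rw [← summable_nat_add_iff 1]
  refine Summable.of_nonneg_of_le (fun n => by positivity) (fun n => ?_)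
    ((summable_nat_add_iff 1).2 (summable_natCast_mul_norm_herglotzCoeff hφ))
  push_cast
  rw [div_le_iff₀ (by positivity)]
  have : 0 ≤ ‖herglotzCoeff φ (n + 1)‖ ^ 2 := by positivity
  have hn : (0:ℝ) ≤ n := by positivity
  nlinarith [mul_nonneg hn this, mul_nonneg (mul_nonneg hn hn) this]

end Herglotz

/-! ### Existence for the Neumann problem -/

section Neumann

instance isFiniteMeasure_restrict_ball : IsFiniteMeasure (volume.restrict (Metric.ball (0:ℂ) 1)) :=
  ⟨by rw [Measure.restrict_apply_univ]; exact measure_ball_lt_top⟩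

/-- The holomorphic function `z e^{iG(z)}` on the disk, whose modulus and phase solve the Neumann problem
and the boundary value problem with data `z e^{iφ}`. -/
noncomputable def phaseLift (φ : ℂ → ℝ) (z : ℂ) : ℂ := z * exp (I * herglotz φ z)

theorem phaseLift_ne_zero (φ : ℂ → ℝ) {z : ℂ} (hz : z ≠ 0) : phaseLift φ z ≠ 0 :=
  mul_ne_zero hz (exp_ne_zero _)

theorem log_norm_phaseLift (φ : ℂ → ℝ) {z : ℂ} (hz : z ≠ 0) :
    Real.log ‖phaseLift φ z‖ = Real.log ‖z‖ + (I * herglotz φ z).re := by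
  rw [phaseLift, norm_mul, Real.log_mul (norm_ne_zero_iff.2 hz) (norm_ne_zero_iff.2 (exp_ne_zero _)), norm_exp,
    Real.log_exp]

theorem ae_ball_ne_zero : ∀ᵐ z ∂(volume.restrict (Metric.ball (0:ℂ) 1)), z ≠ 0 :=
  ae_restrict_of_ae (compl_mem_ae_iff.2 (measure_singleton 0))

theorem hasFDerivAt_re_I_mul_herglotz (φ : ℂ → ℝ) {z : ℂ} (hz : z ∈ Metric.ball (0:ℂ) 1) :
    HasFDerivAt (fun z => (I * herglotz φ z).re) (reForm (I * deriv (herglotz φ) z)) z :=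
  ((hasSum_deriv_herglotz φ hz).1.hasDerivAt.const_mul I).re_comp

theorem continuousOn_reForm_herglotz (φ : ℂ → ℝ) :
    ContinuousOn (fun z => reForm (I * deriv (herglotz φ) z)) (Metric.ball 0 1) :=
  continuous_reForm.comp_continuousOn (continuousOn_const.mul (continuousOn_deriv_herglotz φ))

theorem integrableOn_deriv_herglotz {φ : ℂ → ℝ} (hφ : MemHHalf φ) :
    IntegrableOn (deriv (herglotz φ)) (Metric.ball 0 1) :=
  (memLp_deriv_herglotz hφ).integrable one_le_two

theorem integrableOn_reForm_herglotz {φ : ℂ → ℝ} (hφ : MemHHalf φ) :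
    IntegrableOn (fun z => reForm (I * deriv (herglotz φ) z)) (Metric.ball 0 1) := by
  refine Integrable.mono (integrableOn_deriv_herglotz hφ)
    ((continuousOn_reForm_herglotz φ).aestronglyMeasurable measurableSet_ball) (ae_of_all _ fun z => ?_)
  refine (norm_reForm_le _).trans ?_
  rw [norm_mul, norm_I, one_mul]

theorem ofReal_mul_mem_ball {R : ℝ} (hR0 : 0 ≤ R) (hR1 : R < 1) {z : ℂ} (hz : z ∈ Metric.closedBall (0:ℂ) 1) :
    (R : ℂ) * z ∈ Metric.ball (0:ℂ) 1 := by
  rw [mem_ball_zero_iff, norm_mul, norm_real, Real.norm_of_nonneg hR0]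
  have : ‖z‖ ≤ 1 := by simpa using hz
  nlinarith [norm_nonneg z]

/-- Green's formula on the disk for the Poisson integral and its conjugate. -/
theorem integral_ball_conj_gradient {φ : ℂ → ℝ} (hφ : MemHHalf φ) {ζ : ℂ → ℝ} (hζ : ContDiff ℝ ∞ ζ) {R : ℝ}
    (hR : R ∈ Ioo (0:ℝ) 1) :
    ∫ z in Metric.ball (0:ℂ) 1, (fderiv ℝ ζ z 1 * ((R : ℂ) * (I * deriv (herglotz φ) (R * z))).re +
      fderiv ℝ ζ z I * ((R : ℂ) * (I * deriv (herglotz φ) (R * z)) * I).re) =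
      -∫ t, poissonMean φ R t * fderiv ℝ ζ (circleMap 0 1 t) (I * circleMap 0 1 t) ∂arcMeasure := by
  -- With w = Re G(R z), the gradient of -Im G(R z) is (w_y, -w_x). The integrand is w_y ζ_x - w_x
  -- ζ_y = ∂_y(w ζ_x) - ∂_x(w ζ_y), because mixed derivatives of ζ commute, and Gauss-Green leaves
  -- -w ∂_θ ζ on the circle.
  set w : ℂ → ℝ := fun z => (herglotz φ (R * z)).re
  set w' : ℂ → ℂ →L[ℝ] ℝ := fun z => reForm (deriv (herglotz φ) (R * z) * R)
  have hw : ∀ z ∈ Metric.closedBall (0:ℂ) 1, HasFDerivAt w (w' z) z := fun z hz => by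
    have h1 := (hasSum_deriv_herglotz φ (ofReal_mul_mem_ball hR.1.le hR.2 hz)).1.hasDerivAt
    have h2 : HasDerivAt (fun z : ℂ => (R:ℂ) * z) R z := by simpa using (hasDerivAt_id z).const_mul (R:ℂ)
    exact (h1.comp z h2).re_comp
  have hwc : ContinuousOn w' (Metric.closedBall 0 1) := by
    refine continuous_reForm.comp_continuousOn (ContinuousOn.mul ?_ continuousOn_const)
    exact (continuousOn_deriv_herglotz φ).comp (by fun_prop) fun z hz => ofReal_mul_mem_ball hR.1.le hR.2 hz
  have hwcont : ContinuousOn w (Metric.closedBall 0 1) := fun z hz => (hw z hz).continuousAt.continuousWithinAt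
  have hd : ∀ e : ℂ, ContDiff ℝ ∞ (fun z => fderiv ℝ ζ z e) := fun e =>
    (hζ.fderiv_right (by simp)).clm_apply contDiff_const
  have hdc : ∀ e, Continuous (fun z => fderiv ℝ ζ z e) := fun e => (hd e).continuous
  have hprod : ∀ e z, z ∈ Metric.closedBall (0:ℂ) 1 → HasFDerivAt (fun z => w z * fderiv ℝ ζ z e)
      (w z • fderiv ℝ (fun z => fderiv ℝ ζ z e) z + fderiv ℝ ζ z e • w' z) z := fun e z hz =>
    (hw z hz).mul (((hd e).differentiable (by simp)) z).hasFDerivAt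
  have hprodc : ∀ e, ContinuousOn (fun z => w z • fderiv ℝ (fun z => fderiv ℝ ζ z e) z + fderiv ℝ ζ z e • w' z)
      (Metric.closedBall (0:ℂ) 1) := fun e =>
    (hwcont.smul ((hd e).continuous_fderiv (by simp)).continuousOn).add ((hdc e).continuousOn.smul hwc)
  have g1 := integral_ball_fderiv (hprod 1) (hprodc 1) I
  have g2 := integral_ball_fderiv (hprod I) (hprodc I) 1
  have hsymm : ∀ z, fderiv ℝ (fun z => fderiv ℝ ζ z 1) z I = fderiv ℝ (fun z => fderiv ℝ ζ z I) z 1 := fun z => by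
    have hz := (((hζ.fderiv_right (m := ∞) (by simp)).differentiable (by simp)) z)
    rw [fderiv_clm_apply hz (differentiableAt_const _), fderiv_clm_apply hz (differentiableAt_const _)]
    have := (hζ.contDiffAt (x := z)).isSymmSndFDerivAt (by simp; exact WithTop.coe_le_coe.2 le_top)
    simpa using this I 1
  have i : ∀ e d, IntegrableOn (fun z => (w z • fderiv ℝ (fun z => fderiv ℝ ζ z e) z + fderiv ℝ ζ z e • w' z) d)
      (Metric.ball (0:ℂ) 1) := fun e d =>
    ((((hprodc e).clm_apply continuousOn_const)).integrableOn_compact (isCompact_closedBall 0 1)).mono_set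
      Metric.ball_subset_closedBall
  have e1 : ∀ z, fderiv ℝ ζ z 1 * ((R : ℂ) * (I * deriv (herglotz φ) (R * z))).re +
      fderiv ℝ ζ z I * ((R : ℂ) * (I * deriv (herglotz φ) (R * z)) * I).re =
      (w z • fderiv ℝ (fun z => fderiv ℝ ζ z 1) z + fderiv ℝ ζ z 1 • w' z) I -
      (w z • fderiv ℝ (fun z => fderiv ℝ ζ z I) z + fderiv ℝ ζ z I • w' z) 1 := fun z => by
    simp only [ContinuousLinearMap.add_apply, ContinuousLinearMap.smul_apply, smul_eq_mul, hsymm, w', reForm_apply]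
    have a1 : (R : ℂ) * (I * deriv (herglotz φ) (R * z)) = deriv (herglotz φ) (R * z) * R * I := by ring
    rw [a1, mul_assoc _ I I, I_mul_I, mul_neg_one, neg_re, mul_one]
    ring
  simp only [e1]
  rw [integral_sub (i 1 I) (i I 1), g1, g2]
  have cw : ∀ e d : ℂ, Integrable (fun t => ⟪d, circleMap 0 1 t⟫_ℝ • (w (circleMap 0 1 t) *
      fderiv ℝ ζ (circleMap 0 1 t) e)) arcMeasure := fun e d => by
    refine integrable_of_continuous_arc ?_
    have h1 : Continuous fun t => w (circleMap 0 1 t) :=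
      hwcont.comp_continuous (continuous_circleMap 0 1) fun t => by simp
    have h2 := (hdc e).comp (continuous_circleMap 0 1)
    have h3 : Continuous fun t => ⟪d, circleMap 0 1 t⟫_ℝ := continuous_const.inner (continuous_circleMap 0 1)
    exact h3.smul (h1.mul h2)
  rw [← integral_sub (cw 1 I) (cw I 1), ← integral_neg]
  congr 1; ext t
  have hw1 : w (circleMap 0 1 t) = poissonMean φ R t := by
    rw [← re_herglotz hφ.integrable hR.1.le hR.2]
    simp [w, circleMap]
  have a2 : I * circleMap 0 1 t = (-(circleMap 0 1 t).im) • (1:ℂ) + (circleMap 0 1 t).re • I := by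
    apply Complex.ext <;> simp
  rw [hw1, a2, map_add, map_smul, map_smul]
  simp [Complex.inner]
  ring

/-- The limit R → 1 in `integral_ball_conj_gradient`: dilations act continuously on the integrable
gradient, and the Poisson means converge in L¹ of the circle. -/
theorem integral_ball_gradient_herglotz {φ : ℂ → ℝ} (hφ : MemHHalf φ) {ζ : ℂ → ℝ} (hζ : ContDiff ℝ ∞ ζ) :
    ∫ z in Metric.ball (0:ℂ) 1, (reForm (I * deriv (herglotz φ) z) 1 * fderiv ℝ ζ z 1 +
      reForm (I * deriv (herglotz φ) z) I * fderiv ℝ ζ z I) =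
      -∫ t, onCircle φ t * fderiv ℝ ζ (circleMap 0 1 t) (I * circleMap 0 1 t) ∂arcMeasure := by
  have hdc : ∀ e, Continuous (fun z => fderiv ℝ ζ z e) := fun e =>
    (hζ.continuous_fderiv (by simp)).clm_apply continuous_const
  have hi : ∀ d : ℂ, IntegrableOn (fun z => (I * deriv (herglotz φ) z * d).re) (Metric.ball (0:ℂ) 1) := fun d =>
    (((integrableOn_deriv_herglotz hφ).const_mul I).mul_const d).re
  have l1 := tendsto_integral_dilation (hi 1) (hdc 1)
  have l2 := tendsto_integral_dilation (hi I) (hdc I)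
  obtain ⟨C2, hC2⟩ : ∃ C2, ∀ t, |fderiv ℝ ζ (circleMap 0 1 t) (I * circleMap 0 1 t)| ≤ C2 := by
    obtain ⟨C2, h2⟩ := (isCompact_closedBall (0:ℂ) 1).exists_bound_of_continuousOn
      (hζ.continuous_fderiv (by simp)).continuousOn
    refine ⟨C2, fun t => ?_⟩
    have := (fderiv ℝ ζ (circleMap 0 1 t)).le_opNorm (I * circleMap 0 1 t)
    rw [norm_mul, norm_I, norm_circleMap_zero, abs_one, one_mul, mul_one] at this
    exact this.trans (h2 _ (by simp))
  have l3 := (tendsto_integral_poissonMean_mul hφ (continuous_tangential hζ) hC2).neg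
  have lR : Tendsto (fun R : ℝ => R) (𝓝[<] 1) (𝓝 1) := tendsto_id.mono_left nhdsWithin_le_nhds
  have l4 := lR.mul (l1.add l2)
  have hb : ∀ d e, IntegrableOn (fun z => fderiv ℝ ζ z e • (I * deriv (herglotz φ) z * d).re) (Metric.ball (0:ℂ) 1) := by
    intro d e
    obtain ⟨C, hC⟩ := (isCompact_closedBall (0:ℂ) 1).exists_bound_of_continuousOn (hdc e).continuousOn
    refine (hi d).bdd_mul (hdc e).aestronglyMeasurable (c := C) ?_
    filter_upwards [ae_restrict_mem measurableSet_ball] with z hz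
    exact hC z (Metric.ball_subset_closedBall hz)
  have hbR : ∀ R ∈ Ioo (0:ℝ) 1, ∀ d e, IntegrableOn (fun z => fderiv ℝ ζ z e •
      (I * deriv (herglotz φ) (R * z) * d).re) (Metric.ball (0:ℂ) 1) := by
    intro R hR d e
    refine IntegrableOn.mono_set (t := Metric.closedBall 0 1) ?_ Metric.ball_subset_closedBall
    refine ContinuousOn.integrableOn_compact (isCompact_closedBall 0 1) ?_
    have : ContinuousOn (fun z : ℂ => deriv (herglotz φ) (R * z)) (Metric.closedBall 0 1) :=
      (continuousOn_deriv_herglotz φ).comp (by fun_prop) fun z hz => ofReal_mul_mem_ball hR.1.le hR.2 hz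
    exact (hdc e).continuousOn.smul
      (Complex.continuous_re.comp_continuousOn ((continuousOn_const.mul this).mul continuousOn_const))
  have l5 := l4.congr' (f₂ := fun R => -∫ t, poissonMean φ R t *
      fderiv ℝ ζ (circleMap 0 1 t) (I * circleMap 0 1 t) ∂arcMeasure) (by
    filter_upwards [Ioo_mem_nhdsLT (zero_lt_one (α := ℝ))] with R hR
    rw [← integral_ball_conj_gradient hφ hζ hR, ← integral_add (hbR R hR 1 1) (hbR R hR I I), ← integral_const_mul]
    congr 1; ext z
    rw [mul_assoc (R:ℂ), re_ofReal_mul, re_ofReal_mul, mul_one]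
    simp only [smul_eq_mul]; ring)
  have := tendsto_nhds_unique l5 l3
  rw [← this, one_mul, ← integral_add (hb 1 1) (hb I I)]
  congr 1; ext z
  simp only [reForm_apply, smul_eq_mul]; ring

theorem integrableOn_fun_add {E : Type*} [NormedAddCommGroup E] {f g : ℂ → E} {s : Set ℂ}
    (hf : IntegrableOn f s) (hg : IntegrableOn g s) : IntegrableOn (fun z => f z + g z) s :=
  Integrable.add hf hg

/-- In log |z| - Im G, the first term contributes ∫ ζ - 2π ζ(0), and the second -∫ φ ∂_θ ζ. Adding
2π ζ(0) gives the duality product computed in `hasTangentialPairing_of_lifting`. -/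
theorem isNeumannSolution_log_norm {h : ℂ → ℂ} (hh : MemHHalfCircle h) {φ : ℂ → ℝ} (hφ : MemHHalf φ)
    (hl : ∀ᵐ t ∂arcMeasure, onCircle h t = circleMap 0 1 t * exp (I * onCircle φ t)) :
    IsNeumannSolution h (fun z => Real.log ‖phaseLift φ z‖) := by
  obtain ⟨w1, i1, j1⟩ := hasWeakFDeriv_log_norm_self
  have w2 := hasWeakFDeriv_of_hasFDerivAt Metric.isOpen_ball
    (fun z hz => hasFDerivAt_re_I_mul_herglotz φ hz) (continuousOn_reForm_herglotz φ)
  have i2 : IntegrableOn (fun z => (I * herglotz φ z).re) (Metric.ball 0 1) :=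
    (((memLp_herglotz hφ).integrable one_le_two).const_mul I).re
  have j2 := integrableOn_reForm_herglotz hφ
  have hae : (fun z => Real.log ‖z‖ + (I * herglotz φ z).re) =ᵐ[volume.restrict (Metric.ball 0 1)]
      fun z => Real.log ‖phaseLift φ z‖ := by
    filter_upwards [ae_ball_ne_zero] with z hz using (log_norm_phaseLift φ hz).symm
  refine ⟨fun z => reForm z⁻¹ + reForm (I * deriv (herglotz φ) z), ?_, (Integrable.add i1 i2).congr hae, ?_, ?_⟩
  · exact (w1.add w2).congr_ae hae (ae_of_all _ fun z => rfl)
  · exact integrableOn_fun_add j1 j2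
  · intro ζ hζ
    convert hasTangentialPairing_of_lifting hh hφ hl hζ using 1
    have hb : ∀ {K : ℂ → ℂ →L[ℝ] ℝ}, IntegrableOn K (Metric.ball (0:ℂ) 1) →
        IntegrableOn (fun z => K z 1 * fderiv ℝ ζ z 1 + K z I * fderiv ℝ ζ z I) (Metric.ball (0:ℂ) 1) := by
      intro K hK
      have hdc : ∀ e, Continuous (fun z => fderiv ℝ ζ z e) := fun e =>
        (hζ.continuous_fderiv (by simp)).clm_apply continuous_const
      have : ∀ d e, IntegrableOn (fun z => K z d * fderiv ℝ ζ z e) (Metric.ball (0:ℂ) 1) := fun d e => by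
        obtain ⟨C, hC⟩ := (isCompact_closedBall (0:ℂ) 1).exists_bound_of_continuousOn (hdc e).continuousOn
        refine Integrable.mul_bdd (c := C) (hK.apply_continuousLinearMap d) (hdc e).aestronglyMeasurable ?_
        filter_upwards [ae_restrict_mem measurableSet_ball] with z hz
        exact hC z (Metric.ball_subset_closedBall hz)
      exact (this 1 1).add (this I I)
    have e : ∀ z, (reForm z⁻¹ + reForm (I * deriv (herglotz φ) z)) 1 * fderiv ℝ ζ z 1 +
        (reForm z⁻¹ + reForm (I * deriv (herglotz φ) z)) I * fderiv ℝ ζ z I =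
        (reForm z⁻¹ 1 * fderiv ℝ ζ z 1 + reForm z⁻¹ I * fderiv ℝ ζ z I) +
        (reForm (I * deriv (herglotz φ) z) 1 * fderiv ℝ ζ z 1 +
        reForm (I * deriv (herglotz φ) z) I * fderiv ℝ ζ z I) := fun z => by
      simp only [ContinuousLinearMap.add_apply]; ring
    simp only [e]
    rw [integral_add (hb j1) (hb j2), integral_ball_log_gradient hζ, integral_ball_gradient_herglotz hφ hζ]
    ring

end Neumann

/-! ### Uniqueness for the Neumann problem -/

section NeumannUniqueness

local notation "conj" => starRingEnd ℂ

theorem continuous_fderiv_apply {E : Type} [NormedAddCommGroup E] [NormedSpace ℝ E] {ζ : ℂ → E}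
    (hζ : ContDiff ℝ ∞ ζ) (e : ℂ) : Continuous fun z => fderiv ℝ ζ z e :=
  (hζ.continuous_fderiv (by simp)).clm_apply continuous_const

theorem contDiff_fderiv_apply {E : Type} [NormedAddCommGroup E] [NormedSpace ℝ E] {ζ : ℂ → E}
    (hζ : ContDiff ℝ ∞ ζ) (e : ℂ) : ContDiff ℝ ∞ fun z => fderiv ℝ ζ z e :=
  (hζ.fderiv_right (by simp)).clm_apply contDiff_const

theorem fderiv_fderiv_comm {ζ : ℂ → ℝ} (hζ : ContDiff ℝ ∞ ζ) (d e z : ℂ) :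
    fderiv ℝ (fun z => fderiv ℝ ζ z d) z e = fderiv ℝ (fun z => fderiv ℝ ζ z e) z d := by
  have hz := (((hζ.fderiv_right (m := ∞) (by simp)).differentiable (by simp)) z)
  rw [fderiv_clm_apply hz (differentiableAt_const _), fderiv_clm_apply hz (differentiableAt_const _)]
  have := (hζ.contDiffAt (x := z)).isSymmSndFDerivAt (by simp; exact WithTop.coe_le_coe.2 le_top)
  simpa using this e d

theorem integrable_apply_mul {W : ℂ → ℂ →L[ℝ] ℝ} (hW : IntegrableOn W (Metric.ball 0 1)) (d : ℂ) {k : ℂ → ℝ}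
    (hk : Continuous k) : IntegrableOn (fun z => W z d * k z) (Metric.ball (0:ℂ) 1) := by
  obtain ⟨C, hC⟩ := (isCompact_closedBall (0:ℂ) 1).exists_bound_of_continuousOn hk.continuousOn
  refine Integrable.mul_bdd (c := C) (hW.apply_continuousLinearMap d) hk.aestronglyMeasurable ?_
  filter_upwards [ae_restrict_mem measurableSet_ball] with z hz
  exact hC z (Metric.ball_subset_closedBall hz)

/-- The weak differential is closed. -/
theorem HasWeakFDeriv.integral_curl_eq_zero {Ψ : ℂ → ℝ} {W : ℂ → ℂ →L[ℝ] ℝ}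
    (h : HasWeakFDeriv (Metric.ball 0 1) Ψ W) {η : ℂ → ℝ} (hη : ContDiff ℝ ∞ η) (hc : HasCompactSupport η)
    (ht : tsupport η ⊆ Metric.ball 0 1) :
    ∫ z in Metric.ball (0:ℂ) 1, (W z 1 * fderiv ℝ η z I - W z I * fderiv ℝ η z 1) = 0 := by
  have hs : ∀ e, tsupport (fun z => fderiv ℝ η z e) ⊆ tsupport η := fun e =>
    closure_minimal (fun z hz => by
      by_contra hn
      exact hz (by simp [fderiv_eq_zero_of_notMem_tsupport hn])) (isClosed_tsupport η)
  have hcs : ∀ e, HasCompactSupport (fun z => fderiv ℝ η z e) := fun e =>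
    hc.of_isClosed_subset (isClosed_tsupport _) (hs e)
  have h1 := h.integral_eq_neg (contDiff_fderiv_apply hη I) (hcs I) ((hs I).trans ht) 1
  have h2 := h.integral_eq_neg (contDiff_fderiv_apply hη 1) (hcs 1) ((hs 1).trans ht) I
  have i1 := h.integrable_smul_deriv (contDiff_fderiv_apply hη I) (hcs I) ((hs I).trans ht) 1
  have i2 := h.integrable_smul_deriv (contDiff_fderiv_apply hη 1) (hcs 1) ((hs 1).trans ht) I
  simp only [fderiv_fderiv_comm hη 1 I] at h2
  rw [setIntegral_eq_integral_of_forall_compl_eq_zero fun z hz => by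
    rw [fderiv_eq_zero_of_notMem_tsupport fun h => hz (ht h)]; simp]
  have e : ∀ z, W z 1 * fderiv ℝ η z I - W z I * fderiv ℝ η z 1 =
      fderiv ℝ η z I • W z 1 - fderiv ℝ η z 1 • W z I := fun z => by simp only [smul_eq_mul]; ring
  simp only [e]
  rw [integral_sub i1 i2]
  linarith

theorem exists_bound_deriv_smoothTransition : ∃ M, 0 ≤ M ∧ ∀ t, |deriv Real.smoothTransition t| ≤ M := by
  have hc : Continuous (deriv Real.smoothTransition) :=
    (Real.smoothTransition.contDiff (n := ⊤)).continuous_deriv (by simp)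
  obtain ⟨M, hM⟩ := (isCompact_Icc (a := (0:ℝ)) (b := 1)).exists_bound_of_continuousOn hc.continuousOn
  refine ⟨max M 0, le_max_right _ _, fun t => ?_⟩
  by_cases ht : t ∈ Icc (0:ℝ) 1
  · exact (hM t ht).trans (le_max_left _ _)
  · have : deriv Real.smoothTransition t = 0 := by
      rw [mem_Icc, not_and_or, not_le, not_le] at ht
      rcases ht with ht | ht
      · have : Real.smoothTransition =ᶠ[𝓝 t] fun _ => 0 := by
          filter_upwards [gt_mem_nhds ht] with s hs using Real.smoothTransition.zero_of_nonpos hs.le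
        rw [this.deriv_eq]; simp
      · have : Real.smoothTransition =ᶠ[𝓝 t] fun _ => 1 := by
          filter_upwards [lt_mem_nhds ht] with s hs using Real.smoothTransition.one_of_one_le hs.le
        rw [this.deriv_eq]; simp
    rw [this]; simp

/-- A cutoff function equal to `1` on `1 - |z|² ≥ 2 / k` and to `0` on `1 - |z|² ≤ 1 / k`. -/
noncomputable def radialCutoff (k : ℝ) (z : ℂ) : ℝ := Real.smoothTransition (k * (1 - ‖z‖ ^ 2) - 1)

theorem contDiff_radialCutoff (k : ℝ) : ContDiff ℝ ∞ (radialCutoff k) :=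
  Real.smoothTransition.contDiff.comp
    ((contDiff_const.mul (contDiff_const.sub (contDiff_norm_sq ℝ))).sub contDiff_const)

theorem tsupport_radialCutoff {k : ℝ} (hk : 0 < k) : tsupport (radialCutoff k) ⊆ Metric.ball 0 1 := by
  have : tsupport (radialCutoff k) ⊆ {z | 1 ≤ k * (1 - ‖z‖ ^ 2)} := by
    refine closure_minimal (fun z hz => ?_) (isClosed_le continuous_const (by fun_prop))
    by_contra hn
    exact hz (Real.smoothTransition.zero_of_nonpos (by simp only [mem_setOf_eq, not_le] at hn; linarith))
  refine this.trans fun z hz => ?_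
  rw [mem_ball_zero_iff]
  simp only [mem_setOf_eq] at hz
  by_contra hn
  push Not at hn
  have : 1 - ‖z‖ ^ 2 ≤ 0 := by nlinarith
  nlinarith

/-- The derivative has size k but lives where k (1 - |z|²) ≤ 2, that is, at distance at most 2 / k
from the circle. Multiplied by a function vanishing on the circle it stays bounded uniformly in k,
which is needed because W is merely integrable. -/
theorem norm_fderiv_radialCutoff_le {M : ℝ} (hM0 : 0 ≤ M) (hM : ∀ t, |deriv Real.smoothTransition t| ≤ M) {k : ℝ}
    (hk : 0 < k) {z : ℂ} (hz : z ∈ Metric.ball (0:ℂ) 1) :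
    ‖fderiv ℝ (radialCutoff k) z‖ * (1 - ‖z‖) ≤ 4 * M := by
  have hz1 : ‖z‖ < 1 := by simpa using hz
  by_cases hk2 : 2 < k * (1 - ‖z‖ ^ 2)
  · have : radialCutoff k =ᶠ[𝓝 z] fun _ => 1 := by
      have : ∀ᶠ y : ℂ in 𝓝 z, 2 < k * (1 - ‖y‖ ^ 2) :=
        (show ContinuousAt (fun y : ℂ => k * (1 - ‖y‖ ^ 2)) z by fun_prop).tendsto.eventually_const_lt hk2
      filter_upwards [this] with y hy using Real.smoothTransition.one_of_one_le (by linarith)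
    rw [this.fderiv_eq]
    simp [hM0]
  · push Not at hk2
    have h1 : HasFDerivAt (fun z : ℂ => k * (1 - ‖z‖ ^ 2) - 1) (k • (-((2 : ℕ) • (innerSL ℝ z : ℂ →L[ℝ] ℝ)))) z := by
      have := ((hasStrictFDerivAt_norm_sq z).hasFDerivAt.const_sub 1).const_mul k |>.sub_const 1
      exact this
    have h2 : HasDerivAt Real.smoothTransition (deriv Real.smoothTransition (k * (1 - ‖z‖ ^ 2) - 1))
        (k * (1 - ‖z‖ ^ 2) - 1) :=
      ((Real.smoothTransition.contDiff (n := ⊤)).differentiable (by simp) _).hasDerivAt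
    have h3 := h2.comp_hasFDerivAt z h1
    have h4 : fderiv ℝ (radialCutoff k) z = _ := h3.fderiv
    rw [h4, norm_smul, norm_smul, norm_neg, Real.norm_eq_abs, Real.norm_of_nonneg hk.le]
    have h5 : ‖((2 : ℕ) • innerSL ℝ z : ℂ →L[ℝ] ℝ)‖ ≤ 2 := by
      refine ContinuousLinearMap.opNorm_le_bound _ (by norm_num) fun e => ?_
      rw [ContinuousLinearMap.smul_apply, nsmul_eq_mul, norm_mul]
      have := norm_inner_le_norm (𝕜 := ℝ) z e
      rw [innerSL_apply_apply]
      have h6 : ‖(((2:ℕ):ℝ))‖ = 2 := by simp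
      rw [h6]
      nlinarith [norm_nonneg e, norm_nonneg z]
    have h7 : k * (1 - ‖z‖) ≤ 2 := by nlinarith [norm_nonneg z, mul_pos hk (sub_pos.2 hz1)]
    calc _ ≤ M * (k * 2) * (1 - ‖z‖) := by
          have := sub_pos.2 hz1
          gcongr
          exact hM _
      _ = M * 2 * (k * (1 - ‖z‖)) := by ring
      _ ≤ M * 2 * 2 := by gcongr
      _ = _ := by ring

theorem tendsto_radialCutoff {z : ℂ} (hz : z ∈ Metric.ball (0:ℂ) 1) :
    ∀ᶠ n : ℕ in atTop, radialCutoff (n + 1) =ᶠ[𝓝 z] fun _ => 1 := by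
  have hz1 : ‖z‖ < 1 := by simpa using hz
  have h0 : 0 < 1 - ‖z‖ ^ 2 := by nlinarith [norm_nonneg z]
  filter_upwards [tendsto_natCast_atTop_atTop.eventually_gt_atTop (2 / (1 - ‖z‖ ^ 2))] with n hn
  rw [div_lt_iff₀ h0] at hn
  have : ∀ᶠ y : ℂ in 𝓝 z, 2 < (n + 1) * (1 - ‖y‖ ^ 2) :=
    (show ContinuousAt (fun y : ℂ => ((n : ℝ) + 1) * (1 - ‖y‖ ^ 2)) z by fun_prop).tendsto.eventually_const_lt
      (by linarith)
  filter_upwards [this] with y hy using Real.smoothTransition.one_of_one_le (by linarith)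

/-- The weak differential is closed, up to the boundary. -/
theorem HasWeakFDeriv.integral_curl_eq_zero_of_circle {Ψ : ℂ → ℝ} {W : ℂ → ℂ →L[ℝ] ℝ}
    (h : HasWeakFDeriv (Metric.ball 0 1) Ψ W) (hW : IntegrableOn W (Metric.ball 0 1)) {η : ℂ → ℝ}
    (hη : ContDiff ℝ ∞ η) (h0 : ∀ z : ℂ, ‖z‖ = 1 → η z = 0) :
    ∫ z in Metric.ball (0:ℂ) 1, (W z 1 * fderiv ℝ η z I - W z I * fderiv ℝ η z 1) = 0 := by
  obtain ⟨M, hM0, hM⟩ := exists_bound_deriv_smoothTransition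
  obtain ⟨C1, hC1⟩ := (isCompact_closedBall (0:ℂ) 1).exists_bound_of_continuousOn
    (hη.continuous_fderiv (by simp)).continuousOn
  have hC0 : 0 ≤ C1 := (norm_nonneg _).trans (hC1 0 (by simp))
  -- The mean value inequality along the radius to the nearest point of the circle, where `η`
  -- vanishes.
  have hηle : ∀ z ∈ Metric.ball (0:ℂ) 1, |η z| ≤ C1 * (1 - ‖z‖) := by
    intro z hz
    have hz1 : ‖z‖ < 1 := by simpa using hz
    obtain ⟨y, hy, hyz⟩ : ∃ y : ℂ, ‖y‖ = 1 ∧ ‖z - y‖ = 1 - ‖z‖ := by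
      by_cases hz0 : z = 0
      · exact ⟨1, by simp, by simp [hz0]⟩
      · have hn : (0:ℝ) < ‖z‖ := norm_pos_iff.2 hz0
        refine ⟨((‖z‖⁻¹ : ℝ) : ℂ) * z, by rw [norm_mul, norm_real, norm_inv, norm_norm]; field_simp, ?_⟩
        have : z - ((‖z‖⁻¹ : ℝ) : ℂ) * z = ((1 - ‖z‖⁻¹ : ℝ) : ℂ) * z := by push_cast; ring
        rw [this, norm_mul, norm_real, Real.norm_of_nonpos (by
          have := (one_le_inv₀ hn).2 hz1.le
          linarith)]
        field_simp
        ring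
    have := Convex.norm_image_sub_le_of_norm_fderiv_le (𝕜 := ℝ) (s := Metric.closedBall (0:ℂ) 1) (f := η) (C := C1)
      (fun x _ => (hη.differentiable (by simp)) x) hC1 (convex_closedBall _ _) (x := y) (y := z)
      (by simp [hy]) (by simpa using hz1.le)
    rwa [h0 y hy, sub_zero, hyz] at this
  have hk : ∀ n : ℕ, ContDiff ℝ ∞ (fun z => radialCutoff (n + 1) z * η z) := fun n =>
    (contDiff_radialCutoff _).mul hη
  have hz : ∀ n : ℕ, ∫ z in Metric.ball (0:ℂ) 1, (W z 1 * fderiv ℝ (fun z => radialCutoff (n + 1) z * η z) z I -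
      W z I * fderiv ℝ (fun z => radialCutoff (n + 1) z * η z) z 1) = 0 := fun n => by
    have hs : tsupport (fun z => radialCutoff (n + 1) z * η z) ⊆ tsupport (radialCutoff (n + 1)) :=
      tsupport_mul_subset_left
    have hsb := tsupport_radialCutoff (k := n + 1) (by positivity)
    refine h.integral_curl_eq_zero (hk n) ?_ (hs.trans hsb)
    exact (isCompact_closedBall (0:ℂ) 1).of_isClosed_subset (isClosed_tsupport _)
      ((hs.trans hsb).trans Metric.ball_subset_closedBall)
  have hlim := tendsto_integral_of_dominated_convergence (μ := volume.restrict (Metric.ball (0:ℂ) 1))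
    (F := fun (n : ℕ) z => W z 1 * fderiv ℝ (fun z => radialCutoff (n + 1) z * η z) z I -
      W z I * fderiv ℝ (fun z => radialCutoff (n + 1) z * η z) z 1)
    (f := fun z => W z 1 * fderiv ℝ η z I - W z I * fderiv ℝ η z 1)
    (fun z => 2 * (‖W z‖ * (C1 + C1 * (4 * M)))) (fun n => ?_) ?_ (fun n => ?_) ?_
  · simp only [hz] at hlim
    exact (tendsto_nhds_unique hlim tendsto_const_nhds)
  · exact ((integrable_apply_mul hW 1 (continuous_fderiv_apply (hk n) I)).sub
      (integrable_apply_mul hW I (continuous_fderiv_apply (hk n) 1))).1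
  · exact ((hW.norm).mul_const _).const_mul 2
  · filter_upwards [ae_restrict_mem measurableSet_ball] with z hzb
    have hz1 : ‖z‖ < 1 := by simpa using hzb
    have b1 : ‖fderiv ℝ (fun z => radialCutoff (n + 1) z * η z) z‖ ≤ C1 + C1 * (4 * M) := by
      have hd := ((contDiff_radialCutoff (n + 1)).differentiable (by simp) z).hasFDerivAt.mul
        (hη.differentiable (by simp) z).hasFDerivAt
      have hd' : fderiv ℝ (fun z => radialCutoff (n + 1) z * η z) z = _ := hd.fderiv
      rw [hd']
      refine (norm_add_le _ _).trans (add_le_add ?_ ?_)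
      · rw [norm_smul]
        have h1 : ‖radialCutoff (n + 1) z‖ ≤ 1 := by
          rw [radialCutoff, Real.norm_of_nonneg (Real.smoothTransition.nonneg _)]
          exact Real.smoothTransition.le_one _
        have h2 := hC1 z (Metric.ball_subset_closedBall hzb)
        nlinarith [norm_nonneg (radialCutoff (n + 1) z), norm_nonneg (fderiv ℝ η z)]
      · rw [norm_smul, Real.norm_eq_abs]
        have h3 := norm_fderiv_radialCutoff_le hM0 hM (k := n + 1) (by positivity) hzb
        calc _ ≤ (C1 * (1 - ‖z‖)) * ‖fderiv ℝ (radialCutoff (n + 1)) z‖ := by gcongr; exact hηle z hzb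
          _ = C1 * (‖fderiv ℝ (radialCutoff (n + 1)) z‖ * (1 - ‖z‖)) := by ring
          _ ≤ _ := by gcongr
    have b2 : ∀ d e : ℂ, ‖d‖ = 1 → ‖e‖ = 1 → ‖W z d * fderiv ℝ (fun z => radialCutoff (n + 1) z * η z) z e‖ ≤
        ‖W z‖ * (C1 + C1 * (4 * M)) := fun d e hd he => by
      rw [norm_mul]
      have h1 := (W z).le_opNorm d
      have h2 := (fderiv ℝ (fun z => radialCutoff (n + 1) z * η z) z).le_opNorm e
      rw [hd, mul_one] at h1
      rw [he, mul_one] at h2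
      exact mul_le_mul h1 (h2.trans b1) (norm_nonneg _) (norm_nonneg _)
    refine (norm_sub_le _ _).trans ?_
    have := b2 1 I (by simp) (by simp)
    have := b2 I 1 (by simp) (by simp)
    linarith
  · filter_upwards [ae_restrict_mem measurableSet_ball] with z hzb
    refine tendsto_const_nhds.congr' ?_
    filter_upwards [tendsto_radialCutoff hzb] with n hn
    have : (fun z => radialCutoff (n + 1) z * η z) =ᶠ[𝓝 z] η := by
      filter_upwards [hn] with y hy
      rw [hy, one_mul]
    rw [this.fderiv_eq]

end NeumannUniqueness

/-! ### Vanishing of the complex gradient by testing with Cauchy kernels -/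

section NeumannUniqueness

local notation "conj" => starRingEnd ℂ

section Field

variable {Ψ : ℂ → ℝ} {W : ℂ → ℂ →L[ℝ] ℝ}

/-- The complex form `∂_x Ψ - i ∂_y Ψ` of a differential. -/
noncomputable def complexGradient (W : ℂ → ℂ →L[ℝ] ℝ) (z : ℂ) : ℂ := W z 1 - I * W z I

theorem integrableOn_complexGradient (hW : IntegrableOn W (Metric.ball 0 1)) :
    IntegrableOn (complexGradient W) (Metric.ball 0 1) :=
  Integrable.fun_sub' (hW.apply_continuousLinearMap 1).ofReal
    ((hW.apply_continuousLinearMap I).ofReal.const_mul I)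

theorem fderiv_re_im {η : ℂ → ℂ} (hη : ContDiff ℝ ∞ η) (z e : ℂ) :
    fderiv ℝ (fun z => (η z).re) z e = (fderiv ℝ η z e).re ∧
    fderiv ℝ (fun z => (η z).im) z e = (fderiv ℝ η z e).im := by
  have h := (hη.differentiable (by simp) z).hasFDerivAt
  have h1 := (reCLM.hasFDerivAt (x := η z)).comp z h
  have h2 := (imCLM.hasFDerivAt (x := η z)).comp z h
  have e1 : fderiv ℝ (fun z => (η z).re) z = _ := h1.fderiv
  have e2 : fderiv ℝ (fun z => (η z).im) z = _ := h2.fderiv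
  rw [e1, e2]; exact ⟨rfl, rfl⟩

/-- The factor with η is 2 ∂η/∂z̄. The product expands into gradient and curl pairings of W with Re
η and Im η. The gradient pairings vanish for every smooth function, the curl pairings because η is
zero on the circle. -/
theorem integral_complexGradient_eq_zero_of_circle (h : HasWeakFDeriv (Metric.ball 0 1) Ψ W)
    (hW : IntegrableOn W (Metric.ball 0 1))
    (h0 : ∀ ζ : ℂ → ℝ, ContDiff ℝ ∞ ζ →
      ∫ z in Metric.ball 0 1, (W z 1 * fderiv ℝ ζ z 1 + W z I * fderiv ℝ ζ z I) = 0)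
    {η : ℂ → ℂ} (hη : ContDiff ℝ ∞ η) (hc : ∀ z : ℂ, ‖z‖ = 1 → η z = 0) :
    ∫ z in Metric.ball 0 1, complexGradient W z * (fderiv ℝ η z 1 + I * fderiv ℝ η z I) = 0 := by
  have ha : ContDiff ℝ ∞ fun z => (η z).re := reCLM.contDiff.comp hη
  have hb : ContDiff ℝ ∞ fun z => (η z).im := imCLM.contDiff.comp hη
  have A0 := h0 _ ha
  have B0 := h0 _ hb
  have A1 := h.integral_curl_eq_zero_of_circle hW ha fun z hz => by rw [hc z hz]; rfl
  have B1 := h.integral_curl_eq_zero_of_circle hW hb fun z hz => by rw [hc z hz]; rfl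
  have i : ∀ {k : ℂ → ℝ}, ContDiff ℝ ∞ k → ∀ d e : ℂ,
      IntegrableOn (fun z => W z d * fderiv ℝ k z e) (Metric.ball (0:ℂ) 1) := fun hk d e =>
    integrable_apply_mul hW d (continuous_fderiv_apply hk e)
  have iA0 := (i ha 1 1).fun_add (i ha I I)
  have iB0 := (i hb 1 1).fun_add (i hb I I)
  have iA1 := Integrable.fun_sub' (i ha 1 I) (i ha I 1)
  have iB1 := Integrable.fun_sub' (i hb 1 I) (i hb I 1)
  have e : ∀ z, complexGradient W z * (fderiv ℝ η z 1 + I * fderiv ℝ η z I) =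
      (((W z 1 * fderiv ℝ (fun z => (η z).re) z 1 + W z I * fderiv ℝ (fun z => (η z).re) z I : ℝ) : ℂ) -
      ((W z 1 * fderiv ℝ (fun z => (η z).im) z I - W z I * fderiv ℝ (fun z => (η z).im) z 1 : ℝ) : ℂ)) +
      I * (((W z 1 * fderiv ℝ (fun z => (η z).im) z 1 + W z I * fderiv ℝ (fun z => (η z).im) z I : ℝ) : ℂ) +
      ((W z 1 * fderiv ℝ (fun z => (η z).re) z I - W z I * fderiv ℝ (fun z => (η z).re) z 1 : ℝ) : ℂ)) := by
    intro z
    simp only [(fderiv_re_im hη z _).1, (fderiv_re_im hη z _).2, complexGradient]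
    apply Complex.ext <;> simp <;> ring
  simp only [e]
  rw [integral_add, integral_sub iA0.ofReal iB1.ofReal, integral_const_mul, integral_add iB0.ofReal iA1.ofReal]
  · simp only [integral_complex_ofReal, A0, A1, B0, B1]; simp
  · exact Integrable.fun_sub' iA0.ofReal iB1.ofReal
  · exact (Integrable.add iB0.ofReal iA1.ofReal).const_mul I

/-- For antiholomorphic η the integrand is 2 (W_x ∂_x η + W_y ∂_y η): only gradient pairings occur,
so no boundary condition is needed. -/
theorem integral_complexGradient_eq_zero_of_antiholomorphic (hW : IntegrableOn W (Metric.ball 0 1))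
    (h0 : ∀ ζ : ℂ → ℝ, ContDiff ℝ ∞ ζ →
      ∫ z in Metric.ball 0 1, (W z 1 * fderiv ℝ ζ z 1 + W z I * fderiv ℝ ζ z I) = 0)
    {η : ℂ → ℂ} (hη : ContDiff ℝ ∞ η)
    (hc : ∀ z ∈ Metric.ball (0:ℂ) 1, fderiv ℝ η z I = -I * fderiv ℝ η z 1) :
    ∫ z in Metric.ball 0 1, complexGradient W z * (fderiv ℝ η z 1 + I * fderiv ℝ η z I) = 0 := by
  have ha : ContDiff ℝ ∞ fun z => (η z).re := reCLM.contDiff.comp hη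
  have hb : ContDiff ℝ ∞ fun z => (η z).im := imCLM.contDiff.comp hη
  have A0 := h0 _ ha
  have B0 := h0 _ hb
  have i : ∀ {k : ℂ → ℝ}, ContDiff ℝ ∞ k → ∀ d e : ℂ,
      IntegrableOn (fun z => W z d * fderiv ℝ k z e) (Metric.ball (0:ℂ) 1) := fun hk d e =>
    integrable_apply_mul hW d (continuous_fderiv_apply hk e)
  have iA0 := (i ha 1 1).fun_add (i ha I I)
  have iB0 := (i hb 1 1).fun_add (i hb I I)
  have cc : ∀ {f : ℂ → ℝ}, IntegrableOn f (Metric.ball 0 1) →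
    IntegrableOn (fun z => (f z : ℂ)) (Metric.ball 0 1) := fun h => h.ofReal
  have e : ∀ z ∈ Metric.ball (0:ℂ) 1, complexGradient W z * (fderiv ℝ η z 1 + I * fderiv ℝ η z I) =
      2 * (((W z 1 * fderiv ℝ (fun z => (η z).re) z 1 + W z I * fderiv ℝ (fun z => (η z).re) z I : ℝ) : ℂ) +
      I * ((W z 1 * fderiv ℝ (fun z => (η z).im) z 1 + W z I * fderiv ℝ (fun z => (η z).im) z I : ℝ) : ℂ)) := by
    intro z hz
    simp only [(fderiv_re_im hη z _).1, (fderiv_re_im hη z _).2, complexGradient, hc z hz]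
    apply Complex.ext <;> simp <;> ring
  rw [setIntegral_congr_fun measurableSet_ball e, integral_const_mul,
    integral_add (cc iA0) ((cc iB0).const_mul I), integral_const_mul]
  simp only [integral_complex_ofReal, A0, B0]; simp

end Field

/-- A smooth function on the plane equal to `z̄ / (1 - z₀ z̄)` on the closed disk. -/
theorem exists_antiholomorphic_kernel {z₀ : ℂ} (hz₀ : ‖z₀‖ < 1) : ∃ η : ℂ → ℂ, ContDiff ℝ ∞ η ∧
    (∀ z ∈ Metric.closedBall (0:ℂ) 1, η z = conj z / (1 - z₀ * conj z)) ∧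
    ∀ z ∈ Metric.ball (0:ℂ) 1, fderiv ℝ η z I = -I * fderiv ℝ η z 1 := by
  -- This radius satisfies R > 1 and R |z₀| < 1: the cutoff is 1 on the closed disk and vanishes
  -- before the zeros of the denominator are reached.
  set R : ℝ := 2 / (1 + ‖z₀‖)
  have h1R : 1 < R := by rw [lt_div_iff₀ (by positivity)]; linarith
  have hRz : R * ‖z₀‖ < 1 := by
    rw [div_mul_eq_mul_div, div_lt_one (by positivity)]; linarith
  let κ : ContDiffBump (0:ℂ) := ⟨1, R, one_pos, h1R⟩
  have hne : ∀ z : ℂ, ‖z‖ ≤ R → 1 - z₀ * conj z ≠ 0 := by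
    intro z hz h
    have : ‖z₀ * conj z‖ = 1 := by rw [← sub_eq_zero.1 h]; simp
    rw [norm_mul, RCLike.norm_conj] at this
    nlinarith [norm_nonneg z₀]
  have hval : ∀ z ∈ Metric.closedBall (0:ℂ) 1, κ z = 1 := fun z hz => κ.one_of_mem_closedBall hz
  refine ⟨fun z => κ z • (conj z / (1 - z₀ * conj z)), ?_, fun z hz => ?_, fun z hz => ?_⟩
  · rw [contDiff_iff_contDiffAt]
    intro z
    rcases le_or_gt ‖z‖ R with hz | hz
    · have hcj : ContDiff ℝ ∞ fun z : ℂ => conj z := (conjCLE : ℂ →L[ℝ] ℂ).contDiff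
      simp only [div_eq_mul_inv]
      exact κ.contDiff.contDiffAt.smul (hcj.contDiffAt.mul
        ((contDiff_const.sub (contDiff_const.mul hcj)).contDiffAt.inv (hne z hz)))
    · have : (fun z => κ z • (conj z / (1 - z₀ * conj z))) =ᶠ[𝓝 z] fun _ => 0 := by
        filter_upwards [continuous_norm.continuousAt.eventually (lt_mem_nhds hz)] with y hy
        rw [κ.zero_of_le_dist (by simpa using hy.le), zero_smul]
      exact contDiffAt_const.congr_of_eventuallyEq this
  · simp only [hval z hz, one_smul]
  · have hz1 : ‖z‖ < 1 := by simpa using hz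
    have he : (fun z => κ z • (conj z / (1 - z₀ * conj z))) =ᶠ[𝓝 z] (fun w => w / (1 - z₀ * w)) ∘ conj := by
      filter_upwards [Metric.isOpen_ball.mem_nhds hz] with y hy
      simp only [hval y (Metric.ball_subset_closedBall hy), one_smul, Function.comp_apply]
    have hd : DifferentiableAt ℂ (fun w => w / (1 - z₀ * w)) (conj z) :=
      DifferentiableAt.fun_div (by fun_prop) (by fun_prop) (hne z (hz1.trans h1R).le)
    have h2 := hd.hasDerivAt.hasFDerivAt.restrictScalars ℝ
    have h3 := h2.comp z ((conjCLE : ℂ →L[ℝ] ℂ).hasFDerivAt (x := z))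
    rw [he.fderiv_eq]
    have h4 : fderiv ℝ ((fun w => w / (1 - z₀ * w)) ∘ conj) z = _ := h3.fderiv
    rw [h4]
    simp

/-- A smooth radial kernel whose `∂_z̄` derivative is `β(|w|²)`. -/
theorem exists_smooth_cauchy_kernel {β : ℝ → ℝ} (hβ : ContDiff ℝ ∞ β) {δ ρ : ℝ} (hδ : 0 < δ)
    (hβ1 : ∀ t, t < δ → β t = 1) (hβ0 : ∀ t, ρ ≤ t → β t = 0) :
    ∃ (c : ℝ) (η : ℂ → ℂ), ContDiff ℝ ∞ η ∧ (∀ w : ℂ, ρ ≤ ‖w‖ ^ 2 → η w = c / w) ∧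
      ∀ w : ℂ, w ≠ 0 → fderiv ℝ η w 1 + I * fderiv ℝ η w I = 2 * (β (‖w‖ ^ 2) : ℂ) := by
  -- The kernel is χ(|w|²) / w with χ' = β. As ∂|w|²/∂z̄ = w, its ∂/∂z̄ is β(|w|²). Near 0 one has
  -- χ(t) = t, so the kernel is w̄, which is smooth; for |w|² ≥ ρ it is a multiple of the Cauchy
  -- kernel.
  set χ : ℝ → ℝ := fun t => ∫ s in (0:ℝ)..t, β s
  have hχd : ∀ t, HasDerivAt χ (β t) t := fun t =>
    intervalIntegral.integral_hasDerivAt_right (hβ.continuous.intervalIntegrable _ _)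
      (hβ.continuous.stronglyMeasurableAtFilter _ _) hβ.continuous.continuousAt
  have hχ : ContDiff ℝ ∞ χ := by
    rw [contDiff_infty_iff_deriv]
    refine ⟨fun t => (hχd t).differentiableAt, ?_⟩
    rw [show deriv χ = β from funext fun t => (hχd t).deriv]
    exact hβ
  have hχ1 : ∀ t, t < δ → χ t = t := by
    intro t ht
    have : χ t = ∫ s in (0:ℝ)..t, (1:ℝ) := by
      refine intervalIntegral.integral_congr fun s hs => hβ1 s ?_
      have := hs.2
      exact this.trans_lt (max_lt hδ ht)
    rw [this]; simp
  have hχ0 : ∀ t, ρ ≤ t → χ t = χ ρ := by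
    intro t ht
    have := intervalIntegral.integral_interval_sub_left (hβ.continuous.intervalIntegrable 0 t)
      (hβ.continuous.intervalIntegrable (μ := volume) 0 ρ)
    have h2 : ∫ s in ρ..t, β s = 0 := by
      rw [intervalIntegral.integral_congr (g := fun _ => (0:ℝ)) fun s hs => hβ0 s ?_]
      · simp
      · rw [uIcc_of_le ht] at hs; exact hs.1
    rw [h2] at this
    exact sub_eq_zero.1 this
  refine ⟨χ ρ, fun w => χ (‖w‖ ^ 2) / w, ?_, fun w hw => by simp only [hχ0 _ hw], fun w hw => ?_⟩
  · rw [contDiff_iff_contDiffAt]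
    intro w
    by_cases hw : w = 0
    · subst hw
      have : (fun w : ℂ => ((χ (‖w‖ ^ 2) : ℝ) : ℂ) / w) =ᶠ[𝓝 0] fun w => conj w := by
        have h1 : ∀ᶠ w : ℂ in 𝓝 0, ‖w‖ ^ 2 < δ :=
          (show ContinuousAt (fun w : ℂ => ‖w‖ ^ 2) 0 by fun_prop).tendsto.eventually_lt_const (by simpa)
        filter_upwards [h1] with w hw
        rw [hχ1 _ hw]
        by_cases h0 : w = 0
        · simp [h0]
        · rw [← normSq_eq_norm_sq, ← mul_conj, mul_div_cancel_left₀ _ h0]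
      exact ((conjCLE : ℂ →L[ℝ] ℂ).contDiff.contDiffAt).congr_of_eventuallyEq this
    · have h1 : ContDiffAt ℝ ∞ (fun w : ℂ => ((χ (‖w‖ ^ 2) : ℝ) : ℂ)) w :=
        (ofRealCLM.contDiff.comp (hχ.comp (contDiff_norm_sq ℝ))).contDiffAt
      simp only [div_eq_mul_inv]
      exact h1.mul (contDiffAt_id.inv hw)
  · have h1 := (hχd (‖w‖ ^ 2)).comp_hasFDerivAt w (hasStrictFDerivAt_norm_sq w).hasFDerivAt
    have h2 := ofRealCLM.hasFDerivAt.comp w h1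
    have h3 := ((hasDerivAt_inv hw).hasFDerivAt.restrictScalars ℝ)
    have h4 := h2.mul h3
    have h5 : fderiv ℝ (fun w : ℂ => ((χ (‖w‖ ^ 2) : ℝ) : ℂ) / w) w = _ := h4.fderiv
    rw [h5]
    simp [Complex.inner]
    have e : (w.re : ℂ) + I * w.im = w := by rw [mul_comm]; exact re_add_im w
    linear_combination (-((χ (‖w‖ ^ 2) : ℂ) * (w ^ 2)⁻¹)) * I_sq + 2 * w⁻¹ * (β (‖w‖ ^ 2) : ℂ) * e +
      2 * (β (‖w‖ ^ 2) : ℂ) * inv_mul_cancel₀ hw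

/-- On the unit circle c / (z - z₀) = c z̄ / (1 - z₀ z̄). The regularized Cauchy kernel at z₀ minus
this antiholomorphic function vanishes on the circle and is an admissible test; the antiholomorphic
function is admissible as well. Adding the two identities leaves the integral of the complex
gradient against β(|z - z₀|²), and β tends to the indicator of the disk. -/
theorem integral_ball_complexGradient_eq_zero {Ψ : ℂ → ℝ} {W : ℂ → ℂ →L[ℝ] ℝ}
    (h : HasWeakFDeriv (Metric.ball 0 1) Ψ W) (hW : IntegrableOn W (Metric.ball 0 1))
    (h0 : ∀ ζ : ℂ → ℝ, ContDiff ℝ ∞ ζ →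
      ∫ z in Metric.ball 0 1, (W z 1 * fderiv ℝ ζ z 1 + W z I * fderiv ℝ ζ z I) = 0)
    {z₀ : ℂ} {r : ℝ} (hr : 0 < r) (hz₀ : ‖z₀‖ + r < 1) : ∫ z in Metric.ball z₀ r, complexGradient W z = 0 := by
  have hz1 : ‖z₀‖ < 1 := by linarith
  have hP := integrableOn_complexGradient hW
  obtain ⟨η₂, h2s, h2v, h2d⟩ := exists_antiholomorphic_kernel hz1
  -- The factor n + 2 makes the argument at least 1 for t < r² / 2 already when n = 0, so that every
  -- kernel is smooth at its centre.
  set β : ℕ → ℝ → ℝ := fun n t => Real.smoothTransition ((n + 2) * (1 - t / r ^ 2)) with hβ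
  have hβs : ∀ n, ContDiff ℝ ∞ (β n) := fun n =>
    Real.smoothTransition.contDiff.comp (contDiff_const.mul (contDiff_const.sub (contDiff_id.div_const _)))
  have hβ1 : ∀ n, ∀ t, t < r ^ 2 / 2 → β n t = 1 := fun n t ht => by
    refine Real.smoothTransition.one_of_one_le ?_
    have : t / r ^ 2 < 1 / 2 := by rw [div_lt_iff₀ (by positivity)]; linarith
    have hn : (0:ℝ) ≤ n := by positivity
    nlinarith
  have hβ0 : ∀ n, ∀ t, r ^ 2 ≤ t → β n t = 0 := fun n t ht => by
    refine Real.smoothTransition.zero_of_nonpos ?_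
    have : 1 ≤ t / r ^ 2 := by rw [le_div_iff₀ (by positivity)]; linarith
    have hn : (0:ℝ) ≤ n := by positivity
    nlinarith
  have key : ∀ n, ∫ z in Metric.ball (0:ℂ) 1, complexGradient W z * (β n (‖z - z₀‖ ^ 2) : ℂ) = 0 := by
    intro n
    obtain ⟨c, η₁, h1s, h1v, h1d⟩ := exists_smooth_cauchy_kernel (hβs n) (by positivity : 0 < r ^ 2 / 2) (hβ1 n) (hβ0 n)
    have hηs : ContDiff ℝ ∞ (fun z => η₁ (z - z₀)) := h1s.comp (contDiff_id.sub contDiff_const)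
    have hcs : ContDiff ℝ ∞ (fun z => (c : ℂ) * η₂ z) := contDiff_const.mul h2s
    have t1 := integral_complexGradient_eq_zero_of_circle h hW h0 (hηs.sub hcs) (fun z hz => by
      have hne : r < ‖z - z₀‖ := by
        have := norm_sub_norm_le z z₀
        linarith
      have hzz : z * conj z = 1 := by rw [mul_conj, normSq_eq_norm_sq, hz]; simp
      have hz0 : z - z₀ ≠ 0 := norm_pos_iff.1 (hr.trans hne)
      have hz0' : z ≠ 0 := norm_pos_iff.1 (by rw [hz]; exact one_pos)
      have h3 : 1 - z₀ * conj z ≠ 0 := by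
        have : z * (1 - z₀ * conj z) = z - z₀ := by linear_combination -z₀ * hzz
        intro h; rw [h, mul_zero] at this; exact hz0 this.symm
      rw [h1v _ (by nlinarith), h2v z (by simp [hz])]
      field_simp
      linear_combination (-(c : ℂ)) * hzz)
    have t2 := integral_complexGradient_eq_zero_of_antiholomorphic hW h0 hcs (fun z hz => by
      have e : fderiv ℝ (fun z => (c : ℂ) * η₂ z) z = (c : ℂ) • fderiv ℝ η₂ z :=
        ((h2s.differentiable (by simp) z).hasFDerivAt.const_mul (c:ℂ)).fderiv
      rw [e, ContinuousLinearMap.smul_apply, ContinuousLinearMap.smul_apply, h2d z hz]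
      simp only [smul_eq_mul]; ring)
    have bd : ∀ {k : ℂ → ℂ}, Continuous k → IntegrableOn (fun z => complexGradient W z * k z) (Metric.ball (0:ℂ) 1) := by
      intro k hk
      obtain ⟨C, hC⟩ := (isCompact_closedBall (0:ℂ) 1).exists_bound_of_continuousOn hk.continuousOn
      refine Integrable.mul_bdd (c := C) hP hk.aestronglyMeasurable ?_
      filter_upwards [ae_restrict_mem measurableSet_ball] with z hz
      exact hC z (Metric.ball_subset_closedBall hz)
    have bd' : ∀ {k : ℂ → ℂ}, ContDiff ℝ ∞ k → IntegrableOn (fun z => complexGradient W z *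
        (fderiv ℝ k z 1 + I * fderiv ℝ k z I)) (Metric.ball (0:ℂ) 1) := fun hk =>
      bd ((continuous_fderiv_apply hk 1).add (continuous_const.mul (continuous_fderiv_apply hk I)))
    have t3 := integral_add (bd' (hηs.sub hcs)) (bd' hcs)
    rw [t1, t2, add_zero] at t3
    have e : ∀ᵐ z ∂(volume.restrict (Metric.ball (0:ℂ) 1)), complexGradient W z *
        (fderiv ℝ (fun x => η₁ (x - z₀) - (c : ℂ) * η₂ x) z 1 +
        I * fderiv ℝ (fun x => η₁ (x - z₀) - (c : ℂ) * η₂ x) z I) +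
        complexGradient W z * (fderiv ℝ (fun z => (c : ℂ) * η₂ z) z 1 + I * fderiv ℝ (fun z => (c : ℂ) * η₂ z) z I) =
        2 * (complexGradient W z * (β n (‖z - z₀‖ ^ 2) : ℂ)) := by
      have hne : ∀ᵐ z ∂(volume.restrict (Metric.ball (0:ℂ) 1)), z ≠ z₀ :=
        ae_restrict_of_ae (compl_mem_ae_iff.2 (measure_singleton z₀))
      filter_upwards [hne] with z hz
      have e1 : fderiv ℝ (fun x => η₁ (x - z₀) - (c : ℂ) * η₂ x) z =
          fderiv ℝ (fun z => η₁ (z - z₀)) z - fderiv ℝ (fun z => (c : ℂ) * η₂ z) z :=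
        fderiv_fun_sub (hηs.differentiable (by simp) z) (hcs.differentiable (by simp) z)
      have e2 : fderiv ℝ (fun z => η₁ (z - z₀)) z = fderiv ℝ η₁ (z - z₀) := fderiv_comp_sub z₀
      have e3 := h1d (z - z₀) (sub_ne_zero.2 hz)
      rw [e1, e2]
      simp only [ContinuousLinearMap.sub_apply]
      linear_combination complexGradient W z * e3
    rw [integral_congr_ae e, integral_const_mul] at t3
    exact (mul_eq_zero.1 t3).resolve_left two_ne_zero
  have hlim := tendsto_integral_of_dominated_convergence (μ := volume.restrict (Metric.ball (0:ℂ) 1))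
    (F := fun (n : ℕ) z => complexGradient W z * (β n (‖z - z₀‖ ^ 2) : ℂ))
    (f := (Metric.ball z₀ r).indicator (complexGradient W)) (fun z => ‖complexGradient W z‖)
    (fun n => ?_) hP.norm (fun n => ae_of_all _ fun z => ?_) (ae_of_all _ fun z => ?_)
  · simp only [key] at hlim
    have hsub : Metric.ball z₀ r ⊆ Metric.ball 0 1 := Metric.ball_subset_ball' (by rw [dist_zero_right]; linarith)
    rw [setIntegral_indicator measurableSet_ball, inter_eq_right.2 hsub] at hlim
    exact tendsto_nhds_unique hlim tendsto_const_nhds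
  · exact hP.1.mul (Continuous.aestronglyMeasurable (by have := (hβs n).continuous; fun_prop))
  · rw [norm_mul, norm_real, Real.norm_of_nonneg (Real.smoothTransition.nonneg _)]
    exact mul_le_of_le_one_right (norm_nonneg _) (Real.smoothTransition.le_one _)
  · refine tendsto_const_nhds.congr' ?_
    by_cases hz : z ∈ Metric.ball z₀ r
    · rw [indicator_of_mem hz]
      rw [mem_ball_iff_norm] at hz
      have h1 : 0 < 1 - ‖z - z₀‖ ^ 2 / r ^ 2 := by
        rw [sub_pos, div_lt_one (by positivity)]
        exact pow_lt_pow_left₀ hz (norm_nonneg _) two_ne_zero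
      filter_upwards [tendsto_natCast_atTop_atTop.eventually_gt_atTop (1 / (1 - ‖z - z₀‖ ^ 2 / r ^ 2))] with n hn
      rw [div_lt_iff₀ h1] at hn
      have : β n (‖z - z₀‖ ^ 2) = 1 := Real.smoothTransition.one_of_one_le (by linarith)
      rw [this]; simp
    · rw [indicator_of_notMem hz]
      rw [mem_ball_iff_norm, not_lt] at hz
      refine Eventually.of_forall fun n => ?_
      simp only [hβ0 n _ (pow_le_pow_left₀ hr.le hz 2)]; simp

theorem closedBall_ae_eq_ball (x : ℂ) {r : ℝ} (hr : r ≠ 0) : Metric.closedBall x r =ᵐ[volume] Metric.ball x r := by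
  refine ((Metric.ball_subset_closedBall).eventuallyLE.antisymm ?_).symm
  rw [ae_le_set, Metric.closedBall_diff_ball]
  exact Measure.addHaar_sphere_of_ne_zero _ _ hr

/-- Lebesgue differentiation. It is available for closed balls, which differ from open ones by null
sets. -/
theorem ae_eq_zero_of_integral_ball {P : ℂ → ℂ} (hP : IntegrableOn P (Metric.ball 0 1))
    (h : ∀ (z₀ : ℂ) (r : ℝ), 0 < r → ‖z₀‖ + r < 1 → ∫ z in Metric.ball z₀ r, P z = 0) :
    ∀ᵐ z ∂(volume.restrict (Metric.ball (0:ℂ) 1)), P z = 0 := by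
  have hf : Integrable ((Metric.ball (0:ℂ) 1).indicator P) := (integrable_indicator_iff measurableSet_ball).2 hP
  have hL := IsUnifLocDoublingMeasure.ae_tendsto_average volume hf.locallyIntegrable 1
  rw [ae_restrict_iff' measurableSet_ball]
  filter_upwards [hL] with x hx hxb
  have hx1 : ‖x‖ < 1 := by simpa using hxb
  have hδ : Tendsto (fun n : ℕ => 1 / ((n : ℝ) + 1)) atTop (𝓝[>] 0) := by
    refine tendsto_nhdsWithin_iff.2 ⟨tendsto_one_div_add_atTop_nhds_zero_nat, Eventually.of_forall fun n => ?_⟩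
    exact mem_Ioi.2 (by positivity)
  have hx2 := hx (fun _ => x) (fun n : ℕ => 1 / ((n : ℝ) + 1)) hδ
    (Eventually.of_forall fun n => by simp only [one_mul]; exact Metric.mem_closedBall_self (by positivity))
  rw [indicator_of_mem hxb] at hx2
  refine tendsto_nhds_unique hx2 (tendsto_const_nhds.congr' ?_)
  have : ∀ᶠ n : ℕ in atTop, 1 / ((n : ℝ) + 1) < 1 - ‖x‖ :=
    tendsto_one_div_add_atTop_nhds_zero_nat.eventually_lt_const (sub_pos.2 hx1)
  filter_upwards [this] with n hn
  have hn0 : (0:ℝ) < 1 / ((n : ℝ) + 1) := by positivity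
  have h1 := h x _ hn0 (by linarith)
  have hsub : Metric.ball x (1 / ((n : ℝ) + 1)) ⊆ Metric.ball 0 1 :=
    Metric.ball_subset_ball' (by rw [dist_zero_right]; linarith)
  rw [setAverage_eq, setIntegral_congr_set (closedBall_ae_eq_ball x hn0.ne'),
    setIntegral_indicator measurableSet_ball, inter_eq_left.2 hsub, h1, smul_zero]

/-- Both solutions have the same right-hand side and the same term 2π ζ(0), so the difference of the
gradients is orthogonal to all gradients; its complex gradient then vanishes. -/
theorem IsNeumannSolution.ae_eq_add_const {h : ℂ → ℂ} {Φ₁ Φ₂ : ℂ → ℝ} (h₁ : IsNeumannSolution h Φ₁)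
    (h₂ : IsNeumannSolution h Φ₂) :
    ∃ c : ℝ, ∀ᵐ z ∂(volume.restrict (Metric.ball 0 1)), Φ₁ z = Φ₂ z + c := by
  obtain ⟨D₁, w₁, -, i₁, p₁⟩ := h₁
  obtain ⟨D₂, w₂, -, i₂, p₂⟩ := h₂
  set W : ℂ → ℂ →L[ℝ] ℝ := fun z => D₁ z + (-ContinuousLinearMap.id ℝ ℝ) ∘L D₂ z
  have hWz : ∀ z e, W z e = D₁ z e - D₂ z e := fun z e => by simp [W, sub_eq_add_neg]
  have hw : HasWeakFDeriv (Metric.ball 0 1) (fun z => Φ₁ z + (-ContinuousLinearMap.id ℝ ℝ) (Φ₂ z)) W :=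
    w₁.add (w₂.clm_comp _)
  have hWi : IntegrableOn W (Metric.ball 0 1) := by
    have : W = fun z => D₁ z - D₂ z := by
      ext z e; simp [W, sub_eq_add_neg]
    rw [this]
    exact Integrable.fun_sub' i₁ i₂
  have h0 : ∀ ζ : ℂ → ℝ, ContDiff ℝ ∞ ζ →
      ∫ z in Metric.ball 0 1, (W z 1 * fderiv ℝ ζ z 1 + W z I * fderiv ℝ ζ z I) = 0 := by
    intro ζ hζ
    have := HasSum.unique (p₁ ζ hζ) (p₂ ζ hζ)
    have hi : ∀ {D : ℂ → ℂ →L[ℝ] ℝ}, IntegrableOn D (Metric.ball 0 1) →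
        IntegrableOn (fun z => D z 1 * fderiv ℝ ζ z 1 + D z I * fderiv ℝ ζ z I) (Metric.ball 0 1) := fun hD =>
      integrableOn_fun_add (integrable_apply_mul hD 1 (continuous_fderiv_apply hζ 1))
        (integrable_apply_mul hD I (continuous_fderiv_apply hζ I))
    have e : ∀ z, W z 1 * fderiv ℝ ζ z 1 + W z I * fderiv ℝ ζ z I =
        (D₁ z 1 * fderiv ℝ ζ z 1 + D₁ z I * fderiv ℝ ζ z I) -
        (D₂ z 1 * fderiv ℝ ζ z 1 + D₂ z I * fderiv ℝ ζ z I) := fun z => by rw [hWz, hWz]; ring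
    simp only [e]
    rw [integral_sub (hi i₁) (hi i₂)]
    linarith
  have hP := ae_eq_zero_of_integral_ball (integrableOn_complexGradient hWi) fun z₀ r hr hz =>
    integral_ball_complexGradient_eq_zero hw hWi h0 hr hz
  have hW0 : W =ᵐ[volume.restrict (Metric.ball 0 1)] fun _ => 0 := by
    filter_upwards [hP] with z hz
    have h1 := congrArg Complex.re hz
    have h2 := congrArg Complex.im hz
    simp [complexGradient] at h1 h2
    exact realCLM_ext (by simpa using h1) (by simpa using h2)
  obtain ⟨c, hc⟩ := hw.ae_const Metric.isOpen_ball (convex_ball (0:ℂ) 1).isPreconnected hW0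
  refine ⟨c, ?_⟩
  filter_upwards [hc] with z hz
  simp at hz
  linarith

end NeumannUniqueness

/-! ### Uniformizations -/

section Uniformization

variable {f f₁ f₂ : ℂ → ℂ} {Ω : Set ℂ} {z w : ℂ}

theorem ball_mem_nhds_of_mem (hz : z ∈ Metric.ball (0:ℂ) 1) : Metric.ball (0:ℂ) 1 ∈ 𝓝 z :=
  Metric.isOpen_ball.mem_nhds hz

namespace IsUniformization

theorem analyticAt (hf : IsUniformization f Ω) (hz : z ∈ Metric.ball (0:ℂ) 1) : AnalyticAt ℂ f z :=
  hf.holo.analyticAt (ball_mem_nhds_of_mem hz)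

theorem inv_mem (hf : IsUniformization f Ω) (hw : w ∈ Ω) : uniformizationInv f w ∈ Metric.ball (0:ℂ) 1 :=
  Function.invFunOn_mem (hf.bij.surjOn hw)

theorem apply_inv (hf : IsUniformization f Ω) (hw : w ∈ Ω) : f (uniformizationInv f w) = w :=
  Function.invFunOn_eq (hf.bij.surjOn hw)

theorem inv_apply (hf : IsUniformization f Ω) (hz : z ∈ Metric.ball (0:ℂ) 1) :
    uniformizationInv f (f z) = z :=
  hf.bij.injOn (hf.inv_mem (hf.bij.mapsTo hz)) hz (hf.apply_inv (hf.bij.mapsTo hz))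

theorem not_eventually_eq (hf : IsUniformization f Ω) (hz : z ∈ Metric.ball (0:ℂ) 1) :
    ¬ ∀ᶠ y in 𝓝 z, f y = f z := by
  intro h
  have h2 : ∀ᶠ y in 𝓝[≠] z, y = z := by
    filter_upwards [nhdsWithin_le_nhds h, nhdsWithin_le_nhds (ball_mem_nhds_of_mem hz)] with y hy hyb
    exact hf.bij.injOn hyb hz hy
  obtain ⟨y, hy, hy'⟩ := (h2.and self_mem_nhdsWithin).exists
  exact hy' hy

/-- Open mapping theorem; injectivity excludes local constancy. -/
theorem nhds_le_map (hf : IsUniformization f Ω) (hz : z ∈ Metric.ball (0:ℂ) 1) : 𝓝 (f z) ≤ map f (𝓝 z) :=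
  (hf.analyticAt hz).eventually_constant_or_nhds_le_map_nhds.resolve_left (hf.not_eventually_eq hz)

theorem isOpen (hf : IsUniformization f Ω) : IsOpen Ω := by
  refine isOpen_iff_mem_nhds.2 fun w hw => ?_
  obtain ⟨z, hz, rfl⟩ := hf.bij.surjOn hw
  exact mem_of_superset (hf.nhds_le_map hz (image_mem_map (ball_mem_nhds_of_mem hz))) hf.bij.mapsTo.image_subset

theorem continuousAt_inv (hf : IsUniformization f Ω) (hw : w ∈ Ω) : ContinuousAt (uniformizationInv f) w := by
  obtain ⟨z, hz, rfl⟩ := hf.bij.surjOn hw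
  rw [ContinuousAt, hf.inv_apply hz]
  refine Tendsto.mono_left ?_ (hf.nhds_le_map hz)
  rw [tendsto_map'_iff]
  refine tendsto_id.congr' ?_
  filter_upwards [ball_mem_nhds_of_mem hz] with y hy
  exact (hf.inv_apply hy).symm

theorem hasDerivAt_inv_of_ne_zero (hf : IsUniformization f Ω) (hw : w ∈ Ω)
    (h0 : deriv f (uniformizationInv f w) ≠ 0) :
    HasDerivAt (uniformizationInv f) (deriv f (uniformizationInv f w))⁻¹ w := by
  refine HasDerivAt.of_local_left_inverse (hf.continuousAt_inv hw)
    (hf.analyticAt (hf.inv_mem hw)).differentiableAt.hasDerivAt h0 ?_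
  filter_upwards [hf.isOpen.mem_nhds hw] with y hy
  exact hf.apply_inv hy

/-- The zeros of f' are isolated. Off their images the inverse is holomorphic by the inverse
function rule, and continuity makes the exceptional points removable. The chain rule shows
afterwards that f' has no zeros at all. -/
theorem differentiableAt_inv (hf : IsUniformization f Ω) (hw : w ∈ Ω) :
    DifferentiableAt ℂ (uniformizationInv f) w := by
  obtain ⟨z, hz, rfl⟩ := hf.bij.surjOn hw
  refine (analyticAt_of_differentiable_on_punctured_nhds_of_continuousAt ?_ (hf.continuousAt_inv hw)).differentiableAt
  have h1 : ∀ᶠ y in 𝓝[≠] z, deriv f y ≠ 0 := by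
    rcases (hf.analyticAt hz).deriv.eventually_eq_zero_or_eventually_ne_zero with h | h
    · exfalso
      obtain ⟨ε, hε, hb⟩ := Metric.eventually_nhds_iff_ball.1 (h.and (ball_mem_nhds_of_mem hz))
      refine hf.not_eventually_eq hz ?_
      filter_upwards [Metric.ball_mem_nhds z hε] with y hy
      refine (convex_ball z ε).is_const_of_fderivWithin_eq_zero (𝕜 := ℂ)
        (fun y hy => ((hf.analyticAt (hb y hy).2).differentiableAt).differentiableWithinAt) (fun y hy => ?_) hy
        (Metric.mem_ball_self hε)
      rw [fderivWithin_of_isOpen Metric.isOpen_ball hy]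
      ext
      simpa using (hb y hy).1
    · exact h
  have h2 : Tendsto (uniformizationInv f) (𝓝[≠] (f z)) (𝓝[≠] z) := by
    refine tendsto_nhdsWithin_iff.2 ⟨?_, ?_⟩
    · simpa [ContinuousAt, hf.inv_apply hz] using (hf.continuousAt_inv hw).tendsto.mono_left
        (nhdsWithin_le_nhds (s := {f z}ᶜ))
    · filter_upwards [nhdsWithin_le_nhds (hf.isOpen.mem_nhds hw), self_mem_nhdsWithin] with y hy hne h
      exact hne (by rw [← hf.apply_inv hy, h]; rfl)
  filter_upwards [h2.eventually h1, nhdsWithin_le_nhds (hf.isOpen.mem_nhds hw)] with y hy hyΩ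
  exact (hf.hasDerivAt_inv_of_ne_zero hyΩ hy).differentiableAt

theorem deriv_ne_zero (hf : IsUniformization f Ω) (hz : z ∈ Metric.ball (0:ℂ) 1) : deriv f z ≠ 0 := by
  intro h0
  have h1 := (hf.differentiableAt_inv (hf.bij.mapsTo hz)).hasDerivAt.comp z
    (hf.analyticAt hz).differentiableAt.hasDerivAt
  have h2 : HasDerivAt (uniformizationInv f ∘ f) 1 z := by
    refine (hasDerivAt_id z).congr_of_eventuallyEq ?_
    filter_upwards [ball_mem_nhds_of_mem hz] with y hy
    exact hf.inv_apply hy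
  have := h1.unique h2
  simp [h0] at this

theorem hasDerivAt_inv (hf : IsUniformization f Ω) (hw : w ∈ Ω) :
    HasDerivAt (uniformizationInv f) (deriv f (uniformizationInv f w))⁻¹ w :=
  hf.hasDerivAt_inv_of_ne_zero hw (hf.deriv_ne_zero (hf.inv_mem hw))

theorem inv_eq_zero_iff (hf : IsUniformization f Ω) (hw : w ∈ Ω) : uniformizationInv f w = 0 ↔ w = f 0 := by
  constructor
  · intro h; rw [← hf.apply_inv hw, h]
  · rintro rfl; exact hf.inv_apply (by simp)

theorem comp (hf : IsUniformization f Ω) {M : ℂ → ℂ} (hM : DifferentiableOn ℂ M (Metric.ball 0 1))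
    (hb : BijOn M (Metric.ball 0 1) (Metric.ball 0 1)) : IsUniformization (f ∘ M) Ω :=
  ⟨hf.holo.comp hM hb.mapsTo, hf.bij.comp hb⟩

/-- Two uniformizations with the same value at the origin differ by a rotation (Schwarz' lemma). -/
theorem eqOn_rotation (hf₁ : IsUniformization f₁ Ω) (hf₂ : IsUniformization f₂ Ω) (h0 : f₁ 0 = f₂ 0) :
    ∃ α : ℝ, EqOn f₂ (fun z => f₁ (exp (I * α) * z)) (Metric.ball 0 1) := by
  have key : ∀ {g₁ g₂ : ℂ → ℂ}, IsUniformization g₁ Ω → IsUniformization g₂ Ω → g₁ 0 = g₂ 0 →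
      DifferentiableOn ℂ (uniformizationInv g₁ ∘ g₂) (Metric.ball 0 1) ∧
      MapsTo (uniformizationInv g₁ ∘ g₂) (Metric.ball 0 1) (Metric.ball 0 1) ∧
      (uniformizationInv g₁ ∘ g₂) 0 = 0 := fun {g₁ g₂} h₁ h₂ h => by
    refine ⟨fun z hz => ?_, fun z hz => h₁.inv_mem (h₂.bij.mapsTo hz), ?_⟩
    · exact ((h₁.differentiableAt_inv (h₂.bij.mapsTo hz)).comp z
        (h₂.analyticAt hz).differentiableAt).differentiableWithinAt
    · simp only [Function.comp_apply]; rw [← h, h₁.inv_apply (by simp)]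
  obtain ⟨d1, m1, z1⟩ := key hf₁ hf₂ h0
  obtain ⟨d2, m2, z2⟩ := key hf₂ hf₁ h0.symm
  set N := uniformizationInv f₁ ∘ f₂ with hN
  -- Schwarz' lemma for `N` and for its inverse. The equality case, used below at the point 1/2,
  -- makes `N` a rotation.
  have hn : ∀ z ∈ Metric.ball (0:ℂ) 1, ‖N z‖ = ‖z‖ := fun z hz => by
    refine le_antisymm (norm_le_norm_of_mapsTo_ball d1 (m1.mono_right Metric.ball_subset_closedBall) z1
      (by simpa using hz)) ?_
    have h3 := norm_le_norm_of_mapsTo_ball d2 (m2.mono_right Metric.ball_subset_closedBall) z2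
      (z := N z) (by simpa using m1 hz)
    have h4 : (uniformizationInv f₂ ∘ f₁) (N z) = z := by
      simp only [hN, Function.comp_apply]
      rw [hf₁.apply_inv (hf₂.bij.mapsTo hz), hf₂.inv_apply hz]
    rwa [h4] at h3
  have hmem : ((1 / 2 : ℝ) : ℂ) ∈ Metric.ball (0:ℂ) 1 := by
    rw [mem_ball_zero_iff, norm_real]; norm_num
  obtain ⟨C, hC, hE⟩ := affine_of_mapsTo_ball_of_exists_norm_dslope_eq_div' (R₁ := 1) (R₂ := 1) (c := 0) d1
    (by rw [z1]; exact m1.mono_right Metric.ball_subset_closedBall) ⟨((1 / 2 : ℝ) : ℂ), hmem, by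
      rw [dslope_of_ne _ (by norm_num), slope_def_module, z1, sub_zero, sub_zero, norm_smul, hn _ hmem,
        norm_inv, inv_mul_cancel₀, div_one]
      rw [norm_real]; norm_num⟩
  refine ⟨arg C, fun z hz => ?_⟩
  have hC' : exp (I * arg C) = C := by
    have := norm_mul_exp_arg_mul_I C
    rw [hC] at this
    rw [mul_comm I]; simpa using this
  have := hE hz
  simp only [z1, sub_zero, zero_add, smul_eq_mul] at this
  simp only [hC']
  rw [mul_comm C, ← this, hN, Function.comp_apply, hf₁.apply_inv (hf₂.bij.mapsTo hz)]

end IsUniformization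

/-- `extendFrom` takes a default value where no limit exists. Here the two image filters are equal,
so the extensions agree whether or not the limit exists. -/
theorem boundaryExt_comp {M N : ℂ → ℂ} {z : ℂ} (hM : ContinuousAt M z) (hMm : MapsTo M (Metric.ball 0 1) (Metric.ball 0 1))
    (hN : ContinuousAt N (M z)) (hNm : MapsTo N (Metric.ball 0 1) (Metric.ball 0 1)) (hNz : N (M z) = z)
    (hMN : ∀ w ∈ Metric.ball (0:ℂ) 1, M (N w) = w) (hE : EqOn f₂ (f₁ ∘ M) (Metric.ball 0 1)) :
    boundaryExt f₂ z = boundaryExt f₁ (M z) := by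
  have h1 : map f₂ (𝓝[Metric.ball 0 1] z) = map f₁ (𝓝[Metric.ball 0 1] (M z)) := by
    rw [map_congr (hE.eventuallyEq_of_mem self_mem_nhdsWithin), ← map_map]
    congr 1
    refine le_antisymm (hM.continuousWithinAt.tendsto_nhdsWithin hMm) ?_
    have h2 : map N (𝓝[Metric.ball 0 1] (M z)) ≤ 𝓝[Metric.ball 0 1] z := by
      have := hN.continuousWithinAt.tendsto_nhdsWithin hNm
      rwa [hNz] at this
    refine le_trans ?_ (map_mono h2)
    have h3 : M ∘ N =ᶠ[𝓝[Metric.ball 0 1] (M z)] id := by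
      filter_upwards [self_mem_nhdsWithin] with w hw using hMN w hw
    rw [Filter.map_map, Filter.map_congr h3, Filter.map_id]
  unfold boundaryExt extendFrom limUnder
  rw [h1]

end Uniformization

/-! ### Möbius transformations of the disk -/

section Moebius

open scoped ComplexConjugate

/-- The automorphism `z ↦ (z + b) / (1 + b̄ z)` of the disk. -/
noncomputable def moebius (b z : ℂ) : ℂ := (z + b) / (1 + conj b * z)

variable {b z w : ℂ}

theorem norm_conj_mul_lt_one (hb : ‖b‖ < 1) (hz : ‖z‖ ≤ 1) : ‖conj b * z‖ < 1 := by
  rw [norm_mul, RCLike.norm_conj]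
  nlinarith [norm_nonneg b, norm_nonneg z]

theorem moebius_denom_re_pos (hb : ‖b‖ < 1) (hz : ‖z‖ ≤ 1) : 0 < (1 + conj b * z).re := by
  have := (abs_le.1 ((abs_re_le_norm (conj b * z)).trans (norm_conj_mul_lt_one hb hz).le)).1
  have h2 := (abs_lt.1 ((abs_re_le_norm (conj b * z)).trans_lt (norm_conj_mul_lt_one hb hz))).1
  rw [add_re, one_re]; linarith

theorem moebius_denom_ne_zero (hb : ‖b‖ < 1) (hz : ‖z‖ ≤ 1) : 1 + conj b * z ≠ 0 := fun h => by
  have := moebius_denom_re_pos hb hz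
  simp [h] at this

theorem moebius_mem_ball (hb : ‖b‖ < 1) (hz : z ∈ Metric.ball (0:ℂ) 1) : moebius b z ∈ Metric.ball (0:ℂ) 1 := by
  rw [mem_ball_zero_iff] at *
  have h0 := moebius_denom_ne_zero hb hz.le
  rw [moebius, norm_div, div_lt_one (norm_pos_iff.2 h0)]
  refine lt_of_pow_lt_pow_left₀ 2 (norm_nonneg _) ?_
  rw [← normSq_eq_norm_sq, ← normSq_eq_norm_sq]
  have h1 : normSq z < 1 := by rw [normSq_eq_norm_sq]; nlinarith [norm_nonneg z]
  have h2 : normSq b < 1 := by rw [normSq_eq_norm_sq]; nlinarith [norm_nonneg b]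
  have h3 : normSq (1 + conj b * z) - normSq (z + b) = (1 - normSq z) * (1 - normSq b) := by
    simp only [normSq_apply, add_re, add_im, mul_re, mul_im, conj_re, conj_im, one_re, one_im]; ring
  nlinarith

theorem moebius_neg_moebius (hb : ‖b‖ < 1) (hz : ‖z‖ ≤ 1) : moebius (-b) (moebius b z) = z := by
  have h0 := moebius_denom_ne_zero hb hz
  have h1 : (1:ℂ) - conj b * b ≠ 0 := by
    have h2 := norm_conj_mul_lt_one hb hb.le
    intro h
    rw [← sub_eq_zero.1 h, norm_one] at h2
    exact lt_irrefl _ h2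
  have h2 : 1 + conj b * z - conj b * (z + b) = 1 - conj b * b := by ring
  rw [moebius, moebius, map_neg]
  have e1 : (z + b) / (1 + conj b * z) + -b = (1 - conj b * b) * z / (1 + conj b * z) := by
    rw [eq_div_iff h0, add_mul, div_mul_cancel₀ _ h0]; ring
  have e2 : 1 + -conj b * ((z + b) / (1 + conj b * z)) = (1 - conj b * b) / (1 + conj b * z) := by
    rw [eq_div_iff h0, add_mul, mul_assoc, div_mul_cancel₀ _ h0]; ring
  rw [e1, e2]
  field_simp

theorem hasDerivAt_moebius (hb : ‖b‖ < 1) (hz : ‖z‖ ≤ 1) :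
    HasDerivAt (moebius b) ((1 - conj b * b) / (1 + conj b * z) ^ 2) z := by
  have h := ((hasDerivAt_id z).add_const b).div (((hasDerivAt_id z).const_mul (conj b)).const_add 1)
    (moebius_denom_ne_zero hb hz)
  refine (h.congr_deriv ?_)
  simp only [id]
  congr 1
  ring

theorem bijOn_moebius (hb : ‖b‖ < 1) : BijOn (moebius b) (Metric.ball 0 1) (Metric.ball 0 1) := by
  have hb' : ‖-b‖ < 1 := by rwa [norm_neg]
  refine InvOn.bijOn (f' := moebius (-b)) ⟨fun z hz => moebius_neg_moebius hb (by simpa using (mem_ball_zero_iff.1 hz).le),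
    fun z hz => ?_⟩ (fun z hz => moebius_mem_ball hb hz) (fun z hz => moebius_mem_ball hb' hz)
  simpa using moebius_neg_moebius hb' (by simpa using (mem_ball_zero_iff.1 hz).le)

theorem IsUniformization.comp_moebius {f : ℂ → ℂ} {Ω : Set ℂ} (hf : IsUniformization f Ω) (hb : ‖b‖ < 1) :
    IsUniformization (f ∘ moebius b) Ω :=
  hf.comp (fun z hz => (hasDerivAt_moebius hb (by simpa using (mem_ball_zero_iff.1 hz).le)).differentiableAt.differentiableWithinAt)
    (bijOn_moebius hb)

theorem norm_moebius_of_norm_eq_one (hb : ‖b‖ < 1) (hz : ‖z‖ = 1) : ‖moebius b z‖ = 1 := by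
  have h0 := moebius_denom_ne_zero hb hz.le
  rw [moebius, norm_div, div_eq_one_iff_eq (norm_ne_zero_iff.2 h0)]
  refine (sq_eq_sq₀ (norm_nonneg _) (norm_nonneg _)).1 ?_
  rw [← normSq_eq_norm_sq, ← normSq_eq_norm_sq]
  have h1 : normSq z = 1 := by rw [normSq_eq_norm_sq, hz]; norm_num
  have h3 : normSq (1 + conj b * z) - normSq (z + b) = (1 - normSq z) * (1 - normSq b) := by
    simp only [normSq_apply, add_re, add_im, mul_re, mul_im, conj_re, conj_im, one_re, one_im]; ring
  rw [h1] at h3; linarith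

theorem boundaryExt_comp_moebius (f : ℂ → ℂ) (hb : ‖b‖ < 1) (hz : ‖z‖ = 1) :
    boundaryExt (f ∘ moebius b) z = boundaryExt f (moebius b z) := by
  have hb' : ‖-b‖ < 1 := by rwa [norm_neg]
  refine boundaryExt_comp (N := moebius (-b)) (hasDerivAt_moebius hb hz.le).continuousAt
    (fun z hz => moebius_mem_ball hb hz) (hasDerivAt_moebius hb' (norm_moebius_of_norm_eq_one hb hz).le).continuousAt
    (fun z hz => moebius_mem_ball hb' hz) (moebius_neg_moebius hb hz.le) (fun w hw => ?_) (fun _ _ => rfl)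
  simpa using moebius_neg_moebius hb' (by simpa using (mem_ball_zero_iff.1 hw).le)

theorem boundaryExt_rotation {f₁ f₂ : ℂ → ℂ} {α : ℝ}
    (hE : EqOn f₂ (fun z => f₁ (exp (I * α) * z)) (Metric.ball 0 1)) (z : ℂ) :
    boundaryExt f₂ z = boundaryExt f₁ (exp (I * α) * z) := by
  have h1 : ‖exp (I * α)‖ = 1 := by rw [mul_comm, norm_exp_ofReal_mul_I]
  refine boundaryExt_comp (M := fun z => exp (I * α) * z) (N := fun z => exp (-(I * α)) * z)
    (by fun_prop) (fun z hz => ?_) (by fun_prop) (fun z hz => ?_) ?_ (fun w _ => ?_) hE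
  · simpa [h1] using hz
  · simpa [exp_neg, h1] using hz
  · simp [exp_neg, ← mul_assoc]
  · simp [exp_neg, ← mul_assoc]

/-- The angle of the image of `e^{it}` under a Möbius transformation of the disk. -/
noncomputable def moebiusAngle (b : ℂ) (t : ℝ) : ℝ := t - 2 * (log (1 + conj b * circleMap 0 1 t)).im

theorem norm_circleMap_one (t : ℝ) : ‖circleMap 0 1 t‖ = 1 := by simp

/-- For |z| = 1 and w = 1 + b̄ z one has z + b = z w̄, so the image is z w̄ / w, of angle t - 2 arg
w. As Re w > 0, the principal logarithm of w is smooth. -/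
theorem circleMap_moebiusAngle (hb : ‖b‖ < 1) (t : ℝ) :
    circleMap 0 1 (moebiusAngle b t) = moebius b (circleMap 0 1 t) := by
  set z := circleMap 0 1 t with hz
  have h0 := moebius_denom_ne_zero hb (norm_circleMap_one t).le
  have hw : conj z * z = 1 := by
    rw [mul_comm, mul_conj, normSq_eq_norm_sq, norm_circleMap_one]; norm_num
  set w := 1 + conj b * z with hwd
  have e1 : circleMap 0 1 (moebiusAngle b t) = z * exp (conj (log w) - log w) := by
    rw [moebiusAngle, hz]
    simp only [circleMap, ofReal_one, one_mul, zero_add]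
    rw [← exp_add]
    congr 1
    apply Complex.ext <;> simp [w, hz, circleMap]
    ring
  rw [e1, exp_sub, exp_conj, exp_log h0, moebius, hwd]
  rw [← hwd, mul_div_assoc']
  congr 1
  rw [hwd, map_add, map_one, map_mul, conj_conj]
  linear_combination b * hw

theorem hasDerivAt_moebiusAngle (hb : ‖b‖ < 1) (t : ℝ) :
    HasDerivAt (moebiusAngle b) ((1 - normSq b) / normSq (1 + conj b * circleMap 0 1 t)) t := by
  have hre := moebius_denom_re_pos hb (norm_circleMap_one t).le
  have h0 := moebius_denom_ne_zero hb (norm_circleMap_one t).le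
  have h1 : HasDerivAt (fun t : ℝ => 1 + conj b * circleMap 0 1 t) (conj b * (circleMap 0 1 t * I)) t :=
    ((hasDerivAt_circleMap 0 1 t).const_mul _).const_add 1
  have h2 := h1.clog_real (Or.inl hre)
  have h3 := (imCLM.hasFDerivAt (x := log (1 + conj b * circleMap 0 1 t))).comp_hasDerivAt t h2
  refine (((hasDerivAt_id t).sub (h3.const_mul 2))).congr_deriv ?_
  have hn : normSq (circleMap 0 1 t) = 1 := by rw [normSq_eq_norm_sq, norm_circleMap_one]; norm_num
  have hnw : normSq (1 + conj b * circleMap 0 1 t) ≠ 0 := fun h => h0 (normSq_eq_zero.1 h)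
  rw [eq_div_iff hnw]
  simp only [imCLM_apply, div_im]
  field_simp
  rw [normSq_apply] at hn
  simp only [normSq_apply, add_re, add_im, mul_re, mul_im, conj_re, conj_im, one_re, one_im, I_re, I_im]
  generalize (circleMap 0 1 t).re = x at *
  generalize (circleMap 0 1 t).im = y at *
  have : y ^ 2 = 1 - x ^ 2 := by linarith
  ring_nf
  simp only [this]
  ring_nf

end Moebius

/-! ### Change of variables on the circle -/

section CircleLift

/-- `θ` is the angular expression of a diffeomorphism of the circle of degree one, whose derivative is
bounded below by `c`. -/
structure IsCircleLift (θ θ' : ℝ → ℝ) (c : ℝ) : Prop where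
  pos : 0 < c
  hasDerivAt : ∀ t, HasDerivAt θ (θ' t) t
  le : ∀ t, c ≤ θ' t
  add_two_pi : ∀ t, θ (t + 2 * Real.pi) = θ t + 2 * Real.pi

variable {θ θ' : ℝ → ℝ} {c : ℝ}

theorem setLIntegral_Ioc_of_periodic {F : ℝ → ℝ≥0∞} (hF : Function.Periodic F (2 * Real.pi)) (a : ℝ) :
    ∫⁻ t in Ioc a (a + 2 * Real.pi), F t = ∫⁻ t, F t ∂arcMeasure := by
  have h0 := isAddFundamentalDomain_Ioc Real.two_pi_pos 0
  have ha := isAddFundamentalDomain_Ioc Real.two_pi_pos a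
  rw [zero_add] at h0
  refine ha.setLIntegral_eq h0 F fun g x => ?_
  obtain ⟨n, hn⟩ := AddSubgroup.mem_zmultiples_iff.1 g.2
  rw [AddSubgroup.vadd_def, ← hn, vadd_eq_add, add_comm]
  exact hF.zsmul n x

/-- A circle lift does not map the period (0, 2π] to itself, so almost-everywhere statements are
first extended to the line. -/
theorem ae_of_ae_arcMeasure {p : ℂ → Prop} (h : ∀ᵐ t ∂arcMeasure, p (circleMap 0 1 t)) :
    ∀ᵐ t : ℝ, p (circleMap 0 1 t) := by
  have h0 := isAddFundamentalDomain_Ioc Real.two_pi_pos 0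
  rw [zero_add] at h0
  refine h0.measure_zero_of_invariant _ (fun g => ?_) ?_
  · obtain ⟨n, hn⟩ := AddSubgroup.mem_zmultiples_iff.1 g.2
    ext x
    rw [mem_vadd_set_iff_neg_vadd_mem, AddSubgroup.vadd_def, AddSubgroup.coe_neg, ← hn, vadd_eq_add, ← neg_zsmul,
      add_comm]
    simp only [mem_setOf_eq, mem_compl_iff]
    rw [(periodic_circleMap 0 1).zsmul (-n) x]
  · rw [arcMeasure, ae_restrict_iff' measurableSet_Ioc] at h
    refine measure_mono_null (fun t ht => ?_) h
    intro hc
    exact ht.1 (hc ht.2)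

theorem aestronglyMeasurable_onCircle_volume {E : Type} [NormedAddCommGroup E] {h : ℂ → E}
    (hh : AEStronglyMeasurable (onCircle h) arcMeasure) : AEStronglyMeasurable (onCircle h) := by
  obtain ⟨k, hk, hkh⟩ := hh
  have hu := iUnion_Ioc_zsmul Real.two_pi_pos
  rw [← Measure.restrict_univ (μ := volume), ← hu, aestronglyMeasurable_iUnion_iff]
  intro n
  have hm : MeasurePreserving (fun t : ℝ => t + (-n) • (2 * Real.pi))
      (volume.restrict (Ioc (n • (2 * Real.pi)) ((n + 1) • (2 * Real.pi)))) arcMeasure := by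
    have h1 := (measurePreserving_add_right volume ((-n) • (2 * Real.pi))).restrict_preimage
      (s := Ioc 0 (2 * Real.pi)) measurableSet_Ioc
    convert! h1 using 2
    ext t
    simp only [mem_Ioc, mem_preimage, neg_smul, add_smul, one_smul]
    constructor <;> rintro ⟨h1, h2⟩ <;> constructor <;> linarith
  refine (AEStronglyMeasurable.comp_measurePreserving ⟨k, hk, hkh⟩ hm).congr (ae_of_all _ fun t => ?_)
  simp only [Function.comp_apply, onCircle]
  rw [(periodic_circleMap 0 1).zsmul (-n) t]

theorem periodic_comp_circleMap {α : Type*} (F : ℂ → α) : Function.Periodic (fun t => F (circleMap 0 1 t)) (2 * Real.pi) :=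
  fun t => by simp only [periodic_circleMap 0 1 t]

namespace IsCircleLift

theorem strictMono (h : IsCircleLift θ θ' c) : StrictMono θ :=
  strictMono_of_hasDerivAt_pos h.hasDerivAt fun t => h.pos.trans_le (h.le t)

theorem continuous (h : IsCircleLift θ θ' c) : Continuous θ :=
  continuous_iff_continuousAt.2 fun t => (h.hasDerivAt t).continuousAt

/-- The change of variables formula with the Jacobian replaced by its lower bound. One inequality is
enough for finiteness and for null sets, and it asks no measurability of F. -/
theorem mul_lintegral_le_lintegral_image (h : IsCircleLift θ θ' c) {s : Set ℝ} (hs : MeasurableSet s) (F : ℝ → ℝ≥0∞) :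
    ENNReal.ofReal c * ∫⁻ t in s, F (θ t) ≤ ∫⁻ t in θ '' s, F t := by
  rw [lintegral_image_eq_lintegral_abs_deriv_mul hs (fun t _ => (h.hasDerivAt t).hasDerivWithinAt)
    h.strictMono.injective.injOn]
  refine (lintegral_const_mul_le _ _).trans (lintegral_mono fun t => ?_)
  gcongr
  exact (h.le t).trans (le_abs_self _)

theorem lintegral_comp_le (h : IsCircleLift θ θ' c) {F : ℝ → ℝ≥0∞} (hF : Function.Periodic F (2 * Real.pi)) :
    ENNReal.ofReal c * ∫⁻ t, F (θ t) ∂arcMeasure ≤ ∫⁻ t, F t ∂arcMeasure := by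
  refine (h.mul_lintegral_le_lintegral_image measurableSet_Ioc F).trans ?_
  rw [← setLIntegral_Ioc_of_periodic hF (θ 0)]
  refine lintegral_mono_set ?_
  rintro _ ⟨t, ht, rfl⟩
  have h1 := h.add_two_pi 0
  rw [zero_add] at h1
  exact ⟨h.strictMono ht.1, h1 ▸ h.strictMono.monotone ht.2⟩

theorem lintegral_comp_lt_top (h : IsCircleLift θ θ' c) {F : ℝ → ℝ≥0∞} (hF : Function.Periodic F (2 * Real.pi))
    (ht : ∫⁻ t, F t ∂arcMeasure < ⊤) : ∫⁻ t, F (θ t) ∂arcMeasure < ⊤ := by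
  have := (h.lintegral_comp_le hF).trans_lt ht
  by_contra hc
  rw [not_lt, top_le_iff] at hc
  rw [hc, ENNReal.mul_top (by simpa using h.pos)] at this
  exact lt_irrefl _ this

theorem quasiMeasurePreserving (h : IsCircleLift θ θ' c) : Measure.QuasiMeasurePreserving θ := by
  refine ⟨h.continuous.measurable, Measure.AbsolutelyContinuous.mk fun s hs h0 => ?_⟩
  rw [Measure.map_apply h.continuous.measurable hs]
  have h1 := h.mul_lintegral_le_lintegral_image (h.continuous.measurable hs) 1
  simp only [Pi.one_apply, lintegral_const, one_mul, Measure.restrict_apply_univ] at h1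
  have h2 : volume (θ '' (θ ⁻¹' s)) = 0 := measure_mono_null (image_preimage_subset _ _) h0
  rw [h2, nonpos_iff_eq_zero, mul_eq_zero] at h1
  exact h1.resolve_left (by simpa using h.pos)

variable {M : ℂ → ℂ}

theorem ae_comp (h : IsCircleLift θ θ' c) (hM : ∀ t, circleMap 0 1 (θ t) = M (circleMap 0 1 t)) {p : ℂ → Prop}
    (hp : ∀ᵐ t ∂arcMeasure, p (circleMap 0 1 t)) : ∀ᵐ t ∂arcMeasure, p (M (circleMap 0 1 t)) := by
  have h1 := ae_restrict_of_ae (s := Ioc 0 (2 * Real.pi)) (h.quasiMeasurePreserving.ae (ae_of_ae_arcMeasure hp))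
  simpa only [hM] using! h1

/-- The Lipschitz bound on M compares the denominators of the two Gagliardo quotients, and the lower
bound on θ' controls the change of variables in each of the two integrals. -/
theorem memHHalf_comp {E : Type} [NormedAddCommGroup E] [NormedSpace ℝ E] (h : IsCircleLift θ θ' c)
    (hM : ∀ t, circleMap 0 1 (θ t) = M (circleMap 0 1 t)) {L : ℝ}
    (hL : ∀ s t, ‖M (circleMap 0 1 s) - M (circleMap 0 1 t)‖ ≤ L * ‖circleMap 0 1 s - circleMap 0 1 t‖)
    {φ : ℂ → E} (hφ : MemHHalf φ) : MemHHalf (φ ∘ M) := by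
  have hc : ∀ t, onCircle (φ ∘ M) t = onCircle φ (θ t) := fun t => by simp [onCircle, hM]
  have hp2 := hφ.1.eLpNorm_lt_top
  rw [eLpNorm_lt_top_iff_lintegral_rpow_enorm_lt_top two_ne_zero ENNReal.ofNat_ne_top] at hp2
  refine ⟨⟨?_, ?_⟩, ?_⟩
  · have := ((aestronglyMeasurable_onCircle_volume hφ.1.1).comp_quasiMeasurePreserving
      h.quasiMeasurePreserving).restrict (s := Ioc 0 (2 * Real.pi))
    exact this.congr (ae_of_all _ fun t => (hc t).symm)
  · rw [eLpNorm_lt_top_iff_lintegral_rpow_enorm_lt_top two_ne_zero ENNReal.ofNat_ne_top]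
    simp only [hc]
    exact h.lintegral_comp_lt_top (F := fun t => ‖onCircle φ t‖ₑ ^ (2:ℝ≥0∞).toReal)
      (periodic_comp_circleMap fun z => ‖φ z‖ₑ ^ (2:ℝ≥0∞).toReal) hp2
  · set F : ℂ → ℂ → ℝ≥0∞ := fun z w => ‖φ z - φ w‖ₑ ^ 2 / ‖z - w‖ₑ ^ 2 with hF
    have h1 : ∫⁻ s, ∫⁻ t, F (circleMap 0 1 (θ s)) (circleMap 0 1 (θ t)) ∂arcMeasure ∂arcMeasure < ⊤ := by
      have h2 := h.lintegral_comp_lt_top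
        (F := fun s => ∫⁻ t, F (circleMap 0 1 s) (circleMap 0 1 t) ∂arcMeasure)
        (periodic_comp_circleMap fun z => ∫⁻ t, F z (circleMap 0 1 t) ∂arcMeasure) hφ.2
      have h3 : ENNReal.ofReal c * ∫⁻ s, ∫⁻ t, F (circleMap 0 1 (θ s)) (circleMap 0 1 (θ t)) ∂arcMeasure ∂arcMeasure
          ≤ ∫⁻ s, ∫⁻ t, F (circleMap 0 1 (θ s)) (circleMap 0 1 t) ∂arcMeasure ∂arcMeasure := by
        refine (lintegral_const_mul_le _ _).trans (lintegral_mono fun s => ?_)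
        exact h.lintegral_comp_le (periodic_comp_circleMap (F (circleMap 0 1 (θ s))))
      have h4 := h3.trans_lt h2
      by_contra hc
      rw [not_lt, top_le_iff] at hc
      rw [hc, ENNReal.mul_top (by simpa using h.pos)] at h4
      exact lt_irrefl _ h4
    have h5 : ∀ s t, ‖onCircle (φ ∘ M) s - onCircle (φ ∘ M) t‖ₑ ^ 2 / ‖circleMap 0 1 s - circleMap 0 1 t‖ₑ ^ 2 ≤
        ENNReal.ofReal (L ^ 2) * F (circleMap 0 1 (θ s)) (circleMap 0 1 (θ t)) := fun s t => by
      have e1 := ofReal_gagliardo (φ ∘ M) (s, t)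
      have e2 := ofReal_gagliardo φ (θ s, θ t)
      simp only [onCircle] at e1 e2
      simp only [onCircle, hF]
      rw [← e1, ← e2, ← ENNReal.ofReal_mul (sq_nonneg _)]
      refine ENNReal.ofReal_le_ofReal ?_
      have h6 := hL s t
      simp only [gagliardo, hc]
      rcases eq_or_ne (circleMap 0 1 s) (circleMap 0 1 t) with he | he
      · rw [he, sub_self, norm_zero]; norm_num; positivity
      · have h7 : 0 < ‖circleMap 0 1 s - circleMap 0 1 t‖ := norm_pos_iff.2 (sub_ne_zero.2 he)
        rcases eq_or_ne (circleMap 0 1 (θ s)) (circleMap 0 1 (θ t)) with he' | he'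
        · simp [onCircle, he']
        · have h8 : 0 < ‖circleMap 0 1 (θ s) - circleMap 0 1 (θ t)‖ := norm_pos_iff.2 (sub_ne_zero.2 he')
          rw [mul_div_assoc', div_le_div_iff₀ (by positivity) (by positivity)]
          have h9 : ‖circleMap 0 1 (θ s) - circleMap 0 1 (θ t)‖ ^ 2 ≤ L ^ 2 * ‖circleMap 0 1 s - circleMap 0 1 t‖ ^ 2 := by
            rw [← mul_pow, hM, hM]; gcongr
          nlinarith [mul_le_mul_of_nonneg_left h9 (sq_nonneg ‖onCircle φ (θ s) - onCircle φ (θ t)‖)]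
    refine (lintegral_mono fun s => lintegral_mono fun t => h5 s t).trans_lt ?_
    simp only [lintegral_const_mul' _ _ ENNReal.ofReal_ne_top]
    exact ENNReal.mul_lt_top ENNReal.ofReal_lt_top h1

end IsCircleLift

theorem aestronglyMeasurable_of_lifting {h : ℂ → ℂ} {φ : ℂ → ℝ} (hφ : MemHHalf φ)
    (hl : ∀ᵐ t ∂arcMeasure, onCircle h t = circleMap 0 1 t * exp (I * onCircle φ t)) :
    AEStronglyMeasurable (onCircle h) arcMeasure := by
  refine AEStronglyMeasurable.congr (f := fun t => circleMap 0 1 t * exp (I * onCircle φ t)) ?_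
    (by filter_upwards [hl] with t ht using ht.symm)
  refine (continuous_circleMap 0 1).aestronglyMeasurable.mul ?_
  exact (Continuous.comp_aestronglyMeasurable (g := fun x : ℝ => exp (I * x)) (by fun_prop) hφ.1.1)

theorem norm_exp_I_mul_sub_le (x y : ℝ) : ‖exp (I * x) - exp (I * y)‖ ≤ |x - y| := by
  have e : exp (I * x) - exp (I * y) = exp (I * y) * (exp (I * (x - y : ℝ)) - 1) := by
    rw [mul_sub, ← exp_add, mul_one]; congr 2; push_cast; ring
  rw [e, norm_mul, mul_comm I (y : ℂ), norm_exp_ofReal_mul_I, one_mul]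
  exact Real.norm_exp_I_mul_ofReal_sub_one_le

theorem memHHalfCircle_of_lifting {h : ℂ → ℂ} {φ : ℂ → ℝ} (hφ : MemHHalf φ)
    (hl : ∀ᵐ t ∂arcMeasure, onCircle h t = circleMap 0 1 t * exp (I * onCircle φ t)) : MemHHalfCircle h := by
  have hn : ∀ᵐ t ∂arcMeasure, ‖onCircle h t‖ = 1 := by
    filter_upwards [hl] with t ht
    rw [ht, norm_mul, norm_circleMap_one, mul_comm I, norm_exp_ofReal_mul_I, one_mul]
  refine ⟨hφ.of_norm_sub_le (A := 2) (B := 2) ?_ ?_, hn⟩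
  · refine MemLp.of_bound (aestronglyMeasurable_of_lifting hφ hl) 1 ?_
    filter_upwards [hn] with t ht using ht.le
  · filter_upwards [Measure.quasiMeasurePreserving_fst (μ := arcMeasure) (ν := arcMeasure) |>.ae hl,
      Measure.quasiMeasurePreserving_snd (μ := arcMeasure) (ν := arcMeasure) |>.ae hl] with p h1 h2
    rw [h1, h2]
    have e : circleMap 0 1 p.1 * exp (I * onCircle φ p.1) - circleMap 0 1 p.2 * exp (I * onCircle φ p.2) =
      circleMap 0 1 p.1 * (exp (I * onCircle φ p.1) - exp (I * onCircle φ p.2)) +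
        (circleMap 0 1 p.1 - circleMap 0 1 p.2) * exp (I * onCircle φ p.2) := by ring
    have h3 := norm_add_le (circleMap 0 1 p.1 * (exp (I * onCircle φ p.1) - exp (I * onCircle φ p.2)))
      ((circleMap 0 1 p.1 - circleMap 0 1 p.2) * exp (I * onCircle φ p.2))
    rw [← e, norm_mul, norm_mul, norm_circleMap_one, one_mul, mul_comm I ((onCircle φ p.2 : ℝ) : ℂ), norm_exp_ofReal_mul_I,
      mul_one, mul_comm _ I] at h3
    have h4 := norm_exp_I_mul_sub_le (onCircle φ p.1) (onCircle φ p.2)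
    rw [← Real.norm_eq_abs] at h4
    set x := ‖onCircle φ p.1 - onCircle φ p.2‖
    set y := ‖circleMap 0 1 p.1 - circleMap 0 1 p.2‖
    calc _ ≤ (x + y) ^ 2 := by gcongr; linarith
      _ ≤ _ := by nlinarith [sq_nonneg (x - y)]

theorem MemHHalf.add_lipschitz {φ k : ℂ → ℝ} (hφ : MemHHalf φ) (hk : Continuous (onCircle k)) {L : ℝ}
    (hle : ∀ s t : ℝ, ‖onCircle k s - onCircle k t‖ ≤ L * ‖circleMap 0 1 s - circleMap 0 1 t‖) :
    MemHHalf (fun z => φ z + k z) := by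
  refine hφ.of_norm_sub_le (A := 2) (B := 2 * L ^ 2) (hφ.1.add (memHHalf_of_lipschitz hk hle).1) (ae_of_all _ fun p => ?_)
  have h1 := hle p.1 p.2
  simp only [onCircle] at *
  have h2 := norm_add_le (φ (circleMap 0 1 p.1) - φ (circleMap 0 1 p.2)) (k (circleMap 0 1 p.1) - k (circleMap 0 1 p.2))
  rw [add_sub_add_comm]
  set x := ‖φ (circleMap 0 1 p.1) - φ (circleMap 0 1 p.2)‖
  set y := ‖circleMap 0 1 p.1 - circleMap 0 1 p.2‖
  calc _ ≤ (x + L * y) ^ 2 := by gcongr; linarith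
    _ ≤ _ := by nlinarith [sq_nonneg (x - L * y)]

theorem isCircleLift_add_const (α : ℝ) : IsCircleLift (fun t => t + α) (fun _ => 1) 1 :=
  ⟨one_pos, fun t => (hasDerivAt_id t).add_const α, fun _ => le_rfl, fun t => by ring⟩

theorem circleMap_add_const (α t : ℝ) : circleMap 0 1 (t + α) = exp (I * α) * circleMap 0 1 t := by
  simp only [circleMap, ofReal_one, one_mul, zero_add]
  rw [← exp_add]; congr 1; push_cast; ring

/-- This is the phase of the rotated datum: h(e^{iα} z) = z e^{i(φ(e^{iα} z) + α)}, where α comes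
from the factor e^{iα} z. -/
theorem MemHHalf.comp_rotation {φ : ℂ → ℝ} (hφ : MemHHalf φ) (α : ℝ) :
    MemHHalf (fun z => φ (exp (I * α) * z) + α) := by
  have h := (isCircleLift_add_const α).memHHalf_comp (M := fun z => exp (I * α) * z) (circleMap_add_const α) (L := 1)
    (fun s t => by rw [← mul_sub, norm_mul, mul_comm I, norm_exp_ofReal_mul_I]) hφ
  exact h.add_lipschitz (k := fun _ => α) continuous_const (L := 0) (fun s t => by simp [onCircle])

theorem HasCircleDegree.lifting {h : ℂ → ℂ} (hh : HasCircleDegree h 1) : ∃ φ : ℂ → ℝ, MemHHalf φ ∧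
    ∀ᵐ t ∂arcMeasure, onCircle h t = circleMap 0 1 t * exp (I * onCircle φ t) := by
  simpa [HasCircleDegree] using hh

theorem lifting_rotation {h : ℂ → ℂ} {φ : ℂ → ℝ} (α : ℝ)
    (hl : ∀ᵐ t ∂arcMeasure, onCircle h t = circleMap 0 1 t * exp (I * onCircle φ t)) :
    ∀ᵐ t ∂arcMeasure, onCircle (fun z => h (exp (I * α) * z)) t =
      circleMap 0 1 t * exp (I * onCircle (fun z => φ (exp (I * α) * z) + α) t) := by
  have := (isCircleLift_add_const α).ae_comp (M := fun z => exp (I * α) * z) (circleMap_add_const α)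
    (p := fun z => h z = z * exp (I * φ z)) hl
  filter_upwards [this] with t ht
  simp only [onCircle]
  rw [ht]
  push_cast
  rw [mul_add, exp_add]; ring

open scoped ComplexConjugate

variable {b : ℂ}

theorem one_sub_le_norm_moebius_denom {z : ℂ} (hz : ‖z‖ ≤ 1) : 1 - ‖b‖ ≤ ‖1 + conj b * z‖ := by
  have h1 := norm_sub_norm_le (1:ℂ) (-(conj b * z))
  rw [sub_neg_eq_add, norm_neg, norm_one, norm_mul, RCLike.norm_conj] at h1
  nlinarith [norm_nonneg b, norm_nonneg z]

theorem norm_circleMap_sub_le_of_deriv {F F' : ℂ → ℂ} {C : ℝ} (h : ∀ z : ℂ, ‖z‖ ≤ 1 → HasDerivAt F (F' z) z)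
    (hC : ∀ z : ℂ, ‖z‖ ≤ 1 → ‖F' z‖ ≤ C) (s t : ℝ) :
    ‖F (circleMap 0 1 s) - F (circleMap 0 1 t)‖ ≤ C * ‖circleMap 0 1 s - circleMap 0 1 t‖ := by
  refine (convex_closedBall (0:ℂ) 1).norm_image_sub_le_of_norm_hasDerivWithin_le (f' := F')
    (fun z hz => (h z (by simpa using hz)).hasDerivWithinAt) (fun z hz => hC z (by simpa using hz)) ?_ ?_ <;> simp

theorem isCircleLift_moebiusAngle (hb : ‖b‖ < 1) : IsCircleLift (moebiusAngle b)
    (fun t => (1 - normSq b) / normSq (1 + conj b * circleMap 0 1 t)) ((1 - normSq b) / 4) := by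
  have hb2 : normSq b < 1 := by rw [normSq_eq_norm_sq]; nlinarith [norm_nonneg b]
  refine ⟨by linarith, hasDerivAt_moebiusAngle hb, fun t => ?_, fun t => ?_⟩
  · have h0 := moebius_denom_ne_zero hb (norm_circleMap_one t).le
    refine div_le_div_of_nonneg_left (by linarith) (normSq_pos.2 h0) ?_
    rw [normSq_eq_norm_sq]
    have h1 := norm_add_le (1:ℂ) (conj b * circleMap 0 1 t)
    have h2 := norm_conj_mul_lt_one hb (norm_circleMap_one t).le
    rw [norm_one] at h1
    nlinarith [norm_nonneg (1 + conj b * circleMap 0 1 t)]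
  · simp only [moebiusAngle]
    rw [periodic_circleMap 0 1 t]; ring

/-- On the circle the Möbius image of z is z e^{-2i arg w} with w = 1 + b̄ z. The new phase is φ
composed with the transformation, which stays in H^{1/2}, plus the Lipschitz function -2 arg w. -/
theorem exists_lifting_comp_moebius {h : ℂ → ℂ} {φ : ℂ → ℝ} (hb : ‖b‖ < 1) (hφ : MemHHalf φ)
    (hl : ∀ᵐ t ∂arcMeasure, onCircle h t = circleMap 0 1 t * exp (I * onCircle φ t)) :
    ∃ ψ : ℂ → ℝ, MemHHalf ψ ∧ ∀ᵐ t ∂arcMeasure, onCircle (h ∘ moebius b) t = circleMap 0 1 t * exp (I * onCircle ψ t) := by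
  have hb1 : 0 < 1 - ‖b‖ := by linarith
  have hL := (isCircleLift_moebiusAngle hb)
  have h1 := hL.memHHalf_comp (circleMap_moebiusAngle hb) (L := 2 / (1 - ‖b‖) ^ 2)
    (norm_circleMap_sub_le_of_deriv (fun z hz => hasDerivAt_moebius hb hz) fun z hz => by
      rw [norm_div, norm_pow]
      have h2 := one_sub_le_norm_moebius_denom (b := b) hz
      have h3 : ‖1 - conj b * b‖ ≤ 2 := by
        refine (norm_sub_le _ _).trans ?_
        rw [norm_one]; linarith [norm_conj_mul_lt_one hb hb.le]
      gcongr) hφ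
  set k : ℂ → ℝ := fun z => -(2 * (log (1 + conj b * z)).im) with hk
  have hd : ∀ z : ℂ, ‖z‖ ≤ 1 → HasDerivAt (fun z => log (1 + conj b * z)) (conj b / (1 + conj b * z)) z := fun z hz => by
    have := (((hasDerivAt_id z).const_mul (conj b)).const_add 1).clog (Or.inl (moebius_denom_re_pos hb hz))
    simpa using this
  have h2 : ∀ s t : ℝ, ‖onCircle k s - onCircle k t‖ ≤ (2 / (1 - ‖b‖)) * ‖circleMap 0 1 s - circleMap 0 1 t‖ := fun s t => by
    have h3 := norm_circleMap_sub_le_of_deriv (C := 1 / (1 - ‖b‖)) hd (fun z hz => by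
      rw [norm_div, RCLike.norm_conj]
      have := one_sub_le_norm_moebius_denom (b := b) hz
      gcongr) s t
    have h4 := (abs_im_le_norm _).trans h3
    rw [sub_im] at h4
    simp only [onCircle, hk]
    rw [show -(2 * (log (1 + conj b * circleMap 0 1 s)).im) - -(2 * (log (1 + conj b * circleMap 0 1 t)).im) =
      -(2 * ((log (1 + conj b * circleMap 0 1 s)).im - (log (1 + conj b * circleMap 0 1 t)).im)) by ring,
      norm_neg, norm_mul, Real.norm_eq_abs, Real.norm_eq_abs, abs_two]
    rw [div_mul_eq_mul_div, one_mul] at h4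
    rw [div_mul_eq_mul_div, mul_div_assoc]
    linarith
  have hkc : Continuous (onCircle k) := by
    refine continuous_iff_continuousAt.2 fun t => ?_
    have h5 := (hd _ (norm_circleMap_one t).le).continuousAt.comp (continuous_circleMap 0 1).continuousAt
    exact ((continuous_im.continuousAt.comp h5).const_mul 2).neg
  refine ⟨fun z => (φ ∘ moebius b) z + k z, h1.add_lipschitz hkc h2, ?_⟩
  filter_upwards [hL.ae_comp (circleMap_moebiusAngle hb) (p := fun z => h z = z * exp (I * φ z)) hl] with t ht
  simp only [onCircle, Function.comp_apply]
  rw [ht, ← circleMap_moebiusAngle hb t]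
  nth_rewrite 1 [circleMap, moebiusAngle]
  simp only [circleMap, hk, ofReal_one, one_mul, zero_add]
  rw [← exp_add, ← exp_add]
  congr 1
  push_cast
  ring

end CircleLift

/-! ### Traces on the unit circle -/

section Trace

theorem isOpen_innerAnnulus (ρ : ℝ) : IsOpen (innerAnnulus ρ) := Metric.isOpen_ball.sdiff Metric.isClosed_closedBall

theorem integral_ball_eq_integral_innerAnnulus {ρ : ℝ} {F : ℂ → ℂ} (h : ∀ z ∈ Metric.closedBall (0:ℂ) ρ, F z = 0) :
    ∫ z in Metric.ball (0:ℂ) 1, F z = ∫ z in innerAnnulus ρ, F z := by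
  refine (setIntegral_eq_of_subset_of_forall_diff_eq_zero measurableSet_ball diff_subset fun z hz => h z ?_)
  by_contra hc
  exact hz.2 ⟨hz.1, hc⟩

theorem apply_eq_zero_of_tsupport_subset {ρ : ℝ} {ζ : ℂ → ℝ} (hs : tsupport ζ ⊆ (Metric.closedBall 0 ρ)ᶜ) {z : ℂ}
    (hz : z ∈ Metric.closedBall (0:ℂ) ρ) : ζ z = 0 ∧ fderiv ℝ ζ z = 0 := by
  have h : z ∉ tsupport ζ := fun hc => hs hc hz
  exact ⟨image_eq_zero_of_notMem_tsupport h, fderiv_eq_zero_of_notMem_tsupport h⟩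

/-- Gauss-Green formula on an annulus, for test functions which vanish near the inner circle. -/
theorem integral_innerAnnulus_of_hasFDerivAt {ρ : ℝ} {v : ℂ → ℂ} {Dv : ℂ → ℂ →L[ℝ] ℂ}
    (hv : ∀ z ∈ Metric.closedBall (0:ℂ) 1 \ Metric.closedBall 0 ρ, HasFDerivAt v (Dv z) z)
    (hc : ContinuousOn Dv (Metric.closedBall (0:ℂ) 1 \ Metric.closedBall 0 ρ)) {ζ : ℂ → ℝ} (hζ : ContDiff ℝ ∞ ζ)
    (hs : tsupport ζ ⊆ (Metric.closedBall 0 ρ)ᶜ) (e : ℂ) :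
    ∫ z in innerAnnulus ρ, ((fderiv ℝ ζ z e) • v z + ζ z • Dv z e) =
      ∫ t, (⟪e, circleMap 0 1 t⟫_ℝ * onCircle ζ t) • v (circleMap 0 1 t) ∂arcMeasure := by
  set w' : ℂ → ℂ →L[ℝ] ℂ := fun z => (fderiv ℝ ζ z).smulRight (v z) + ζ z • Dv z with hw'
  have hnear : ∀ z ∈ Metric.closedBall (0:ℂ) ρ, ∀ᶠ y in 𝓝 z, y ∉ tsupport ζ := fun z hz =>
    (isClosed_tsupport ζ).isOpen_compl.mem_nhds fun hc => hs hc hz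
  have hz0 : ∀ y ∉ tsupport ζ, w' y = 0 := fun y hy => by
    simp only [hw', fderiv_eq_zero_of_notMem_tsupport hy, image_eq_zero_of_notMem_tsupport hy]
    ext; simp
  have h1 : ∀ z ∈ Metric.closedBall (0:ℂ) 1, HasFDerivAt (fun z => ζ z • v z) (w' z) z := fun z hz => by
    by_cases hzρ : z ∈ Metric.closedBall (0:ℂ) ρ
    · rw [hz0 z (hnear z hzρ).self_of_nhds]
      refine (hasFDerivAt_const (0:ℂ) z).congr_of_eventuallyEq ?_
      filter_upwards [hnear z hzρ] with y hy
      rw [image_eq_zero_of_notMem_tsupport hy, zero_smul]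
    · refine (((hζ.differentiable (by simp)) z).hasFDerivAt.smul (hv z ⟨hz, hzρ⟩)).congr_fderiv ?_
      rw [hw', add_comm]
  have h2 : ContinuousOn w' (Metric.closedBall 0 1) := fun z hz => by
    by_cases hzρ : z ∈ Metric.closedBall (0:ℂ) ρ
    · refine ContinuousAt.continuousWithinAt ((continuousAt_const (y := 0)).congr ?_)
      filter_upwards [hnear z hzρ] with y hy using (hz0 y hy).symm
    · have h3 : Metric.closedBall (0:ℂ) 1 \ Metric.closedBall 0 ρ ∈ 𝓝[Metric.closedBall 0 1] z := by
        rw [sdiff_eq]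
        exact inter_mem_nhdsWithin _ (Metric.isClosed_closedBall.isOpen_compl.mem_nhds hzρ)
      have h4 : ContinuousWithinAt w' (Metric.closedBall (0:ℂ) 1 \ Metric.closedBall 0 ρ) z := by
        refine ContinuousWithinAt.add ?_ (hζ.continuous.continuousWithinAt.smul (hc z ⟨hz, hzρ⟩))
        have h5 := ((ContinuousLinearMap.smulRightL ℝ ℂ ℂ).continuous₂.continuousAt
          (x := (fderiv ℝ ζ z, v z))).comp_continuousWithinAt (f := fun y => (fderiv ℝ ζ y, v y))
          (s := Metric.closedBall (0:ℂ) 1 \ Metric.closedBall 0 ρ) (x := z)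
          ((hζ.continuous_fderiv (by simp)).continuousWithinAt.prodMk
            (hv z ⟨hz, hzρ⟩).continuousAt.continuousWithinAt)
        exact h5
      exact h4.mono_of_mem_nhdsWithin h3
  have h3 := integral_ball_fderiv h1 h2 e
  rw [integral_ball_eq_integral_innerAnnulus (ρ := ρ) fun z hz => by
    rw [hz0 z (hnear z hz).self_of_nhds]; rfl] at h3
  refine Eq.trans ?_ (h3.trans ?_)
  · simp [hw']
  · simp only [onCircle, mul_smul]

theorem HasCircleTrace.congr {v v' h : ℂ → ℂ} (hv : HasCircleTrace v h)
    (he : ∀ᵐ z ∂(volume.restrict (Metric.ball 0 1)), v z = v' z) : HasCircleTrace v' h := by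
  obtain ⟨hi, ρ, h0, h1, Dv, hm, hg⟩ := hv
  have he' : ∀ᵐ z ∂(volume.restrict (innerAnnulus ρ)), v z = v' z :=
    ae_restrict_of_ae_restrict_of_subset diff_subset he
  refine ⟨hi, ρ, h0, h1, Dv, ⟨hm.1.congr_ae he' (ae_eq_refl _), (memLp_congr_ae he').1 hm.2, hm.3⟩, fun ζ a b c e => ?_⟩
  rw [← hg ζ a b c e]
  exact integral_congr_ae (he'.mono fun z hz => by simp [hz])

theorem integrableOn_ball_dilation {E : Type*} [NormedAddCommGroup E] {K : ℂ → E} (hK : IntegrableOn K (Metric.ball 0 1))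
    {R : ℝ} (hR0 : 0 < R) (hR1 : R < 1) : IntegrableOn (fun z => K (R * z)) (Metric.ball 0 1) := by
  have h1 := ((integrable_indicator_iff measurableSet_ball).2 hK).comp_smul hR0.ne'
  refine (h1.integrableOn (s := Metric.ball 0 1)).congr_fun (fun z hz => ?_) measurableSet_ball
  simp only [real_smul]
  exact indicator_of_mem (ofReal_mul_mem_ball hR0.le hR1 (Metric.ball_subset_closedBall hz)) _

/-- The unit part of the holomorphic function `phaseLift φ`. -/
noncomputable def unitLift (φ : ℂ → ℝ) (z : ℂ) : ℂ := phaseLift φ z / ‖phaseLift φ z‖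

/-- The logarithmic derivative of `phaseLift φ`. -/
noncomputable def phaseLogDeriv (φ : ℂ → ℝ) (z : ℂ) : ℂ := z⁻¹ + I * deriv (herglotz φ) z

variable {φ : ℂ → ℝ} {z : ℂ}

theorem hasDerivAt_phaseLift (φ : ℂ → ℝ) (hz : z ∈ Metric.ball (0:ℂ) 1) (h0 : z ≠ 0) :
    HasDerivAt (phaseLift φ) (phaseLogDeriv φ z * phaseLift φ z) z := by
  have h1 := (hasSum_deriv_herglotz φ hz).1.hasDerivAt
  refine ((hasDerivAt_id z).mul (h1.const_mul I).cexp).congr_deriv ?_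
  simp only [phaseLogDeriv, phaseLift, id]
  field_simp

theorem differentiableAt_phaseLift (φ : ℂ → ℝ) (hz : z ∈ Metric.ball (0:ℂ) 1) : DifferentiableAt ℂ (phaseLift φ) z :=
  differentiableAt_id.mul ((hasSum_deriv_herglotz φ hz).1.const_mul I).cexp

theorem hasFDerivAt_unitLift (φ : ℂ → ℝ) (hz : z ∈ Metric.ball (0:ℂ) 1) (h0 : z ≠ 0) :
    HasFDerivAt (unitLift φ) (circForm (unitLift φ z) (phaseLogDeriv φ z)) z := by
  have h1 := hasFDerivAt_div_norm (hasDerivAt_phaseLift φ hz h0) (phaseLift_ne_zero φ h0)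
  rwa [mul_div_cancel_right₀ _ (phaseLift_ne_zero φ h0)] at h1

theorem norm_unitLift (φ : ℂ → ℝ) (h0 : z ≠ 0) : ‖unitLift φ z‖ = 1 := norm_div_norm (phaseLift_ne_zero φ h0)

theorem continuousOn_phaseLogDeriv (φ : ℂ → ℝ) : ContinuousOn (phaseLogDeriv φ) (Metric.ball 0 1 \ {0}) :=
  (continuousOn_id.inv₀ fun z hz => hz.2).add
    (continuousOn_const.mul ((continuousOn_deriv_herglotz φ).mono diff_subset))

theorem continuousOn_unitLift (φ : ℂ → ℝ) : ContinuousOn (unitLift φ) (Metric.ball 0 1 \ {0}) := fun z hz =>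
  (hasFDerivAt_unitLift φ hz.1 hz.2).continuousAt.continuousWithinAt

theorem continuousOn_circForm_unitLift (φ : ℂ → ℝ) :
    ContinuousOn (fun z => circForm (unitLift φ z) (phaseLogDeriv φ z)) (Metric.ball 0 1 \ {0}) :=
  continuous_circForm.comp_continuousOn (f := fun z => (unitLift φ z, phaseLogDeriv φ z))
    ((continuousOn_unitLift φ).prodMk (continuousOn_phaseLogDeriv φ))

/-- On the circle of radius R the phase is the angle plus Re G, which is the Poisson mean of φ: the
link with the boundary datum. -/
theorem unitLift_circleMap (hφ : Integrable (onCircle φ) arcMeasure) {R : ℝ} (hR0 : 0 < R) (hR1 : R < 1) (t : ℝ) :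
    unitLift φ (R * circleMap 0 1 t) = circleMap 0 1 t * exp (I * poissonMean φ R t) := by
  have e : (R : ℂ) * circleMap 0 1 t = circleMap 0 R t := by simp [circleMap]
  have h1 := re_herglotz hφ hR0.le hR1 t
  rw [unitLift, phaseLift, norm_mul, norm_exp, ← h1, e]
  set G := herglotz φ (circleMap 0 R t)
  have e2 : (I * G).re = -G.im := by simp
  have e3 : exp (I * G) = Real.exp (-G.im) * exp (I * G.re) := by
    rw [ofReal_exp, ← exp_add]
    congr 1
    apply Complex.ext <;> simp
  have e4 : (Real.exp (-G.im) : ℂ) ≠ 0 := by exact_mod_cast (Real.exp_pos _).ne'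
  have hR : (R:ℂ) ≠ 0 := by exact_mod_cast hR0.ne'
  rw [e2, e3, ← e, norm_mul, norm_circleMap_one, norm_real, Real.norm_of_nonneg hR0.le]
  push_cast
  push_cast at e4
  field_simp

theorem ball_restrict_eq : volume.restrict (Metric.ball (0:ℂ) 1 \ {0}) = volume.restrict (Metric.ball (0:ℂ) 1) :=
  Measure.restrict_congr_set (diff_null_ae_eq_self (measure_singleton 0))

theorem aestronglyMeasurable_ball_of_continuousOn {E : Type*} [NormedAddCommGroup E] [SecondCountableTopology E] {F : ℂ → E}
    (hF : ContinuousOn F (Metric.ball 0 1 \ {0})) : AEStronglyMeasurable F (volume.restrict (Metric.ball 0 1)) := by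
  rw [← ball_restrict_eq]
  exact hF.aestronglyMeasurable (measurableSet_ball.diff (measurableSet_singleton 0))

theorem integrableOn_unitLift (φ : ℂ → ℝ) : IntegrableOn (unitLift φ) (Metric.ball 0 1) := by
  refine Integrable.of_bound (aestronglyMeasurable_ball_of_continuousOn (continuousOn_unitLift φ)) 1 ?_
  filter_upwards [ae_ball_ne_zero] with z hz using (norm_unitLift φ hz).le

theorem integrableOn_phaseLogDeriv (hφ : MemHHalf φ) : IntegrableOn (phaseLogDeriv φ) (Metric.ball 0 1) := by
  refine integrableOn_fun_add ?_ ((integrableOn_deriv_herglotz hφ).const_mul I)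
  refine integrableOn_ball_of_norm_le (measurable_inv.aestronglyMeasurable) (C := 1) fun z _ _ => ?_
  rw [norm_inv, one_mul]

theorem integrableOn_circForm_unitLift (hφ : MemHHalf φ) :
    IntegrableOn (fun z => circForm (unitLift φ z) (phaseLogDeriv φ z)) (Metric.ball 0 1) := by
  refine Integrable.mono (integrableOn_phaseLogDeriv hφ)
    (aestronglyMeasurable_ball_of_continuousOn (continuousOn_circForm_unitLift φ)) ?_
  filter_upwards [ae_ball_ne_zero] with z hz using norm_circForm_le (norm_unitLift φ hz) _

theorem innerAnnulus_subset {ρ : ℝ} (hρ : 0 ≤ ρ) : innerAnnulus ρ ⊆ Metric.ball 0 1 \ {0} := fun z hz =>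
  ⟨hz.1, fun h => hz.2 (by rw [mem_singleton_iff.1 h]; simpa using hρ)⟩

/-- The term 1 / z is not square integrable at 0, hence the annulus; the other term has finite norm
on the whole disk because φ is in H^{1/2}. -/
theorem memLp_phaseLogDeriv (hφ : MemHHalf φ) {ρ : ℝ} (hρ : 0 < ρ) :
    MemLp (phaseLogDeriv φ) 2 (volume.restrict (innerAnnulus ρ)) := by
  have hsub : innerAnnulus ρ ⊆ Metric.ball 0 1 := diff_subset
  have : IsFiniteMeasure (volume.restrict (innerAnnulus ρ)) :=
    ⟨by rw [Measure.restrict_apply_univ]; exact (measure_mono hsub).trans_lt measure_ball_lt_top⟩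
  have h1 : MemLp (fun z : ℂ => z⁻¹) 2 (volume.restrict (innerAnnulus ρ)) := by
    refine MemLp.of_bound measurable_inv.aestronglyMeasurable ρ⁻¹ ?_
    rw [ae_restrict_iff' (isOpen_innerAnnulus ρ).measurableSet]
    refine ae_of_all _ fun z hz => ?_
    have : ρ < ‖z‖ := by simpa [innerAnnulus] using hz.2
    rw [norm_inv]
    gcongr
  exact h1.add (((memLp_deriv_herglotz hφ).mono_measure (Measure.restrict_mono hsub le_rfl)).const_mul I)

theorem memH1_unitLift (hφ : MemHHalf φ) {ρ : ℝ} (hρ : 0 < ρ) :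
    MemH1 (innerAnnulus ρ) (unitLift φ) (fun z => circForm (unitLift φ z) (phaseLogDeriv φ z)) := by
  have hs := innerAnnulus_subset hρ.le
  have hsub : innerAnnulus ρ ⊆ Metric.ball 0 1 := diff_subset
  have hm := (isOpen_innerAnnulus ρ).measurableSet
  have : IsFiniteMeasure (volume.restrict (innerAnnulus ρ)) :=
    ⟨by rw [Measure.restrict_apply_univ]; exact (measure_mono hsub).trans_lt measure_ball_lt_top⟩
  refine ⟨hasWeakFDeriv_of_hasFDerivAt (isOpen_innerAnnulus ρ)
    (fun z hz => hasFDerivAt_unitLift φ (hs hz).1 (hs hz).2) ((continuousOn_circForm_unitLift φ).mono hs), ?_, ?_⟩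
  · refine MemLp.of_bound (((continuousOn_unitLift φ).mono hs).aestronglyMeasurable hm) 1 ?_
    rw [ae_restrict_iff' hm]
    exact ae_of_all _ fun z hz => (norm_unitLift φ (hs hz).2).le
  · refine (memLp_phaseLogDeriv hφ hρ).mono (((continuousOn_circForm_unitLift φ).mono hs).aestronglyMeasurable hm) ?_
    rw [ae_restrict_iff' hm]
    exact ae_of_all _ fun z hz => norm_circForm_le (norm_unitLift φ (hs hz).2) _

/-- The dilated map z ↦ u(R z) is smooth up to the circle, where Gauss-Green is classical. As R → 1
the interior terms converge by continuity of dilations, and the boundary terms because |e^{ix} -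
e^{iy}| ≤ |x - y| and Poisson means converge to φ in L¹. -/
theorem hasCircleTrace_unitLift {h : ℂ → ℂ} (hφ : MemHHalf φ)
    (hl : ∀ᵐ t ∂arcMeasure, onCircle h t = circleMap 0 1 t * exp (I * onCircle φ t)) :
    HasCircleTrace (unitLift φ) h := by
  have hh := memHHalfCircle_of_lifting hφ hl
  refine ⟨hh.1.integrable, 1 / 2, by norm_num, by norm_num, _, memH1_unitLift hφ (by norm_num), fun ζ hζ hζc hζs e => ?_⟩
  set ρ : ℝ := 1 / 2
  set U := unitLift φ
  set D : ℂ → ℂ →L[ℝ] ℂ := fun z => circForm (U z) (phaseLogDeriv φ z)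
  have hdc : Continuous fun z => fderiv ℝ ζ z e := (hζ.continuous_fderiv (by simp)).clm_apply continuous_const
  have iD : IntegrableOn (fun z => D z e) (Metric.ball 0 1) := (integrableOn_circForm_unitLift hφ).apply_continuousLinearMap e
  have ibdd : ∀ {ξ : ℂ → ℝ} {K : ℂ → ℂ}, Continuous ξ → IntegrableOn K (Metric.ball 0 1) →
      IntegrableOn (fun z => ξ z • K z) (Metric.ball 0 1) := fun {ξ K} hξ hK => by
    obtain ⟨M, hM⟩ := (isCompact_closedBall (0:ℂ) 1).exists_bound_of_continuousOn hξ.continuousOn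
    refine Integrable.bdd_smul hK M hξ.aestronglyMeasurable ?_
    rw [ae_restrict_iff' measurableSet_ball]
    exact ae_of_all _ fun z hz => hM z (Metric.ball_subset_closedBall hz)
  -- the formula on the dilated domains
  have key : ∀ R ∈ Ioo (0:ℝ) 1, (∫ z in Metric.ball (0:ℂ) 1, fderiv ℝ ζ z e • U (R * z)) +
      R • ∫ z in Metric.ball (0:ℂ) 1, ζ z • D (R * z) e =
      ∫ t, (⟪e, circleMap 0 1 t⟫_ℝ * onCircle ζ t) • U (R * circleMap 0 1 t) ∂arcMeasure := fun R hR => by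
    have hmem : ∀ z ∈ Metric.closedBall (0:ℂ) 1 \ Metric.closedBall 0 ρ, (R:ℂ) * z ∈ Metric.ball (0:ℂ) 1 \ {0} :=
      fun z hz => ⟨ofReal_mul_mem_ball hR.1.le hR.2 hz.1, fun h0 => by
        rcases mul_eq_zero.1 (mem_singleton_iff.1 h0) with h | h
        · exact hR.1.ne' (by exact_mod_cast h)
        · exact hz.2 (by rw [h]; simp [ρ])⟩
    have h1 : ∀ z ∈ Metric.closedBall (0:ℂ) 1 \ Metric.closedBall 0 ρ,
        HasFDerivAt (fun z => U (R * z)) (R • D (R * z)) z := fun z hz => by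
      have h2 : HasFDerivAt (fun z : ℂ => (R:ℂ) * z) (R • ContinuousLinearMap.id ℝ ℂ) z := by
        have := (hasFDerivAt_id (𝕜 := ℝ) z).const_smul R
        simpa [real_smul] using! this
      refine ((hasFDerivAt_unitLift φ (hmem z hz).1 (hmem z hz).2).comp z h2).congr_fderiv ?_
      refine ContinuousLinearMap.ext fun y => ?_
      change circForm (U (R * z)) (phaseLogDeriv φ (R * z)) (R • y) = _
      rw [map_smul]; rfl
    have h2 := integral_innerAnnulus_of_hasFDerivAt h1 (ContinuousOn.const_smul
      ((continuousOn_circForm_unitLift φ).comp (by fun_prop) hmem) R) hζ hζs e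
    rw [← h2, ← integral_ball_eq_integral_innerAnnulus (ρ := ρ), ← integral_smul, ← integral_add]
    · refine integral_congr_ae (ae_of_all _ fun z => ?_)
      simp only [FunLike.coe_smul, Pi.smul_apply]
      rw [smul_comm]
    · exact ibdd hdc (integrableOn_ball_dilation (integrableOn_unitLift φ) hR.1 hR.2)
    · exact (ibdd hζ.continuous (integrableOn_ball_dilation iD hR.1 hR.2)).smul R
    · intro z hz
      obtain ⟨h3, h4⟩ := apply_eq_zero_of_tsupport_subset hζs hz
      simp [h3, h4]
  have hev : ∀ᶠ R : ℝ in 𝓝[<] 1, R ∈ Ioo (0:ℝ) 1 := Ioo_mem_nhdsLT one_pos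
  have hid : Tendsto (fun R : ℝ => R) (𝓝[<] 1) (𝓝 1) := tendsto_id.mono_left nhdsWithin_le_nhds
  have hleft := (tendsto_integral_dilation (integrableOn_unitLift φ) hdc).add
    (hid.smul (tendsto_integral_dilation iD hζ.continuous))
  have hright : Tendsto (fun R : ℝ => ∫ t, (⟪e, circleMap 0 1 t⟫_ℝ * onCircle ζ t) • U (R * circleMap 0 1 t) ∂arcMeasure)
      (𝓝[<] 1) (𝓝 (∫ t, (⟪e, circleMap 0 1 t⟫_ℝ * onCircle ζ t) • onCircle h t ∂arcMeasure)) := by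
    set c : ℝ → ℝ := fun t => ⟪e, circleMap 0 1 t⟫_ℝ * onCircle ζ t
    have hcc : Continuous c := (continuous_const.inner (continuous_circleMap 0 1)).mul (continuous_onCircle hζ.continuous)
    obtain ⟨M, hM⟩ := (isCompact_Icc (a := (0:ℝ)) (b := 2 * Real.pi)).exists_bound_of_continuousOn hcc.continuousOn
    have hMae : ∀ᵐ t ∂arcMeasure, ‖c t‖ ≤ M := by
      rw [arcMeasure, ae_restrict_iff' measurableSet_Ioc]
      exact ae_of_all _ fun t ht => hM t (Ioc_subset_Icc_self ht)
    rw [tendsto_iff_norm_sub_tendsto_zero]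
    refine squeeze_zero' (Eventually.of_forall fun _ => norm_nonneg _) ?_
      (by simpa using (tendsto_integral_abs_poissonMean_sub hφ).const_mul M)
    filter_upwards [hev] with R hR
    have hpc := continuous_poissonMean hR.1.le hR.2 hφ.integrable
    have hUc : Continuous fun t => U (R * circleMap 0 1 t) := by
      simp only [U, unitLift_circleMap hφ.integrable hR.1 hR.2]
      have := continuous_circleMap 0 1
      fun_prop
    have i1 : Integrable (fun t => c t • U (R * circleMap 0 1 t)) arcMeasure :=
      integrable_of_continuous_arc (hcc.smul hUc)
    have i2 : Integrable (fun t => c t • onCircle h t) arcMeasure :=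
      Integrable.bdd_smul hh.1.integrable M hcc.aestronglyMeasurable hMae
    rw [← integral_sub i1 i2, ← integral_const_mul]
    refine norm_integral_le_of_norm_le ((((integrable_of_continuous_arc hpc).sub hφ.integrable).abs).const_mul M) ?_
    filter_upwards [hl, hMae] with t ht hMt
    rw [← smul_sub, norm_smul]
    refine mul_le_mul hMt ?_ (norm_nonneg _) ((norm_nonneg _).trans hMt)
    rw [show U (R * circleMap 0 1 t) = _ from unitLift_circleMap hφ.integrable hR.1 hR.2 t, ht, ← mul_sub, norm_mul,
      norm_circleMap_one, one_mul]
    exact norm_exp_I_mul_sub_le _ _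
  have hlim := tendsto_nhds_unique (hleft.congr' (by filter_upwards [hev] with R hR using key R hR)) hright
  rw [← hlim, one_smul, ← integral_ball_eq_integral_innerAnnulus (ρ := ρ), integral_add
    (ibdd hdc (integrableOn_unitLift φ)) (ibdd hζ.continuous iD)]
  intro z hz
  obtain ⟨h3, h4⟩ := apply_eq_zero_of_tsupport_subset hζs hz
  simp [h3, h4]

end Trace

/-! ### The degree of the unit part of a holomorphic function at a simple zero -/

section Degree

/-- Classical Gauss-Green for a map smooth across the circle. The centre is excluded because the
unit part of a function with a zero there is singular. -/
theorem hasCircleTrace_of_contDiffOn {v : ℂ → ℂ} {W : Set ℂ} (hW : IsOpen W) (hv : ContDiffOn ℝ ∞ v W)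
    (hs : Metric.closedBall (0:ℂ) 1 \ {0} ⊆ W) : HasCircleTrace v v := by
  have hd : ∀ z ∈ W, HasFDerivAt v (fderiv ℝ v z) z := fun z hz =>
    ((hv.contDiffAt (hW.mem_nhds hz)).differentiableAt (by simp)).hasFDerivAt
  have hdc : ContinuousOn (fderiv ℝ v) W := hv.continuousOn_fderiv_of_isOpen hW (by simp)
  have h1 : Metric.closedBall (0:ℂ) 1 \ Metric.closedBall 0 (1 / 2) ⊆ W := fun z hz =>
    hs ⟨hz.1, fun h => hz.2 (by rw [mem_singleton_iff.1 h]; simp)⟩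
  have h2 : innerAnnulus (1 / 2) ⊆ W := (diff_subset_diff_left Metric.ball_subset_closedBall).trans h1
  have hK : IsCompact (Metric.closedBall (0:ℂ) 1 \ Metric.ball 0 (1 / 2)) :=
    (isCompact_closedBall 0 1).diff Metric.isOpen_ball
  have hKW : Metric.closedBall (0:ℂ) 1 \ Metric.ball 0 (1 / 2) ⊆ W := fun z hz =>
    hs ⟨hz.1, fun h => hz.2 (by rw [mem_singleton_iff.1 h]; simp)⟩
  have hsK : innerAnnulus (1 / 2) ⊆ Metric.closedBall (0:ℂ) 1 \ Metric.ball 0 (1 / 2) :=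
    diff_subset_diff Metric.ball_subset_closedBall Metric.ball_subset_closedBall
  have hm := (isOpen_innerAnnulus (1 / 2)).measurableSet
  have : IsFiniteMeasure (volume.restrict (innerAnnulus (1 / 2))) :=
    ⟨by rw [Measure.restrict_apply_univ]; exact (measure_mono hsK).trans_lt hK.measure_lt_top⟩
  have hb : ∀ {E : Type} [NormedAddCommGroup E] [SecondCountableTopology E] {F : ℂ → E}, ContinuousOn F W →
      MemLp F 2 (volume.restrict (innerAnnulus (1 / 2))) := fun {E _ _ F} hF => by
    obtain ⟨M, hM⟩ := hK.exists_bound_of_continuousOn (hF.mono hKW)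
    refine MemLp.of_bound ((hF.mono h2).aestronglyMeasurable hm) M ?_
    rw [ae_restrict_iff' hm]
    exact ae_of_all _ fun z hz => hM z (hsK hz)
  refine ⟨integrable_of_continuous_arc ?_, 1 / 2, by norm_num, by norm_num, fderiv ℝ v,
    ⟨hasWeakFDeriv_of_hasFDerivAt (isOpen_innerAnnulus _) (fun z hz => hd z (h2 hz)) (hdc.mono h2),
      hb hv.continuousOn, hb hdc⟩, fun ζ hζ _ hζs e => ?_⟩
  · refine hv.continuousOn.comp_continuous (continuous_circleMap 0 1) fun t => hs ⟨by simp, fun h => ?_⟩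
    have := norm_circleMap_one t
    rw [mem_singleton_iff.1 h, norm_zero] at this
    exact zero_ne_one this
  · exact integral_innerAnnulus_of_hasFDerivAt (fun z hz => hd z (h1 hz)) (hdc.mono h1) hζ hζs e

/-- Write q(z) = (z - a) k(z) with k(a) = q'(a) ≠ 0. On a small circle the unit part of q is the
unit part of z - a times that of k, and the latter has the Lipschitz phase arg k(a) + Im log (k /
k(a)), since k / k(a) stays near 1. -/
theorem hasDegreeAt_div_norm {q : ℂ → ℂ} {Ω : Set ℂ} {a : ℂ} (hΩ : IsOpen Ω) (ha : a ∈ Ω) (hq : DifferentiableOn ℂ q Ω)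
    (h0 : ∀ z ∈ Ω \ {a}, q z ≠ 0) (hqa : q a = 0) (hq' : deriv q a ≠ 0) :
    HasDegreeAt (fun z => q z / ‖q z‖) a 1 := by
  set k := dslope q a with hk
  have hka : k a = deriv q a := dslope_same _ _
  have hkd : DifferentiableOn ℂ k Ω := (differentiableOn_dslope (hΩ.mem_nhds ha)).2 hq
  have hkc : ContinuousAt (fun z => k z / k a) a :=
    ((hkd.differentiableAt (hΩ.mem_nhds ha)).continuousAt).div_const _
  have hev : ∀ᶠ z in 𝓝 a, k z / k a ∈ slitPlane ∧ z ∈ Ω :=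
    (hkc.eventually_mem (isOpen_slitPlane.mem_nhds (by
      rw [div_self (by rwa [hka])]; exact one_mem_slitPlane))).and (hΩ.mem_nhds ha)
  obtain ⟨r₀, hr₀, hb⟩ := Metric.eventually_nhds_iff_ball.1 hev
  have hka0 : k a ≠ 0 := by rwa [hka]
  refine ⟨r₀, hr₀, fun r hr hr1 => ?_⟩
  have hmem : ∀ z : ℂ, ‖z‖ ≤ 1 → a + r * z ∈ Metric.ball a r₀ := fun z hz => by
    rw [mem_ball_iff_norm, add_sub_cancel_left, norm_mul, norm_real, Real.norm_of_nonneg hr.le]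
    nlinarith
  have hmr : ∀ z : ℂ, HasDerivAt (fun z : ℂ => a + r * z) r z := fun z => by
    simpa using ((hasDerivAt_id z).const_mul (r:ℂ)).const_add a
  set F : ℂ → ℂ := fun z => log (k (a + r * z) / k a) with hF
  set F' : ℂ → ℂ := fun z => (deriv k (a + r * z) * r / k a) / (k (a + r * z) / k a) with hF'
  have hFd : ∀ z : ℂ, ‖z‖ ≤ 1 → HasDerivAt F (F' z) z := fun z hz => by
    have h1 := hb _ (hmem z hz)
    have h2 := (hkd.differentiableAt (hΩ.mem_nhds h1.2)).hasDerivAt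
    exact ((h2.comp z (hmr z)).div_const (k a)).clog h1.1
  have hF'c : ContinuousOn F' (Metric.closedBall 0 1) := by
    have hm : MapsTo (fun z : ℂ => a + r * z) (Metric.closedBall 0 1) Ω := fun z hz =>
      (hb _ (hmem z (by simpa using hz))).2
    have h3 : ContinuousOn (fun z : ℂ => a + r * z) (Metric.closedBall 0 1) := by fun_prop
    refine ContinuousOn.div ?_ ((hkd.continuousOn.comp h3 hm).div_const _) fun z hz h => ?_
    · exact (((hkd.deriv hΩ).continuousOn.comp h3 hm).mul continuousOn_const).div_const _
    · have := (hb _ (hmem z (by simpa using hz))).1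
      rw [h] at this
      exact zero_notMem_slitPlane this
  obtain ⟨C, hC⟩ := (isCompact_closedBall (0:ℂ) 1).exists_bound_of_continuousOn hF'c
  set φ : ℂ → ℝ := fun z => arg (k a) + (F z).im with hφdef
  have hφ : MemHHalf φ := by
    refine memHHalf_of_lipschitz (C := C) ?_ fun s t => ?_
    · refine continuous_iff_continuousAt.2 fun t => ?_
      exact continuousAt_const.add (continuous_im.continuousAt.comp
        ((hFd _ (norm_circleMap_one t).le).continuousAt.comp (continuous_circleMap 0 1).continuousAt))
    · refine le_trans ?_ (norm_circleMap_sub_le_of_deriv hFd (fun z hz => hC z (by simpa using hz)) s t)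
      simp only [onCircle, hφdef, add_sub_add_left_eq_sub]
      rw [← sub_im, Real.norm_eq_abs]
      exact abs_im_le_norm _
  set v : ℂ → ℂ := fun z => q (a + r * z) / ‖q (a + r * z)‖ with hv
  have hl : ∀ᵐ t ∂arcMeasure, onCircle v t = circleMap 0 1 t * exp (I * onCircle φ t) := ae_of_all _ fun t => by
    set z := circleMap 0 1 t with hz
    have hz1 : ‖z‖ = 1 := norm_circleMap_one t
    have h1 := (hb _ (hmem z hz1.le)).1
    have hk0 : k (a + r * z) ≠ 0 := fun h => by
      rw [h, zero_div] at h1; exact zero_notMem_slitPlane h1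
    have h2 : q (a + r * z) = r * z * k (a + r * z) := by
      have := sub_smul_dslope q a (a + r * z)
      rw [hqa, sub_zero, add_sub_cancel_left, smul_eq_mul] at this
      exact this.symm
    have h3 := div_norm_eq_mul_exp hk0 hka0
    have h4 : k a / ‖k a‖ = exp (I * arg (k a)) := by
      rw [div_eq_iff (by simpa using hka0), mul_comm I, mul_comm]
      exact (norm_mul_exp_arg_mul_I _).symm
    have hr' : (r:ℂ) ≠ 0 := by exact_mod_cast hr.ne'
    change q (a + r * z) / ‖q (a + r * z)‖ = z * exp (I * φ z)
    rw [h2, norm_mul, norm_mul, hz1, norm_real, Real.norm_of_nonneg hr.le, mul_one, hφdef]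
    push_cast
    rw [mul_add, exp_add, ← h4, ← h3]
    have : (‖k (a + r * z)‖ : ℂ) ≠ 0 := by simpa using hk0
    field_simp
  have hcirc := memHHalfCircle_of_lifting hφ hl
  refine ⟨v, ?_, hcirc, φ, hφ, by simpa using hl⟩
  have hΩ' : IsOpen (Ω \ {a}) := hΩ.sdiff isClosed_singleton
  refine hasCircleTrace_of_contDiffOn (W := (fun z : ℂ => a + r * z) ⁻¹' (Ω \ {a})) (hΩ'.preimage (by fun_prop)) ?_
    fun z hz => ⟨(hb _ (hmem z (by simpa using hz.1))).2, fun h => ?_⟩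
  · exact (contDiffOn_div_norm hΩ' (hq.mono diff_subset) h0).comp (t := Ω \ {a})
      (f := fun z : ℂ => a + r * z) (by fun_prop) fun z hz => hz
  · rw [mem_singleton_iff, add_eq_left, mul_eq_zero] at h
    exact h.elim (fun h => hr.ne' (by exact_mod_cast h)) hz.2

end Degree

/-! ### The canonical map -/

section Canonical

variable {f : ℂ → ℂ} {Ω : Set ℂ} {φ : ℂ → ℝ}

/-- The logarithmic derivative of `phaseLift φ ∘ f⁻¹`. -/
noncomputable def pullbackLogDeriv (φ : ℂ → ℝ) (f : ℂ → ℂ) (w : ℂ) : ℂ :=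
  phaseLogDeriv φ (uniformizationInv f w) * (deriv f (uniformizationInv f w))⁻¹

namespace IsUniformization

theorem isOpen_diff (hf : IsUniformization f Ω) (a : ℂ) : IsOpen (Ω \ {a}) := hf.isOpen.sdiff isClosed_singleton

theorem inv_mem_diff (hf : IsUniformization f Ω) {w : ℂ} (hw : w ∈ Ω \ {f 0}) :
    uniformizationInv f w ∈ Metric.ball (0:ℂ) 1 \ {0} :=
  ⟨hf.inv_mem hw.1, fun h => hw.2 ((hf.inv_eq_zero_iff hw.1).1 h)⟩

theorem differentiableOn_phaseLift (hf : IsUniformization f Ω) (φ : ℂ → ℝ) :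
    DifferentiableOn ℂ (phaseLift φ ∘ uniformizationInv f) Ω := fun _ hw =>
  ((differentiableAt_phaseLift φ (hf.inv_mem hw)).comp _ (hf.differentiableAt_inv hw)).differentiableWithinAt

theorem hasDerivAt_phaseLift (hf : IsUniformization f Ω) (φ : ℂ → ℝ) {w : ℂ} (hw : w ∈ Ω \ {f 0}) :
    HasDerivAt (phaseLift φ ∘ uniformizationInv f)
      (pullbackLogDeriv φ f w * phaseLift φ (uniformizationInv f w)) w := by
  have h := hf.inv_mem_diff hw
  refine ((_root_.hasDerivAt_phaseLift φ h.1 h.2).comp w (hf.hasDerivAt_inv hw.1)).congr_deriv ?_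
  rw [pullbackLogDeriv]; ring

theorem phaseLift_inv_ne_zero (hf : IsUniformization f Ω) (φ : ℂ → ℝ) {w : ℂ} (hw : w ∈ Ω \ {f 0}) :
    phaseLift φ (uniformizationInv f w) ≠ 0 :=
  phaseLift_ne_zero φ (hf.inv_mem_diff hw).2

theorem hasFDerivAt_unitLift (hf : IsUniformization f Ω) (φ : ℂ → ℝ) {w : ℂ} (hw : w ∈ Ω \ {f 0}) :
    HasFDerivAt (unitLift φ ∘ uniformizationInv f)
      (circForm (unitLift φ (uniformizationInv f w)) (pullbackLogDeriv φ f w)) w := by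
  have h1 := hasFDerivAt_div_norm (hf.hasDerivAt_phaseLift φ hw) (hf.phaseLift_inv_ne_zero φ hw)
  rwa [Function.comp_apply, mul_div_cancel_right₀ _ (hf.phaseLift_inv_ne_zero φ hw)] at h1

theorem hasFDerivAt_log_norm (hf : IsUniformization f Ω) (φ : ℂ → ℝ) {w : ℂ} (hw : w ∈ Ω \ {f 0}) :
    HasFDerivAt (fun w => Real.log ‖phaseLift φ (uniformizationInv f w)‖) (reForm (pullbackLogDeriv φ f w)) w := by
  have h1 := _root_.hasFDerivAt_log_norm (hf.hasDerivAt_phaseLift φ hw) (hf.phaseLift_inv_ne_zero φ hw)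
  rwa [Function.comp_apply, mul_div_cancel_right₀ _ (hf.phaseLift_inv_ne_zero φ hw)] at h1

theorem continuousOn_pullbackLogDeriv (hf : IsUniformization f Ω) (φ : ℂ → ℝ) :
    ContinuousOn (pullbackLogDeriv φ f) (Ω \ {f 0}) := by
  have h1 : ContinuousOn (uniformizationInv f) (Ω \ {f 0}) := fun w hw =>
    (hf.continuousAt_inv hw.1).continuousWithinAt
  have h2 : MapsTo (uniformizationInv f) (Ω \ {f 0}) (Metric.ball 0 1 \ {0}) := fun w hw => hf.inv_mem_diff hw
  refine ((continuousOn_phaseLogDeriv φ).comp h1 h2).mul (ContinuousOn.inv₀ ?_ fun w hw => hf.deriv_ne_zero (h2 hw).1)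
  exact ((hf.holo.deriv Metric.isOpen_ball).continuousOn).comp h1 fun w hw => (h2 hw).1

theorem continuousOn_unitLift (hf : IsUniformization f Ω) (φ : ℂ → ℝ) :
    ContinuousOn (unitLift φ ∘ uniformizationInv f) (Ω \ {f 0}) := fun w hw =>
  (hf.hasFDerivAt_unitLift φ hw).continuousAt.continuousWithinAt

theorem continuousOn_circForm (hf : IsUniformization f Ω) (φ : ℂ → ℝ) :
    ContinuousOn (fun w => circForm (unitLift φ (uniformizationInv f w)) (pullbackLogDeriv φ f w)) (Ω \ {f 0}) :=
  continuous_circForm.comp_continuousOn (f := fun w => (unitLift φ (uniformizationInv f w), pullbackLogDeriv φ f w))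
    ((hf.continuousOn_unitLift φ).prodMk (hf.continuousOn_pullbackLogDeriv φ))

theorem hasWeakFDeriv_unitLift (hf : IsUniformization f Ω) (φ : ℂ → ℝ) :
    HasWeakFDeriv (Ω \ {f 0}) (unitLift φ ∘ uniformizationInv f)
      (fun w => circForm (unitLift φ (uniformizationInv f w)) (pullbackLogDeriv φ f w)) :=
  hasWeakFDeriv_of_hasFDerivAt (hf.isOpen_diff _) (fun _ hw => hf.hasFDerivAt_unitLift φ hw) (hf.continuousOn_circForm φ)

theorem hasWeakFDeriv_log_norm (hf : IsUniformization f Ω) (φ : ℂ → ℝ) :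
    HasWeakFDeriv (Ω \ {f 0}) (fun w => Real.log ‖phaseLift φ (uniformizationInv f w)‖)
      (fun w => reForm (pullbackLogDeriv φ f w)) :=
  hasWeakFDeriv_of_hasFDerivAt (hf.isOpen_diff _) (fun _ hw => hf.hasFDerivAt_log_norm φ hw)
    (continuous_reForm.comp_continuousOn (hf.continuousOn_pullbackLogDeriv φ))

/-- The real Jacobian of a holomorphic map is the square of the modulus of its derivative: the
source of the conformal invariance of the Dirichlet integral. -/
theorem lintegral_comp_inv_mul (hf : IsUniformization f Ω) {s : Set ℂ} (hs : MeasurableSet s) (hsΩ : s ⊆ Ω)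
    (F : ℂ → ℝ≥0∞) : ∫⁻ z in uniformizationInv f '' s, F z =
      ∫⁻ w in s, ‖(deriv f (uniformizationInv f w))⁻¹‖ₑ ^ 2 * F (uniformizationInv f w) := by
  have hinj : InjOn (uniformizationInv f) s := fun w hw w' hw' h => by
    rw [← hf.apply_inv (hsΩ hw), h, hf.apply_inv (hsΩ hw')]
  rw [lintegral_image_eq_lintegral_abs_det_fderiv_mul volume hs (fun w hw =>
    (hf.hasDerivAt_inv (hsΩ hw)).complexToReal_fderiv.hasFDerivWithinAt) hinj]
  refine lintegral_congr fun w => ?_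
  congr 1
  set c := (deriv f (uniformizationInv f w))⁻¹
  have e1 : (c • (1 : ℂ →L[ℝ] ℂ)).det = normSq c := by
    rw [← Algebra.norm_complex_apply, ContinuousLinearMap.det]
    have e2 := LinearMap.det_restrictScalars (R := ℝ) (f := c • (LinearMap.id : ℂ →ₗ[ℂ] ℂ))
    rw [LinearMap.det_ring] at e2
    simp only [LinearMap.smul_apply, LinearMap.id_coe, id, smul_eq_mul, mul_one] at e2
    rw [← e2]; rfl
  rw [e1, abs_of_nonneg (normSq_nonneg _), normSq_eq_norm_sq, ENNReal.ofReal_pow (norm_nonneg _), ofReal_norm]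

/-- By conformal invariance the norm of du on C ∩ Ω is controlled on its preimage in the disk. As C
is compact and misses f(0), this preimage avoids a neighbourhood of 0, and it may reach the circle
freely; nothing is asked of f near the boundary. -/
theorem memH1LocPunctured_unitLift (hf : IsUniformization f Ω) (hφ : MemHHalf φ) :
    MemH1LocPunctured Ω (f 0) (unitLift φ ∘ uniformizationInv f) := by
  refine ⟨_, hf.hasWeakFDeriv_unitLift φ, fun C hC hCs => ?_⟩
  have hm : MeasurableSet (C ∩ Ω) := hC.measurableSet.inter hf.isOpen.measurableSet
  have hsub : C ∩ Ω ⊆ Ω \ {f 0} := fun w hw => ⟨hw.2, (hCs hw.1).2⟩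
  have : IsFiniteMeasure (volume.restrict (C ∩ Ω)) :=
    ⟨by rw [Measure.restrict_apply_univ]; exact (measure_mono inter_subset_left).trans_lt hC.measure_lt_top⟩
  have hn : ∀ᵐ w ∂(volume.restrict (C ∩ Ω)), ‖unitLift φ (uniformizationInv f w)‖ = 1 := by
    rw [ae_restrict_iff' hm]
    exact ae_of_all _ fun w hw => norm_unitLift φ (hf.inv_mem_diff (hsub hw)).2
  refine ⟨MemLp.of_bound (((hf.continuousOn_unitLift φ).mono hsub).aestronglyMeasurable hm) 1
    (hn.mono fun w hw => hw.le), ?_⟩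
  have hl : MemLp (pullbackLogDeriv φ f) 2 (volume.restrict (C ∩ Ω)) := by
    refine ⟨((hf.continuousOn_pullbackLogDeriv φ).mono hsub).aestronglyMeasurable hm, ?_⟩
    obtain ⟨ρ, hρ, hρs⟩ : ∃ ρ : ℝ, 0 < ρ ∧ uniformizationInv f '' (C ∩ Ω) ⊆ innerAnnulus ρ := by
      have h1 : Cᶜ ∈ 𝓝 (f 0) := hC.isClosed.isOpen_compl.mem_nhds fun h => (hCs h).2 rfl
      have h2 : f ⁻¹' Cᶜ ∈ 𝓝 0 := (hf.analyticAt (by simp)).continuousAt h1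
      obtain ⟨ε, hε, hb⟩ := Metric.mem_nhds_iff.1 h2
      refine ⟨ε / 2, by positivity, ?_⟩
      rintro _ ⟨w, hw, rfl⟩
      refine ⟨hf.inv_mem hw.2, fun hc => ?_⟩
      have h3 := hb (Metric.closedBall_subset_ball (by linarith) hc)
      rw [mem_preimage, hf.apply_inv hw.2] at h3
      exact h3 hw.1
    have h1 := (memLp_phaseLogDeriv hφ hρ).eLpNorm_lt_top
    rw [eLpNorm_lt_top_iff_lintegral_rpow_enorm_lt_top two_ne_zero ENNReal.ofNat_ne_top] at h1 ⊢
    have h2 := (lintegral_mono_set hρs).trans_lt h1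
    rw [hf.lintegral_comp_inv_mul hm inter_subset_right] at h2
    refine lt_of_eq_of_lt (lintegral_congr fun w => ?_) h2
    rw [pullbackLogDeriv, enorm_mul, ENNReal.toReal_ofNat, ENNReal.rpow_ofNat, ENNReal.rpow_ofNat, mul_pow, mul_comm]
  refine hl.mono (((hf.continuousOn_circForm φ).mono hsub).aestronglyMeasurable hm) ?_
  exact hn.mono fun w hw => norm_circForm_le hw _

theorem hasDegreeAt_unitLift (hf : IsUniformization f Ω) (φ : ℂ → ℝ) :
    HasDegreeAt (unitLift φ ∘ uniformizationInv f) (f 0) 1 := by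
  have h0 : (0:ℂ) ∈ Metric.ball (0:ℂ) 1 := by simp
  have ha := hf.bij.mapsTo h0
  refine hasDegreeAt_div_norm hf.isOpen ha (hf.differentiableOn_phaseLift φ)
    (fun w hw => hf.phaseLift_inv_ne_zero φ hw) ?_ ?_
  · simp [hf.inv_apply h0, phaseLift]
  · have h1 : HasDerivAt (phaseLift φ) (exp (I * herglotz φ 0)) 0 := by
      have := (hasDerivAt_id (0:ℂ)).mul ((hasSum_deriv_herglotz φ h0).1.hasDerivAt.const_mul I).cexp
      simpa using! this
    have h2 := hf.hasDerivAt_inv ha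
    rw [← hf.inv_apply h0] at h1
    have h3 : HasDerivAt (fun z => phaseLift φ (uniformizationInv f z)) _ (f 0) := h1.comp (f 0) h2
    rw [h3.deriv, hf.inv_apply h0]
    exact mul_ne_zero (exp_ne_zero _) (inv_ne_zero (hf.deriv_ne_zero h0))

theorem isHarmonicMapToCircle_unitLift (hf : IsUniformization f Ω) (φ : ℂ → ℝ) :
    IsHarmonicMapToCircle (Ω \ {f 0}) (unitLift φ ∘ uniformizationInv f) :=
  isHarmonicMapToCircle_div_norm (hf.isOpen_diff _) ((hf.differentiableOn_phaseLift φ).mono diff_subset)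
    fun _ hw => hf.phaseLift_inv_ne_zero φ hw

theorem isCanonicalHarmonicMap_unitLift (hf : IsUniformization f Ω) {g : ℂ → ℂ} (hφ : MemHHalf φ)
    (hl : ∀ᵐ t ∂arcMeasure, onCircle (g ∘ boundaryExt f) t = circleMap 0 1 t * exp (I * onCircle φ t)) :
    IsCanonicalHarmonicMap Ω (f 0) g f (unitLift φ ∘ uniformizationInv f) where
  norm_eq_one w hw := norm_unitLift φ (hf.inv_mem_diff hw).2
  memH1Loc := hf.memH1LocPunctured_unitLift hφ
  degree := hf.hasDegreeAt_unitLift φ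
  boundary := by
    refine (hasCircleTrace_unitLift hφ hl).congr ?_
    rw [ae_restrict_iff' measurableSet_ball]
    exact ae_of_all _ fun z hz => by simp [hf.inv_apply hz]
  star_eq := by
    refine ⟨_, isNeumannSolution_log_norm (memHHalfCircle_of_lifting hφ hl) hφ hl, _, _, hf.hasWeakFDeriv_unitLift φ,
      hf.hasWeakFDeriv_log_norm φ, ?_⟩
    rw [ae_restrict_iff' (hf.isOpen_diff _).measurableSet]
    exact ae_of_all _ fun w hw e => starForm_currentForm (norm_unitLift φ (hf.inv_mem_diff hw).2) _ e

end IsUniformization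

end Canonical

/-! ### Uniqueness of traces -/

section TraceUniqueness

/-- Arc length is pushed forward to a measure on the plane, where the fundamental lemma holds for
smooth test functions of the plane. -/
theorem ae_eq_zero_of_integral_circleMap_smul {H : ℝ → ℂ} (hH : Integrable H arcMeasure)
    (h : ∀ k : ℂ → ℝ, ContDiff ℝ ∞ k → HasCompactSupport k → ∫ t, onCircle k t • H t ∂arcMeasure = 0) :
    ∀ᵐ t ∂arcMeasure, H t = 0 := by
  set H' : ℝ → ℂ := hH.1.mk H with hH'
  have hm : StronglyMeasurable H' := hH.1.stronglyMeasurable_mk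
  have he : H =ᵐ[arcMeasure] H' := hH.1.ae_eq_mk
  -- The angle π + arg (-z) takes values in (0, 2π], the interval carrying `arcMeasure`.
  set F : ℂ → ℂ := fun z => H' (Real.pi + arg (-z))
  have hFm : StronglyMeasurable F := hm.comp_measurable (by fun_prop)
  have hF : ∀ t ∈ Ioc 0 (2 * Real.pi), F (circleMap 0 1 t) = H' t := fun t ht => by
    have e1 : -circleMap 0 1 t = exp ((t - Real.pi : ℝ) * I) := by
      simp only [circleMap, ofReal_one, one_mul, zero_add]
      push_cast
      rw [sub_mul, exp_sub, exp_pi_mul_I, div_neg, div_one]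
    simp only [F]
    rw [e1, arg_exp_mul_I, (toIocMod_eq_self _).2 ⟨by linarith [ht.1], by linarith [ht.2]⟩]
    congr 1; ring
  have hFae : (fun t => F (circleMap 0 1 t)) =ᵐ[arcMeasure] H := by
    refine EventuallyEq.trans ?_ he.symm
    rw [EventuallyEq, arcMeasure, ae_restrict_iff' measurableSet_Ioc]
    exact ae_of_all _ hF
  have hcm : AEMeasurable (circleMap 0 1) arcMeasure := (continuous_circleMap 0 1).aemeasurable
  have hi : Integrable F (arcMeasure.map (circleMap 0 1)) := by
    rw [integrable_map_measure hFm.aestronglyMeasurable hcm]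
    exact hH.congr hFae.symm
  have h0 := ae_eq_zero_of_integral_contDiff_smul_eq_zero hi.locallyIntegrable fun k hk hkc => by
    rw [integral_map (f := fun z => k z • F z) hcm
      (hk.continuous.aestronglyMeasurable.smul hFm.aestronglyMeasurable)]
    exact (integral_congr_ae (hFae.mono fun t ht => by simp only [onCircle]; rw [← ht])).trans (h k hk hkc)
  have h1 := ae_of_ae_map hcm h0
  filter_upwards [h1, hFae] with t h1 h2
  rw [← h2, h1]

theorem exists_cutoff_circle {ρ : ℝ} (h0 : 0 ≤ ρ) (h1 : ρ < 1) : ∃ χ : ℂ → ℝ, ContDiff ℝ ∞ χ ∧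
    tsupport χ ⊆ (Metric.closedBall 0 ρ)ᶜ ∧ ∀ t, χ (circleMap 0 1 t) = 1 := by
  let b : ContDiffBump (0:ℂ) := ⟨(1 + ρ) / 2, (3 + ρ) / 4, by linarith, by linarith⟩
  refine ⟨fun z => 1 - b z, contDiff_const.sub b.contDiff, ?_, fun t => ?_⟩
  · have h2 : tsupport (fun z => 1 - b z) ⊆ (Metric.ball 0 ((1 + ρ) / 2))ᶜ := by
      refine closure_minimal (fun z hz hzb => hz ?_) Metric.isOpen_ball.isClosed_compl
      simp only [b.one_of_mem_closedBall (Metric.ball_subset_closedBall hzb), sub_self]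
    exact h2.trans (compl_subset_compl.2 (Metric.closedBall_subset_ball (by linarith)))
  · have : b (circleMap 0 1 t) = 0 := b.zero_of_le_dist (by simp [b]; linarith)
    simp only [this, sub_zero]

/-- If `v' = b v` in the disk, then the same relation holds between the traces. -/
theorem HasCircleTrace.ae_eq_mul {v v' h h' : ℂ → ℂ} (hv : HasCircleTrace v h) (hv' : HasCircleTrace v' h') {b : ℂ}
    (hb : ∀ᵐ z ∂(volume.restrict (Metric.ball 0 1)), v' z = b * v z) :
    ∀ᵐ t ∂arcMeasure, onCircle h' t = b * onCircle h t := by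
  obtain ⟨hi, ρ, h0, h1, D, hm, hg⟩ := hv
  obtain ⟨hi', ρ', h0', h1', D', hm', hg'⟩ := hv'
  set r := max ρ ρ' with hr
  have hs : innerAnnulus r ⊆ innerAnnulus ρ := diff_subset_diff_right (Metric.closedBall_subset_closedBall (le_max_left _ _))
  have hs' : innerAnnulus r ⊆ innerAnnulus ρ' := diff_subset_diff_right (Metric.closedBall_subset_closedBall (le_max_right _ _))
  have hbr : ∀ᵐ z ∂(volume.restrict (innerAnnulus r)), v' z = b * v z := ae_restrict_of_ae_restrict_of_subset diff_subset hb
  have hD := HasWeakFDeriv.ae_eq (isOpen_innerAnnulus r) (hm'.1.mono hs')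
    ((hm.1.mono hs).clm_comp (ContinuousLinearMap.mul ℝ ℂ b)) hbr
  -- integrals only see the outer annulus
  have hred : ∀ {σ : ℝ} {F : ℂ → ℂ} {DF : ℂ → ℂ →L[ℝ] ℂ} {ζ : ℂ → ℝ} (e : ℂ), σ ≤ r → tsupport ζ ⊆ (Metric.closedBall 0 r)ᶜ →
      ∫ z in innerAnnulus σ, ((fderiv ℝ ζ z e) • F z + ζ z • DF z e) =
      ∫ z in innerAnnulus r, ((fderiv ℝ ζ z e) • F z + ζ z • DF z e) := fun {σ F DF ζ} e hσ hζ => by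
    have hz : ∀ z ∈ Metric.closedBall (0:ℂ) r, (fderiv ℝ ζ z e) • F z + ζ z • DF z e = 0 := fun z hz => by
      obtain ⟨h3, h4⟩ := apply_eq_zero_of_tsupport_subset hζ hz
      simp [h3, h4]
    rw [← integral_ball_eq_integral_innerAnnulus hz, ← integral_ball_eq_integral_innerAnnulus fun z hz' =>
      hz z (Metric.closedBall_subset_closedBall hσ hz')]
  have key : ∀ ζ : ℂ → ℝ, ContDiff ℝ ∞ ζ → HasCompactSupport ζ → tsupport ζ ⊆ (Metric.closedBall 0 r)ᶜ → ∀ e : ℂ,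
      ∫ t, (⟪e, circleMap 0 1 t⟫_ℝ * onCircle ζ t) • (onCircle h' t - b * onCircle h t) ∂arcMeasure = 0 := by
    intro ζ a c d e
    have hc : Continuous fun t => ⟪e, circleMap 0 1 t⟫_ℝ * onCircle ζ t :=
      (continuous_const.inner (continuous_circleMap 0 1)).mul (continuous_onCircle a.continuous)
    obtain ⟨M, hM⟩ := (isCompact_Icc (a := (0:ℝ)) (b := 2 * Real.pi)).exists_bound_of_continuousOn hc.continuousOn
    have hMae : ∀ᵐ t ∂arcMeasure, ‖⟪e, circleMap 0 1 t⟫_ℝ * onCircle ζ t‖ ≤ M := by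
      rw [arcMeasure, ae_restrict_iff' measurableSet_Ioc]
      exact ae_of_all _ fun t ht => hM t (Ioc_subset_Icc_self ht)
    have ib : ∀ {H : ℝ → ℂ}, Integrable H arcMeasure →
        Integrable (fun t => (⟪e, circleMap 0 1 t⟫_ℝ * onCircle ζ t) • H t) arcMeasure := fun {H} hH =>
      Integrable.bdd_smul hH M hc.aestronglyMeasurable hMae
    have e1 := hg ζ a c (d.trans (compl_subset_compl.2 (Metric.closedBall_subset_closedBall (le_max_left _ _)))) e
    have e2 := hg' ζ a c (d.trans (compl_subset_compl.2 (Metric.closedBall_subset_closedBall (le_max_right _ _)))) e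
    rw [hred e (le_max_left _ _) d] at e1
    rw [hred e (le_max_right _ _) d] at e2
    simp only [smul_sub]
    rw [integral_sub (ib hi') (ib (hi.const_mul b)), ← e2]
    have e3 : ∀ t, (⟪e, circleMap 0 1 t⟫_ℝ * onCircle ζ t) • (b * onCircle h t) =
        b * ((⟪e, circleMap 0 1 t⟫_ℝ * onCircle ζ t) • onCircle h t) := fun t => by rw [mul_smul_comm]
    simp only [e3]
    rw [integral_const_mul, ← e1, ← integral_const_mul, sub_eq_zero]
    refine integral_congr_ae ?_
    filter_upwards [hbr, hD] with z h3 h4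
    rw [h3, h4]
    simp [mul_add, mul_left_comm]
  obtain ⟨χ, hχ, hχs, hχ1⟩ := exists_cutoff_circle (le_max_of_le_left h0 : 0 ≤ r) (max_lt h1 h1')
  have hfin := ae_eq_zero_of_integral_circleMap_smul (H := fun t => onCircle h' t - b * onCircle h t)
    (hi'.sub (hi.const_mul b)) fun k hk hkc => by
    have hcomp : ∀ {p : ℂ → ℝ}, ContDiff ℝ ∞ p → ∀ e : ℂ,
        ∫ t, (⟪e, circleMap 0 1 t⟫_ℝ * onCircle (fun z => χ z * (p z * k z)) t) •
          (onCircle h' t - b * onCircle h t) ∂arcMeasure = 0 := fun {p} hp e =>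
      key _ (hχ.mul (hp.mul hk)) ((hkc.mul_left (f := p)).mul_left (f := χ))
        ((closure_mono (Function.support_mul_subset_left _ _)).trans hχs) e
    have h3 := hcomp (p := fun z => z.re) reCLM.contDiff 1
    have h4 := hcomp (p := fun z => z.im) imCLM.contDiff I
    -- Since x² + y² = 1 on the circle, the tests `χ x k` in direction `1` and `χ y k` in direction
    -- `I` add up to an unweighted test with `k`.
    have hsum : ∀ t, onCircle k t = ⟪(1:ℂ), circleMap 0 1 t⟫_ℝ * onCircle (fun z => χ z * (z.re * k z)) t +
        ⟪I, circleMap 0 1 t⟫_ℝ * onCircle (fun z => χ z * (z.im * k z)) t := fun t => by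
      have hn : (circleMap 0 1 t).re ^ 2 + (circleMap 0 1 t).im ^ 2 = 1 := by
        have := norm_circleMap_one t
        rw [← sq_norm_sub_sq_re, this]; ring
      simp only [onCircle, hχ1, Complex.inner, map_one, mul_one, one_mul, conj_I, mul_neg, neg_re, mul_I_re, neg_neg]
      linear_combination -(k (circleMap 0 1 t)) * hn
    have hint : ∀ {p : ℂ → ℝ}, Continuous p → ∀ e : ℂ,
        Integrable (fun t => (⟪e, circleMap 0 1 t⟫_ℝ * onCircle (fun z => χ z * (p z * k z)) t) •
          (onCircle h' t - b * onCircle h t)) arcMeasure := fun {p} hp e => by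
      have hc : Continuous fun t => ⟪e, circleMap 0 1 t⟫_ℝ * onCircle (fun z => χ z * (p z * k z)) t :=
        (continuous_const.inner (continuous_circleMap 0 1)).mul
          (continuous_onCircle (hχ.continuous.mul (hp.mul hk.continuous)))
      obtain ⟨M, hM⟩ := (isCompact_Icc (a := (0:ℝ)) (b := 2 * Real.pi)).exists_bound_of_continuousOn hc.continuousOn
      refine Integrable.bdd_smul (hi'.sub (hi.const_mul b)) M hc.aestronglyMeasurable ?_
      rw [arcMeasure, ae_restrict_iff' measurableSet_Ioc]
      exact ae_of_all _ fun t ht => hM t (Ioc_subset_Icc_self ht)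
    simp only [hsum, add_smul]
    rw [integral_add (hint continuous_re 1) (hint continuous_im I), h3, h4, add_zero]
  exact hfin.mono fun t ht => sub_eq_zero.1 ht

end TraceUniqueness

/-! ### Uniqueness of the canonical map -/

section Uniqueness

theorem isPreconnected_punctured_ball : IsPreconnected (Metric.ball (0:ℂ) 1 \ {0}) := by
  have h1 : Metric.ball (0:ℂ) 1 \ {0} = exp '' {z | z.re < 0} := by
    ext z
    constructor
    · rintro ⟨hz, h0⟩
      refine ⟨log z, ?_, exp_log h0⟩
      rw [mem_setOf_eq, log_re]
      exact Real.log_neg (norm_pos_iff.2 h0) (by simpa using hz)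
    · rintro ⟨w, hw, rfl⟩
      refine ⟨?_, exp_ne_zero _⟩
      rw [mem_ball_zero_iff, norm_exp]
      exact Real.exp_lt_one_iff.2 hw
  rw [h1]
  exact ((convex_halfSpace_re_lt 0).isPreconnected).image _ continuous_exp.continuousOn

/-- Product of a weakly differentiable map with the conjugate of a smooth one. -/
theorem HasWeakFDeriv.conj_mul {U : Set ℂ} (hU : IsOpen U) {u v : ℂ → ℂ} {Dv : ℂ → ℂ →L[ℝ] ℂ}
    (hv : HasWeakFDeriv U v Dv) (hu : ContDiffOn ℝ ∞ u U) :
    ∃ Dw : ℂ → ℂ →L[ℝ] ℂ, HasWeakFDeriv U (fun z => (starRingEnd ℂ) (u z) * v z) Dw ∧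
      ∀ z ∈ U, ∀ e, Dw z e = (starRingEnd ℂ) (u z) * Dv z e + (starRingEnd ℂ) (fderiv ℝ u z e) * v z := by
  -- Here ū v = (Re u) v + (Im u) (-i v), a sum of two products with smooth real functions.
  have h1 := hv.smul hU (reCLM.contDiff.comp_contDiffOn hu)
  have h2 := (hv.clm_comp (ContinuousLinearMap.mul ℝ ℂ (-I))).smul hU (imCLM.contDiff.comp_contDiffOn hu)
  have h3 := h1.add h2
  refine ⟨_, h3.congr_ae (ae_of_all _ fun z => ?_) (ae_eq_refl _), fun z hz e => ?_⟩
  · simp only [Function.comp_apply, reCLM_apply, imCLM_apply, real_smul, mul_apply']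
    apply Complex.ext <;> simp
  · have hd : HasFDerivAt u (fderiv ℝ u z) z := ((hu.contDiffAt (hU.mem_nhds hz)).differentiableAt (by simp)).hasFDerivAt
    have e1 : fderiv ℝ (reCLM ∘ u) z = reCLM.comp (fderiv ℝ u z) := (reCLM.hasFDerivAt.comp z hd).fderiv
    have e2 : fderiv ℝ (imCLM ∘ u) z = imCLM.comp (fderiv ℝ u z) := (imCLM.hasFDerivAt.comp z hd).fderiv
    rw [e1, e2]
    apply Complex.ext <;> simp <;> ring

/-- The vectors u and i u form an orthonormal basis: the component of L e along u vanishes, and the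
component along i u is the current. -/
theorem eq_circForm_of_inner {u l : ℂ} (hu : ‖u‖ = 1) {L : ℂ →L[ℝ] ℂ} (h0 : ∀ e : ℂ, e = 1 ∨ e = I → ⟪u, L e⟫_ℝ = 0)
    (h1 : ∀ e, currentForm u L e = (l * e).im) : L = circForm u l := by
  have key : ∀ e : ℂ, e = 1 ∨ e = I → L e = circForm u l e := fun e he => by
    have a := h0 e he
    have b := h1 e
    have hn : normSq u = 1 := by rw [normSq_eq_norm_sq, hu]; norm_num
    rw [normSq_apply] at hn
    rw [circForm_apply, ← b, currentForm]
    rw [Complex.inner] at a ⊢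
    simp only [mul_re, conj_re, conj_im, mul_im, I_re, I_im] at a ⊢
    apply Complex.ext
    · simp
      linear_combination (-(L e).re) * hn + u.re * a
    · simp
      linear_combination (-(L e).im) * hn + u.im * a
  exact realCLM_ext (key 1 (Or.inl rfl)) (key I (Or.inr rfl))

namespace IsUniformization

variable {f : ℂ → ℂ} {Ω : Set ℂ} {φ : ℂ → ℝ}

theorem isPreconnected_diff (hf : IsUniformization f Ω) : IsPreconnected (Ω \ {f 0}) := by
  have h1 : Ω \ {f 0} = f '' (Metric.ball (0:ℂ) 1 \ {0}) := by
    ext w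
    constructor
    · intro hw
      exact ⟨_, hf.inv_mem_diff hw, hf.apply_inv hw.1⟩
    · rintro ⟨z, hz, rfl⟩
      exact ⟨hf.bij.mapsTo hz.1, fun h => hz.2 (hf.bij.injOn hz.1 (by simp) h)⟩
  rw [h1]
  exact isPreconnected_punctured_ball.image _ (hf.holo.continuousOn.mono diff_subset)

/-- Differentiable maps of the plane send null sets to null sets, so exceptional sets can be carried
through f. -/
theorem ae_comp_inv (hf : IsUniformization f Ω) {p : ℂ → Prop} (hp : ∀ᵐ z ∂(volume.restrict (Metric.ball 0 1)), p z) :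
    ∀ᵐ w ∂(volume.restrict Ω), p (uniformizationInv f w) := by
  rw [ae_restrict_iff' measurableSet_ball] at hp
  rw [ae_restrict_iff' hf.isOpen.measurableSet]
  have h1 : volume (f '' (Metric.ball 0 1 ∩ {z | ¬ p z})) = 0 := by
    refine addHaar_image_eq_zero_of_differentiableOn_of_addHaar_eq_zero volume
      (fun z hz => ((hf.analyticAt hz.1).differentiableAt.restrictScalars ℝ).differentiableWithinAt) ?_
    refine measure_mono_null (fun z hz => ?_) hp
    simpa using hz
  refine measure_mono_null (fun w hw => ?_) h1
  simp only [mem_compl_iff, mem_setOf_eq, not_forall] at hw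
  obtain ⟨hw, hn⟩ := hw
  exact ⟨_, ⟨hf.inv_mem hw, hn⟩, hf.apply_inv hw⟩

theorem ae_comp (hf : IsUniformization f Ω) {p : ℂ → Prop} (hp : ∀ᵐ w ∂(volume.restrict (Ω \ {f 0})), p w) :
    ∀ᵐ z ∂(volume.restrict (Metric.ball 0 1)), p (f z) := by
  rw [ae_restrict_iff' (hf.isOpen_diff _).measurableSet] at hp
  rw [← ball_restrict_eq, ae_restrict_iff' (measurableSet_ball.diff (measurableSet_singleton 0))]
  have h1 : volume (uniformizationInv f '' ((Ω \ {f 0}) ∩ {z | ¬ p z})) = 0 := by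
    refine addHaar_image_eq_zero_of_differentiableOn_of_addHaar_eq_zero volume
      (fun z hz => ((hf.differentiableAt_inv hz.1.1).restrictScalars ℝ).differentiableWithinAt) ?_
    exact measure_mono_null (fun z hz (hc : z ∈ Ω \ {f 0} → p z) => hz.2 (hc hz.1)) hp
  refine measure_mono_null (fun z hz => ?_) h1
  simp only [mem_compl_iff, mem_setOf_eq, not_forall] at hz
  obtain ⟨hz, hn⟩ := hz
  exact ⟨_, ⟨⟨hf.bij.mapsTo hz.1, fun h => hz.2 (hf.bij.injOn hz.1 (by simp) h)⟩, hn⟩, hf.inv_apply hz.1⟩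

/-- The Neumann solution is unique up to a constant, so the current of u' is Im (l ·) with the known
l; unimodularity then determines Du'. The product ū u' has zero differential, hence equals a
constant b, and the traces force b = 1. -/
theorem ae_eq_of_isCanonicalHarmonicMap (hf : IsUniformization f Ω) {g u' : ℂ → ℂ} (hφ : MemHHalf φ)
    (hl : ∀ᵐ t ∂arcMeasure, onCircle (g ∘ boundaryExt f) t = circleMap 0 1 t * exp (I * onCircle φ t))
    (hu' : IsCanonicalHarmonicMap Ω (f 0) g f u') :
    u' =ᵐ[volume.restrict (Ω \ {f 0})] unitLift φ ∘ uniformizationInv f := by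
  set V := Ω \ {f 0} with hV
  have hVo : IsOpen V := hf.isOpen_diff _
  set ψ := uniformizationInv f
  set l := pullbackLogDeriv φ f
  set u := unitLift φ ∘ ψ with hu
  have hu1 : ∀ w ∈ V, ‖u w‖ = 1 := fun w hw => norm_unitLift φ (hf.inv_mem_diff hw).2
  have hcirc := memHHalfCircle_of_lifting hφ hl
  obtain ⟨Φ, hΦ, Du, DΦ, hDu, hDΦ, hstar⟩ := hu'.star_eq
  obtain ⟨c, hc⟩ := hΦ.ae_eq_add_const (isNeumannSolution_log_norm hcirc hφ hl)
  have hc' : (Φ ∘ ψ) =ᵐ[volume.restrict V] fun w => Real.log ‖phaseLift φ (ψ w)‖ + c :=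
    ae_restrict_of_ae_restrict_of_subset diff_subset (hf.ae_comp_inv hc)
  have hDΦ' := HasWeakFDeriv.ae_eq hVo hDΦ (hasWeakFDeriv_of_hasFDerivAt hVo
    (fun w hw => (hf.hasFDerivAt_log_norm φ hw).add_const c)
    (continuous_reForm.comp_continuousOn (hf.continuousOn_pullbackLogDeriv φ))) hc'
  have hae : ∀ e, ∀ᵐ w ∂(volume.restrict V), ⟪u' w, Du w e⟫_ℝ = 0 := fun e => by
    rw [ae_restrict_iff' hVo.measurableSet]
    exact hDu.ae_inner_eq_zero hVo hu'.norm_eq_one e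
  have hmem : ∀ᵐ w ∂(volume.restrict V), w ∈ V := ae_restrict_mem hVo.measurableSet
  have hDu' : ∀ᵐ w ∂(volume.restrict V), Du w = circForm (u' w) (l w) := by
    filter_upwards [hstar, hDΦ', hae 1, hae I, hmem] with w h1 h2 h3 h4 hw
    refine eq_circForm_of_inner (hu'.norm_eq_one w hw) ?_ fun e => ?_
    · rintro e (rfl | rfl)
      · exact h3
      · exact h4
    -- The star operator evaluates at i e, so it is undone by inserting -i e.
    · have h5 := h1 (-I * e)
      rw [starForm, ← mul_assoc, mul_neg, I_mul_I, neg_neg, one_mul, h2] at h5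
      rw [h5]
      simp [l]
      ring
  have husm : ContDiffOn ℝ ∞ u V := (hf.isHarmonicMapToCircle_unitLift φ).smooth
  obtain ⟨Dw, hDw, hDwe⟩ := hDu.conj_mul hVo husm
  -- Both u and u' turn at the rate Im (l e); the conjugation on u makes the two terms cancel.
  have hDw0 : Dw =ᵐ[volume.restrict V] fun _ => 0 := by
    filter_upwards [hDu', hmem] with w h1 hw
    ext e
    rw [hDwe w hw, h1, (hf.hasFDerivAt_unitLift φ hw).fderiv]
    simp only [circForm_apply, real_smul, map_mul, conj_ofReal, conj_I, ContinuousLinearMap.zero_apply]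
    simp only [u, l, Function.comp_apply, ψ]
    ring
  obtain ⟨b, hb⟩ := hDw.ae_const hVo hf.isPreconnected_diff hDw0
  have hb' : ∀ᵐ w ∂(volume.restrict V), u' w = b * u w := by
    filter_upwards [hb, hmem] with w h1 hw
    rw [← h1, mul_right_comm, ← normSq_eq_conj_mul_self, normSq_eq_norm_sq, hu1 w hw]
    simp
  have htr : HasCircleTrace (unitLift φ) (g ∘ boundaryExt f) := hasCircleTrace_unitLift hφ hl
  -- Both maps have the trace `g ∘ boundaryExt f`, which is then equal to `b` times itself; being
  -- unimodular almost everywhere, it is nonzero at some point.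
  have hbt := htr.ae_eq_mul hu'.boundary (b := b) (by
    filter_upwards [hf.ae_comp hb', ae_restrict_mem measurableSet_ball] with z h1 hz
    rw [Function.comp_apply, h1, hu, Function.comp_apply, show ψ (f z) = z from hf.inv_apply hz])
  have hne : arcMeasure ≠ 0 := by
    intro h
    have := arcMeasure_real_univ
    rw [h] at this
    simp at this
  have : NeZero arcMeasure := ⟨hne⟩
  obtain ⟨t, h1, h2⟩ := (hbt.and hcirc.2).exists
  have hb1 : b = 1 := by
    have h0 : onCircle (g ∘ boundaryExt f) t ≠ 0 := fun h => by rw [h, norm_zero] at h2; exact zero_ne_one h2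
    exact mul_right_cancel₀ h0 (by rw [← h1, one_mul])
  filter_upwards [hb'] with w hw
  rw [hw, hb1, one_mul]

end IsUniformization

end Uniqueness

/-! ### Independence of the uniformization -/

section Rotation

theorem integral_arcMeasure_add_const {F : ℝ → ℂ} (hF : Function.Periodic F (2 * Real.pi)) (α : ℝ) :
    ∫ t, F (t + α) ∂arcMeasure = ∫ t, F t ∂arcMeasure := by
  rw [arcMeasure, ← intervalIntegral.integral_of_le Real.two_pi_pos.le,
    ← intervalIntegral.integral_of_le Real.two_pi_pos.le, intervalIntegral.integral_comp_add_right, zero_add,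
    add_comm (2 * Real.pi)]
  simpa using hF.intervalIntegral_add_eq α 0

theorem circleCoeff_rotation (h : ℂ → ℂ) (α : ℝ) (n : ℤ) :
    circleCoeff (fun z => h (exp (I * α) * z)) n = exp (I * α) ^ n * circleCoeff h n := by
  have h1 := integral_arcMeasure_add_const (F := fun t : ℝ => exp (-(I * n * t)) * onCircle h t) (fun t => by
    simp only [onCircle, periodic_circleMap 0 1 t]
    congr 1
    rw [show -(I * n * ((t + 2 * Real.pi : ℝ) : ℂ)) = -(I * n * t) + ((-n : ℤ) : ℂ) * (2 * Real.pi * I) by push_cast; ring,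
      exp_add, exp_int_mul_two_pi_mul_I, mul_one]) α
  rw [circleCoeff, circleCoeff, ← h1, mul_smul_comm, ← integral_const_mul]
  congr 1
  refine integral_congr_ae (ae_of_all _ fun t => ?_)
  simp only [onCircle]
  rw [circleMap_add_const, ← mul_assoc, ← exp_int_mul, ← exp_add]
  congr 2
  push_cast; ring

/-- Rotation multiplies the coefficient of index n by e^{iαn}, and the constant α enters only at
index 0, where the coefficient is not doubled. -/
theorem herglotz_rotation {φ : ℂ → ℝ} (hφ : MemHHalf φ) (α : ℝ) {z : ℂ} (hz : z ∈ Metric.ball (0:ℂ) 1) :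
    herglotz (fun z => φ (exp (I * α) * z) + α) z = herglotz φ (exp (I * α) * z) + α := by
  have hz' : exp (I * α) * z ∈ Metric.ball (0:ℂ) 1 := by
    rw [mem_ball_zero_iff, norm_mul, mul_comm I, norm_exp_ofReal_mul_I, one_mul]
    simpa using hz
  have hi : Integrable (onCircle (fun z => (φ (exp (I * α) * z) : ℂ))) arcMeasure := by
    have h1 := (hφ.comp_rotation α).integrable.sub (integrable_const α)
    refine (h1.ofReal (𝕜 := ℂ)).congr (ae_of_all _ fun t => ?_)
    simp [onCircle]
  have hc : ∀ n : ℕ, herglotzCoeff (fun z => φ (exp (I * α) * z) + α) n =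
      exp (I * α) ^ n * herglotzCoeff φ n + if n = 0 then (α : ℂ) else 0 := fun n => by
    have h1 : circleCoeff (fun z => ((φ (exp (I * α) * z) + α : ℝ) : ℂ)) n =
        circleCoeff (fun z => (φ (exp (I * α) * z) : ℂ)) n + circleCoeff (fun _ => (α : ℂ)) n := by
      have hm : ∀ {h : ℂ → ℂ}, Integrable (onCircle h) arcMeasure →
          Integrable (fun t : ℝ => exp (-(I * n * t)) * onCircle h t) arcMeasure := fun {h} hh => by
        refine hh.bdd_mul (c := 1) (Continuous.aestronglyMeasurable (by fun_prop)) (ae_of_all _ fun t => ?_)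
        rw [show -(I * n * (t:ℂ)) = ((-(n * t) : ℝ) : ℂ) * I by push_cast; ring, norm_exp_ofReal_mul_I]
      rw [circleCoeff, circleCoeff, circleCoeff, ← smul_add]
      have := integral_add (hm hi) (hm (h := fun _ => (α:ℂ)) (integrable_const _))
      simp only [Int.cast_natCast] at this ⊢
      rw [← this]
      congr 1
      refine integral_congr_ae (ae_of_all _ fun t => ?_)
      simp only [onCircle]
      push_cast; ring
    have h2 : circleCoeff (fun _ => (α : ℂ)) n = if n = 0 then (α : ℂ) else 0 := by
      have h3 : circleCoeff (fun _ => (α : ℂ)) n = α * circleCoeff (fun _ => 1) n := by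
        rw [circleCoeff, circleCoeff, mul_smul_comm, ← integral_const_mul]
        simp only [onCircle, mul_one, mul_comm]
      rw [h3, circleCoeff_one]
      simp
    rw [herglotzCoeff, h1, circleCoeff_rotation (fun z => (φ z : ℂ)), h2, herglotzCoeff]
    by_cases hn : n = 0
    · simp [hn]
    · simp [hn]; ring
  refine (hasSum_herglotz _ hz).unique ?_
  have h1 := (hasSum_herglotz φ hz').add (hasSum_ite_eq 0 (α : ℂ))
  refine h1.of_fun_eq fun n => ?_
  rw [hc, add_mul, mul_pow]
  by_cases hn : n = 0
  · simp [hn]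
  · simp [hn]; ring

/-- The constant α in the new phase produces the factor e^{iα} that turns z into e^{iα} z. -/
theorem phaseLift_rotation {φ : ℂ → ℝ} (hφ : MemHHalf φ) (α : ℝ) {z : ℂ} (hz : z ∈ Metric.ball (0:ℂ) 1) :
    phaseLift (fun z => φ (exp (I * α) * z) + α) z = phaseLift φ (exp (I * α) * z) := by
  rw [phaseLift, phaseLift, herglotz_rotation hφ α hz, mul_add, exp_add]
  ring

end Rotation

/-- Uniformizations exist with a prescribed value at the origin, and all boundary data of degree one admit liftings. -/
theorem HasBoundaryDegree.exists_lifting {Ω : Set ℂ} {g : ℂ → ℂ} (hdeg : HasBoundaryDegree Ω g 1) {a : ℂ} (ha : a ∈ Ω) :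
    ∃ (f : ℂ → ℂ) (φ : ℂ → ℝ), IsUniformization f Ω ∧ f 0 = a ∧ MemHHalf φ ∧
      ∀ᵐ t ∂arcMeasure, onCircle (g ∘ boundaryExt f) t = circleMap 0 1 t * exp (I * onCircle φ t) := by
  obtain ⟨f, hf, hd⟩ := hdeg
  obtain ⟨φ, hφ, hl⟩ := hd.lifting
  -- The transformation `moebius b` sends 0 to b, and f sends b to a.
  set b := uniformizationInv f a with hbdef
  have hb : ‖b‖ < 1 := by simpa using hf.inv_mem ha
  obtain ⟨ψ, hψ, hψl⟩ := exists_lifting_comp_moebius hb hφ hl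
  refine ⟨f ∘ moebius b, ψ, hf.comp_moebius hb, ?_, hψ, ?_⟩
  · simp [moebius, hbdef, hf.apply_inv ha]
  · filter_upwards [hψl] with t ht
    rw [← ht]
    simp only [onCircle, Function.comp_apply]
    rw [boundaryExt_comp_moebius f hb (norm_circleMap_one t)]

/-- The map `unitLift φ ∘ f⁻¹` does not depend on the uniformization. -/
theorem IsUniformization.exists_lifting_rotation {Ω : Set ℂ} {g f₁ f₂ : ℂ → ℂ} (hf₁ : IsUniformization f₁ Ω)
    (hf₂ : IsUniformization f₂ Ω) (h0 : f₁ 0 = f₂ 0) {φ : ℂ → ℝ} (hφ : MemHHalf φ)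
    (hl : ∀ᵐ t ∂arcMeasure, onCircle (g ∘ boundaryExt f₁) t = circleMap 0 1 t * exp (I * onCircle φ t)) :
    ∃ ψ : ℂ → ℝ, MemHHalf ψ ∧
      (∀ᵐ t ∂arcMeasure, onCircle (g ∘ boundaryExt f₂) t = circleMap 0 1 t * exp (I * onCircle ψ t)) ∧
      EqOn (unitLift ψ ∘ uniformizationInv f₂) (unitLift φ ∘ uniformizationInv f₁) Ω := by
  obtain ⟨α, hα⟩ := hf₁.eqOn_rotation hf₂ h0
  refine ⟨fun z => φ (exp (I * α) * z) + α, hφ.comp_rotation α, ?_, fun w hw => ?_⟩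
  · filter_upwards [lifting_rotation α hl] with t ht
    rw [← ht]
    simp only [onCircle, Function.comp_apply]
    rw [boundaryExt_rotation hα]
  · have hz := hf₂.inv_mem hw
    set z := uniformizationInv f₂ w with hzdef
    have h1 : uniformizationInv f₁ w = exp (I * α) * z := by
      rw [← hf₂.apply_inv hw, hα hz]
      refine hf₁.inv_apply ?_
      rw [mem_ball_zero_iff, norm_mul, mul_comm I, norm_exp_ofReal_mul_I, one_mul]
      simpa using hz
    simp only [Function.comp_apply, unitLift]
    rw [h1, phaseLift_rotation hφ α hz]

/-- This transfers all properties from the map built with one uniformization to the map built with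
another, which agrees with it on Ω. In the degree condition the radius is reduced so that the disks
lie in Ω. -/
theorem IsCanonicalHarmonicMap.congr {Ω : Set ℂ} {a : ℂ} {g f u v : ℂ → ℂ} (hf : IsUniformization f Ω)
    (ha : a ∈ Ω) (hu : IsCanonicalHarmonicMap Ω a g f u) (h : EqOn u v Ω) : IsCanonicalHarmonicMap Ω a g f v := by
  have hV : MeasurableSet (Ω \ {a}) := (hf.isOpen_diff a).measurableSet
  have hae : u =ᵐ[volume.restrict (Ω \ {a})] v := by
    filter_upwards [ae_restrict_mem hV] with w hw using h hw.1
  refine ⟨fun z hz => h hz.1 ▸ hu.norm_eq_one z hz, ?_, ?_, ?_, ?_⟩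
  · obtain ⟨Du, h1, h2⟩ := hu.memH1Loc
    refine ⟨Du, h1.congr_ae hae (ae_eq_refl _), fun C hC hCs => ⟨(memLp_congr_ae ?_).1 (h2 C hC hCs).1, (h2 C hC hCs).2⟩⟩
    filter_upwards [ae_restrict_mem (hC.measurableSet.inter hf.isOpen.measurableSet)] with w hw using h hw.2
  · obtain ⟨r₀, hr₀, h1⟩ := hu.degree
    obtain ⟨ε, hε, hb⟩ := Metric.isOpen_iff.1 hf.isOpen a ha
    refine ⟨min r₀ ε, lt_min hr₀ hε, fun r hr hr1 => ?_⟩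
    obtain ⟨k, hk, hk'⟩ := h1 r hr (hr1.trans_le (min_le_left _ _))
    refine ⟨k, hk.congr ?_, hk'⟩
    filter_upwards [ae_restrict_mem measurableSet_ball] with z hz
    refine h (hb ?_)
    have hz1 : ‖z‖ < 1 := by simpa using hz
    rw [mem_ball_iff_norm, add_sub_cancel_left, norm_mul, norm_real, Real.norm_of_nonneg hr.le]
    nlinarith [hr1.trans_le (min_le_right _ _), norm_nonneg z]
  · refine hu.boundary.congr ?_
    filter_upwards [ae_restrict_mem measurableSet_ball] with z hz using h (hf.bij.mapsTo hz)
  · obtain ⟨Φ, hΦ, Du, DΦ, h1, h2, h3⟩ := hu.star_eq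
    refine ⟨Φ, hΦ, Du, DΦ, h1.congr_ae hae (ae_eq_refl _), h2, ?_⟩
    filter_upwards [h3, hae] with w hw he
    rwa [← he]

theorem mainTheorem7 (Ω : Set ℂ) (hΩ : IsQuasidisk Ω) (a : ℂ) (ha : a ∈ Ω)
    (g : ℂ → ℂ) (hg : MemHHalfBoundary Ω g) (hdeg : HasBoundaryDegree Ω g 1) :
    -- there are uniformizations of `Ω` which map `0` to `a`
    (∃ f : ℂ → ℂ, IsUniformization f Ω ∧ f 0 = a) ∧
    -- the Neumann problem has a solution, unique up to a constant
    (∀ f : ℂ → ℂ, IsUniformization f Ω → f 0 = a →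
      (∃ Φ : ℂ → ℝ, IsNeumannSolution (g ∘ boundaryExt f) Φ) ∧
      ∀ Φ₁ Φ₂ : ℂ → ℝ, IsNeumannSolution (g ∘ boundaryExt f) Φ₁ →
        IsNeumannSolution (g ∘ boundaryExt f) Φ₂ →
        ∃ c : ℝ, ∀ᵐ z ∂(volume.restrict (Metric.ball 0 1)), Φ₁ z = Φ₂ z + c) ∧
    -- there is a canonical harmonic map, it is harmonic, it does not depend on the
    -- uniformization, and it is unique (as an element of `H¹_loc`)
    ∃ u : ℂ → ℂ, IsHarmonicMapToCircle (Ω \ {a}) u ∧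
      (∀ f : ℂ → ℂ, IsUniformization f Ω → f 0 = a → IsCanonicalHarmonicMap Ω a g f u) ∧
      ∀ f u' : ℂ → ℂ, IsUniformization f Ω → f 0 = a → IsCanonicalHarmonicMap Ω a g f u' →
        u' =ᵐ[volume.restrict (Ω \ {a})] u := by
  -- The map u is built from one uniformization `f₀` and one lifting `φ`; any other admissible f is
  -- a rotation of `f₀`, and its rotated lifting yields the same map on Ω.
  obtain ⟨f₀, φ, hf₀, h₀, hφ, hl⟩ := hdeg.exists_lifting ha
  have key := fun (f : ℂ → ℂ) (hf : IsUniformization f Ω) (h : f 0 = a) =>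
    hf₀.exists_lifting_rotation hf (h₀.trans h.symm) hφ hl
  refine ⟨⟨f₀, hf₀, h₀⟩, fun f hf h => ?_, unitLift φ ∘ uniformizationInv f₀,
    h₀ ▸ hf₀.isHarmonicMapToCircle_unitLift φ, fun f hf h => ?_, fun f u' hf h hu' => ?_⟩
  · obtain ⟨ψ, hψ, hψl, -⟩ := key f hf h
    exact ⟨⟨_, isNeumannSolution_log_norm (memHHalfCircle_of_lifting hψ hψl) hψ hψl⟩,
      fun Φ₁ Φ₂ h₁ h₂ => h₁.ae_eq_add_const h₂⟩
  · obtain ⟨ψ, hψ, hψl, he⟩ := key f hf h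
    exact (h ▸ hf.isCanonicalHarmonicMap_unitLift hψ hψl).congr hf ha he
  · obtain ⟨ψ, hψ, hψl, he⟩ := key f hf h
    subst h
    filter_upwards [hf.ae_eq_of_isCanonicalHarmonicMap hψ hψl hu', ae_restrict_mem (hf.isOpen_diff _).measurableSet]
      with w h1 hw
    rw [h1, he hw.1]
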